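/- **Setting.** Let $\mathbb{M}=\mathbb{R}^{1+3}$ be Minkowski space-time with product $v\cdot w=v^0w^0-\vec v\cdot\vec w$ and $|v|=\sqrt{v\cdot v}$ for timelike or lightlike $v$; $\mathrm{future}(\cdot)$ denotes the closed causal future. A *spacelike surface* is a set $\Sigma\subset\mathbb{M}$ that is intersected exactly once by every timelike straight line. A *unitary hypersurface evolution* for $N$ distinguishable particles consists of a Hilbert space $\mathscr{H}_\Sigma$ for every spacelike surface $\Sigma$, unitary isomorphisms $U_\Sigma^{\Sigma'}:\mathscr{H}_\Sigma\to\mathscr{H}_{\Sigma'}$ with $U_\Sigma^\Sigma=I$ and $U_{\Sigma'}^{\Sigma''}U_\Sigma^{\Sigma'}=U_\Sigma^{\Sigma''}$, and for every $\Sigma$ a projection-valued measure $P_\Sigma$ on $\Sigma^N$ acting on $\mathscr{H}_\Sigma$; for $f:\Sigma^N\to\mathbb{R}$ write $P_\Sigma(f)=\int f\,dP_\Sigma$. It satisfies *interaction locality* if for all spacelike surfaces $\Sigma,\Sigma'$, all (Borel) $A\subseteq\Sigma\cap\Sigma'$ and all $i\in\{1,\dots,N\}$, $$P_{\Sigma'}\bigl((\Sigma')^{i-1}\times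 A\times(\Sigma')^{N-i}\bigr)=U_\Sigma^{\Sigma'}\,P_\Sigma\bigl(\Sigma^{i-1}\times A\times\Sigma^{N-i}\bigr)\,U_{\Sigma'}^{\Sigma}.$$ Fix $\sigma,\tau>0$, an initial spacelike surface $\Sigma_0$ (write $\mathscr{H}_0=\mathscr{H}_{\Sigma_0}$, $U_0^\Sigma=U_{\Sigma_0}^\Sigma$, $U_\Sigma^0=U_\Sigma^{\Sigma_0}$), numbers $n_1,\dots,n_N\ge 0$ with $\nu=\sum_i n_i$, and seed flashes $x_{10},\dots,x_{N0}\in\mathbb{M}$. For $\underline{x}=(x_{ik})_{1\le i\le N,\,1\le k\le n_i}\in\mathbb{M}^\nu$ such that $x_{ik}\in\mathrm{future}(x_{i,k-1})$ for all $i,k$, let $\mathbb{H}_y(x)=\{z\in\mathrm{future}(y):|z-y|=|x-y|\}$ and $\mathbb{H}_{ik}=\mathbb{H}_{x_{i,k-1}}(x_{ik})$. *Cells.* An abstract 4-cell is an element $\underline{k}$ of ${}^4\!\mathscr{A}=\prod_i\{0,\dots,n_i\}$; its predecessors are obtained by replacing one $k_j$ by $k_j-1$. For $k_i\ge 1$ the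 3-cell ${}^3C_{i\underline{k}}$ is the set of $z\in\mathbb{H}_{ik_i}$ such that for every $j\ne i$, $z\in\mathrm{future}(\mathbb{H}_{jk_j})$ (no condition if $k_j=0$) and $z\notin\mathrm{future}(\mathbb{H}_{j,k_j+1})$ (no condition if $k_j=n_j$). For almost every such $\underline{x}$, the 3-cells with $k_i=k$ partition $\mathbb{H}_{ik}$; let ${}^3C(x_{ik})$ be the one containing $x_{ik}$. An *admissible sequence* is a sequence $\emptyset=V_1,V_2,\dots,V_{r+1}={}^4\!\mathscr{A}$ of sets of abstract 4-cells, each containing all predecessors of its elements, with $V_{m+1}=V_m\cup\{\underline{k}_m\}$, $\underline{k}_m\notin V_m$; it crosses the 4-cell $\underline{k}_m$ and all 3-cells ${}^3C_{i\underline{k}_m}$ in step $m$. *Collapse operators.* Let $\tilde g_{yx}(z)=\exp\bigl(-d(x,z)^2/4\sigma^2\bigr)$ for $z\in\mathbb{H}_y(x)$, with $d$ the geodesic distance along $\mathbb{H}_y(x)$; for $A\subseteq\mathbb{H}_y(x)$ let $\|f\|_A=(\int_A|f|^2d^3z)^{1/2}$ with $d^3z$ the invariant 3-volume, and $$g_{yAx}(z)=\frac{1_{z\in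 A}\,1_{x\in A}}{\|\tilde g_{yz}\|_A}\,\tilde g_{yx}(z).$$ Let $K(x_{ik})=U^0_{\mathbb{H}_{ik}}\,P_{\mathbb{H}_{ik}}\bigl(g_{x_{i,k-1},{}^3C(x_{ik}),x_{ik}}\text{ in the }i\text{-th variable}\bigr)\,U_0^{\mathbb{H}_{ik}}$. Given an admissible sequence, let $L(\underline{x})$ be the product of all $K(x_{ik})$ in the order, from right to left, in which the 3-cells ${}^3C(x_{ik})$ are crossed, operators crossed in the same step being multiplied in any chosen order of the particle labels (the choice may depend on the step). Finally, for $\underline{x}\in\mathbb{M}^\nu$ let $$D(\underline{x})=\Bigl(\frac1{\tau^{\nu}}\prod_{i=1}^N\prod_{k=1}^{n_i}1_{x_{ik}\in\mathrm{future}(x_{i,k-1})}\,e^{-|x_{ik}-x_{i,k-1}|/\tau}\Bigr)L(\underline{x})^\dagger L(\underline{x}),$$ which is $0$ unless $x_{ik}\in\mathrm{future}(x_{i,k-1})$ for all $i,k$. **Proposition 4.8.** Suppose the unitary hypersurface evolution satisfies interaction locality. Then, for every admissible sequence (and every choice of the order within a step), $$\int_{\mathbb{M}^\nu}d\underline{x}\;D(\underline{x})=I$$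 in the weak sense, i.e. $\underline{x}\mapsto\langle\phi|D(\underline{x})\psi\rangle$ is integrable with integral $\langle\phi|\psi\rangle$ for all $\phi,\psi\in\mathscr{H}_0$. As a consequence, $G(B)=\int_B d\underline{x}\,D(\underline{x})$ (weak integral; $B\subseteq\mathbb{M}^\nu$ Borel) exists as a bounded operator and defines a POVM on $\mathbb{M}^\nu$, and for every $\psi_0\in\mathscr{H}_0$ with $\|\psi_0\|=1$, $\langle\psi_0|D(\underline{x})|\psi_0\rangle\,d\underline{x}$ is a probability measure on $\mathbb{M}^\nu$. -/

import Mathlib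

open MeasureTheory Set
open scoped ENNReal InnerProductSpace

universe u

noncomputable section

namespace RelGRW

/-! ### Minkowski space-time (units with `c = 1`) -/

/-- Minkowski space-time: a point is `(t, ξ)` with time `t` and spatial part `ξ`; the instance
`volume` is the invariant 4-volume (Lebesgue measure). -/
abbrev Minkowski : Type := ℝ × EuclideanSpace ℝ (Fin 3)

/-- The Minkowski product, of signature `(+,-,-,-)`. -/
def mink (v w : Minkowski) : ℝ := v.1 * w.1 - ⟪v.2, w.2⟫_ℝ

/-- A vector is timelike iff its Minkowski square is positive. -/
def IsTimelike (v : Minkowski) : Prop := 0 < mink v v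

/-- The invariant (proper) length of a timelike or lightlike vector. -/
def properLength (v : Minkowski) : ℝ := √(mink v v)

/-- The closed causal future of a point. -/
def future (y : Minkowski) : Set Minkowski := {z | ‖z.2 - y.2‖ ≤ z.1 - y.1}

/-- The causal future of a set. -/
def futureSet (A : Set Minkowski) : Set Minkowski := ⋃ p ∈ A, future p

/-- A spacelike surface: a set that is intersected exactly once by every timelike straight line. -/
structure SpacelikeSurface where
  carrier : Set Minkowski
  meets_once : ∀ p v : Minkowski, IsTimelike v →
    ∃! z : Minkowski, z ∈ carrier ∧ ∃ r : ℝ, z = p + r • v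

/-- A spacelike surface as a type (the set of its points, with the Borel σ-algebra inherited from
Minkowski space-time). -/
instance : CoeSort SpacelikeSurface Type := ⟨fun S => {z : Minkowski // z ∈ S.carrier}⟩

namespace SpacelikeSurface

theorem exists_time (S : SpacelikeSurface) (ξ : EuclideanSpace ℝ (Fin 3)) :
    ∃ t : ℝ, ((t, ξ) : Minkowski) ∈ S.carrier := by
  obtain ⟨z, ⟨hz, r, hr⟩, -⟩ := S.meets_once (0, ξ) (1, 0) (by simp [IsTimelike, mink])
  refine ⟨z.1, ?_⟩
  have h2 : z.2 = ξ := by simp [hr]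
  rw [← h2]
  exact hz

/-- The function `ξ ↦ t` of which the surface is the graph. -/
def time (S : SpacelikeSurface) (ξ : EuclideanSpace ℝ (Fin 3)) : ℝ := (S.exists_time ξ).choose

theorem time_mem (S : SpacelikeSurface) (ξ : EuclideanSpace ℝ (Fin 3)) :
    ((S.time ξ, ξ) : Minkowski) ∈ S.carrier := (S.exists_time ξ).choose_spec

/-- The invariant 3-volume on a spacelike surface, as a measure on space-time supported by the
surface. In the coordinate `ξ`, the 3-metric on the graph of `t = f ξ` is `|dξ|² - (df)²`, whose
volume density is `√(1 - |∇f|²)`. -/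
def volume3 (S : SpacelikeSurface) : Measure Minkowski :=
  Measure.map (fun ξ => ((S.time ξ, ξ) : Minkowski))
    ((volume : Measure (EuclideanSpace ℝ (Fin 3))).withDensity
      (fun ξ => ENNReal.ofReal (√(1 - ‖fderiv ℝ S.time ξ‖ ^ 2))))

end SpacelikeSurface

/-! ### Hyperboloids -/

/-- The points in the future of `y` at timelike distance `s` from `y`. -/
def hyperboloidSet (y : Minkowski) (s : ℝ) : Set Minkowski :=
  {z | z ∈ future y ∧ properLength (z - y) = s}

theorem mem_hyperboloidSet_iff (y z : Minkowski) {s : ℝ} (hs : 0 ≤ s) :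
    z ∈ hyperboloidSet y s ↔ z.1 - y.1 = √(s ^ 2 + ‖z.2 - y.2‖ ^ 2) := by
  have key : mink (z - y) (z - y) = (z.1 - y.1) ^ 2 - ‖z.2 - y.2‖ ^ 2 := by
    simp only [mink, Prod.fst_sub, Prod.snd_sub, real_inner_self_eq_norm_sq]
    ring
  have hn := norm_nonneg (z.2 - y.2)
  simp only [hyperboloidSet, future, mem_ofPred_eq, properLength, key]
  constructor
  · rintro ⟨h1, h2⟩
    have h3 : 0 ≤ (z.1 - y.1) ^ 2 - ‖z.2 - y.2‖ ^ 2 := by nlinarith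
    have h4 : (z.1 - y.1) ^ 2 - ‖z.2 - y.2‖ ^ 2 = s ^ 2 := by rw [← h2, Real.sq_sqrt h3]
    symm
    rw [Real.sqrt_eq_iff_mul_self_eq (by positivity) (by linarith)]
    linarith
  · intro h
    have h3 : (z.1 - y.1) ^ 2 = s ^ 2 + ‖z.2 - y.2‖ ^ 2 := by
      rw [h, Real.sq_sqrt (by positivity)]
    refine ⟨?_, ?_⟩
    · rw [h]
      exact Real.le_sqrt_of_sq_le (by nlinarith [sq_nonneg s])
    · rw [h3, add_sub_cancel_right, Real.sqrt_sq hs]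


theorem sqrt_sq_add_le {s α β δ : ℝ} (hα : 0 ≤ α) (hβ : 0 ≤ β) (hδ : 0 ≤ δ) (h : β ≤ α + δ) :
    √(s ^ 2 + β ^ 2) ≤ √(s ^ 2 + α ^ 2) + δ := by
  have h1 : α ≤ √(s ^ 2 + α ^ 2) := Real.le_sqrt_of_sq_le (by nlinarith [sq_nonneg s])
  have h2 : √(s ^ 2 + α ^ 2) ^ 2 = s ^ 2 + α ^ 2 := Real.sq_sqrt (by positivity)
  apply Real.sqrt_le_iff.mpr
  constructor
  · positivity
  · nlinarith [mul_nonneg hδ (sub_nonneg.mpr h1)]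

theorem hyperboloid_meets_once_aux (y : Minkowski) {s : ℝ} (hs : 0 ≤ s) (p v : Minkowski)
    (hv : ‖v.2‖ < v.1) :
    ∃! z : Minkowski, z ∈ hyperboloidSet y s ∧ ∃ r : ℝ, z = p + r • v := by
  let φ : ℝ → ℝ := fun r =>
    (p + r • v).1 - y.1 - √(s ^ 2 + ‖(p + r • v).2 - y.2‖ ^ 2)
  have hmem : ∀ r, p + r • v ∈ hyperboloidSet y s ↔ φ r = 0 := fun r => by
    rw [mem_hyperboloidSet_iff y _ hs, sub_eq_zero]
  have hφ : ∀ r₁ r₂, r₁ ≤ r₂ → φ r₁ + (v.1 - ‖v.2‖) * (r₂ - r₁) ≤ φ r₂ := by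
    intro r₁ r₂ h
    have hd : 0 ≤ r₂ - r₁ := sub_nonneg.mpr h
    have h1 : ‖(p + r₂ • v).2 - y.2‖ ≤ ‖(p + r₁ • v).2 - y.2‖ + (r₂ - r₁) * ‖v.2‖ := by
      have : (p + r₂ • v).2 - y.2 = ((p + r₁ • v).2 - y.2) + (r₂ - r₁) • v.2 := by
        simp only [Prod.snd_add, Prod.smul_snd, sub_smul]
        abel
      rw [this]
      refine (norm_add_le _ _).trans ?_
      rw [norm_smul, Real.norm_eq_abs, abs_of_nonneg hd]
    have h2 := sqrt_sq_add_le (s := s) (norm_nonneg _) (norm_nonneg _)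
      (mul_nonneg hd (norm_nonneg v.2)) h1
    simp only [φ, Prod.fst_add, Prod.smul_fst, smul_eq_mul] at h2 ⊢
    linarith
  have hc : 0 < v.1 - ‖v.2‖ := sub_pos.mpr hv
  have hcont : Continuous φ := by
    simp only [φ]
    fun_prop
  obtain ⟨r, hr⟩ : ∃ r, φ r = 0 := by
    let R : ℝ := |φ 0| / (v.1 - ‖v.2‖)
    have hR : 0 ≤ R := by positivity
    have hRc : (v.1 - ‖v.2‖) * R = |φ 0| := mul_div_cancel₀ _ hc.ne'
    have h1 : 0 ≤ φ R := by
      have := hφ 0 R hR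
      rw [sub_zero, hRc] at this
      linarith [neg_abs_le (φ 0)]
    have h2 : φ (-R) ≤ 0 := by
      have := hφ (-R) 0 (by linarith)
      rw [zero_sub, neg_neg, hRc] at this
      linarith [le_abs_self (φ 0)]
    obtain ⟨r, -, hr⟩ := intermediate_value_Icc (show -R ≤ R by linarith) hcont.continuousOn
      (show (0 : ℝ) ∈ Icc (φ (-R)) (φ R) from ⟨h2, h1⟩)
    exact ⟨r, hr⟩
  refine ⟨p + r • v, ⟨(hmem r).mpr hr, r, rfl⟩, ?_⟩
  rintro z ⟨hz, q, rfl⟩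
  have hq := (hmem q).mp hz
  have : q = r := by
    rcases le_total q r with h | h
    · have := hφ q r h
      rw [hq, hr] at this
      nlinarith
    · have := hφ r q h
      rw [hq, hr] at this
      nlinarith
  rw [this]

/-- The hyperboloid of timelike distance `s` from `y`, a spacelike surface. -/
def hyperboloid (y : Minkowski) (s : ℝ) (hs : 0 ≤ s) : SpacelikeSurface where
  carrier := hyperboloidSet y s
  meets_once := by
    intro p v hv
    have hv' : ‖v.2‖ ^ 2 < v.1 ^ 2 := by
      simp only [IsTimelike, mink, real_inner_self_eq_norm_sq] at hv
      nlinarith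
    have hv2 : ‖v.2‖ < |v.1| := by
      have := sq_lt_sq.mp hv'
      rwa [abs_of_nonneg (norm_nonneg _)] at this
    rcases lt_abs.mp hv2 with h | h
    · exact hyperboloid_meets_once_aux y hs p v h
    · obtain ⟨z, ⟨hz, r, hr⟩, hu⟩ :=
        hyperboloid_meets_once_aux y hs p (-v) (by simpa using h)
      refine ⟨z, ⟨hz, -r, by simpa using hr⟩, ?_⟩
      rintro w ⟨hw, q, hq⟩
      exact hu w ⟨hw, -q, by simpa using hq⟩

/-- The hyperboloid based at `y` that contains `x` (for `x` in the future of `y`). -/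
def hyperboloidThrough (y x : Minkowski) : SpacelikeSurface :=
  hyperboloid y (properLength (x - y)) (Real.sqrt_nonneg _)

/-! ### Profile functions -/

/-- The spacelike (geodesic) distance along the hyperboloid based at `y` that contains `x`,
between `x` and another point `z` of it. The hyperboloid at timelike distance `s` is a hyperbolic
3-space of curvature radius `s`, on which `cosh (d / s) = (x - y) · (z - y) / s ^ 2`. -/
def sDist (y x z : Minkowski) : ℝ :=
  properLength (x - y) * Real.arcosh (mink (x - y) (z - y) / properLength (x - y) ^ 2)

/-- The Gaussian of width `σ` centered at `x` along the hyperboloid based at `y`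
that contains `x`. -/
def gaussian (σ : ℝ) (y x z : Minkowski) : ℝ :=
  Real.exp (-(sDist y x z) ^ 2 / (4 * σ ^ 2))

/-- The `L²` norm of `f` over a subset `A` of the spacelike surface `S`. -/
def l2norm (S : SpacelikeSurface) (A : Set Minkowski) (f : Minkowski → ℝ) : ℝ :=
  √(∫ z in A, |f z| ^ 2 ∂S.volume3)

open Classical in
/-- The cut-off profile function
`g_{yAx}(z) = 1_{z ∈ A} 1_{x ∈ A} (gaussian centered at x)(z) / ‖gaussian centered at z‖_A`. -/
def cutoffProfile (σ : ℝ) (y : Minkowski) (A : Set Minkowski) (x z : Minkowski) : ℝ :=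
  if z ∈ A ∧ x ∈ A then
    gaussian σ y x z / l2norm (hyperboloidThrough y z) A (gaussian σ y z)
  else 0

/-! ### Operator-valued measures -/

section OperatorMeasures

variable {α : Type*} [MeasurableSpace α]
  {H : Type*} [NormedAddCommGroup H] [InnerProductSpace ℂ H] [CompleteSpace H]

/-- A positive-operator-valued measure (POVM): positive, normalized, and countably additive in the
strong operator topology. Values on non-measurable sets are irrelevant. -/
structure IsPOVM (G : Set α → H →L[ℂ] H) : Prop where
  isPositive : ∀ B, MeasurableSet B → (G B).IsPositive
  univ : G Set.univ = 1
  hasSum_iUnion : ∀ B : ℕ → Set α, (∀ m, MeasurableSet (B m)) →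
    Pairwise (Function.onFun Disjoint B) → ∀ ψ : H, HasSum (fun m => G (B m) ψ) (G (⋃ m, B m) ψ)

/-- `T = ∫ D dμ` in the weak sense, for an operator-valued function `D`. -/
def HasWeakIntegral (D : α → H →L[ℂ] H) (μ : Measure α) (T : H →L[ℂ] H) : Prop :=
  ∀ φ ψ : H, Integrable (fun x => ⟪φ, D x ψ⟫_ℂ) μ ∧ ∫ x, ⟪φ, D x ψ⟫_ℂ ∂μ = ⟪φ, T ψ⟫_ℂ

variable (α H) in
/-- A projection-valued measure (PVM): a POVM whose values are orthogonal projections. -/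
structure PVM where
  toFun : Set α → H →L[ℂ] H
  isPOVM : IsPOVM toFun
  isStarProjection : ∀ B, MeasurableSet B → IsStarProjection (toFun B)

namespace PVM

theorem toFun_empty (P : PVM α H) : P.toFun ∅ = 0 := by
  ext ψ
  have h := P.isPOVM.hasSum_iUnion (fun _ => ∅) (fun _ => MeasurableSet.empty)
    (fun _ _ _ => by simp [Function.onFun]) ψ
  have h0 := h.summable.tendsto_atTop_zero
  simpa using tendsto_nhds_unique tendsto_const_nhds h0

/-- The scalar measure `B ↦ ⟪ψ, P(B) ψ⟫` of a vector `ψ`. -/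
def measure (P : PVM α H) (ψ : H) : Measure α :=
  Measure.ofMeasurable (fun B _ => ENNReal.ofReal (⟪ψ, P.toFun B ψ⟫_ℂ).re)
    (by simp [P.toFun_empty])
    (by
      intro B hB hd
      have h := P.isPOVM.hasSum_iUnion B hB hd ψ
      have h2 : HasSum (fun m => (⟪ψ, P.toFun (B m) ψ⟫_ℂ).re)
          (⟪ψ, P.toFun (⋃ m, B m) ψ⟫_ℂ).re :=
        Complex.hasSum_re (h.mapL (innerSL ℂ ψ))
      have hpos : ∀ m, 0 ≤ (⟪ψ, P.toFun (B m) ψ⟫_ℂ).re := fun m =>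
        (P.isPOVM.isPositive (B m) (hB m)).re_inner_nonneg_right ψ
      rw [← h2.tsum_eq, ENNReal.ofReal_tsum_of_nonneg hpos h2.summable])

theorem measure_apply (P : PVM α H) (ψ : H) {B : Set α} (hB : MeasurableSet B) :
    P.measure ψ B = ENNReal.ofReal (⟪ψ, P.toFun B ψ⟫_ℂ).re :=
  Measure.ofMeasurable_apply B hB

/-- `T` is the bounded operator `∫ f dP`, i.e. `⟪ψ, T ψ⟫ = ∫ f(q) ⟪ψ, P(dq) ψ⟫` for all `ψ`. By
polarization there is at most one such `T`. -/
def IsMultOp (P : PVM α H) (f : α → ℝ) (T : H →L[ℂ] H) : Prop :=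
  ∀ ψ : H, Integrable f (P.measure ψ) ∧ ⟪ψ, T ψ⟫_ℂ = ((∫ q, f q ∂(P.measure ψ) : ℝ) : ℂ)

open Classical in
/-- The multiplication operator `P(f) = ∫ f dP` of a real function that is bounded off a `P`-null
set (and `0` if `∫ f dP` is not a bounded operator). -/
def multOp (P : PVM α H) (f : α → ℝ) : H →L[ℂ] H :=
  if h : ∃ T, P.IsMultOp f T then h.choose else 0

end PVM

end OperatorMeasures

/-! ### Unitary hypersurface evolutions -/



/-- A unitary hypersurface evolution for `N` distinguishable particles: a Hilbert space for every
spacelike surface, unitary isomorphisms between them (`U S S'` goes from `S` to `S'`), and a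
position PVM on the `N`-th Cartesian power of every spacelike surface. -/
structure HypersurfaceEvolution (N : ℕ) where
  Hil : SpacelikeSurface → Type u
  [normedAddCommGroup : ∀ S, NormedAddCommGroup (Hil S)]
  [innerProductSpace : ∀ S, InnerProductSpace ℂ (Hil S)]
  [completeSpace : ∀ S, CompleteSpace (Hil S)]
  U : ∀ S S' : SpacelikeSurface, Hil S ≃ₗᵢ[ℂ] Hil S'
  U_self : ∀ S ψ, U S S ψ = ψ
  U_comp : ∀ S S' S'' ψ, U S' S'' (U S S' ψ) = U S S'' ψ
  P : ∀ S : SpacelikeSurface, PVM (Fin N → S) (Hil S)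

attribute [instance] HypersurfaceEvolution.normedAddCommGroup
  HypersurfaceEvolution.innerProductSpace HypersurfaceEvolution.completeSpace

namespace HypersurfaceEvolution

variable {N : ℕ} (E : HypersurfaceEvolution.{u} N)

/-- The evolution `U S S'` as a bounded operator. -/
def evol (S S' : SpacelikeSurface) : E.Hil S →L[ℂ] E.Hil S' :=
  (E.U S S' : E.Hil S ≃L[ℂ] E.Hil S')

/-- The projection onto the `i`-th particle being in `A` on the surface `S`. -/
def posProj (S : SpacelikeSurface) (i : Fin N) (A : Set Minkowski) : E.Hil S →L[ℂ] E.Hil S :=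
  (E.P S).toFun {q | (q i : Minkowski) ∈ A}

/-- Interaction locality: the localization of any particle in the overlap of two spacelike surfaces
is the same for both surfaces. -/
def InteractionLocal : Prop :=
  ∀ (S S' : SpacelikeSurface) (A : Set Minkowski), MeasurableSet A →
    A ⊆ S.carrier ∩ S'.carrier → ∀ i : Fin N,
      E.posProj S' i A = E.evol S S' ∘L E.posProj S i A ∘L E.evol S' S

end HypersurfaceEvolution

/-! ### Abstract cells and admissible sequences -/

section Abstract

variable {N : ℕ}

/-- Abstract 4-cells: multi-indices `(k_1, …, k_N)` with `0 ≤ k_i ≤ n_i`. -/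
abbrev Cell (n : Fin N → ℕ) : Type := ∀ i, Fin (n i + 1)

/-- `a` is a predecessor of `b`: one `b_i` has been replaced by `b_i - 1`. -/
def IsPredecessor {n : Fin N → ℕ} (a b : Cell n) : Prop :=
  ∃ i, (a i : ℕ) + 1 = b i ∧ ∀ j, j ≠ i → a j = b j

/-- A set of abstract 4-cells that contains every predecessor of each of its elements. -/
def PredecessorComplete {n : Fin N → ℕ} (V : Set (Cell n)) : Prop :=
  ∀ a b, IsPredecessor a b → b ∈ V → a ∈ V

/-- An admissible sequence: a path from `∅` to the set of all abstract 4-cells, through predecessor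
complete sets, each step adding exactly one 4-cell (the one crossed in that step). -/
structure AdmissibleSequence (n : Fin N → ℕ) where
  r : ℕ
  V : Fin (r + 1) → Set (Cell n)
  crossed : Fin r → Cell n
  predecessorComplete : ∀ m, PredecessorComplete (V m)
  first : V 0 = ∅
  last : V (Fin.last r) = Set.univ
  crossed_notMem : ∀ m, crossed m ∉ V m.castSucc
  step : ∀ m, V m.succ = insert (crossed m) (V m.castSucc)

end Abstract

/-! ### Cells in space-time and the collapse model -/

section Model

variable {N : ℕ} {n : Fin N → ℕ}

/-- Flash patterns: `x i k` is the `(k+1)`-st flash of particle `i` (`k` counts from `0`), so this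
is the product of `n_1 + … + n_N` copies of Minkowski space-time. -/
abbrev Flashes (n : Fin N → ℕ) : Type := ∀ i, Fin (n i) → Minkowski

/-- The points `x_{i0}, x_{i1}, …, x_{i n_i}`, where `x_{i0} = y i` is the seed flash. -/
def pt (y : Fin N → Minkowski) (x : Flashes n) (i : Fin N) : Fin (n i + 1) → Minkowski :=
  Fin.cons (y i) (x i)

/-- The hyperboloid based at the flash (or seed) before `x i k`, and containing `x i k`. -/
def hyp (y : Fin N → Minkowski) (x : Flashes n) (i : Fin N) (k : Fin (n i)) : SpacelikeSurface :=
  hyperboloidThrough (pt y x i k.castSucc) (pt y x i k.succ)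

/-- The future of the `k`-th hyperboloid of particle `i`, `1 ≤ k ≤ n_i`;
all of space-time for `k = 0`. -/
def afterHyp (y : Fin N → Minkowski) (x : Flashes n) (i : Fin N) (k : Fin (n i + 1)) :
    Set Minkowski :=
  {z | ∀ l : Fin (n i), (l : ℕ) + 1 = k → z ∈ futureSet (hyp y x i l).carrier}

/-- The strict past of the `(k+1)`-st hyperboloid of particle `i`, `k + 1 ≤ n_i`, that is, the
complement of its future; all of space-time for `k = n_i`. -/
def beforeNextHyp (y : Fin N → Minkowski) (x : Flashes n) (i : Fin N) (k : Fin (n i + 1)) :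
    Set Minkowski :=
  {z | ∀ l : Fin (n i), (l : ℕ) = k → z ∉ futureSet (hyp y x i l).carrier}

/-- The 3-cell `(i, a)`, where `i` is the particle of the flash `(i, k)` and `a i = k + 1`: the part
of the hyperboloid of that flash that lies between the `a j`-th and the next hyperboloid of every
other particle `j`. An overlap of adjacent cells belongs to the later one only, so that the 3-cells
form a partition of the hyperboloid. -/
def threeCell (y : Fin N → Minkowski) (x : Flashes n) (i : Fin N) (k : Fin (n i)) (a : Cell n) :
    Set Minkowski :=
  (hyp y x i k).carrier ∩ ⋂ j, ⋂ (_ : j ≠ i), afterHyp y x j (a j) ∩ beforeNextHyp y x j (a j)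

variable (E : HypersurfaceEvolution.{u} N) (S₀ : SpacelikeSurface) (σ τ : ℝ)

/-- The collapse operator of the flash `x i k`, with profile function cut off outside `A`: the
multiplication by the profile function in the `i`-th variable, on the hyperboloid of the flash,
evolved to the initial surface `S₀`. -/
def collapseOp (y : Fin N → Minkowski) (x : Flashes n) (i : Fin N) (k : Fin (n i))
    (A : Set Minkowski) : E.Hil S₀ →L[ℂ] E.Hil S₀ :=
  E.evol (hyp y x i k) S₀ ∘L
    (E.P (hyp y x i k)).multOp
      (fun q => cutoffProfile σ (pt y x i k.castSucc) A (x i k) (q i)) ∘L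
    E.evol S₀ (hyp y x i k)

open Classical in
/-- The factor contributed by particle `i` when the 4-cell `a` is crossed: with `a` the 3-cell
`(i, a)` is crossed if `a i ≥ 1`; the factor is the collapse operator of the flash `(i, k)` with
`k + 1 = a i` if that flash lies on this 3-cell; otherwise there is no factor. -/
def crossingFactor (y : Fin N → Minkowski) (x : Flashes n) (a : Cell n) (i : Fin N) :
    E.Hil S₀ →L[ℂ] E.Hil S₀ :=
  if h : ∃ k : Fin (n i), (k : ℕ) + 1 = a i ∧ x i k ∈ threeCell y x i k a then
    collapseOp E S₀ σ y x i h.choose (threeCell y x i h.choose a)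
  else 1

/-- The operator `L(x)`: the product of the collapse operators of all flashes, in the order, from
right to left, in which the 3-cells containing them are crossed in the admissible sequence. The
operators crossed in the same step `m` are multiplied in the order of particle labels prescribed by
the permutation `ord m`. -/
def opL (y : Fin N → Minkowski) (s : AdmissibleSequence n) (ord : Fin s.r → Equiv.Perm (Fin N))
    (x : Flashes n) : E.Hil S₀ →L[ℂ] E.Hil S₀ :=
  ((List.finRange s.r).reverse.map fun m =>
    ((List.finRange N).map fun i =>
      crossingFactor E S₀ σ y x (s.crossed m) (ord m i)).prod).prod

open Classical in
/-- The scalar weight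
`τ ^ (-ν) ∏_{ik} 1_{x_{ik} ∈ future(x_{i,k-1})} exp (- |x_{ik} - x_{i,k-1}| / τ)`. -/
def weight (y : Fin N → Minkowski) (x : Flashes n) : ℝ :=
  (1 / τ ^ (∑ i, n i)) * ∏ i, ∏ k : Fin (n i),
    (if pt y x i k.succ ∈ future (pt y x i k.castSucc) then
      Real.exp (-properLength (pt y x i k.succ - pt y x i k.castSucc) / τ) else 0)

/-- The operator-valued density `D(x) = weight · L(x)† L(x)`. -/
def opD (y : Fin N → Minkowski) (s : AdmissibleSequence n) (ord : Fin s.r → Equiv.Perm (Fin N))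
    (x : Flashes n) : E.Hil S₀ →L[ℂ] E.Hil S₀ :=
  ((weight τ y x : ℝ) : ℂ) •
    (ContinuousLinearMap.adjoint (opL E S₀ σ y s ord x) ∘L opL E S₀ σ y s ord x)

end Model

end RelGRW

end

open scoped Topology

noncomputable section

namespace RelGRW

/-! ### Functional calculus of projection-valued measures. -/

namespace PVM

variable {α : Type*} [MeasurableSpace α]
  {H : Type*} [NormedAddCommGroup H] [InnerProductSpace ℂ H] [CompleteSpace H]
  (P : PVM α H)

/-! Fix all proper times between successive flashes of each particle. Once a flash is given, the
hyperboloid carrying the next flash of that particle is then known, and only the position on it is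
still to be integrated over. The normalization is proved by crossing one 3-cell at a time.

Suppose that the 3-cells in a set `D` have been crossed and that `κ i` flashes of particle `i` are
realized. Let `remOp` be the product, over particles with a pending flash, of the projections to not
being found in a crossed cell of the next hyperboloid. The central claim, `posMarginal_pathWeight`,
is that the weights of all continuations, integrated over the positions of the unrealized flashes,
add up to `‖remOp φ‖ ^ 2`. It is proved by induction on the list of cells still to be crossed. When
`(a, i)` is crossed, Pythagoras (`IsChain.norm_remOp_sq`) splits `‖remOp φ‖ ^ 2` into the same
quantity for the enlarged `D` and the squared norm of the projection to the cell `a`. The second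
term is the integral of the squared norms of the collapsed vectors, because the squared profiles
integrate to one over their centers (`IsChain.lintegral_collapse`). After such a collapse the
remaining operator is the product `restOp` over the other particles (`IsChain.remOp_bump`).
Initially nothing is crossed and `remOp` is the identity.

Interaction locality enters through a common surface (`IsChain.exists_surface`,
`IsChain.exists_common`): the crossed 4-cells lie below one spacelike surface, which contains the
3-cells crossed next. All projections of a step are position projections of that single surface, so
they commute.

A path may or may not realize a flash when it could. For a given flash pattern only one branch has
nonzero weight, the one in which each flash is realized when its own 3-cell is crossed; hence
`pathWeight_eq` identifies the path weight with the volume densities times `‖L φ‖ ^ 2`.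

The collapse operators must also be bounded and measurable. For each particle only countably many
radii produce a 3-cell not contained in the closure of its interior, so almost all patterns are
regular. Far out, a regular cell is cut out by affine inequalities and contains balls of
polynomially small radius near its points, whereas the Gaussian decays faster than every power; so
the normalized profiles are bounded (`RegularRegion.exists_prof_le`). Measurability without a
separability assumption rests on the orthogonality of projections for spacelike separated sets
(`LocalFamily.stronglyMeasurable_open`).

Finally, hyperbolic coordinates turn the 4-volume into proper times and positions, the proper times
are independent and exponentially distributed, and a density of the form `V† V` with `∫ ‖V φ‖ ^ 2 =
‖φ‖ ^ 2` defines a POVM (`exists_isPOVM`). -/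

theorem toFun_union {A B : Set α} (hA : MeasurableSet A) (hB : MeasurableSet B)
    (h : Disjoint A B) : P.toFun (A ∪ B) = P.toFun A + P.toFun B := by
  ext ψ
  let S : ℕ → Set α := fun m => if m = 0 then A else if m = 1 then B else ∅
  have hS : ∀ m, MeasurableSet (S m) := by
    intro m; simp only [S]; split_ifs <;> simp [hA, hB]
  have hd : Pairwise (Function.onFun Disjoint S) := by
    intro i j hij
    simp only [Function.onFun, S]
    split_ifs <;> simp_all [disjoint_comm]
  have hU : (⋃ m, S m) = A ∪ B := by
    ext x
    simp only [mem_iUnion, mem_union, S]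
    constructor
    · rintro ⟨m, hm⟩
      split_ifs at hm
      · exact Or.inl hm
      · exact Or.inr hm
      · exact hm.elim
    · rintro (hx | hx)
      · exact ⟨0, by simpa using hx⟩
      · exact ⟨1, by simpa using hx⟩
  have h1 := P.isPOVM.hasSum_iUnion S hS hd ψ
  rw [hU] at h1
  have h2 : HasSum (fun m => P.toFun (S m) ψ) (∑ m ∈ Finset.range 2, P.toFun (S m) ψ) := by
    apply hasSum_sum_of_ne_finset_zero
    intro m hm
    have : S m = ∅ := by
      simp only [Finset.mem_range, not_lt] at hm
      simp only [S]
      rw [if_neg (by omega), if_neg (by omega)]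
    rw [this, P.toFun_empty]; rfl
  rw [h1.unique h2]
  simp [Finset.sum_range_succ, S]

theorem toFun_compl {A : Set α} (hA : MeasurableSet A) : P.toFun Aᶜ = 1 - P.toFun A := by
  have := P.toFun_union hA hA.compl disjoint_compl_right
  rw [union_compl_self, P.isPOVM.univ] at this
  rw [this]; abel

theorem toFun_mul_self {A : Set α} (hA : MeasurableSet A) : P.toFun A * P.toFun A = P.toFun A :=
  (P.isStarProjection A hA).isIdempotentElem

/-- Idempotence of `p + q` forces `p * q + q * p = 0`. Multiplying by `p` from either side shows
that `p * q` and `q * p` both equal `-(p * q * p)`, so they coincide and `2 • (p * q) = 0`. -/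
theorem toFun_mul_of_disjoint {A B : Set α} (hA : MeasurableSet A) (hB : MeasurableSet B)
    (h : Disjoint A B) : P.toFun A * P.toFun B = 0 := by
  have h0 := P.toFun_mul_self (hA.union hB)
  rw [P.toFun_union hA hB h] at h0
  set p := P.toFun A
  set q := P.toFun B
  have hp : p * p = p := P.toFun_mul_self hA
  have hq : q * q = q := P.toFun_mul_self hB
  have h1 : p * q + q * p = 0 := by
    have : (p + q) * (p + q) = p * p + q * q + (p * q + q * p) := by noncomm_ring
    rw [this, hp, hq] at h0
    simpa using h0
  have h2 : p * q + p * q * p = 0 := by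
    have := congrArg (p * ·) h1
    simp only [mul_add, mul_zero, ← mul_assoc, hp] at this
    exact this
  have h3 : p * q * p + q * p = 0 := by
    have := congrArg (· * p) h1
    simp only [add_mul, zero_mul, mul_assoc, hp] at this
    rw [← mul_assoc] at this
    exact this
  have h4 : p * q = q * p := by
    have e1 := eq_neg_of_add_eq_zero_left h2
    have e2 := eq_neg_of_add_eq_zero_right h3
    rw [e1, e2]
  rw [← h4, ← two_smul ℂ] at h1
  exact (smul_eq_zero.mp h1).resolve_left two_ne_zero

theorem toFun_inter {A B : Set α} (hA : MeasurableSet A) (hB : MeasurableSet B) :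
    P.toFun (A ∩ B) = P.toFun A * P.toFun B := by
  have h1 : P.toFun A = P.toFun (A ∩ B) + P.toFun (A \ B) := by
    rw [← P.toFun_union (hA.inter hB) (hA.diff hB) disjoint_inf_sdiff, inter_union_sdiff]
  have h2 : P.toFun B = P.toFun (A ∩ B) + P.toFun (B \ A) := by
    rw [← P.toFun_union (hA.inter hB) (hB.diff hA)
      (by rw [inter_comm]; exact disjoint_inf_sdiff), inter_comm, inter_union_sdiff]
  have e1 : P.toFun (A ∩ B) * P.toFun (B \ A) = 0 :=
    P.toFun_mul_of_disjoint (hA.inter hB) (hB.diff hA)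
      (by rw [inter_comm]; exact disjoint_inf_sdiff)
  have e2 : P.toFun (A \ B) * P.toFun (A ∩ B) = 0 :=
    P.toFun_mul_of_disjoint (hA.diff hB) (hA.inter hB) disjoint_inf_sdiff.symm
  have e3 : P.toFun (A \ B) * P.toFun (B \ A) = 0 :=
    P.toFun_mul_of_disjoint (hA.diff hB) (hB.diff hA) disjoint_sdiff_sdiff
  rw [h1, h2, add_mul, mul_add, mul_add, e1, e2, e3, P.toFun_mul_self (hA.inter hB)]
  simp

theorem toFun_commute {A B : Set α} (hA : MeasurableSet A) (hB : MeasurableSet B) :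
    Commute (P.toFun A) (P.toFun B) := by
  rw [commute_iff_eq, ← P.toFun_inter hA hB, ← P.toFun_inter hB hA, inter_comm]

theorem inner_toFun {A : Set α} (hA : MeasurableSet A) (φ ψ : H) :
    ⟪φ, P.toFun A ψ⟫_ℂ = ⟪P.toFun A φ, P.toFun A ψ⟫_ℂ := by
  have hsa := (P.isStarProjection A hA).isSelfAdjoint
  have h1 : P.toFun A ψ = P.toFun A (P.toFun A ψ) := by
    conv_lhs => rw [← P.toFun_mul_self hA]
    rfl
  have h2 := (ContinuousLinearMap.isSelfAdjoint_iff_isSymmetric.mp hsa) φ (P.toFun A ψ)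
  rw [h1]
  simp only [ContinuousLinearMap.coe_coe] at h2
  rw [← h2, ← h1]

theorem inner_toFun_symm {A : Set α} (hA : MeasurableSet A) (φ ψ : H) :
    ⟪φ, P.toFun A ψ⟫_ℂ = ⟪P.toFun A φ, ψ⟫_ℂ := by
  have hsa := (P.isStarProjection A hA).isSelfAdjoint
  exact ((ContinuousLinearMap.isSelfAdjoint_iff_isSymmetric.mp hsa) φ ψ).symm

theorem inner_toFun_self {A : Set α} (hA : MeasurableSet A) (ψ : H) :
    ⟪ψ, P.toFun A ψ⟫_ℂ = ((‖P.toFun A ψ‖ ^ 2 : ℝ) : ℂ) := by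
  rw [P.inner_toFun hA, inner_self_eq_norm_sq_to_K]
  norm_cast

theorem measure_apply' {A : Set α} (hA : MeasurableSet A) (ψ : H) :
    P.measure ψ A = ENNReal.ofReal (‖P.toFun A ψ‖ ^ 2) := by
  rw [P.measure_apply ψ hA, P.inner_toFun_self hA]
  simp only [Complex.ofReal_re]

instance (ψ : H) : IsFiniteMeasure (P.measure ψ) := by
  refine ⟨?_⟩
  rw [P.measure_apply' MeasurableSet.univ]
  exact ENNReal.ofReal_lt_top

theorem norm_toFun_le {A : Set α} (hA : MeasurableSet A) : ‖P.toFun A‖ ≤ 1 :=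
  IsStarProjection.norm_le _ (P.isStarProjection A hA)

/-! Binary digits -/

/-- The set where the `k`-th binary digit of a function with values in `[0, 1)` is one. -/
def digitSet (f : α → ℝ) (k : ℕ) : Set α := {q | ⌊2 ^ (k + 1) * f q⌋ = 2 * ⌊2 ^ k * f q⌋ + 1}

theorem measurableSet_digitSet {f : α → ℝ} (hf : Measurable f) (k : ℕ) :
    MeasurableSet (digitSet f k) := by
  apply measurableSet_eq_fun
  · exact Int.measurable_floor.comp (hf.const_mul _)
  · exact ((Int.measurable_floor.comp (hf.const_mul _)).const_mul 2).add_const 1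

omit [MeasurableSpace α] in
theorem digitSet_indicator (f : α → ℝ) (k : ℕ) (q : α) :
    (digitSet f k).indicator (fun _ => (1 : ℝ)) q = ⌊2 ^ (k + 1) * f q⌋ - 2 * ⌊2 ^ k * f q⌋ := by
  have h1 := Int.floor_le (2 ^ k * f q)
  have h2 := Int.lt_floor_add_one (2 ^ k * f q)
  have e : (2 : ℝ) ^ (k + 1) * f q = 2 * (2 ^ k * f q) := by ring
  have h3 : 2 * ⌊2 ^ k * f q⌋ ≤ ⌊2 ^ (k + 1) * f q⌋ := by
    rw [Int.le_floor]; push_cast; rw [e]; linarith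
  have h4 : ⌊2 ^ (k + 1) * f q⌋ < 2 * ⌊2 ^ k * f q⌋ + 2 := by
    rw [Int.floor_lt]; push_cast; rw [e]; linarith
  by_cases h : q ∈ digitSet f k
  · rw [indicator_of_mem h]
    have : ⌊2 ^ (k + 1) * f q⌋ = 2 * ⌊2 ^ k * f q⌋ + 1 := h
    rw [this]; push_cast; ring
  · rw [indicator_of_notMem h]
    have h5 : ¬ ⌊2 ^ (k + 1) * f q⌋ = 2 * ⌊2 ^ k * f q⌋ + 1 := h
    have : ⌊2 ^ (k + 1) * f q⌋ = 2 * ⌊2 ^ k * f q⌋ := by omega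
    rw [this]; push_cast; ring

-- The partial sums telescope to the dyadic truncations `⌊2 ^ n * f q⌋ / 2 ^ n`.
omit [MeasurableSpace α] in
theorem digitSet_hasSum {f : α → ℝ} {q : α} (h0 : 0 ≤ f q) (h1 : f q < 1) :
    HasSum (fun k : ℕ => (1 / 2 : ℝ) ^ (k + 1) * (digitSet f k).indicator (fun _ => (1 : ℝ)) q)
      (f q) := by
  have hpart : ∀ n : ℕ, ∑ k ∈ Finset.range n,
      (1 / 2 : ℝ) ^ (k + 1) * (digitSet f k).indicator (fun _ => (1 : ℝ)) q
        = (1 / 2 : ℝ) ^ n * ⌊2 ^ n * f q⌋ := by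
    intro n
    induction n with
    | zero =>
      have : ⌊f q⌋ = 0 := by rw [Int.floor_eq_zero_iff]; exact ⟨h0, h1⟩
      simp [this]
    | succ n ih =>
      rw [Finset.sum_range_succ, ih, digitSet_indicator]
      ring
  rw [hasSum_iff_tendsto_nat_of_nonneg]
  · simp_rw [hpart]
    have hsq : ∀ n : ℕ, f q - (1 / 2 : ℝ) ^ n ≤ (1 / 2 : ℝ) ^ n * ⌊2 ^ n * f q⌋ := by
      intro n
      have := Int.sub_one_lt_floor (2 ^ n * f q)
      have hp : (0 : ℝ) < (1 / 2) ^ n := by positivity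
      have hm : (1 / 2 : ℝ) ^ n * 2 ^ n = 1 := by rw [← mul_pow]; norm_num
      nlinarith
    have hle : ∀ n : ℕ, (1 / 2 : ℝ) ^ n * ⌊2 ^ n * f q⌋ ≤ f q := by
      intro n
      have := Int.floor_le (2 ^ n * f q)
      have hp : (0 : ℝ) < (1 / 2) ^ n := by positivity
      have hm : (1 / 2 : ℝ) ^ n * 2 ^ n = 1 := by rw [← mul_pow]; norm_num
      nlinarith
    refine tendsto_of_tendsto_of_tendsto_of_le_of_le ?_ tendsto_const_nhds hsq hle
    have := (tendsto_pow_atTop_nhds_zero_of_lt_one (r := (1 / 2 : ℝ)) (by norm_num)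
      (by norm_num)).const_sub (f q)
    simpa using this
  · intro k
    exact mul_nonneg (by positivity) (indicator_nonneg (fun _ _ => zero_le_one) _)

-- Hence `digitOp f` involves only projections to subsets of the support of `f`. This is what later
-- makes a collapse operator local to its 3-cell.
omit [MeasurableSpace α] in
theorem digitSet_subset {f : α → ℝ} (k : ℕ) : digitSet f k ⊆ {q | f q ≠ 0} := by
  intro q hq h
  have : ⌊2 ^ (k + 1) * f q⌋ = 2 * ⌊2 ^ k * f q⌋ + 1 := hq
  rw [h] at this
  simp at this

/-- The operator `∫ f dP` for a measurable `f` with `0 ≤ f < 1`, from binary digits. -/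
def digitOp (f : α → ℝ) : H →L[ℂ] H :=
  ∑' k : ℕ, (((1 / 2 : ℝ) ^ (k + 1) : ℝ) : ℂ) • P.toFun (digitSet f k)

theorem summable_half : Summable (fun k : ℕ => (1 / 2 : ℝ) ^ (k + 1)) := by
  simpa [pow_succ] using (summable_geometric_two).mul_right (1 / 2 : ℝ)

theorem digitOp_hasSum {f : α → ℝ} (hf : Measurable f) :
    HasSum (fun k : ℕ => (((1 / 2 : ℝ) ^ (k + 1) : ℝ) : ℂ) • P.toFun (digitSet f k))
      (P.digitOp f) := by
  apply Summable.hasSum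
  apply Summable.of_norm_bounded summable_half
  intro k
  rw [norm_smul, Complex.norm_real, Real.norm_of_nonneg (by positivity)]
  exact mul_le_of_le_one_right (by positivity) (P.norm_toFun_le (measurableSet_digitSet hf k))

theorem digitOp_hasSum_apply {f : α → ℝ} (hf : Measurable f) (ψ : H) :
    HasSum (fun k : ℕ => (((1 / 2 : ℝ) ^ (k + 1) : ℝ) : ℂ) • P.toFun (digitSet f k) ψ)
      (P.digitOp f ψ) :=
  (P.digitOp_hasSum hf).mapL (ContinuousLinearMap.apply ℂ H ψ)

theorem digitOp_commute {f : α → ℝ} (hf : Measurable f) {X : H →L[ℂ] H}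
    (hX : ∀ A, MeasurableSet A → A ⊆ {q | f q ≠ 0} → Commute (P.toFun A) X) :
    Commute (P.digitOp f) X := by
  have h := P.digitOp_hasSum hf
  rw [commute_iff_eq]
  refine (h.mul_right X).unique ?_
  refine (h.mul_left X).congr_fun ?_
  intro k
  rw [smul_mul_assoc, mul_smul_comm, (hX _ (measurableSet_digitSet hf k) (digitSet_subset k)).eq]

/-- The free weight `g` serves two uses: an indicator yields the matrix elements of `digitOp`, and
`g = f` yields the norm. -/
theorem integral_eq_digits {f : α → ℝ} (hf : Measurable f) (h0 : ∀ q, 0 ≤ f q)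
    (h1 : ∀ q, f q < 1) (g : α → ℝ) (μ : Measure α) (hg : Integrable g μ) :
    HasSum (fun k : ℕ => (1 / 2 : ℝ) ^ (k + 1) * ∫ q in digitSet f k, g q ∂μ)
      (∫ q, f q * g q ∂μ) := by
  have h : ∀ q, f q * g q = ∑' k : ℕ,
      (1 / 2 : ℝ) ^ (k + 1) * (digitSet f k).indicator g q := by
    intro q
    have := (digitSet_hasSum (h0 q) (h1 q)).mul_right (g q)
    rw [← this.tsum_eq]
    congr 1; ext k
    by_cases hq : q ∈ digitSet f k <;> simp [hq]
  simp_rw [h]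
  have hi : ∀ k : ℕ, Integrable (fun q => (1 / 2 : ℝ) ^ (k + 1) * (digitSet f k).indicator g q) μ :=
    fun k => (hg.indicator (measurableSet_digitSet hf k)).const_mul _
  have := hasSum_integral_of_summable_integral_norm hi ?_
  · refine this.congr_fun ?_
    intro k
    rw [integral_const_mul, integral_indicator (measurableSet_digitSet hf k)]
  · refine Summable.of_nonneg_of_le (fun k => integral_nonneg fun q => norm_nonneg _) ?_
      (summable_half.mul_right (∫ q, ‖g q‖ ∂μ))
    intro k
    rw [← integral_const_mul]
    apply integral_mono (hi k).norm (hg.norm.const_mul _)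
    intro q
    simp only [norm_mul, norm_pow]
    rw [Real.norm_of_nonneg (by norm_num : (0 : ℝ) ≤ 1 / 2)]
    gcongr
    exact norm_indicator_le_norm_self _ _

theorem inner_digitOp {f : α → ℝ} (hf : Measurable f) (φ ψ : H) :
    HasSum (fun k : ℕ => (((1 / 2 : ℝ) ^ (k + 1) : ℝ) : ℂ) * ⟪φ, P.toFun (digitSet f k) ψ⟫_ℂ)
      ⟪φ, P.digitOp f ψ⟫_ℂ := by
  have := (P.digitOp_hasSum_apply hf ψ).mapL (innerSL ℂ φ)
  simpa [inner_smul_right] using this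

theorem measure_real {A : Set α} (hA : MeasurableSet A) (ψ : H) :
    (P.measure ψ).real A = ‖P.toFun A ψ‖ ^ 2 := by
  rw [Measure.real, P.measure_apply' hA, ENNReal.toReal_ofReal (by positivity)]

theorem integrable_of_bounded {f : α → ℝ} (hf : Measurable f) {c : ℝ} (h0 : ∀ q, 0 ≤ f q)
    (h1 : ∀ q, f q ≤ c) (μ : Measure α) [IsFiniteMeasure μ] : Integrable f μ :=
  Integrable.of_bound hf.aestronglyMeasurable c
    (Filter.Eventually.of_forall fun q => by rw [Real.norm_of_nonneg (h0 q)]; exact h1 q)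

theorem inner_toFun_digitOp {f : α → ℝ} (hf : Measurable f) (h0 : ∀ q, 0 ≤ f q)
    (h1 : ∀ q, f q < 1) {B : Set α} (hB : MeasurableSet B) (ψ : H) :
    ⟪P.toFun B ψ, P.digitOp f ψ⟫_ℂ = ((∫ q in B, f q ∂P.measure ψ : ℝ) : ℂ) := by
  have e := integral_eq_digits hf h0 h1 (B.indicator fun _ => (1 : ℝ)) (P.measure ψ)
    ((integrable_const _).indicator hB)
  have e' := Complex.hasSum_ofReal.mpr e
  refine (P.inner_digitOp hf (P.toFun B ψ) ψ).unique ?_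
  have hr : ∫ q, f q * B.indicator (fun _ => (1 : ℝ)) q ∂P.measure ψ
      = ∫ q in B, f q ∂P.measure ψ := by
    rw [← integral_indicator hB]
    congr 1; ext q
    by_cases hq : q ∈ B <;> simp [hq]
  rw [hr] at e'
  refine e'.congr_fun ?_
  intro k
  have hk := measurableSet_digitSet hf k
  rw [setIntegral_indicator hB, setIntegral_const, smul_eq_mul, mul_one,
    P.measure_real (hk.inter hB), Complex.ofReal_mul, ← P.inner_toFun_self (hk.inter hB),
    ← P.inner_toFun_symm hB, inter_comm, P.toFun_inter hB hk]
  rfl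

/-- One of the two factors of `⟪T ψ, T ψ⟫` is expanded in digits; each term is the integral of `f`
over a digit set, and the digit expansion of the other factor recombines them to `∫ f ^ 2`. -/
theorem norm_digitOp_sq {f : α → ℝ} (hf : Measurable f) (h0 : ∀ q, 0 ≤ f q)
    (h1 : ∀ q, f q < 1) (ψ : H) :
    ‖P.digitOp f ψ‖ ^ 2 = ∫ q, f q ^ 2 ∂P.measure ψ := by
  have e := integral_eq_digits hf h0 h1 f (P.measure ψ)
    (integrable_of_bounded hf h0 (fun q => (h1 q).le) _)
  have e' := Complex.hasSum_ofReal.mpr e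
  have h := (P.inner_digitOp hf (P.digitOp f ψ) ψ).unique (e'.congr_fun fun k => ?_)
  · rw [inner_self_eq_norm_sq_to_K] at h
    have h2 : ((‖P.digitOp f ψ‖ ^ 2 : ℝ) : ℂ) = ((∫ q, f q * f q ∂P.measure ψ : ℝ) : ℂ) := by
      rw [← h]; norm_cast
    have h3 := Complex.ofReal_injective h2
    rw [h3]
    congr 1; ext q; ring
  · have hk := measurableSet_digitSet hf k
    rw [Complex.ofReal_mul, ← P.inner_toFun_digitOp hf h0 h1 hk ψ, ← inner_conj_symm,
      P.inner_toFun_digitOp hf h0 h1 hk ψ, Complex.conj_ofReal]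

theorem isMultOp_digitOp {f : α → ℝ} (hf : Measurable f) (h0 : ∀ q, 0 ≤ f q)
    (h1 : ∀ q, f q < 1) : P.IsMultOp f (P.digitOp f) := by
  intro ψ
  refine ⟨integrable_of_bounded hf h0 (fun q => (h1 q).le) _, ?_⟩
  have := P.inner_toFun_digitOp hf h0 h1 MeasurableSet.univ ψ
  rw [P.isPOVM.univ] at this
  simpa using this

theorem IsMultOp.unique {P : PVM α H} {f : α → ℝ} {S T : H →L[ℂ] H} (hS : P.IsMultOp f S)
    (hT : P.IsMultOp f T) : S = T := by
  have : (S : H →ₗ[ℂ] H) = (T : H →ₗ[ℂ] H) := by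
    rw [← ext_inner_map]
    intro ψ
    simp only [ContinuousLinearMap.coe_coe]
    rw [← inner_conj_symm, (hS ψ).2, ← inner_conj_symm, (hT ψ).2]
  ext ψ
  exact LinearMap.congr_fun this ψ

theorem multOp_eq {f : α → ℝ} {T : H →L[ℂ] H} (hT : P.IsMultOp f T) : P.multOp f = T := by
  have h : ∃ T, P.IsMultOp f T := ⟨T, hT⟩
  rw [multOp, dif_pos h]
  exact h.choose_spec.unique hT

theorem IsMultOp.const_mul {P : PVM α H} {f : α → ℝ} {T : H →L[ℂ] H} (hT : P.IsMultOp f T)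
    (c : ℝ) : P.IsMultOp (fun q => c * f q) ((c : ℂ) • T) := by
  intro ψ
  refine ⟨(hT ψ).1.const_mul c, ?_⟩
  rw [_root_.smul_apply, inner_smul_right, (hT ψ).2, integral_const_mul]
  push_cast; rfl

theorem multOp_eq_digitOp {f : α → ℝ} (hf : Measurable f) {c : ℝ} (hc : 0 < c)
    (h0 : ∀ q, 0 ≤ f q) (h1 : ∀ q, f q < c) :
    P.IsMultOp f ((c : ℂ) • P.digitOp (fun q => f q / c)) := by
  have := (P.isMultOp_digitOp (hf.div_const c) (fun q => div_nonneg (h0 q) hc.le)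
    (fun q => (div_lt_one hc).mpr (h1 q))).const_mul c
  have e : (fun q => c * (f q / c)) = f := by
    ext q; field_simp
  rwa [e] at this

theorem norm_multOp_sq {f : α → ℝ} (hf : Measurable f) {c : ℝ}
    (h0 : ∀ q, 0 ≤ f q) (h1 : ∀ q, f q ≤ c) (ψ : H) :
    ‖P.multOp f ψ‖ ^ 2 = ∫ q, f q ^ 2 ∂P.measure ψ := by
  -- The binary expansion needs values in `[0, 1)`, so the bound `c`, which may be attained or fail
  -- to be positive, is replaced by a strict positive one.
  have hc : 0 < |c| + 1 := by positivity
  have hlt : ∀ q, f q < |c| + 1 := fun q => by linarith [h1 q, le_abs_self c]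
  rw [P.multOp_eq (P.multOp_eq_digitOp hf hc h0 hlt)]
  rw [_root_.smul_apply, norm_smul, mul_pow,
    P.norm_digitOp_sq (hf.div_const _) (fun q => div_nonneg (h0 q) hc.le)
      (fun q => (div_lt_one hc).mpr (hlt q)), ← integral_const_mul]
  congr 1; ext q
  rw [Complex.norm_real, Real.norm_of_nonneg hc.le]
  field_simp

theorem multOp_commute {f : α → ℝ} (hf : Measurable f) {c : ℝ}
    (h0 : ∀ q, 0 ≤ f q) (h1 : ∀ q, f q ≤ c) {X : H →L[ℂ] H}
    (hX : ∀ A, MeasurableSet A → A ⊆ {q | f q ≠ 0} → Commute (P.toFun A) X) :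
    Commute (P.multOp f) X := by
  have hc : 0 < |c| + 1 := by positivity
  have hlt : ∀ q, f q < |c| + 1 := fun q => by linarith [h1 q, le_abs_self c]
  rw [P.multOp_eq (P.multOp_eq_digitOp hf hc h0 hlt)]
  refine (P.digitOp_commute (hf.div_const _) fun A hA hA' => hX A hA fun q hq hq0 => ?_).smul_left _
  exact hA' hq (by rw [hq0, zero_div])

end PVM

/-- Physical 3-space. -/
abbrev E3 : Type := EuclideanSpace ℝ (Fin 3)

/-! ### Spacelike surfaces as graphs -/

/-- Along a future-directed timelike line the height above the graph grows at least at the rate `v.1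
- ‖v.2‖ > 0`, so it vanishes exactly once. -/
theorem graph_meets_once_aux {f : E3 → ℝ} (hf : LipschitzWith 1 f) (p v : Minkowski)
    (hv : ‖v.2‖ < v.1) :
    ∃! z : Minkowski, z ∈ {z : Minkowski | z.1 = f z.2} ∧ ∃ r : ℝ, z = p + r • v := by
  let φ : ℝ → ℝ := fun r => (p + r • v).1 - f (p + r • v).2
  have hmem : ∀ r, p + r • v ∈ {z : Minkowski | z.1 = f z.2} ↔ φ r = 0 := fun r => by
    rw [sub_eq_zero]; rfl
  have hφ : ∀ r₁ r₂, r₁ ≤ r₂ → φ r₁ + (v.1 - ‖v.2‖) * (r₂ - r₁) ≤ φ r₂ := by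
    intro r₁ r₂ h
    have hd : 0 ≤ r₂ - r₁ := sub_nonneg.mpr h
    have h1 : f (p + r₂ • v).2 - f (p + r₁ • v).2 ≤ (r₂ - r₁) * ‖v.2‖ := by
      have e : (p + r₂ • v).2 - (p + r₁ • v).2 = (r₂ - r₁) • v.2 := by
        simp only [Prod.snd_add, Prod.smul_snd, sub_smul]
        abel
      have := hf.dist_le_mul (p + r₂ • v).2 (p + r₁ • v).2
      rw [dist_eq_norm, dist_eq_norm, e, norm_smul, Real.norm_eq_abs, Real.norm_eq_abs,
        abs_of_nonneg hd, NNReal.coe_one, one_mul] at this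
      exact (le_abs_self _).trans this
    simp only [φ, Prod.fst_add, Prod.smul_fst, smul_eq_mul]
    linarith
  have hc : 0 < v.1 - ‖v.2‖ := sub_pos.mpr hv
  have hcont : Continuous φ := by
    have := hf.continuous
    simp only [φ]
    fun_prop
  obtain ⟨r, hr⟩ : ∃ r, φ r = 0 := by
    let R : ℝ := |φ 0| / (v.1 - ‖v.2‖)
    have hR : 0 ≤ R := by positivity
    have hRc : (v.1 - ‖v.2‖) * R = |φ 0| := mul_div_cancel₀ _ hc.ne'
    have h1 : 0 ≤ φ R := by
      have := hφ 0 R hR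
      rw [sub_zero, hRc] at this
      linarith [neg_abs_le (φ 0)]
    have h2 : φ (-R) ≤ 0 := by
      have := hφ (-R) 0 (by linarith)
      rw [zero_sub, neg_neg, hRc] at this
      linarith [le_abs_self (φ 0)]
    obtain ⟨r, -, hr⟩ := intermediate_value_Icc (show -R ≤ R by linarith) hcont.continuousOn
      (show (0 : ℝ) ∈ Icc (φ (-R)) (φ R) from ⟨h2, h1⟩)
    exact ⟨r, hr⟩
  refine ⟨p + r • v, ⟨(hmem r).mpr hr, r, rfl⟩, ?_⟩
  rintro z ⟨hz, q, rfl⟩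
  have hq := (hmem q).mp hz
  have : q = r := by
    rcases le_total q r with h | h
    · have := hφ q r h
      rw [hq, hr] at this
      nlinarith
    · have := hφ r q h
      rw [hq, hr] at this
      nlinarith
  rw [this]

/-- The graph of a 1-Lipschitz function, a spacelike surface. -/
def graphSurface (f : E3 → ℝ) (hf : LipschitzWith 1 f) : SpacelikeSurface where
  carrier := {z | z.1 = f z.2}
  meets_once := by
    intro p v hv
    have hv' : ‖v.2‖ ^ 2 < v.1 ^ 2 := by
      simp only [IsTimelike, mink, real_inner_self_eq_norm_sq] at hv
      nlinarith
    have hv2 : ‖v.2‖ < |v.1| := by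
      have := sq_lt_sq.mp hv'
      rwa [abs_of_nonneg (norm_nonneg _)] at this
    rcases lt_abs.mp hv2 with h | h
    · exact graph_meets_once_aux hf p v h
    · obtain ⟨z, ⟨hz, r, hr⟩, hu⟩ := graph_meets_once_aux hf p (-v) (by simpa using h)
      refine ⟨z, ⟨hz, -r, by simpa using hr⟩, ?_⟩
      rintro w ⟨hw, q, hq⟩
      exact hu w ⟨hw, -q, by simpa using hq⟩

/-- The time function of the hyperboloid of timelike distance `s` from `y`. -/
def hypTime (y : Minkowski) (s : ℝ) (ξ : E3) : ℝ := y.1 + √(s ^ 2 + ‖ξ - y.2‖ ^ 2)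

theorem sqrt_sq_add_sq_sub_le (s s' a a' : ℝ) (ha : 0 ≤ a) (ha' : 0 ≤ a') :
    √(s ^ 2 + a ^ 2) ≤ √(s' ^ 2 + a' ^ 2) + (|s - s'| + |a - a'|) := by
  have h1 := sqrt_sq_add_le (s := s) ha' ha (abs_nonneg (a - a'))
    (by linarith [le_abs_self (a - a')])
  have h2 := sqrt_sq_add_le (s := a') (abs_nonneg s') (abs_nonneg s) (abs_nonneg (s - s'))
    (by have := abs_sub_abs_le_abs_sub s s'; linarith)
  simp only [sq_abs] at h2
  rw [add_comm (a' ^ 2), add_comm (a' ^ 2)] at h2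
  linarith

theorem hypTime_sub_le (y y' : Minkowski) (s s' : ℝ) (ξ η : E3) :
    hypTime y s ξ - hypTime y' s' η ≤ |y.1 - y'.1| + |s - s'| + (‖y.2 - y'.2‖ + ‖ξ - η‖) := by
  have h := sqrt_sq_add_sq_sub_le s s' ‖ξ - y.2‖ ‖η - y'.2‖ (norm_nonneg _) (norm_nonneg _)
  have h2 : |‖ξ - y.2‖ - ‖η - y'.2‖| ≤ ‖y.2 - y'.2‖ + ‖ξ - η‖ := by
    refine (abs_norm_sub_norm_le _ _).trans ?_
    have : ξ - y.2 - (η - y'.2) = (ξ - η) - (y.2 - y'.2) := by abel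
    rw [this, add_comm]
    exact norm_sub_le _ _
  simp only [hypTime]
  linarith [le_abs_self (y.1 - y'.1)]

theorem hypTime_lipschitz (y : Minkowski) (s : ℝ) : LipschitzWith 1 (hypTime y s) := by
  apply LipschitzWith.of_le_add
  intro ξ η
  have := hypTime_sub_le y y s s ξ η
  simp only [sub_self, abs_zero, norm_zero, zero_add] at this
  rw [dist_eq_norm]
  linarith

/-- Equality of the surfaces themselves is required, since the Hilbert spaces and PVMs of an
evolution are indexed by surfaces. -/
theorem hyperboloid_eq_graphSurface (y : Minkowski) (s : ℝ) (hs : 0 ≤ s) :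
    hyperboloid y s hs = graphSurface (hypTime y s) (hypTime_lipschitz y s) := by
  have : hyperboloidSet y s = {z | z.1 = hypTime y s z.2} := by
    ext z
    rw [mem_hyperboloidSet_iff y z hs, mem_ofPred_eq, hypTime, sub_eq_iff_eq_add']
  simp only [hyperboloid, graphSurface, this]

theorem lipschitz_abs_sub_le {f : E3 → ℝ} (hf : LipschitzWith 1 f) (ξ η : E3) :
    |f ξ - f η| ≤ ‖ξ - η‖ := by
  have := hf.dist_le_mul ξ η
  rwa [NNReal.coe_one, one_mul, dist_eq_norm, dist_eq_norm, Real.norm_eq_abs] at this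

theorem lipschitz_le_add {f : E3 → ℝ} (hf : LipschitzWith 1 f) (ξ η : E3) :
    f ξ ≤ f η + ‖ξ - η‖ := by
  linarith [le_abs_self (f ξ - f η), lipschitz_abs_sub_le hf ξ η]

theorem lipschitz_of_le_add {f : E3 → ℝ} (hf : ∀ ξ η, f ξ ≤ f η + ‖ξ - η‖) :
    LipschitzWith 1 f :=
  LipschitzWith.of_le_add fun ξ η => by rw [dist_eq_norm]; exact hf ξ η

/-! ### Transport of projection-valued measures -/

section Transport

variable {α β : Type*} [MeasurableSpace α] [MeasurableSpace β]
  {H H' : Type*} [NormedAddCommGroup H] [InnerProductSpace ℂ H] [CompleteSpace H]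
  [NormedAddCommGroup H'] [InnerProductSpace ℂ H'] [CompleteSpace H']

/-- The image of a PVM under a measurable map of the base and a unitary of the Hilbert space. -/
def PVM.transport (P : PVM α H) (f : α → β) (hf : Measurable f) (U : H ≃ₗᵢ[ℂ] H') : PVM β H' where
  toFun A := (U : H →L[ℂ] H') ∘L P.toFun (f ⁻¹' A) ∘L (U.symm : H' →L[ℂ] H)
  isPOVM :=
    { isPositive := by
        intro B hB
        have h := P.isPOVM.isPositive _ (hf hB)
        rw [ContinuousLinearMap.isPositive_iff_complex] at h ⊢
        intro ψ
        have := h (U.symm ψ)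
        have e : ⟪U (P.toFun (f ⁻¹' B) (U.symm ψ)), ψ⟫_ℂ
            = ⟪P.toFun (f ⁻¹' B) (U.symm ψ), U.symm ψ⟫_ℂ := by
          conv_lhs => rw [← U.apply_symm_apply ψ, U.inner_map_map, U.symm_apply_apply]
        simpa [e] using this
      univ := by
        ext ψ
        simp [P.isPOVM.univ]
      hasSum_iUnion := by
        intro B hB hd ψ
        have h := P.isPOVM.hasSum_iUnion (fun m => f ⁻¹' (B m)) (fun m => hf (hB m))
          (fun i j hij => (hd hij).preimage f) (U.symm ψ)
        rw [← preimage_iUnion] at h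
        exact h.mapL (U : H →L[ℂ] H') }
  isStarProjection := by
    intro B hB
    have h := P.isStarProjection _ (hf hB)
    refine ⟨?_, ?_⟩
    · have h1 := h.isIdempotentElem
      ext ψ
      have := congrArg (fun T : H →L[ℂ] H => U (T (U.symm ψ))) h1.eq
      simpa using this
    · have h1 := ContinuousLinearMap.isSelfAdjoint_iff_isSymmetric.mp h.isSelfAdjoint
      rw [ContinuousLinearMap.isSelfAdjoint_iff_isSymmetric]
      intro φ ψ
      have := h1 (U.symm φ) (U.symm ψ)
      simp only [ContinuousLinearMap.coe_coe] at this
      have e1 : ⟪U (P.toFun (f ⁻¹' B) (U.symm φ)), ψ⟫_ℂ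
            = ⟪P.toFun (f ⁻¹' B) (U.symm φ), U.symm ψ⟫_ℂ := by
          conv_lhs => rw [← U.apply_symm_apply ψ, U.inner_map_map]
      have e2 : ⟪φ, U (P.toFun (f ⁻¹' B) (U.symm ψ))⟫_ℂ
            = ⟪U.symm φ, P.toFun (f ⁻¹' B) (U.symm ψ)⟫_ℂ := by
          conv_lhs => rw [← U.apply_symm_apply φ, U.inner_map_map]
      simp [e1, e2, this]

theorem PVM.transport_apply (P : PVM α H) (f : α → β) (hf : Measurable f) (U : H ≃ₗᵢ[ℂ] H')
    (A : Set β) (ψ : H') :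
    (P.transport f hf U).toFun A ψ = U (P.toFun (f ⁻¹' A) (U.symm ψ)) := rfl

theorem PVM.transport_measure (P : PVM α H) (f : α → β) (hf : Measurable f) (U : H ≃ₗᵢ[ℂ] H')
    (ψ : H') : (P.transport f hf U).measure ψ = (P.measure (U.symm ψ)).map f := by
  ext A hA
  rw [Measure.map_apply hf hA, PVM.measure_apply' _ hA, PVM.measure_apply' _ (hf hA),
    PVM.transport_apply, U.norm_map]

theorem PVM.transport_isMultOp (P : PVM α H) (f : α → β) (hf : Measurable f) (U : H ≃ₗᵢ[ℂ] H')
    {g : β → ℝ} (hg : Measurable g) {T : H' →L[ℂ] H'} (hT : (P.transport f hf U).IsMultOp g T) :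
    P.IsMultOp (g ∘ f) ((U.symm : H' →L[ℂ] H) ∘L T ∘L (U : H →L[ℂ] H')) := by
  intro ψ
  have h := hT (U ψ)
  rw [PVM.transport_measure, U.symm_apply_apply,
    integrable_map_measure hg.aestronglyMeasurable hf.aemeasurable,
    integral_map hf.aemeasurable hg.aestronglyMeasurable] at h
  refine ⟨h.1, ?_⟩
  have h2 := h.2
  have e : ⟪ψ, U.symm (T (U ψ))⟫_ℂ = ⟪U ψ, T (U ψ)⟫_ℂ := by
    conv_lhs => rw [← U.inner_map_map, U.apply_symm_apply]
  simpa [e] using h2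

end Transport

/-! ### Local families of position observables -/

/-- The one-particle position observables of an interaction-local evolution in the Heisenberg
picture, for all spacelike surfaces (graphs of 1-Lipschitz functions). -/
structure LocalFamily (N : ℕ) (H : Type*) [NormedAddCommGroup H] [InnerProductSpace ℂ H]
    [CompleteSpace H] where
  R : (f : E3 → ℝ) → LipschitzWith 1 f → Fin N → PVM E3 H
  isLocal : ∀ f hf g hg i A, MeasurableSet A → (∀ ξ ∈ A, f ξ = g ξ) →
    (R f hf i).toFun A = (R g hg i).toFun A
  comm : ∀ f hf i j A B, MeasurableSet A → MeasurableSet B →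
    Commute ((R f hf i).toFun A) ((R f hf j).toFun B)

theorem measurable_coord {N : ℕ} (S : SpacelikeSurface) (i : Fin N) :
    Measurable (fun q : Fin N → S => ((q i : Minkowski)).2) :=
  measurable_snd.comp (measurable_subtype_coe.comp (measurable_pi_apply i))

namespace HypersurfaceEvolution

variable {N : ℕ} (E : HypersurfaceEvolution.{u} N)

theorem U_symm (S S' : SpacelikeSurface) (ψ : E.Hil S') : (E.U S S').symm ψ = E.U S' S ψ := by
  rw [LinearIsometryEquiv.symm_apply_eq, E.U_comp, E.U_self]

/-- The position observables of the evolution in the Heisenberg picture. -/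
def toLocalFamily (hE : E.InteractionLocal) (S₀ : SpacelikeSurface) :
    LocalFamily N (E.Hil S₀) where
  R f hf i := (E.P (graphSurface f hf)).transport (fun q => ((q i : Minkowski)).2)
    (measurable_coord _ i) (E.U (graphSurface f hf) S₀)
  isLocal := by
    intro f hf g hg i A hA hfg
    ext ψ
    rw [PVM.transport_apply, PVM.transport_apply]
    have hA' : MeasurableSet {z : Minkowski | z.2 ∈ A ∧ z.1 = f z.2} :=
      (measurable_snd hA).inter
        (measurableSet_eq_fun measurable_fst (hf.continuous.measurable.comp measurable_snd))
    -- Locality concerns sets of space-time points: the spatial set `A` is lifted to the piece of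
    -- the graph above it, which lies on both surfaces because `f = g` on `A`.
    have h := hE (graphSurface f hf) (graphSurface g hg) {z | z.2 ∈ A ∧ z.1 = f z.2} hA'
      (fun z hz => ⟨hz.2, hz.2.trans (hfg _ hz.1)⟩) i
    have e1 : ∀ h (hh : LipschitzWith 1 h), (∀ ξ ∈ A, f ξ = h ξ) →
        ((fun q : Fin N → graphSurface h hh => ((q i : Minkowski)).2) ⁻¹' A)
          = {q | (q i : Minkowski) ∈ {z : Minkowski | z.2 ∈ A ∧ z.1 = f z.2}} := by
      intro h hh hfh
      ext q
      have : (q i : Minkowski).1 = h (q i : Minkowski).2 := (q i).2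
      constructor
      · intro hq
        exact ⟨hq, by rw [this, hfh _ hq]⟩
      · intro hq
        exact hq.1
    rw [e1 f hf (fun _ _ => rfl), e1 g hg hfg]
    have h2 := congrArg (fun T => E.U (graphSurface g hg) S₀ (T
      ((E.U (graphSurface g hg) S₀).symm ψ))) h
    simp only [posProj, evol, ContinuousLinearMap.comp_apply] at h2
    rw [h2]
    simp only [U_symm]
    simp [E.U_comp]
  comm := by
    intro f hf i j A B hA hB
    have h := (E.P (graphSurface f hf)).toFun_commute (measurable_coord _ i hA)
      (measurable_coord _ j hB)
    rw [commute_iff_eq] at h ⊢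
    ext ψ
    have := congrArg (fun T => E.U (graphSurface f hf) S₀ (T
      ((E.U (graphSurface f hf) S₀).symm ψ))) h
    simpa [PVM.transport_apply] using this

end HypersurfaceEvolution

/-! ### Measurable dependence of the position observables on the hyperboloid -/

/-- For positive `s`, two points of a hyperboloid are strictly spacelike separated, with a uniform
margin here. With `A = √(s² + a²)`, `B = √(s² + b²)` and spatial distance `D`, one has `|A - B| (A +
B) ≤ D (a + b)`, so the margin is at least `D (A - a) / (A + B)`. On the compact set `A - a` is
bounded below, and `D / (A + B)` is bounded below because `D ≥ r` and `B ≤ A + D`. -/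
theorem hypTime_gap (y : Minkowski) {s : ℝ} (hs : 0 < s) {K O : Set E3} (hK : IsCompact K)
    (hO : IsOpen O) (hKO : K ⊆ O) :
    ∃ ε > 0, ∀ ξ ∈ K, ∀ η ∉ O, |hypTime y s ξ - hypTime y s η| + ε ≤ ‖ξ - η‖ := by
  obtain ⟨r, hr, hrO⟩ := hK.exists_thickening_subset_open hO hKO
  obtain ⟨M, hM⟩ := hK.exists_bound_of_continuousOn
    (f := fun ξ => √(s ^ 2 + ‖ξ - y.2‖ ^ 2)) (by fun_prop)
  have hM0 : 0 < |M| + 1 := by positivity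
  set M' := |M| + 1
  refine ⟨r * s ^ 2 / (2 * M' * (2 * M' + r)), by positivity, ?_⟩
  intro ξ hξ η hη
  have hD : r ≤ ‖ξ - η‖ := by
    by_contra hlt
    push Not at hlt
    exact hη (hrO (Metric.mem_thickening_iff.mpr ⟨ξ, hξ, by rwa [dist_comm, dist_eq_norm]⟩))
  have hMξ : √(s ^ 2 + ‖ξ - y.2‖ ^ 2) ≤ M' := by
    have := hM ξ hξ
    rw [Real.norm_of_nonneg (Real.sqrt_nonneg _)] at this
    linarith [le_abs_self M]
  set a := ‖ξ - y.2‖ with ha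
  set b := ‖η - y.2‖ with hb
  set D := ‖ξ - η‖ with hDdef
  have ha0 : 0 ≤ a := norm_nonneg _
  have hb0 : 0 ≤ b := norm_nonneg _
  have hab : |a - b| ≤ D := by
    have := abs_norm_sub_norm_le (ξ - y.2) (η - y.2)
    rwa [sub_sub_sub_cancel_right] at this
  set A := √(s ^ 2 + a ^ 2) with hA
  set B := √(s ^ 2 + b ^ 2) with hB
  have hA2 : A ^ 2 = s ^ 2 + a ^ 2 := Real.sq_sqrt (by positivity)
  have hB2 : B ^ 2 = s ^ 2 + b ^ 2 := Real.sq_sqrt (by positivity)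
  have hAa : a ≤ A := Real.le_sqrt_of_sq_le (by nlinarith [sq_nonneg s])
  have hBb : b ≤ B := Real.le_sqrt_of_sq_le (by nlinarith [sq_nonneg s])
  have hApos : 0 < A := Real.sqrt_pos.mpr (by positivity)
  have hBpos : 0 < B := Real.sqrt_pos.mpr (by positivity)
  have hBA : B ≤ A + D := by
    have := sqrt_sq_add_sq_sub_le s s b a hb0 ha0
    rw [sub_self, abs_zero, zero_add, abs_sub_comm] at this
    linarith
  have hdiff : |hypTime y s ξ - hypTime y s η| * (A + B) ≤ D * (a + b) := by
    have e : hypTime y s ξ - hypTime y s η = A - B := by simp [hypTime, hA, hB, ha, hb]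
    rw [e]
    have : |A - B| * (A + B) = |a - b| * (a + b) := by
      have e1 : |A - B| * (A + B) = |(A - B) * (A + B)| := by
        rw [abs_mul, abs_of_pos (add_pos hApos hBpos)]
      have e2 : |a - b| * (a + b) = |(a - b) * (a + b)| := by
        rw [abs_mul, abs_of_nonneg (add_nonneg ha0 hb0)]
      rw [e1, e2]
      congr 1; nlinarith
    rw [this]
    gcongr
  have hδ : s ^ 2 ≤ (A - a) * (2 * M') := by
    have : s ^ 2 = (A - a) * (A + a) := by nlinarith
    rw [this]
    exact mul_le_mul_of_nonneg_left (by linarith) (by linarith)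
  have key : r * s ^ 2 * (A + B) ≤ (D * (A - a)) * (2 * M' * (2 * M' + r)) := by
    have h1 : r * (A + B) ≤ D * (2 * M' + r) := by
      have : r * (A + B) ≤ r * (2 * M' + D) :=
        mul_le_mul_of_nonneg_left (by linarith) hr.le
      nlinarith
    calc r * s ^ 2 * (A + B) = (r * (A + B)) * s ^ 2 := by ring
      _ ≤ (D * (2 * M' + r)) * ((A - a) * (2 * M')) := by gcongr
      _ = _ := by ring
  have h2 : r * s ^ 2 / (2 * M' * (2 * M' + r)) * (A + B) ≤ D * (A - a) := by
    rw [div_mul_eq_mul_div, div_le_iff₀ (by positivity)]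
    exact key
  have hAB : 0 < A + B := by positivity
  have h3 : (|hypTime y s ξ - hypTime y s η| + r * s ^ 2 / (2 * M' * (2 * M' + r))) * (A + B)
      ≤ D * (A + B) := by
    rw [add_mul]
    have : D * (a + b) + D * (A - a) ≤ D * (A + B) := by
      have hD0 : 0 ≤ D := norm_nonneg _
      nlinarith
    linarith
  exact le_of_mul_le_mul_right h3 hAB

section Family

variable {N : ℕ} {H : Type*} [NormedAddCommGroup H] [InnerProductSpace ℂ H] [CompleteSpace H]
  (F : LocalFamily N H)

/-- No signalling: observables on achronally separated pieces of two surfaces are orthogonal. -/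
theorem LocalFamily.mul_eq_zero (i : Fin N) {f g : E3 → ℝ} (hf : LipschitzWith 1 f)
    (hg : LipschitzWith 1 g) {A B : Set E3} (hA : MeasurableSet A) (hB : MeasurableSet B)
    (hd : Disjoint A B) (h : ∀ ξ ∈ A, ∀ η ∈ B, |f ξ - g η| ≤ ‖ξ - η‖) :
    (F.R f hf i).toFun A * (F.R g hg i).toFun B = 0 := by
  classical
  -- Gluing `f` on `A` to `g` on `B` keeps the Lipschitz constant 1, by the achronality hypothesis.
  -- The extension to all of space is a surface on which both projections are those of disjoint
  -- sets.
  have hL : LipschitzOnWith 1 (A.piecewise f g) (A ∪ B) := by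
    apply LipschitzOnWith.of_dist_le_mul
    have hfl := fun ξ η => lipschitz_abs_sub_le hf ξ η
    have hgl := fun ξ η => lipschitz_abs_sub_le hg ξ η
    have hnot : ∀ ξ ∈ B, ξ ∉ A := fun ξ hξ hξ' => hd.le_bot ⟨hξ', hξ⟩
    rintro ξ (hξ | hξ) η (hη | hη)
    all_goals rw [dist_eq_norm, dist_eq_norm, NNReal.coe_one, one_mul, Real.norm_eq_abs]
    · rw [piecewise_eq_of_mem _ _ _ hξ, piecewise_eq_of_mem _ _ _ hη]; exact hfl _ _
    · rw [piecewise_eq_of_mem _ _ _ hξ, piecewise_eq_of_notMem _ _ _ (hnot _ hη)]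
      exact h _ hξ _ hη
    · rw [piecewise_eq_of_notMem _ _ _ (hnot _ hξ), piecewise_eq_of_mem _ _ _ hη, abs_sub_comm,
        norm_sub_rev]
      exact h _ hη _ hξ
    · rw [piecewise_eq_of_notMem _ _ _ (hnot _ hξ), piecewise_eq_of_notMem _ _ _ (hnot _ hη)]
      exact hgl _ _
  obtain ⟨k, hk, hEq⟩ := hL.extend_real
  rw [F.isLocal f hf k hk i A hA fun ξ hξ => ?_, F.isLocal g hg k hk i B hB fun ξ hξ => ?_]
  · exact (F.R k hk i).toFun_mul_of_disjoint hA hB hd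
  · rw [← hEq (Or.inr hξ), piecewise_eq_of_notMem]
    exact fun hξ' => hd.le_bot ⟨hξ', hξ⟩
  · rw [← hEq (Or.inl hξ), piecewise_eq_of_mem _ _ _ hξ]

/-- Parameters of a hyperboloid: the base point and the timelike distance. -/
abbrev HypParam : Type := {p : Minkowski × ℝ // 0 < p.2}

/-- The position observables of particle `i` on a hyperboloid. -/
def LocalFamily.hyp (p : HypParam) (i : Fin N) : PVM E3 H :=
  F.R (hypTime p.1.1 p.1.2) (hypTime_lipschitz _ _) i

/-- The gap between `K` and the complement of `O` survives small changes of the hyperboloid. Hence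
`P_{p₀}(K)` annihilates `P_p(Oᶜ) φ`, so `P_{p₀}(K) φ` is the orthogonal projection of `P_p(O) φ`,
and the identity is Pythagoras. -/
theorem LocalFamily.eventually_norm_sub_sq (i : Fin N) {K O : Set E3} (hK : IsCompact K)
    (hO : IsOpen O) (hKO : K ⊆ O) (φ : H) (p₀ : HypParam) :
    ∀ᶠ p in 𝓝 p₀, ‖(F.hyp p i).toFun O φ - (F.hyp p₀ i).toFun K φ‖ ^ 2
      = ‖(F.hyp p i).toFun O φ‖ ^ 2 - ‖(F.hyp p₀ i).toFun K φ‖ ^ 2 := by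
  obtain ⟨ε, hε, hgap⟩ := hypTime_gap p₀.1.1 p₀.2 hK hO hKO
  have hcont : Continuous fun p : HypParam =>
      |p₀.1.1.1 - p.1.1.1| + |p₀.1.2 - p.1.2| + ‖p₀.1.1.2 - p.1.1.2‖ := by fun_prop
  have h0 := (hcont.tendsto p₀).eventually
    (gt_mem_nhds (show |p₀.1.1.1 - p₀.1.1.1| + |p₀.1.2 - p₀.1.2| + ‖p₀.1.1.2 - p₀.1.1.2‖ < ε by
      simpa using hε))
  filter_upwards [h0] with p hp
  have hO' := hO.measurableSet
  have hK' := hK.measurableSet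
  have hz : (F.hyp p₀ i).toFun K * (F.hyp p i).toFun Oᶜ = 0 := by
    apply F.mul_eq_zero i _ _ hK' hO'.compl
    · exact disjoint_compl_right_iff_subset.mpr hKO
    · intro ξ hξ η hη
      have h1 := hgap ξ hξ η hη
      have h2 := hypTime_sub_le p₀.1.1 p.1.1 p₀.1.2 p.1.2 η η
      have h3 := hypTime_sub_le p.1.1 p₀.1.1 p.1.2 p₀.1.2 η η
      rw [abs_sub_comm, abs_sub_comm p.1.2, norm_sub_rev p.1.1.2] at h3
      rw [sub_self, norm_zero] at h2 h3
      have h4 := abs_le.mp (show |hypTime p₀.1.1 p₀.1.2 ξ - hypTime p₀.1.1 p₀.1.2 η|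
        ≤ ‖ξ - η‖ - ε by linarith)
      rw [abs_le]
      constructor <;> linarith [h4.1, h4.2]
  rw [PVM.toFun_compl _ hO', mul_sub, mul_one, sub_eq_zero] at hz
  have e : (F.hyp p₀ i).toFun K φ = (F.hyp p₀ i).toFun K ((F.hyp p i).toFun O φ) := by
    conv_lhs => rw [hz]
    rfl
  have e2 : ⟪(F.hyp p₀ i).toFun K φ, (F.hyp p i).toFun O φ⟫_ℂ
      = ((‖(F.hyp p₀ i).toFun K φ‖ ^ 2 : ℝ) : ℂ) := by
    have h5 : (F.hyp p₀ i).toFun K φ = (F.hyp p₀ i).toFun K ((F.hyp p₀ i).toFun K φ) := by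
      conv_lhs => rw [← PVM.toFun_mul_self _ hK']
      rfl
    conv_lhs => rw [h5, ← PVM.inner_toFun_symm _ hK', ← e]
    rw [inner_self_eq_norm_sq_to_K]; norm_cast
  rw [@norm_sub_sq ℂ, ← inner_conj_symm, e2, Complex.conj_ofReal]
  simp only [RCLike.re_to_complex, Complex.ofReal_re]
  ring

theorem LocalFamily.exists_compact (i : Fin N) {O : Set E3} (hO : IsOpen O) (φ : H)
    (p₀ : HypParam) {ε : ℝ} (hε : 0 < ε) : ∃ K, IsCompact K ∧ K ⊆ O ∧
      ‖(F.hyp p₀ i).toFun O φ‖ ^ 2 - ε < ‖(F.hyp p₀ i).toFun K φ‖ ^ 2 := by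
  set P := F.hyp p₀ i
  by_cases h0 : ‖P.toFun O φ‖ ^ 2 - ε < 0
  · exact ⟨∅, isCompact_empty, empty_subset _, by rw [P.toFun_empty]; simpa using h0⟩
  · push Not at h0
    have : ENNReal.ofReal (‖P.toFun O φ‖ ^ 2 - ε) < P.measure φ O := by
      rw [P.measure_apply' hO.measurableSet]
      exact (ENNReal.ofReal_lt_ofReal_iff (by linarith)).mpr (by linarith)
    obtain ⟨K, hKO, hK, hlt⟩ := hO.exists_lt_isCompact this
    refine ⟨K, hK, hKO, ?_⟩
    rw [P.measure_apply' hK.measurableSet] at hlt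
    exact ((ENNReal.ofReal_lt_ofReal_iff_of_nonneg h0).mp hlt)

theorem LocalFamily.lowerSemicontinuous_norm (i : Fin N) {O : Set E3} (hO : IsOpen O) (φ : H) :
    LowerSemicontinuous fun p => ‖(F.hyp p i).toFun O φ‖ ^ 2 := by
  intro p₀ c hc
  obtain ⟨K, hK, hKO, hlt⟩ := F.exists_compact i hO φ p₀ (sub_pos.mpr hc)
  filter_upwards [F.eventually_norm_sub_sq i hK hO hKO φ p₀] with p hp
  have : 0 ≤ ‖(F.hyp p i).toFun O φ - (F.hyp p₀ i).toFun K φ‖ ^ 2 := by positivity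
  linarith

/-- The Hilbert space may be nonseparable, so weak measurability is not enough. The norm is lower
semicontinuous in `p`; where it also does not jump up, the vectors at `p` and at `p₀` are both close
to `P_{p₀}(K) φ`. So the vector depends continuously on the pair of `p` and its norm. -/
theorem LocalFamily.stronglyMeasurable_open (i : Fin N) {O : Set E3} (hO : IsOpen O) (φ : H) :
    StronglyMeasurable fun p => (F.hyp p i).toFun O φ := by
  let n : HypParam → ℝ := fun p => ‖(F.hyp p i).toFun O φ‖ ^ 2
  have hn : Measurable n := (F.lowerSemicontinuous_norm i hO φ).measurable
  -- The graph of the norm function is a separable metric space, on which the continuous map `v` is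
  -- strongly measurable; `p ↦ (p, n p)` maps into it measurably.
  let G : Type := {q : HypParam × ℝ // q.2 = n q.1}
  let v : G → H := fun q => (F.hyp q.1.1 i).toFun O φ
  have hv : Continuous v := by
    rw [continuous_iff_continuousAt]
    rintro ⟨⟨p₀, t₀⟩, ht₀⟩
    rw [ContinuousAt, Metric.tendsto_nhds]
    intro ε hε
    obtain ⟨K, hK, hKO, hlt⟩ := F.exists_compact i hO φ p₀ (show 0 < ε ^ 2 / 16 by positivity)
    have h1 := F.eventually_norm_sub_sq i hK hO hKO φ p₀
    have c1 : Continuous fun q : G => q.1.1 := by fun_prop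
    have c2 : Continuous fun q : G => q.1.2 := by fun_prop
    have h2 := (c1.tendsto ⟨⟨p₀, t₀⟩, ht₀⟩).eventually h1
    have h3 := (c2.tendsto ⟨⟨p₀, t₀⟩, ht₀⟩).eventually
      (Iio_mem_nhds (show t₀ < t₀ + ε ^ 2 / 16 by linarith [show 0 < ε ^ 2 / 16 by positivity]))
    filter_upwards [h2, h3] with q hq1 hq2
    have hq3 : q.1.2 = ‖(F.hyp q.1.1 i).toFun O φ‖ ^ 2 := q.2
    have ht : t₀ = ‖(F.hyp p₀ i).toFun O φ‖ ^ 2 := ht₀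
    have h4 := h1.self_of_nhds
    have a1 : ‖(F.hyp q.1.1 i).toFun O φ - (F.hyp p₀ i).toFun K φ‖ ^ 2 < (ε / 2) ^ 2 := by
      rw [hq1, ← hq3]
      have : q.1.2 < t₀ + ε ^ 2 / 16 := hq2
      nlinarith [sq_pos_of_pos hε]
    have a2 : ‖(F.hyp p₀ i).toFun O φ - (F.hyp p₀ i).toFun K φ‖ ^ 2 < (ε / 2) ^ 2 := by
      rw [h4]
      nlinarith [sq_pos_of_pos hε]
    have b1 := lt_of_pow_lt_pow_left₀ 2 (by positivity) a1
    have b2 := lt_of_pow_lt_pow_left₀ 2 (by positivity) a2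
    rw [← dist_eq_norm] at b1 b2
    calc dist (v q) (v ⟨⟨p₀, t₀⟩, ht₀⟩) ≤ _ := dist_triangle_right _ _ _
      _ < ε / 2 + ε / 2 := add_lt_add b1 b2
      _ = ε := by ring
  have hm : Measurable (fun p : HypParam => (⟨(p, n p), rfl⟩ : G)) :=
    (measurable_id.prodMk hn).subtype_mk
  exact hv.stronglyMeasurable.comp_measurable hm

theorem LocalFamily.stronglyMeasurable_borel (i : Fin N) {B : Set E3} (hB : MeasurableSet B)
    (φ : H) : StronglyMeasurable fun p => (F.hyp p i).toFun B φ := by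
  induction B, hB using MeasurableSpace.induction_on_inter
    (BorelSpace.measurable_eq (α := E3)) isPiSystem_isOpen with
  | empty =>
    simp only [PVM.toFun_empty]
    exact stronglyMeasurable_const
  | basic O hO => exact F.stronglyMeasurable_open i hO φ
  | compl B hB ih =>
    have : (fun p => (F.hyp p i).toFun Bᶜ φ) = fun p => φ - (F.hyp p i).toFun B φ := by
      ext p; rw [PVM.toFun_compl _ hB]; rfl
    rw [this]
    exact stronglyMeasurable_const.sub ih
  | iUnion B hd hB ih =>
    refine stronglyMeasurable_of_tendsto (u := Filter.atTop)
      (f := fun n : ℕ => fun p => ∑ m ∈ Finset.range n, (F.hyp p i).toFun (B m) φ) ?_ ?_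
    · intro n
      exact Finset.stronglyMeasurable_fun_sum _ fun m _ => ih m
    · rw [tendsto_pi_nhds]
      intro p
      exact ((F.hyp p i).isPOVM.hasSum_iUnion B hB hd φ).tendsto_sum_nat

variable {X : Type*} [MeasurableSpace X]

theorem LocalFamily.stronglyMeasurable_section (i : Fin N) {p : X → HypParam} (hp : Measurable p)
    {S : Set (X × E3)} (hS : MeasurableSet S) (φ : H) :
    StronglyMeasurable fun x => (F.hyp (p x) i).toFun {ξ | (x, ξ) ∈ S} φ := by
  classical
  induction S, hS using MeasurableSpace.induction_on_inter generateFrom_prod.symm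
    isPiSystem_prod with
  | empty =>
    simp only [mem_empty_iff_false, ofPred_false, PVM.toFun_empty]
    exact stronglyMeasurable_const
  | basic S hS =>
    obtain ⟨A, hA, B, hB, rfl⟩ := hS
    have : (fun x => (F.hyp (p x) i).toFun {ξ | (x, ξ) ∈ A ×ˢ B} φ)
        = A.indicator fun x => (F.hyp (p x) i).toFun B φ := by
      ext x
      by_cases hx : x ∈ A
      · simp [hx]
      · simp [hx, PVM.toFun_empty]
    rw [this]
    exact ((F.stronglyMeasurable_borel i hB φ).comp_measurable hp).indicator hA
  | compl S hS ih =>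
    have : (fun x => (F.hyp (p x) i).toFun {ξ | (x, ξ) ∈ Sᶜ} φ)
        = fun x => φ - (F.hyp (p x) i).toFun {ξ | (x, ξ) ∈ S} φ := by
      ext x
      have := PVM.toFun_compl (F.hyp (p x) i) (measurable_prodMk_left (x := x) hS)
      change (F.hyp (p x) i).toFun ((Prod.mk x ⁻¹' S)ᶜ) φ = _
      rw [this]; rfl
    rw [this]
    exact stronglyMeasurable_const.sub ih
  | iUnion B hd hB ih =>
    refine stronglyMeasurable_of_tendsto (u := Filter.atTop)
      (f := fun n : ℕ => fun x => ∑ m ∈ Finset.range n,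
        (F.hyp (p x) i).toFun {ξ | (x, ξ) ∈ B m} φ) ?_ ?_
    · intro n
      exact Finset.stronglyMeasurable_fun_sum _ fun m _ => ih m
    · rw [tendsto_pi_nhds]
      intro x
      have := ((F.hyp (p x) i).isPOVM.hasSum_iUnion (fun m => Prod.mk x ⁻¹' (B m))
        (fun m => measurable_prodMk_left (hB m)) (fun a b hab => (hd hab).preimage _)
        φ).tendsto_sum_nat
      rw [← preimage_iUnion] at this
      exact this

theorem LocalFamily.stronglyMeasurable_multOp (i : Fin N) {p : X → HypParam} (hp : Measurable p)
    {f : X → E3 → ℝ} (hf : Measurable (Function.uncurry f)) (h0 : ∀ x ξ, 0 ≤ f x ξ)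
    (hb : ∀ x, ∃ c, ∀ ξ, f x ξ ≤ c) (φ : H) :
    StronglyMeasurable fun x => (F.hyp (p x) i).multOp (f x) φ := by
  -- uniformly bounded truncations
  have hunif : ∀ n : ℕ, StronglyMeasurable fun x =>
      (F.hyp (p x) i).multOp (fun ξ => min (f x ξ) n) φ := by
    intro n
    have hc : (0 : ℝ) < n + 1 := by positivity
    let g : X → E3 → ℝ := fun x ξ => min (f x ξ) n / (n + 1)
    have hg : Measurable (Function.uncurry g) := (hf.min measurable_const).div_const _
    have hgx : ∀ x, Measurable (g x) := fun x => hg.comp measurable_prodMk_left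
    have e : (fun x => (F.hyp (p x) i).multOp (fun ξ => min (f x ξ) n) φ)
        = fun x => (((n : ℝ) + 1 : ℝ) : ℂ) • (F.hyp (p x) i).digitOp (g x) φ := by
      ext x
      have hm : Measurable fun ξ => min (f x ξ) (n : ℝ) :=
        ((hf.comp measurable_prodMk_left).min measurable_const)
      rw [PVM.multOp_eq _ (PVM.multOp_eq_digitOp (F.hyp (p x) i) hm hc
        (fun ξ => le_min (h0 x ξ) (by positivity))
        (fun ξ => (min_le_right _ _).trans_lt (by linarith)))]
      rfl
    rw [e]
    refine StronglyMeasurable.const_smul ?_ _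
    refine stronglyMeasurable_of_tendsto (u := Filter.atTop)
      (f := fun m : ℕ => fun x => ∑ k ∈ Finset.range m, (((1 / 2 : ℝ) ^ (k + 1) : ℝ) : ℂ) •
        (F.hyp (p x) i).toFun (PVM.digitSet (g x) k) φ) ?_ ?_
    · intro m
      refine Finset.stronglyMeasurable_fun_sum _ fun k _ => StronglyMeasurable.const_smul ?_ _
      exact F.stronglyMeasurable_section i hp (PVM.measurableSet_digitSet hg k) φ
    · rw [tendsto_pi_nhds]
      intro x
      exact (PVM.digitOp_hasSum_apply _ (hgx x) φ).tendsto_sum_nat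
  refine stronglyMeasurable_of_tendsto (u := Filter.atTop) hunif ?_
  rw [tendsto_pi_nhds]
  intro x
  obtain ⟨c, hc⟩ := hb x
  obtain ⟨n₀, hn₀⟩ := exists_nat_ge c
  refine tendsto_const_nhds.congr' ?_
  filter_upwards [Filter.eventually_ge_atTop n₀] with n hn
  congr 2
  ext ξ
  have : (n₀ : ℝ) ≤ n := by exact_mod_cast hn
  rw [min_eq_left ((hc ξ).trans (hn₀.trans this))]

-- Products of collapse operators apply an operator depending on `x` to a vector that also depends
-- on `x`. Approximating that vector by simple functions reduces this to fixed vectors.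
omit [CompleteSpace H] in
theorem stronglyMeasurable_clm_apply {T : X → H →L[ℂ] H}
    (hT : ∀ φ, StronglyMeasurable fun x => T x φ) {v : X → H} (hv : StronglyMeasurable v) :
    StronglyMeasurable fun x => T x (v x) := by
  classical
  refine stronglyMeasurable_of_tendsto (u := Filter.atTop)
    (f := fun n : ℕ => fun x => T x (hv.approx n x)) ?_ ?_
  · intro n
    generalize hv.approx n = w
    induction w using SimpleFunc.induction with
    | @const c s hs =>
      have : (fun x => T x ((SimpleFunc.piecewise s hs (SimpleFunc.const X c)
          (SimpleFunc.const X 0)) x)) = Set.indicator s fun x => T x c := by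
        ext x
        simp only [SimpleFunc.coe_piecewise, SimpleFunc.coe_const, Function.const_zero]
        rw [piecewise_eq_indicator]
        by_cases hx : x ∈ s
        · rw [indicator_of_mem hx, indicator_of_mem hx]; rfl
        · rw [indicator_of_notMem hx, indicator_of_notMem hx, map_zero]
      rw [this]
      exact (hT c).indicator hs
    | add _ hf hg =>
      simp only [SimpleFunc.coe_add, Pi.add_apply, map_add]
      exact hf.add hg
  · rw [tendsto_pi_nhds]
    intro x
    exact ((T x).continuous.tendsto _).comp (hv.tendsto_approx x)

end Family

/-! ### The Gaussian kernel on a hyperboloid in spatial coordinates -/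

/-- The energy `√(s² + |v|²)` of a vector of Minkowski length `s` with spatial part `v`. -/
def energy (s : ℝ) (v : E3) : ℝ := √(s ^ 2 + ‖v‖ ^ 2)

theorem energy_sq (s : ℝ) (v : E3) : energy s v ^ 2 = s ^ 2 + ‖v‖ ^ 2 :=
  Real.sq_sqrt (by positivity)

theorem energy_pos {s : ℝ} (hs : 0 < s) (v : E3) : 0 < energy s v :=
  Real.sqrt_pos.mpr (by positivity)

theorem norm_le_energy (s : ℝ) (v : E3) : ‖v‖ ≤ energy s v :=
  Real.le_sqrt_of_sq_le (by nlinarith [sq_nonneg s])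

theorem norm_lt_energy {s : ℝ} (hs : 0 < s) (v : E3) : ‖v‖ < energy s v :=
  Real.lt_sqrt_of_sq_lt (by nlinarith [sq_pos_of_pos hs])

theorem le_energy {s : ℝ} (v : E3) : s ≤ energy s v :=
  Real.le_sqrt_of_sq_le (by nlinarith [sq_nonneg ‖v‖])

theorem energy_sub_le (s : ℝ) (v w : E3) : energy s v - energy s w ≤ ‖v - w‖ := by
  have := sqrt_sq_add_sq_sub_le s s ‖v‖ ‖w‖ (norm_nonneg _) (norm_nonneg _)
  simp only [sub_self, abs_zero, zero_add] at this
  have h2 := abs_norm_sub_norm_le v w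
  simp only [energy]; linarith

/-- The Minkowski product of two vectors of length `s` with spatial parts `v`, `w`. -/
def hypProd (s : ℝ) (v w : E3) : ℝ := energy s v * energy s w - ⟪v, w⟫_ℝ

theorem hypProd_comm (s : ℝ) (v w : E3) : hypProd s v w = hypProd s w v := by
  rw [hypProd, hypProd, mul_comm, real_inner_comm]

theorem sq_le_hypProd (s : ℝ) (v w : E3) : s ^ 2 ≤ hypProd s v w := by
  have h1 := real_inner_le_norm v w
  have h2 : s ^ 2 + ‖v‖ * ‖w‖ ≤ energy s v * energy s w := by
    have hv : 0 ≤ energy s v := Real.sqrt_nonneg _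
    have hw : 0 ≤ energy s w := Real.sqrt_nonneg _
    rw [← sq_le_sq₀ (add_nonneg (sq_nonneg s) (mul_nonneg (norm_nonneg v) (norm_nonneg w)))
      (mul_nonneg hv hw), mul_pow, energy_sq, energy_sq]
    nlinarith [sq_nonneg (s * (‖v‖ - ‖w‖))]
  unfold hypProd; linarith

theorem hypProd_le (s : ℝ) (v w : E3) : hypProd s v w ≤ s ^ 2 + ‖v - w‖ ^ 2 / 2 := by
  rw [@norm_sub_sq_real, hypProd]
  nlinarith [sq_nonneg (energy s v - energy s w), energy_sq s v, energy_sq s w]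

theorem mul_energy_le_hypProd (s : ℝ) (v w : E3) :
    (energy s v - ‖v‖) * energy s w ≤ hypProd s v w := by
  have h1 := real_inner_le_norm v w
  have h2 := norm_le_energy s w
  have := mul_le_mul_of_nonneg_left h2 (norm_nonneg v)
  unfold hypProd; nlinarith

/-- The Gaussian of width `σ` on the hyperboloid of radius `s`, in spatial coordinates. -/
def gaussKernel (σ s : ℝ) (v w : E3) : ℝ :=
  Real.exp (-(s * Real.arcosh (hypProd s v w / s ^ 2)) ^ 2 / (4 * σ ^ 2))

theorem gaussKernel_comm (σ s : ℝ) (v w : E3) : gaussKernel σ s v w = gaussKernel σ s w v := by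
  rw [gaussKernel, gaussKernel, hypProd_comm]

theorem gaussKernel_pos (σ s : ℝ) (v w : E3) : 0 < gaussKernel σ s v w := Real.exp_pos _

theorem gaussKernel_le_one (σ s : ℝ) (v w : E3) : gaussKernel σ s v w ≤ 1 := by
  rw [gaussKernel, Real.exp_le_one_iff]
  apply div_nonpos_of_nonpos_of_nonneg
  · linarith [sq_nonneg (s * Real.arcosh (hypProd s v w / s ^ 2))]
  · positivity

theorem measurable_arcosh : Measurable Real.arcosh := by
  unfold Real.arcosh; fun_prop

theorem measurable_gaussKernel (σ : ℝ) :
    Measurable fun p : ℝ × E3 × E3 => gaussKernel σ p.1 p.2.1 p.2.2 := by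
  unfold gaussKernel hypProd energy
  have := measurable_arcosh
  fun_prop

theorem log_le_arcosh {x : ℝ} (hx : 1 ≤ x) : Real.log x ≤ Real.arcosh x := by
  unfold Real.arcosh
  exact Real.log_le_log (by linarith) (by linarith [Real.sqrt_nonneg (x ^ 2 - 1)])

/-- The constant is uniform over the whole hyperboloid, since the Minkowski product equals `s² + (‖v
- w‖² - (energy s v - energy s w)²) / 2` and so is bounded by the Euclidean distance alone. -/
theorem gaussKernel_lower {σ s : ℝ} (hs : 0 < s) (R : ℝ) :
    ∃ c > 0, ∀ v w : E3, ‖v - w‖ ≤ R → c ≤ gaussKernel σ s v w := by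
  refine ⟨Real.exp (-(s * Real.arcosh (1 + R ^ 2 / (2 * s ^ 2))) ^ 2 / (4 * σ ^ 2)),
    Real.exp_pos _, ?_⟩
  intro v w h
  have h1 : 1 ≤ hypProd s v w / s ^ 2 := by
    rw [le_div_iff₀ (by positivity), one_mul]; exact sq_le_hypProd s v w
  have h2 : hypProd s v w / s ^ 2 ≤ 1 + R ^ 2 / (2 * s ^ 2) := by
    rw [div_le_iff₀ (by positivity), add_mul, one_mul]
    have : R ^ 2 / (2 * s ^ 2) * s ^ 2 = R ^ 2 / 2 := by field_simp
    rw [this]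
    have := hypProd_le s v w
    have : ‖v - w‖ ^ 2 ≤ R ^ 2 := by gcongr
    linarith
  have h3 := (Real.arcosh_le_arcosh (by linarith) (by linarith)).mpr h2
  have h4 := Real.arcosh_nonneg h1
  rw [gaussKernel]
  gcongr

/-- Since `arcosh x ≥ log x` and `x` grows at least linearly in the energy of `w`, the kernel is at
most `exp (-a (log x)²)`. Completing the square bounds this by `exp (m² / (4 a)) / x ^ m` for every
`m`. -/
theorem gaussKernel_decay {σ s : ℝ} (hσ : 0 < σ) (hs : 0 < s) (v : E3) (m : ℕ) :
    ∃ C > 0, ∀ w : E3, gaussKernel σ s v w ≤ C / energy s w ^ m := by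
  set a := s ^ 2 / (4 * σ ^ 2) with ha
  have ha0 : 0 < a := by positivity
  set c := (energy s v - ‖v‖) / s ^ 2 with hc
  have hc0 : 0 < c := div_pos (by linarith [norm_lt_energy hs v]) (by positivity)
  refine ⟨Real.exp (m ^ 2 / (4 * a)) / c ^ m, by positivity, ?_⟩
  intro w
  set x := hypProd s v w / s ^ 2 with hx
  have h1 : 1 ≤ x := by
    rw [hx, le_div_iff₀ (by positivity), one_mul]; exact sq_le_hypProd s v w
  have h2 : c * energy s w ≤ x := by
    rw [hx, hc, div_mul_eq_mul_div]
    gcongr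
    exact mul_energy_le_hypProd s v w
  have hL := log_le_arcosh h1
  have hL0 := Real.log_nonneg h1
  have he := energy_pos hs w
  calc gaussKernel σ s v w ≤ Real.exp (m ^ 2 / (4 * a) - m * Real.log x) := by
        rw [gaussKernel, Real.exp_le_exp]
        have e1 : -(s * Real.arcosh (hypProd s v w / s ^ 2)) ^ 2 / (4 * σ ^ 2)
            = -(a * Real.arcosh x ^ 2) := by rw [ha, hx]; field_simp
        rw [e1]
        have e2 : a * Real.log x ^ 2 ≤ a * Real.arcosh x ^ 2 := by gcongr
        have e3 : 0 ≤ a * (Real.log x - m / (2 * a)) ^ 2 := by positivity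
        have e4 : a * (Real.log x - m / (2 * a)) ^ 2
            = a * Real.log x ^ 2 - m * Real.log x + m ^ 2 / (4 * a) := by field_simp; ring
        linarith
    _ = Real.exp (m ^ 2 / (4 * a)) / x ^ m := by
        rw [Real.exp_sub, Real.exp_nat_mul, Real.exp_log (by linarith)]
    _ ≤ Real.exp (m ^ 2 / (4 * a)) / (c * energy s w) ^ m := by gcongr
    _ = _ := by rw [mul_pow]; field_simp

/-- The density of the invariant volume on the hyperboloid of radius `s`. -/
def volDensity (s : ℝ) (v : E3) : ℝ := s / energy s v

theorem volDensity_pos {s : ℝ} (hs : 0 < s) (v : E3) : 0 < volDensity s v :=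
  div_pos hs (energy_pos hs v)

theorem volDensity_le_one {s : ℝ} (hs : 0 < s) (v : E3) : volDensity s v ≤ 1 :=
  (div_le_one (energy_pos hs v)).mpr (le_energy v)

theorem measurable_volDensity : Measurable fun p : ℝ × E3 => volDensity p.1 p.2 := by
  unfold volDensity energy; fun_prop

theorem integrable_gaussKernel_sq {σ s : ℝ} (hσ : 0 < σ) (hs : 0 < s) (v : E3) :
    Integrable fun w : E3 => gaussKernel σ s v w ^ 2 * volDensity s w := by
  -- Any order of decay above the spatial dimension 3 is integrable.
  obtain ⟨C, hC, h⟩ := gaussKernel_decay hσ hs v 4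
  have hi := (integrable_one_add_norm (E := E3) (μ := volume) (r := 4)
    (by rw [finrank_euclideanSpace_fin]; norm_num)).const_mul (C * (1 + 1 / s) ^ 4)
  refine hi.mono' ?_ (Filter.Eventually.of_forall fun w => ?_)
  · have h1 := (measurable_gaussKernel σ).comp
      (measurable_const.prodMk (measurable_const.prodMk measurable_id) :
        Measurable fun w : E3 => (s, v, w))
    have h2 := measurable_volDensity.comp
      (measurable_const.prodMk measurable_id : Measurable fun w : E3 => (s, w))
    exact ((h1.pow_const 2).mul h2).aestronglyMeasurable
  · have hg := gaussKernel_pos σ s v w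
    have hd := volDensity_pos hs w
    have he := energy_pos hs w
    rw [Real.norm_of_nonneg (by positivity)]
    have h1 : gaussKernel σ s v w ^ 2 * volDensity s w ≤ gaussKernel σ s v w := by
      have := gaussKernel_le_one σ s v w
      have := volDensity_le_one hs w
      calc _ ≤ gaussKernel σ s v w ^ 2 * 1 := by gcongr
        _ ≤ _ := by nlinarith
    refine h1.trans ((h w).trans ?_)
    have h2 : 1 + ‖w‖ ≤ (1 + 1 / s) * energy s w := by
      have a1 := norm_le_energy s w
      have a2 : 1 ≤ 1 / s * energy s w := by
        rw [div_mul_eq_mul_div, one_mul, one_le_div hs]; exact le_energy w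
      linarith
    have e : (1 + ‖w‖) ^ (-4 : ℝ) = ((1 + ‖w‖) ^ 4)⁻¹ := by
      rw [Real.rpow_neg (by positivity)]; norm_cast
    rw [e, mul_assoc, div_eq_mul_inv]
    gcongr
    rw [← div_eq_mul_inv, inv_eq_one_div, div_le_div_iff₀ (by positivity) (by positivity), one_mul,
      ← mul_pow]
    gcongr

/-! ### Fatness at infinity of regions of a hyperboloid cut out by affine constraints -/

/-- The restriction to the hyperboloid of radius `s` of the affine function on space-time with
coefficients `c = (d, δ, γ)`, in spatial coordinates. -/
def affOn (s : ℝ) (c : ℝ × E3 × ℝ) (v : E3) : ℝ := c.1 * energy s v - ⟪v, c.2.1⟫_ℝ + c.2.2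

theorem abs_affOn_sub_le (s : ℝ) (c : ℝ × E3 × ℝ) (v w : E3) :
    |affOn s c v - affOn s c w| ≤ (|c.1| + ‖c.2.1‖) * ‖v - w‖ := by
  have e : affOn s c v - affOn s c w
      = c.1 * (energy s v - energy s w) - ⟪v - w, c.2.1⟫_ℝ := by
    simp only [affOn, inner_sub_left]; ring
  have h1 : |energy s v - energy s w| ≤ ‖v - w‖ := by
    rw [abs_sub_le_iff]
    exact ⟨energy_sub_le s v w, by rw [norm_sub_rev]; exact energy_sub_le s w v⟩
  have h2 := abs_real_inner_le_norm (v - w) c.2.1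
  rw [e]
  calc _ ≤ |c.1 * (energy s v - energy s w)| + |⟪v - w, c.2.1⟫_ℝ| := abs_sub _ _
    _ ≤ |c.1| * ‖v - w‖ + ‖v - w‖ * ‖c.2.1‖ := by
      rw [abs_mul]; gcongr
    _ = _ := by ring

/-- Under `hc` the terms along `ω` combine, and the affine function depends on a point only through
its null coordinate `energy s v - ⟪v, ω⟫` and its part transverse to `ω`, in an affine way. -/
theorem affOn_nonneg_of_convex {s : ℝ} {ω : E3} {c : ℝ × E3 × ℝ}
    (hc : c.1 = ⟪ω, c.2.1⟫_ℝ) {v u w : E3} {μ : ℝ}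
    (hτ : energy s w - ⟪w, ω⟫_ℝ
      = (1 - μ) * (energy s v - ⟪v, ω⟫_ℝ) + μ * (energy s u - ⟪u, ω⟫_ℝ))
    (hb : w - ⟪w, ω⟫_ℝ • ω
      = (1 - μ) • (v - ⟪v, ω⟫_ℝ • ω) + μ • (u - ⟪u, ω⟫_ℝ • ω)) :
    affOn s c w = (1 - μ) * affOn s c v + μ * affOn s c u := by
  have key : ∀ x : E3, affOn s c x
      = c.1 * (energy s x - ⟪x, ω⟫_ℝ) - ⟪x - ⟪x, ω⟫_ℝ • ω, c.2.1⟫_ℝ + c.2.2 := by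
    intro x
    rw [affOn, inner_sub_left, inner_smul_left, ← hc]
    simp only [conj_trivial]; ring
  rw [key w, key v, key u, hτ, hb, inner_add_left, inner_smul_left, inner_smul_left]
  simp only [conj_trivial]
  ring

/-- Here `P` and `τ` are the two null coordinates, tied by `P τ = s² + β²`. Moving `τ` and the
transverse part by `O(μ e)` changes `P τ` by `O(μ e²)`; solving for `P` divides by `τ'`, which may
be as small as `s² / (4 e)`. This is the origin of the third power of `e`. -/
theorem null_displacement_le {s e U μ τ τ₀ τ' P P' β β' Δ : ℝ} (hs : 0 < s) (he : 1 ≤ e)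
    (hU : 0 < U) (hμ0 : 0 ≤ μ) (hμ1 : μ ≤ 1 / 2) (hτ0 : 0 < τ) (hτ₀0 : 0 < τ₀)
    (hτ' : τ' = (1 - μ) * τ + μ * τ₀) (hPτ : P * τ = s ^ 2 + β ^ 2)
    (hPτ' : P' * τ' = s ^ 2 + β' ^ 2) (hβ0 : 0 ≤ β) (hβ'0 : 0 ≤ β') (hβΔ : |β' - β| ≤ Δ)
    (hΔ : Δ ≤ μ * ((1 + U) * e)) (hβ : β ≤ e) (hβ' : β' ≤ (1 + U) * e) (hτe : τ ≤ 2 * e)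
    (hPe : P ≤ 2 * e) (hP0 : 0 ≤ P) (hτ₀e : τ₀ ≤ U) :
    Δ + |(P' - P) / 2 - (τ' - τ) / 2|
      ≤ ((1 + U) + (2 + 4 / s ^ 2 * ((1 + U) * (2 + U) + 2 * (2 + U))) + (2 + U)) * μ * e ^ 3 := by
  have he0 : 0 < e := by linarith
  have hτlow : τ / 2 ≤ τ' := by
    have : τ / 2 ≤ (1 - μ) * τ := by nlinarith
    have : 0 ≤ μ * τ₀ := mul_nonneg hμ0 hτ₀0.le
    linarith
  have hτ'0 : 0 < τ' := by linarith
  have hΔτ : |τ' - τ| ≤ μ * ((2 + U) * e) := by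
    have : τ' - τ = μ * (τ₀ - τ) := by rw [hτ']; ring
    rw [this, abs_mul, abs_of_nonneg hμ0]
    have hUe : U ≤ U * e := le_mul_of_one_le_right hU.le he
    gcongr
    rw [abs_le]
    constructor <;> linarith
  have hτlow : s ^ 2 / (4 * e) ≤ τ' := by
    have h1 : s ^ 2 ≤ 2 * e * τ := by
      have : P * τ ≤ 2 * e * τ := by gcongr
      linarith [sq_nonneg β]
    rw [div_le_iff₀ (by positivity)]
    have := mul_le_mul_of_nonneg_right hτlow he0.le
    linarith
  set K := (1 + U) * (2 + U) + 2 * (2 + U) with hK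
  have hK0 : 0 < K := by positivity
  have hΔP : |P' - P| ≤ 4 / s ^ 2 * (μ * (K * e ^ 3)) := by
    have e1 : (P' - P) * τ' = (β' ^ 2 - β ^ 2) - P * (τ' - τ) := by
      rw [sub_mul, hPτ', mul_sub, hPτ]; ring
    have e2 : |β' ^ 2 - β ^ 2| ≤ μ * ((1 + U) * e) * ((2 + U) * e) := by
      have : β' ^ 2 - β ^ 2 = (β' - β) * (β' + β) := by ring
      rw [this, abs_mul, abs_of_nonneg (add_nonneg hβ'0 hβ0)]
      have h2 := hβΔ.trans hΔ
      have h3 : β' + β ≤ (2 + U) * e := by linarith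
      exact mul_le_mul h2 h3 (add_nonneg hβ'0 hβ0) (by positivity)
    have e3 : |P * (τ' - τ)| ≤ 2 * e * (μ * ((2 + U) * e)) := by
      rw [abs_mul, abs_of_nonneg hP0]
      exact mul_le_mul hPe hΔτ (abs_nonneg _) (by positivity)
    have e4 : |P' - P| * τ' ≤ μ * (K * e ^ 2) := by
      have : |P' - P| * τ' = |(P' - P) * τ'| := by rw [abs_mul, abs_of_pos hτ'0]
      rw [this, e1]
      refine (abs_sub _ _).trans ((add_le_add e2 e3).trans (le_of_eq ?_))
      rw [hK]; ring
    have e5 : |P' - P| * (s ^ 2 / (4 * e)) ≤ μ * (K * e ^ 2) :=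
      (mul_le_mul_of_nonneg_left hτlow (abs_nonneg _)).trans e4
    calc |P' - P| = |P' - P| * (s ^ 2 / (4 * e)) * (4 * e / s ^ 2) := by field_simp
      _ ≤ μ * (K * e ^ 2) * (4 * e / s ^ 2) :=
        mul_le_mul_of_nonneg_right e5 (by positivity)
      _ = _ := by field_simp
  have he2 : e ≤ e ^ 3 := le_self_pow₀ he (by norm_num)
  have h1 : |(P' - P) / 2 - (τ' - τ) / 2| ≤ |P' - P| + |τ' - τ| := by
    refine (abs_sub _ _).trans ?_
    rw [abs_div, abs_div, abs_two]
    linarith [abs_nonneg (P' - P), abs_nonneg (τ' - τ)]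
  have h2 : 0 ≤ 2 * (μ * e ^ 3) := by positivity
  have h3 : μ * ((1 + U) * e) ≤ μ * ((1 + U) * e ^ 3) := by gcongr
  have h4 : μ * ((2 + U) * e) ≤ μ * ((2 + U) * e ^ 3) := by gcongr
  calc Δ + |(P' - P) / 2 - (τ' - τ) / 2|
      ≤ μ * ((1 + U) * e ^ 3) + (4 / s ^ 2 * (μ * (K * e ^ 3)) + μ * ((2 + U) * e ^ 3))
        + 2 * (μ * e ^ 3) := by linarith
    _ = _ := by ring

/-- Existence of the point with prescribed null coordinates, and an estimate of its displacement. -/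
theorem exists_convex_point {s : ℝ} (hs : 0 < s) {ω : E3} (hω : ‖ω‖ = 1) (u : E3) :
    ∃ C > 0, ∀ v : E3, 1 ≤ energy s v → ∀ μ : ℝ, 0 ≤ μ → μ ≤ 1 / 2 → ∃ w : E3,
      energy s w - ⟪w, ω⟫_ℝ
        = (1 - μ) * (energy s v - ⟪v, ω⟫_ℝ) + μ * (energy s u - ⟪u, ω⟫_ℝ) ∧
      w - ⟪w, ω⟫_ℝ • ω = (1 - μ) • (v - ⟪v, ω⟫_ℝ • ω) + μ • (u - ⟪u, ω⟫_ℝ • ω) ∧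
      ‖w - v‖ ≤ C * μ * energy s v ^ 3 := by
  have hωω : ⟪ω, ω⟫_ℝ = 1 := by rw [real_inner_self_eq_norm_sq, hω]; norm_num
  set U := 2 * energy s u with hU
  have hU0 : 0 < U := by have := energy_pos hs u; positivity
  have hperp : ∀ x : E3, ⟪x - ⟪x, ω⟫_ℝ • ω, ω⟫_ℝ = 0 := by
    intro x
    rw [inner_sub_left, inner_smul_left, hωω]; simp
  have habs : ∀ x : E3, |⟪x, ω⟫_ℝ| ≤ ‖x‖ := fun x => by
    have := abs_real_inner_le_norm x ω; rwa [hω, mul_one] at this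
  have hpn : ∀ x : E3, ‖x - ⟪x, ω⟫_ℝ • ω‖ ≤ ‖x‖ := by
    intro x
    have h1 : ‖x‖ ^ 2 = ‖x - ⟪x, ω⟫_ℝ • ω‖ ^ 2 + ⟪x, ω⟫_ℝ ^ 2 := by
      have := @norm_add_sq_real E3 _ _ (x - ⟪x, ω⟫_ℝ • ω) (⟪x, ω⟫_ℝ • ω)
      rw [sub_add_cancel, inner_smul_right, hperp, norm_smul, hω, mul_zero, mul_zero, add_zero,
        mul_one, Real.norm_eq_abs, sq_abs] at this
      exact this
    apply le_of_sq_le_sq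
    · nlinarith [sq_nonneg ⟪x, ω⟫_ℝ]
    · exact norm_nonneg _
  have hprod : ∀ x : E3, (energy s x + ⟪x, ω⟫_ℝ) * (energy s x - ⟪x, ω⟫_ℝ)
      = s ^ 2 + ‖x - ⟪x, ω⟫_ℝ • ω‖ ^ 2 := by
    intro x
    have h1 : ‖x‖ ^ 2 = ‖x - ⟪x, ω⟫_ℝ • ω‖ ^ 2 + ⟪x, ω⟫_ℝ ^ 2 := by
      have := @norm_add_sq_real E3 _ _ (x - ⟪x, ω⟫_ℝ • ω) (⟪x, ω⟫_ℝ • ω)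
      rw [sub_add_cancel, inner_smul_right, hperp, norm_smul, hω, mul_zero, mul_zero, add_zero,
        mul_one, Real.norm_eq_abs, sq_abs] at this
      exact this
    have := energy_sq s x
    nlinarith
  have hτpos : ∀ x : E3, 0 < energy s x - ⟪x, ω⟫_ℝ := fun x => by
    linarith [norm_lt_energy hs x, le_abs_self ⟪x, ω⟫_ℝ, habs x]
  refine ⟨(1 + U) + (2 + 4 / s ^ 2 * ((1 + U) * (2 + U) + 2 * (2 + U))) + (2 + U), by positivity, ?_⟩
  intro v hv μ hμ0 hμ1
  set τ := energy s v - ⟪v, ω⟫_ℝ with hτdef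
  set τ₀ := energy s u - ⟪u, ω⟫_ℝ with hτ₀def
  set b := v - ⟪v, ω⟫_ℝ • ω with hbdef
  set b₀ := u - ⟪u, ω⟫_ℝ • ω with hb₀def
  set e := energy s v with he
  set τ' := (1 - μ) * τ + μ * τ₀ with hτ'
  set b' := (1 - μ) • b + μ • b₀ with hb'
  have hτ0 : 0 < τ := hτpos v
  have hτ₀0 : 0 < τ₀ := hτpos u
  have hτ'0 : 0 < τ' := by
    have : 0 < (1 - μ) * τ := mul_pos (by linarith) hτ0
    have : 0 ≤ μ * τ₀ := mul_nonneg hμ0 hτ₀0.le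
    linarith
  -- Once `τ'` and `b'` are prescribed, the other null coordinate is forced by the equation of the
  -- hyperboloid.
  set P' := (s ^ 2 + ‖b'‖ ^ 2) / τ' with hP'
  set P := e + ⟪v, ω⟫_ℝ with hP
  have hP'0 : 0 < P' := by positivity
  have hb'ω : ⟪b', ω⟫_ℝ = 0 := by
    rw [hb', inner_add_left, inner_smul_left, inner_smul_left, hbdef, hb₀def, hperp, hperp]; simp
  set p' := (P' - τ') / 2 with hp'
  set w := b' + p' • ω with hw
  have hwω : ⟪w, ω⟫_ℝ = p' := by
    rw [hw, inner_add_left, hb'ω, inner_smul_left, hωω]; simp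
  have hwn : ‖w‖ ^ 2 = ‖b'‖ ^ 2 + p' ^ 2 := by
    rw [hw, @norm_add_sq_real, inner_smul_right, hb'ω, norm_smul, hω, mul_zero, mul_zero, add_zero,
        mul_one, Real.norm_eq_abs, sq_abs]
  have hPτ' : P' * τ' = s ^ 2 + ‖b'‖ ^ 2 := div_mul_cancel₀ _ hτ'0.ne'
  have hwe : energy s w = (P' + τ') / 2 := by
    rw [energy, Real.sqrt_eq_iff_mul_self_eq (by positivity) (by positivity), hwn]
    rw [← add_assoc, ← hPτ', hp']; ring
  refine ⟨w, ?_, ?_, ?_⟩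
  · rw [hwe, hwω, hp']; ring
  · rw [hwω, hw, add_sub_cancel_right]
  have hvdec : v = b + ⟪v, ω⟫_ℝ • ω := by rw [hbdef, sub_add_cancel]
  have hPτ : P * τ = s ^ 2 + ‖b‖ ^ 2 := hprod v
  have hvω : ⟪v, ω⟫_ℝ = (P - τ) / 2 := by rw [hP, hτdef]; ring
  have hnv : ‖v‖ ≤ e := norm_le_energy s v
  have hbn : ‖b‖ ≤ e := (hpn v).trans hnv
  have hb₀n : ‖b₀‖ ≤ U := (hpn u).trans ((norm_le_energy s u).trans
    (by rw [hU]; linarith [energy_pos hs u]))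
  have hτe : τ ≤ 2 * e := by
    linarith [neg_abs_le ⟪v, ω⟫_ℝ, habs v]
  have hPe : P ≤ 2 * e := by linarith [le_abs_self ⟪v, ω⟫_ℝ, habs v]
  have hP0 : 0 ≤ P := by linarith [neg_abs_le ⟪v, ω⟫_ℝ, habs v]
  have hτ₀e : τ₀ ≤ U := by
    linarith [neg_abs_le ⟪u, ω⟫_ℝ, habs u, norm_le_energy s u]
  have hUe : U ≤ U * e := le_mul_of_one_le_right hU0.le hv
  have hΔb : ‖b' - b‖ ≤ μ * ((1 + U) * e) := by
    have : b' - b = μ • (b₀ - b) := by rw [hb']; module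
    rw [this, norm_smul, Real.norm_of_nonneg hμ0]
    refine mul_le_mul_of_nonneg_left ((norm_sub_le _ _).trans ?_) hμ0
    linarith
  have hb'n : ‖b'‖ ≤ (1 + U) * e := by
    have h1 : ‖(1 - μ) • b‖ ≤ ‖b‖ := by
      rw [norm_smul, Real.norm_of_nonneg (by linarith)]
      exact mul_le_of_le_one_left (norm_nonneg _) (by linarith)
    have h2 : ‖μ • b₀‖ ≤ ‖b₀‖ := by
      rw [norm_smul, Real.norm_of_nonneg hμ0]
      exact mul_le_of_le_one_left (norm_nonneg _) (by linarith)
    have := norm_add_le ((1 - μ) • b) (μ • b₀)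
    linarith
  have hwv : w - v = (b' - b) + ((P' - P) / 2 - (τ' - τ) / 2) • ω := by
    conv_lhs => rw [hvdec, hw, hvω, hp']
    module
  rw [hwv]
  refine (norm_add_le _ _).trans ?_
  rw [norm_smul, hω, mul_one, Real.norm_eq_abs]
  exact null_displacement_le hs hv hU0 hμ0 hμ1 hτ0 hτ₀0 hτ' hPτ hPτ' (norm_nonneg _)
    (norm_nonneg _) (abs_norm_sub_norm_le b' b) hΔb hbn hb'n hτe hPe hP0 hτ₀e

/-- Points of a region of the hyperboloid cut out by finitely many affine constraints and tending to
infinity have near them balls in the region whose radius decreases at most polynomially. -/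
theorem exists_ball_of_tendsto {ι : Type*} [Finite ι] {s : ℝ} (hs : 0 < s) (c : ι → ℝ × E3 × ℝ)
    {v : ℕ → E3} (hv : Filter.Tendsto (fun n => ‖v n‖) Filter.atTop Filter.atTop)
    (hnn : ∀ n i, 0 ≤ affOn s (c i) (v n)) {ω : E3}
    (hω : Filter.Tendsto (fun n => ‖v n‖⁻¹ • v n) Filter.atTop (𝓝 ω))
    {u : E3} (hu : ∀ i, 0 < affOn s (c i) u) :
    ∃ κ > 0, ∀ᶠ n in Filter.atTop, ∃ w : E3, ‖w - v n‖ ≤ 1 / 2 ∧ κ / energy s (v n) ^ 3 ≤ 1 / 2 ∧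
      ∀ x, ‖x - w‖ < κ / energy s (v n) ^ 3 → ∀ i, 0 < affOn s (c i) x := by
  cases nonempty_fintype ι
  have hωn : ‖ω‖ = 1 := by
    have h1 := hω.norm
    have h2 : Filter.Tendsto (fun n => ‖‖v n‖⁻¹ • v n‖) Filter.atTop (𝓝 1) := by
      refine tendsto_const_nhds.congr' ?_
      filter_upwards [hv.eventually_gt_atTop 0] with n hn
      rw [norm_smul, norm_inv, norm_norm, inv_mul_cancel₀ hn.ne']
    exact tendsto_nhds_unique h1 h2
  have hen : Filter.Tendsto (fun n => energy s (v n)) Filter.atTop Filter.atTop :=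
    Filter.tendsto_atTop_mono (fun n => norm_le_energy s (v n)) hv
  -- A common Lipschitz constant of all the constraints.
  set B : ℝ := 1 + ∑ i, (|(c i).1| + ‖(c i).2.1‖) with hB
  have hBi : ∀ i, |(c i).1| + ‖(c i).2.1‖ ≤ B := fun i => by
    have := Finset.single_le_sum (f := fun i => |(c i).1| + ‖(c i).2.1‖)
      (fun j _ => by positivity) (Finset.mem_univ i)
    rw [hB]; linarith
  have hB1 : 1 ≤ B := by
    have : 0 ≤ ∑ i, (|(c i).1| + ‖(c i).2.1‖) := Finset.sum_nonneg fun i _ => by positivity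
    rw [hB]; linarith
  clear_value B
  -- Along the limiting direction such a constraint grows at a rate that is nonnegative, because the
  -- constraint holds along the sequence, and nonzero, hence positive. So it eventually exceeds `B`,
  -- a margin that absorbs a unit displacement.
  have hnt : ∀ i, (c i).1 ≠ ⟪ω, (c i).2.1⟫_ℝ →
      ∀ᶠ n in Filter.atTop, B < affOn s (c i) (v n) := by
    intro i hi
    have hlim : Filter.Tendsto (fun n => affOn s (c i) (v n) * ‖v n‖⁻¹) Filter.atTop
        (𝓝 ((c i).1 - ⟪ω, (c i).2.1⟫_ℝ)) := by
      have h1 : Filter.Tendsto (fun n => energy s (v n) * ‖v n‖⁻¹) Filter.atTop (𝓝 1) := by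
        have h2 : Filter.Tendsto (fun n => 1 + s * ‖v n‖⁻¹) Filter.atTop (𝓝 (1 + s * 0)) :=
          (hv.inv_tendsto_atTop.const_mul s).const_add 1
        rw [mul_zero, add_zero] at h2
        refine tendsto_of_tendsto_of_tendsto_of_le_of_le' tendsto_const_nhds h2 ?_ ?_
        · filter_upwards [hv.eventually_gt_atTop 0] with n hn
          rw [← div_eq_mul_inv, one_le_div hn]
          exact norm_le_energy s _
        · filter_upwards [hv.eventually_gt_atTop 0] with n hn
          have : energy s (v n) ≤ ‖v n‖ + s := by
            rw [energy, Real.sqrt_le_left (by positivity)]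
            nlinarith [mul_pos hs hn]
          calc energy s (v n) * ‖v n‖⁻¹ ≤ (‖v n‖ + s) * ‖v n‖⁻¹ := by gcongr
            _ = 1 + s * ‖v n‖⁻¹ := by field_simp
      have h2 := (h1.const_mul (c i).1).sub (hω.inner (tendsto_const_nhds (x := (c i).2.1)))
      have h3 := h2.add (hv.inv_tendsto_atTop.const_mul (c i).2.2)
      rw [mul_one, mul_zero, add_zero] at h3
      refine h3.congr fun n => ?_
      simp only [affOn, inner_smul_left, conj_trivial, Pi.inv_apply]
      ring
    have hge : 0 ≤ (c i).1 - ⟪ω, (c i).2.1⟫_ℝ :=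
      ge_of_tendsto' hlim fun n => mul_nonneg (hnn n i) (by positivity)
    have hpos : 0 < (c i).1 - ⟪ω, (c i).2.1⟫_ℝ :=
      lt_of_le_of_ne hge fun h => hi (by linarith)
    have h4 := hlim.pos_mul_atTop hpos hv
    filter_upwards [h4.eventually_gt_atTop B, hv.eventually_gt_atTop 0] with n hn hn0
    rwa [mul_assoc, inv_mul_cancel₀ hn0.ne', mul_one] at hn
  obtain ⟨η, hη, hηu⟩ : ∃ η > 0, ∀ i, η ≤ affOn s (c i) u := by
    rcases isEmpty_or_nonempty ι with h | h
    · exact ⟨1, one_pos, fun i => h.elim i⟩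
    · obtain ⟨i₀, hi₀⟩ := Finite.exists_min fun i => affOn s (c i) u
      exact ⟨_, hu i₀, hi₀⟩
  obtain ⟨C, hC, hconv⟩ := exists_convex_point hs hωn u
  -- Chosen so that over a ball of radius `κ / e ^ 3` the constraints vary by less than the gain `μ
  -- * η` obtained below from the interior point `u`.
  set κ := min (1 / 2) (η / (2 * (C + 1) * B)) with hκ
  have hκ0 : 0 < κ := by positivity
  refine ⟨κ, hκ0, ?_⟩
  have hnt' : ∀ᶠ n in Filter.atTop, ∀ i, (c i).1 ≠ ⟪ω, (c i).2.1⟫_ℝ →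
      B < affOn s (c i) (v n) := by
    rw [Filter.eventually_all]
    intro i
    by_cases hi : (c i).1 = ⟪ω, (c i).2.1⟫_ℝ
    · exact Filter.Eventually.of_forall fun n h => (h hi).elim
    · exact (hnt i hi).mono fun n h _ => h
  filter_upwards [hnt', hen.eventually_ge_atTop 1] with n hn he1
  set e := energy s (v n) with he
  have he3 : 1 ≤ e ^ 3 := one_le_pow₀ he1
  -- The displacement bound `C * μ * e ^ 3` then equals `C / (2 (C + 1)) ≤ 1 / 2`.
  set μ := 1 / (2 * (C + 1) * e ^ 3) with hμ
  have hμ0 : 0 < μ := by positivity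
  have hμ1 : μ ≤ 1 / 2 := by
    rw [hμ]
    apply one_div_le_one_div_of_le (by norm_num)
    nlinarith
  obtain ⟨w, hw1, hw2, hw3⟩ := hconv (v n) he1 μ hμ0.le hμ1
  have hwv : ‖w - v n‖ ≤ 1 / 2 := by
    refine hw3.trans ?_
    rw [hμ]
    have : C * (1 / (2 * (C + 1) * e ^ 3)) * e ^ 3 = C / (2 * (C + 1)) := by field_simp
    rw [this, div_le_div_iff₀ (by positivity) (by norm_num)]
    linarith
  have hr : κ / e ^ 3 ≤ 1 / 2 := (div_le_self hκ0.le he3).trans (min_le_left _ _)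
  refine ⟨w, hwv, hr, ?_⟩
  intro x hx i
  by_cases hi : (c i).1 = ⟪ω, (c i).2.1⟫_ℝ
  · have h1 := affOn_nonneg_of_convex hi hw1 hw2
    have h2 : μ * η ≤ affOn s (c i) w := by
      rw [h1]
      have := mul_nonneg (by linarith : 0 ≤ 1 - μ) (hnn n i)
      have := mul_le_mul_of_nonneg_left (hηu i) hμ0.le
      linarith
    have h3 := (abs_affOn_sub_le s (c i) x w).trans
      (mul_le_mul_of_nonneg_right (hBi i) (norm_nonneg _))
    have h4 : B * ‖x - w‖ < B * (κ / e ^ 3) := by gcongr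
    have h5 : B * (κ / e ^ 3) ≤ μ * η := by
      have : κ ≤ η / (2 * (C + 1) * B) := min_le_right _ _
      calc B * (κ / e ^ 3) ≤ B * (η / (2 * (C + 1) * B) / e ^ 3) := by gcongr
        _ = μ * η := by rw [hμ]; field_simp
    linarith [neg_abs_le (affOn s (c i) x - affOn s (c i) w)]
  · have h1 := hn i hi
    have h2 : ‖x - v n‖ ≤ 1 := by
      have : x - v n = (x - w) + (w - v n) := by abel
      rw [this]
      exact (norm_add_le _ _).trans (by linarith)
    have h3 := (abs_affOn_sub_le s (c i) x (v n)).trans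
      (mul_le_mul (hBi i) h2 (norm_nonneg _) (by linarith))
    linarith [neg_abs_le (affOn s (c i) x - affOn s (c i) (v n))]

/-! ### Regions of a hyperboloid between finitely many other hyperboloids -/

section Region

variable {ι κ : Type*}

/-- The part (in spatial coordinates) of the hyperboloid `p` that lies in the future of the
hyperboloids `a i` and in the strict past of the hyperboloids `b k`. -/
def region (a : ι → Minkowski × ℝ) (b : κ → Minkowski × ℝ) (p : Minkowski × ℝ) : Set E3 :=
  {ξ | (∀ i, hypTime (a i).1 (a i).2 ξ ≤ hypTime p.1 p.2 ξ) ∧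
    ∀ k, hypTime p.1 p.2 ξ < hypTime (b k).1 (b k).2 ξ}

/-- The variant of `region` with only strict inequalities. -/
def openRegion (a : ι → Minkowski × ℝ) (b : κ → Minkowski × ℝ) (p : Minkowski × ℝ) : Set E3 :=
  {ξ | (∀ i, hypTime (a i).1 (a i).2 ξ < hypTime p.1 p.2 ξ) ∧
    ∀ k, hypTime p.1 p.2 ξ < hypTime (b k).1 (b k).2 ξ}

/-- A region is regular if it is contained in the closure of its strict variant. -/
def RegularRegion (a : ι → Minkowski × ℝ) (b : κ → Minkowski × ℝ) (p : Minkowski × ℝ) : Prop :=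
  region a b p ⊆ closure (openRegion a b p)

theorem mem_region {a : ι → Minkowski × ℝ} {b : κ → Minkowski × ℝ} {p : Minkowski × ℝ} {ξ : E3} :
    ξ ∈ region a b p ↔ (∀ i, hypTime (a i).1 (a i).2 ξ ≤ hypTime p.1 p.2 ξ) ∧
      ∀ k, hypTime p.1 p.2 ξ < hypTime (b k).1 (b k).2 ξ := Iff.rfl

theorem mem_openRegion {a : ι → Minkowski × ℝ} {b : κ → Minkowski × ℝ} {p : Minkowski × ℝ}
    {ξ : E3} : ξ ∈ openRegion a b p ↔ (∀ i, hypTime (a i).1 (a i).2 ξ < hypTime p.1 p.2 ξ) ∧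
      ∀ k, hypTime p.1 p.2 ξ < hypTime (b k).1 (b k).2 ξ := Iff.rfl

theorem openRegion_subset (a : ι → Minkowski × ℝ) (b : κ → Minkowski × ℝ) (p : Minkowski × ℝ) :
    openRegion a b p ⊆ region a b p := fun _ h => ⟨fun i => (h.1 i).le, h.2⟩

@[fun_prop]
theorem continuous_hypTime :
    Continuous fun q : (Minkowski × ℝ) × E3 => hypTime q.1.1 q.1.2 q.2 := by
  unfold hypTime; fun_prop

theorem isOpen_setOf_openRegion [Finite ι] [Finite κ] :
    IsOpen {q : ((ι → Minkowski × ℝ) × (κ → Minkowski × ℝ) × (Minkowski × ℝ)) × E3 |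
      q.2 ∈ openRegion q.1.1 q.1.2.1 q.1.2.2} := by
  have h : ∀ f : ((ι → Minkowski × ℝ) × (κ → Minkowski × ℝ) × (Minkowski × ℝ)) × E3 →
      (Minkowski × ℝ) × E3, Continuous f → Continuous fun q => hypTime (f q).1.1 (f q).1.2 (f q).2 :=
    fun f hf => continuous_hypTime.comp hf
  have h0 := h (fun q => (q.1.2.2, q.2)) (by fun_prop)
  simp only [mem_openRegion]
  simp only [ofPred_and, ofPred_forall]
  apply IsOpen.inter
  · refine isOpen_iInter_of_finite fun i => isOpen_lt (h (fun q => (q.1.1 i, q.2)) (by fun_prop)) h0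
  · refine isOpen_iInter_of_finite fun k =>
      isOpen_lt h0 (h (fun q => (q.1.2.1 k, q.2)) (by fun_prop))

theorem isOpen_openRegion [Finite ι] [Finite κ] (a : ι → Minkowski × ℝ) (b : κ → Minkowski × ℝ)
    (p : Minkowski × ℝ) : IsOpen (openRegion a b p) :=
  isOpen_setOf_openRegion.preimage (f := fun ξ : E3 => ((a, b, p), ξ)) (by fun_prop)

theorem measurableSet_setOf_region [Finite ι] [Finite κ] :
    MeasurableSet {q : ((ι → Minkowski × ℝ) × (κ → Minkowski × ℝ) × (Minkowski × ℝ)) × E3 |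
      q.2 ∈ region q.1.1 q.1.2.1 q.1.2.2} := by
  have h : ∀ f : ((ι → Minkowski × ℝ) × (κ → Minkowski × ℝ) × (Minkowski × ℝ)) × E3 →
      (Minkowski × ℝ) × E3, Measurable f → Measurable fun q => hypTime (f q).1.1 (f q).1.2 (f q).2 :=
    fun f hf => continuous_hypTime.measurable.comp hf
  have h0 := h (fun q => (q.1.2.2, q.2)) (by fun_prop)
  simp only [mem_region]
  simp only [ofPred_and, ofPred_forall]
  apply MeasurableSet.inter
  · exact MeasurableSet.iInter fun i =>
      measurableSet_le (h (fun q => (q.1.1 i, q.2)) (by fun_prop)) h0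
  · exact MeasurableSet.iInter fun k =>
      measurableSet_lt h0 (h (fun q => (q.1.2.1 k, q.2)) (by fun_prop))

theorem isOpen_setOf_openRegion_nonempty [Finite ι] [Finite κ] (x : E3) (r : ℝ) :
    IsOpen {q : (ι → Minkowski × ℝ) × (κ → Minkowski × ℝ) × (Minkowski × ℝ) |
      (openRegion q.1 q.2.1 q.2.2 ∩ Metric.ball x r).Nonempty} := by
  have : {q : (ι → Minkowski × ℝ) × (κ → Minkowski × ℝ) × (Minkowski × ℝ) |
      (openRegion q.1 q.2.1 q.2.2 ∩ Metric.ball x r).Nonempty}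
      = ⋃ ξ ∈ Metric.ball x r, {q | ξ ∈ openRegion q.1 q.2.1 q.2.2} := by
    ext q; simp only [mem_ofPred_eq, mem_iUnion, Set.Nonempty, mem_inter_iff]
    exact ⟨fun ⟨ξ, h1, h2⟩ => ⟨ξ, h2, h1⟩, fun ⟨ξ, h2, h1⟩ => ⟨ξ, h1, h2⟩⟩
  rw [this]
  exact isOpen_biUnion fun ξ _ => isOpen_setOf_openRegion.preimage
    (f := fun q : (ι → Minkowski × ℝ) × (κ → Minkowski × ℝ) × (Minkowski × ℝ) => (q, ξ))
    (by fun_prop)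

/-- With a margin `1 / (n + 1)` in the strict inequalities the incidence set is closed, and closed
sets project to closed sets along a compact ball. The set in question is the countable union of
these projections. -/
theorem measurableSet_region_nonempty [Finite ι] [Finite κ] (x : E3) (r : ℝ) :
    MeasurableSet {q : (ι → Minkowski × ℝ) × (κ → Minkowski × ℝ) × (Minkowski × ℝ) |
      (region q.1 q.2.1 q.2.2 ∩ Metric.closedBall x r).Nonempty} := by
  have h : ∀ f : ((ι → Minkowski × ℝ) × (κ → Minkowski × ℝ) × (Minkowski × ℝ)) × Metric.closedBall x r → (Minkowski × ℝ) × E3, Continuous f →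
      Continuous fun q => hypTime (f q).1.1 (f q).1.2 (f q).2 :=
    fun f hf => continuous_hypTime.comp hf
  have h0 := h (fun q => (q.1.2.2, (q.2 : E3))) (by fun_prop)
  let T : ℕ → Set  (((ι → Minkowski × ℝ) × (κ → Minkowski × ℝ) × (Minkowski × ℝ)) × Metric.closedBall x r) := fun n =>
    {q | (∀ i, hypTime (q.1.1 i).1 (q.1.1 i).2 q.2 ≤ hypTime q.1.2.2.1 q.1.2.2.2 q.2) ∧
      ∀ k, hypTime q.1.2.2.1 q.1.2.2.2 q.2 + 1 / ((n : ℝ) + 1)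
        ≤ hypTime (q.1.2.1 k).1 (q.1.2.1 k).2 q.2}
  have hT : ∀ n, IsClosed (T n) := by
    intro n
    simp only [T, ofPred_and, ofPred_forall]
    apply IsClosed.inter
    · exact isClosed_iInter fun i => isClosed_le (h (fun q => (q.1.1 i, (q.2 : E3))) (by fun_prop)) h0
    · exact isClosed_iInter fun k => isClosed_le (h0.add_const _)
        (h (fun q => (q.1.2.1 k, (q.2 : E3))) (by fun_prop))
  have : CompactSpace (Metric.closedBall x r) :=
    isCompact_iff_compactSpace.mp (isCompact_closedBall x r)
  have : {q : (ι → Minkowski × ℝ) × (κ → Minkowski × ℝ) × (Minkowski × ℝ) | (region q.1 q.2.1 q.2.2 ∩ Metric.closedBall x r).Nonempty}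
      = ⋃ n, Prod.fst '' T n := by
    ext q
    simp only [mem_ofPred_eq, mem_iUnion, mem_image, Prod.exists, exists_and_right, exists_eq_right]
    constructor
    · rintro ⟨ξ, ⟨h1, h2⟩, hξ⟩
      have : ∃ n : ℕ, ∀ k, hypTime q.2.2.1 q.2.2.2 ξ + 1 / ((n : ℝ) + 1)
          ≤ hypTime (q.2.1 k).1 (q.2.1 k).2 ξ := by
        have : ∀ᶠ n : ℕ in Filter.atTop, ∀ k, hypTime q.2.2.1 q.2.2.2 ξ + 1 / ((n : ℝ) + 1)
          ≤ hypTime (q.2.1 k).1 (q.2.1 k).2 ξ := by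
          rw [Filter.eventually_all]
          intro k
          filter_upwards [(tendsto_one_div_add_atTop_nhds_zero_nat (𝕜 := ℝ)).eventually
            (gt_mem_nhds (sub_pos.mpr (h2 k)))] with n hn
          linarith
        exact this.exists
      obtain ⟨n, hn⟩ := this
      exact ⟨n, ⟨ξ, hξ⟩, h1, hn⟩
    · rintro ⟨n, ⟨ξ, hξ⟩, h1, h2⟩
      refine ⟨ξ, ⟨h1, fun k => ?_⟩, hξ⟩
      have := h2 k
      have : 0 < 1 / ((n : ℝ) + 1) := by positivity
      change hypTime q.2.2.1 q.2.2.2 ξ < _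
      linarith [h2 k]
  rw [this]
  exact MeasurableSet.iUnion fun n => (isClosedMap_fst_of_compactSpace _ (hT n)).measurableSet

/-- A countable test that makes regularity a measurable condition on the parameters. The doubled
radius lets the open ball contain the points of the closed one. -/
theorem regularRegion_iff [Finite ι] [Finite κ] (a : ι → Minkowski × ℝ) (b : κ → Minkowski × ℝ)
    (p : Minkowski × ℝ) : RegularRegion a b p ↔ ∀ m n : ℕ,
      (region a b p ∩ Metric.closedBall (TopologicalSpace.denseSeq E3 m) (1 / (n + 1))).Nonempty →
      (openRegion a b p ∩ Metric.ball (TopologicalSpace.denseSeq E3 m) (2 / (n + 1))).Nonempty := by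
  constructor
  · rintro h m n ⟨ξ, hξ, hb⟩
    have h1 : Metric.ball (TopologicalSpace.denseSeq E3 m) (2 / ((n : ℝ) + 1)) ∈ 𝓝 ξ := by
      apply Metric.isOpen_ball.mem_nhds
      refine lt_of_le_of_lt (Metric.mem_closedBall.mp hb) ?_
      gcongr; norm_num
    have := mem_closure_iff_nhds.mp (h hξ) _ h1
    rwa [inter_comm] at this
  · intro h ξ hξ
    rw [Metric.mem_closure_iff]
    intro ε hε
    obtain ⟨n, hn⟩ := exists_nat_one_div_lt (show 0 < ε / 3 by positivity)
    have hn0 : (0 : ℝ) < 1 / ((n : ℝ) + 1) := by positivity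
    obtain ⟨m, hm⟩ := (TopologicalSpace.denseRange_denseSeq E3).exists_dist_lt ξ hn0
    obtain ⟨w, hw, hwb⟩ := h m n ⟨ξ, hξ, hm.le⟩
    refine ⟨w, hw, ?_⟩
    have h2 : dist w (TopologicalSpace.denseSeq E3 m) < 2 / (n + 1) := hwb
    have h3 : 2 / ((n : ℝ) + 1) = 2 * (1 / (n + 1)) := by ring
    calc dist ξ w ≤ _ := dist_triangle_right _ _ (TopologicalSpace.denseSeq E3 m)
      _ < ε := by linarith

theorem measurableSet_regularRegion [Finite ι] [Finite κ] :
    MeasurableSet {q : (ι → Minkowski × ℝ) × (κ → Minkowski × ℝ) × (Minkowski × ℝ) |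
      RegularRegion q.1 q.2.1 q.2.2} := by
  simp only [regularRegion_iff, ofPred_forall]
  refine MeasurableSet.iInter fun m => MeasurableSet.iInter fun n => ?_
  simp only [imp_iff_not_or]
  exact (measurableSet_region_nonempty _ _).compl.union
    (isOpen_setOf_openRegion_nonempty _ _).measurableSet

theorem hypTime_lt_hypTime (y : Minkowski) {s s' : ℝ} (hs : 0 ≤ s) (h : s < s') (ξ : E3) :
    hypTime y s ξ < hypTime y s' ξ := by
  unfold hypTime
  have : s ^ 2 < s' ^ 2 := by gcongr
  gcongr

/-- For a fixed pair of test balls, a point of the region at radius parameter `r` lies in the strict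
region for all slightly larger parameters: weak inequalities become strict and strict ones persist.
So every bad parameter is isolated from the right among the bad ones, and such a set of reals is
countable. -/
theorem countable_not_regularRegion [Finite ι] [Finite κ] (a : ι → Minkowski × ℝ)
    (b : κ → Minkowski × ℝ) (y : Minkowski) :
    {r : ℝ | ¬ RegularRegion a b (y, Real.exp r)}.Countable := by
  simp only [regularRegion_iff, not_forall, ofPred_exists]
  refine countable_iUnion fun m => countable_iUnion fun n => ?_
  set B := Metric.closedBall (TopologicalSpace.denseSeq E3 m) (1 / ((n : ℝ) + 1))
  set B' := Metric.ball (TopologicalSpace.denseSeq E3 m) (2 / ((n : ℝ) + 1)) with hB'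
  set S : Set ℝ := {r | ∃ _ : (region a b (y, Real.exp r) ∩ B).Nonempty,
    ¬ (openRegion a b (y, Real.exp r) ∩ B').Nonempty} with hS
  have hBB : B ⊆ B' := Metric.closedBall_subset_ball (by gcongr; norm_num)
  suffices h : ∀ r ∈ S, 𝓝[S ∩ Ioi r] r = ⊥ from
    (countable_setOfPred_isolated_right_within (s := S)).mono fun r hr => mem_sep hr (h r hr)
  intro r hr
  obtain ⟨⟨ξ, hξ, hξB⟩, -⟩ := hr
  have hev : ∀ᶠ r' in 𝓝[>] r, ξ ∈ openRegion a b (y, Real.exp r') := by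
    have h1 : ∀ᶠ r' in 𝓝[>] r, ∀ k,
        hypTime y (Real.exp r') ξ < hypTime (b k).1 (b k).2 ξ := by
      rw [Filter.eventually_all]
      intro k
      have hc : Continuous fun r' => hypTime y (Real.exp r') ξ := by unfold hypTime; fun_prop
      exact ((hc.tendsto r).eventually (gt_mem_nhds (hξ.2 k))).filter_mono nhdsWithin_le_nhds
    filter_upwards [h1, self_mem_nhdsWithin] with r' hr' hlt
    refine ⟨fun i => (hξ.1 i).trans_lt ?_, hr'⟩
    exact hypTime_lt_hypTime y (Real.exp_pos r).le (Real.exp_lt_exp.mpr hlt) ξ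
  have hev' := eventually_nhdsWithin_iff.mp hev
  rw [← Filter.empty_mem_iff_bot, mem_nhdsWithin_iff_eventually]
  filter_upwards [hev'] with r' h1
  rintro ⟨⟨_, h3⟩, h4⟩
  exact h3 ⟨ξ, h1 h4, hBB hξB⟩

end Region

/-! ### Boundedness of the cut-off profile functions -/

/-- The affine function comparing the hyperboloid `p'` to the hyperboloid `p`. -/
def hypCoeff (p p' : Minkowski × ℝ) : ℝ × E3 × ℝ :=
  (p.1.1 - p'.1.1, p.1.2 - p'.1.2,
    ((p.1.1 - p'.1.1) ^ 2 + p.2 ^ 2 - p'.2 ^ 2 - ‖p.1.2 - p'.1.2‖ ^ 2) / 2)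

/-- All hyperboloids are quadrics with the same quadratic part, which cancels when one equation is
subtracted from the other. Hence the comparison of two of them is an affine inequality. -/
theorem affOn_hypCoeff (p p' : Minkowski × ℝ) (ξ : E3) :
    2 * affOn p.2 (hypCoeff p p') (ξ - p.1.2) = (p.1.1 - p'.1.1 + energy p.2 (ξ - p.1.2)) ^ 2
      - (p'.2 ^ 2 + ‖ξ - p'.1.2‖ ^ 2) := by
  have h1 : ξ - p'.1.2 = (ξ - p.1.2) + (p.1.2 - p'.1.2) := by abel
  have h2 := energy_sq p.2 (ξ - p.1.2)
  rw [h1, norm_add_sq_real]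
  simp only [affOn, hypCoeff]
  linear_combination -h2

theorem hypTime_le_iff {p p' : Minkowski × ℝ} {ξ : E3}
    (h : 0 < p.1.1 - p'.1.1 + energy p.2 (ξ - p.1.2)) :
    hypTime p'.1 p'.2 ξ ≤ hypTime p.1 p.2 ξ ↔ 0 ≤ affOn p.2 (hypCoeff p p') (ξ - p.1.2) := by
  have h1 := affOn_hypCoeff p p' ξ
  have h2 : hypTime p'.1 p'.2 ξ ≤ hypTime p.1 p.2 ξ ↔
      √(p'.2 ^ 2 + ‖ξ - p'.1.2‖ ^ 2) ≤ p.1.1 - p'.1.1 + energy p.2 (ξ - p.1.2) := by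
    unfold hypTime energy
    constructor <;> intro h <;> linarith
  rw [h2, Real.sqrt_le_left h.le]
  constructor <;> intro h <;> linarith

theorem hypTime_lt_iff {p p' : Minkowski × ℝ} {ξ : E3}
    (h : 0 < p.1.1 - p'.1.1 + energy p.2 (ξ - p.1.2)) :
    hypTime p'.1 p'.2 ξ < hypTime p.1 p.2 ξ ↔ 0 < affOn p.2 (hypCoeff p p') (ξ - p.1.2) := by
  have h1 := affOn_hypCoeff p p' ξ
  have h2 : hypTime p'.1 p'.2 ξ < hypTime p.1 p.2 ξ ↔
      √(p'.2 ^ 2 + ‖ξ - p'.1.2‖ ^ 2) < p.1.1 - p'.1.1 + energy p.2 (ξ - p.1.2) := by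
    unfold hypTime energy
    constructor <;> intro h <;> linarith
  rw [h2, Real.sqrt_lt' h]
  constructor <;> intro h <;> linarith

theorem affOn_neg (s : ℝ) (c : ℝ × E3 × ℝ) (v : E3) : affOn s (-c) v = -affOn s c v := by
  simp only [affOn, Prod.fst_neg, Prod.snd_neg, inner_neg_right]
  ring

/-- The squared norm over `A` of the Gaussian centered at `η`, on the hyperboloid `p`. -/
def profNormSq (σ : ℝ) (p : Minkowski × ℝ) (A : Set E3) (η : E3) : ℝ :=
  ∫ w in A, gaussKernel σ p.2 (η - p.1.2) (w - p.1.2) ^ 2 * volDensity p.2 (w - p.1.2)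

open Classical in
/-- The cut-off profile function on the hyperboloid `p`, in spatial coordinates. -/
def prof (σ : ℝ) (p : Minkowski × ℝ) (A : Set E3) (ξ η : E3) : ℝ :=
  if η ∈ A ∧ ξ ∈ A then
    gaussKernel σ p.2 (ξ - p.1.2) (η - p.1.2) / √(profNormSq σ p A η)
  else 0

theorem prof_nonneg (σ : ℝ) (p : Minkowski × ℝ) (A : Set E3) (ξ η : E3) : 0 ≤ prof σ p A ξ η := by
  unfold prof; split_ifs
  · exact div_nonneg (gaussKernel_pos ..).le (Real.sqrt_nonneg _)
  · exact le_rfl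

theorem integrable_profNormSq {σ : ℝ} (hσ : 0 < σ) {p : Minkowski × ℝ} (hs : 0 < p.2) (η : E3) :
    Integrable fun w : E3 =>
      gaussKernel σ p.2 (η - p.1.2) (w - p.1.2) ^ 2 * volDensity p.2 (w - p.1.2) :=
  (integrable_gaussKernel_sq hσ hs (η - p.1.2)).comp_sub_right p.1.2

theorem le_profNormSq {σ : ℝ} (hσ : 0 < σ) {p : Minkowski × ℝ} (hs : 0 < p.2) {A : Set E3}
    {η w : E3} {ρ c M : ℝ} (hc : 0 ≤ c) (hb : Metric.ball w ρ ⊆ A)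
    (hg : ∀ x ∈ Metric.ball w ρ, c ≤ gaussKernel σ p.2 (η - p.1.2) (x - p.1.2))
    (hM : ∀ x ∈ Metric.ball w ρ, energy p.2 (x - p.1.2) ≤ M) :
    c ^ 2 * (p.2 / M) * volume.real (Metric.ball w ρ) ≤ profNormSq σ p A η := by
  have hi := integrable_profNormSq hσ hs η
  calc c ^ 2 * (p.2 / M) * volume.real (Metric.ball w ρ)
      = ∫ x in Metric.ball w ρ, c ^ 2 * (p.2 / M) := by
        rw [setIntegral_const, smul_eq_mul, mul_comm]
    _ ≤ ∫ x in Metric.ball w ρ,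
        gaussKernel σ p.2 (η - p.1.2) (x - p.1.2) ^ 2 * volDensity p.2 (x - p.1.2) := by
        refine setIntegral_mono_on ?_ hi.integrableOn measurableSet_ball ?_
        · exact integrableOn_const measure_ball_lt_top.ne
        · intro x hx
          have h1 := hg x hx
          have h2 := energy_pos hs (x - p.1.2)
          have h3 : p.2 / M ≤ volDensity p.2 (x - p.1.2) := by
            unfold volDensity
            exact div_le_div_of_nonneg_left hs.le h2 (hM x hx)
          have h4 : 0 ≤ p.2 / M := div_nonneg hs.le (h2.le.trans (hM x hx))
          gcongr
    _ ≤ _ := setIntegral_mono_set hi.integrableOn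
        (ae_of_all _ fun x => mul_nonneg (sq_nonneg _) (volDensity_pos hs _).le)
        (ae_of_all _ hb)

theorem profNormSq_pos_of_norm_le {σ : ℝ} (hσ : 0 < σ) {p : Minkowski × ℝ} (hs : 0 < p.2)
    {A : Set E3} (hi : (interior A).Nonempty) (R : ℝ) :
    ∃ c > 0, ∀ η : E3, ‖η‖ ≤ R → c ≤ profNormSq σ p A η := by
  obtain ⟨w, hw⟩ := hi
  obtain ⟨ρ, hρ, hb⟩ := Metric.isOpen_iff.mp isOpen_interior w hw
  obtain ⟨c, hc, hg⟩ := gaussKernel_lower (σ := σ) hs (R + (‖w‖ + ρ))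
  set M := p.2 + (‖w‖ + ρ + ‖p.1.2‖)
  have hM : 0 < M := by positivity
  refine ⟨c ^ 2 * (p.2 / M) * volume.real (Metric.ball w ρ), ?_, fun η hη => ?_⟩
  · have : 0 < volume.real (Metric.ball w ρ) :=
      ENNReal.toReal_pos (Metric.measure_ball_pos _ _ hρ).ne' measure_ball_lt_top.ne
    positivity
  · have hx : ∀ x ∈ Metric.ball w ρ, ‖x‖ ≤ ‖w‖ + ρ := fun x hx => by
      have := norm_sub_norm_le x w
      have h2 : ‖x - w‖ < ρ := by rwa [mem_ball_iff_norm] at hx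
      linarith
    refine le_profNormSq hσ hs hc.le (hb.trans interior_subset) (fun x hxb => hg _ _ ?_)
      fun x hxb => ?_
    · rw [sub_sub_sub_cancel_right]
      exact (norm_sub_le _ _).trans (add_le_add hη (hx x hxb))
    · refine Real.sqrt_le_iff.mpr ⟨hM.le, ?_⟩
      have h1 : ‖x - p.1.2‖ ≤ ‖w‖ + ρ + ‖p.1.2‖ :=
        (norm_sub_le _ _).trans (add_le_add_left (hx x hxb) _)
      have h2 := norm_nonneg (x - p.1.2)
      simp only [M]
      nlinarith

section Regular

variable {ι κ : Type*} [Finite ι] [Finite κ] {a : ι → Minkowski × ℝ} {b : κ → Minkowski × ℝ}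
  {p : Minkowski × ℝ}

theorem measurableSet_region (a : ι → Minkowski × ℝ) (b : κ → Minkowski × ℝ)
    (p : Minkowski × ℝ) : MeasurableSet (region a b p) :=
  (measurable_prodMk_left (x := (a, b, p))) measurableSet_setOf_region

theorem RegularRegion.interior_nonempty (h : RegularRegion a b p) (hne : (region a b p).Nonempty) :
    (interior (region a b p)).Nonempty := by
  obtain ⟨ξ, hξ⟩ := hne
  obtain ⟨w, hw⟩ := closure_nonempty_iff.mp ⟨ξ, h hξ⟩
  exact ⟨w, interior_maximal (openRegion_subset a b p) (isOpen_openRegion a b p) hw⟩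

theorem RegularRegion.profNormSq_pos {σ : ℝ} (hσ : 0 < σ) (hs : 0 < p.2)
    (h : RegularRegion a b p) (hne : (region a b p).Nonempty) (η : E3) :
    0 < profNormSq σ p (region a b p) η := by
  obtain ⟨c, hc, h⟩ := profNormSq_pos_of_norm_le hσ hs (h.interior_nonempty hne) ‖η‖
  exact hc.trans_le (h η le_rfl)

/-- If points of a regular region escape to infinity along a direction, then the Gaussians centered
at them have norms bounded below by an inverse power of their distance. -/
theorem RegularRegion.profNormSq_lower {σ : ℝ} (hσ : 0 < σ) (hs : 0 < p.2)
    (h : RegularRegion a b p) {η : ℕ → E3} (hη : ∀ n, η n ∈ region a b p)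
    (hlim : Filter.Tendsto (fun n => ‖η n - p.1.2‖) Filter.atTop Filter.atTop) {ω : E3}
    (hω : Filter.Tendsto (fun n => ‖η n - p.1.2‖⁻¹ • (η n - p.1.2)) Filter.atTop (𝓝 ω)) :
    ∃ c > 0, ∀ᶠ n in Filter.atTop,
      c / energy p.2 (η n - p.1.2) ^ 10 ≤ profNormSq σ p (region a b p) (η n) := by
  cases nonempty_fintype ι
  cases nonempty_fintype κ
  -- a bound `D` beyond which the comparison of times is affine
  obtain ⟨D, hD0, hDa, hDb⟩ : ∃ D : ℝ, 0 ≤ D ∧ (∀ i, |p.1.1 - (a i).1.1| ≤ D) ∧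
      ∀ k, |p.1.1 - (b k).1.1| ≤ D := by
    refine ⟨∑ i, |p.1.1 - (a i).1.1| + ∑ k, |p.1.1 - (b k).1.1|, by positivity, fun i => ?_,
      fun k => ?_⟩
    · have := Finset.single_le_sum (f := fun i => |p.1.1 - (a i).1.1|)
        (fun i _ => abs_nonneg _) (Finset.mem_univ i)
      have h2 : 0 ≤ ∑ k, |p.1.1 - (b k).1.1| := by positivity
      linarith
    · have := Finset.single_le_sum (f := fun k => |p.1.1 - (b k).1.1|)
        (fun i _ => abs_nonneg _) (Finset.mem_univ k)
      have h2 : 0 ≤ ∑ i, |p.1.1 - (a i).1.1| := by positivity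
      linarith
  let c : ι ⊕ κ → ℝ × E3 × ℝ := Sum.elim (fun i => hypCoeff p (a i)) (fun k => -hypCoeff p (b k))
  have hpos : ∀ {d E : ℝ}, |d| ≤ D → D < E → 0 < d + E := fun {d E} h1 h2 => by
    linarith [neg_abs_le d]
  have hmem : ∀ ξ, D < energy p.2 (ξ - p.1.2) →
      (ξ ∈ region a b p → ∀ l, 0 ≤ affOn p.2 (c l) (ξ - p.1.2)) ∧
      (ξ ∈ openRegion a b p ↔ ∀ l, 0 < affOn p.2 (c l) (ξ - p.1.2)) := by
    intro ξ hξ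
    refine ⟨fun hr => ?_, ⟨fun hr => ?_, fun hr => ?_⟩⟩
    · rintro (i | k)
      · exact (hypTime_le_iff (hpos (hDa i) hξ)).mp (hr.1 i)
      · simp only [c, Sum.elim_inr, affOn_neg]
        rw [neg_nonneg, ← not_lt]
        exact fun hh => (hr.2 k).not_gt ((hypTime_lt_iff (hpos (hDb k) hξ)).mpr hh)
    · rintro (i | k)
      · exact (hypTime_lt_iff (hpos (hDa i) hξ)).mp (hr.1 i)
      · simp only [c, Sum.elim_inr, affOn_neg]
        rw [neg_pos, ← not_le]
        exact fun hh => (hr.2 k).not_ge ((hypTime_le_iff (hpos (hDb k) hξ)).mpr hh)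
    · refine ⟨fun i => (hypTime_lt_iff (hpos (hDa i) hξ)).mpr (hr (Sum.inl i)), fun k => ?_⟩
      have := hr (Sum.inr k)
      simp only [c, Sum.elim_inr, affOn_neg] at this
      rw [neg_pos, ← not_le] at this
      exact not_le.mp fun hh => this ((hypTime_le_iff (hpos (hDb k) hξ)).mp hh)
  -- The extra 1 keeps the point `u` found below, at distance less than 1, where time comparison is
  -- affine.
  obtain ⟨n₀, hn₀⟩ := Filter.eventually_atTop.mp (hlim.eventually_gt_atTop (D + 1))
  obtain ⟨u, hu, hud⟩ := Metric.mem_closure_iff.mp (h (hη n₀)) 1 one_pos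
  have huD : D < energy p.2 (u - p.1.2) := by
    have h1 := hn₀ n₀ le_rfl
    have h2 : ‖η n₀ - p.1.2‖ ≤ ‖η n₀ - u‖ + ‖u - p.1.2‖ := norm_sub_le_norm_sub_add_norm_sub ..
    rw [dist_eq_norm] at hud
    linarith [norm_le_energy p.2 (u - p.1.2)]
  have huc := ((hmem u huD).2).mp hu
  obtain ⟨q, hq, hev⟩ := exists_ball_of_tendsto hs c (v := fun n => η (n + n₀) - p.1.2)
    (hlim.comp (Filter.tendsto_add_atTop_nat n₀))
    (fun n => (hmem _ ((by linarith [hn₀ (n + n₀) (by omega)] : D < ‖η (n + n₀) - p.1.2‖).trans_le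
      (norm_le_energy _ _))).1 (hη _))
    (hω.comp (Filter.tendsto_add_atTop_nat n₀)) huc
  obtain ⟨g, hg, hgk⟩ := gaussKernel_lower (σ := σ) hs 1
  have hV : 0 < volume.real (Metric.ball (0 : E3) 1) :=
    ENNReal.toReal_pos (Metric.measure_ball_pos _ _ one_pos).ne' measure_ball_lt_top.ne
  set V := volume.real (Metric.ball (0 : E3) 1) with hVdef
  -- Of the ten powers of `E`, nine come from the volume of a ball of radius `q / E ^ 3`, and one
  -- from the volume density.
  refine ⟨g ^ 2 * (p.2 / 2) * (q ^ 3 * V), by positivity, ?_⟩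
  have hlarge := (hlim.comp (Filter.tendsto_add_atTop_nat n₀)).eventually_gt_atTop (1 : ℝ)
  rw [← Filter.map_add_atTop_eq_nat n₀, Filter.eventually_map]
  filter_upwards [hev, hlarge] with n hn hn1
  obtain ⟨w, hw1, hw2, hw3⟩ := hn
  set m := n + n₀
  set E := energy p.2 (η m - p.1.2) with hE
  have hE0 : 0 < E := energy_pos hs _
  have hE1 : 1 ≤ E := (show 1 < ‖η m - p.1.2‖ from hn1).le.trans (norm_le_energy _ _)
  set ρ := q / E ^ 3 with hρ
  have hρ0 : 0 < ρ := by positivity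
  have hclose : ∀ x ∈ Metric.ball (w + p.1.2) ρ, ‖(x - p.1.2) - w‖ < ρ ∧
      ‖x - η m‖ ≤ 1 := by
    intro x hx
    have h1 : ‖(x - p.1.2) - w‖ < ρ := by
      rw [mem_ball_iff_norm] at hx
      rwa [show x - p.1.2 - w = x - (w + p.1.2) by abel]
    refine ⟨h1, ?_⟩
    calc ‖x - η m‖ = ‖((x - p.1.2) - w) + (w - (η m - p.1.2))‖ := by congr 1; abel
      _ ≤ _ := norm_add_le _ _
      _ ≤ 1 := by linarith
  have hkey := le_profNormSq (σ := σ) (A := region a b p) (η := η m) (w := w + p.1.2) (ρ := ρ) (c := g) (M := 2 * E)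
    hσ hs hg.le ?_ ?_ ?_
  · refine le_trans (le_of_eq ?_) hkey
    have hvol : volume.real (Metric.ball (w + p.1.2) ρ) = ρ ^ 3 * V := by
      rw [hVdef, measureReal_def, measureReal_def, Measure.addHaar_ball _ _ hρ0.le,
        finrank_euclideanSpace_fin, ENNReal.toReal_mul, ENNReal.toReal_ofReal (by positivity)]
    rw [hvol, hρ]
    field_simp
  · intro x hx
    obtain ⟨h1, h2⟩ := hclose x hx
    apply openRegion_subset
    refine (hmem x ?_).2.mpr fun l => hw3 _ h1 l
    have h3 : ‖η m - p.1.2‖ ≤ ‖x - η m‖ + ‖x - p.1.2‖ := by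
      rw [norm_sub_rev x]; exact norm_sub_le_norm_sub_add_norm_sub ..
    linarith [norm_le_energy p.2 (x - p.1.2), hn₀ m (by omega)]
  · intro x hx
    apply hgk
    rw [sub_sub_sub_cancel_right, norm_sub_rev]
    exact (hclose x hx).2
  · intro x hx
    have := energy_sub_le p.2 (x - p.1.2) (η m - p.1.2)
    rw [sub_sub_sub_cancel_right] at this
    linarith [(hclose x hx).2]

/-- The profile functions of a regular region are bounded. -/
theorem RegularRegion.exists_prof_le {σ : ℝ} (hσ : 0 < σ) (hs : 0 < p.2)
    (h : RegularRegion a b p) (ξ : E3) :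
    ∃ c, ∀ η, prof σ p (region a b p) ξ η ≤ c := by
  by_contra! hcon
  -- If the profile is unbounded, there are points `η n` at which it exceeds `n`. They cannot stay
  -- bounded, and escaping to infinity they contradict the decay of the Gaussian.
  have hcon : ∀ n : ℕ, ∃ η ∈ region a b p, (n : ℝ) * √(profNormSq σ p (region a b p) η)
      < gaussKernel σ p.2 (ξ - p.1.2) (η - p.1.2) := by
    intro n
    obtain ⟨η, hη⟩ := hcon n
    unfold prof at hη
    split_ifs at hη with hc
    · refine ⟨η, hc.1, ?_⟩
      have := h.profNormSq_pos hσ hs ⟨η, hc.1⟩ η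
      rwa [lt_div_iff₀ (Real.sqrt_pos.mpr this)] at hη
    · exact absurd hη (by simp)
  choose η hηA hη using hcon
  have hint := h.interior_nonempty ⟨_, hηA 0⟩
  -- On a bounded set the norm in the denominator is bounded below and the Gaussian is at most 1, so
  -- only finitely many `η n` lie there.
  have hlim0 : Filter.Tendsto (fun n => ‖η n‖) Filter.atTop Filter.atTop := by
    rw [Filter.tendsto_atTop]
    intro R
    obtain ⟨c, hc, hcb⟩ := profNormSq_pos_of_norm_le (σ := σ) hσ hs hint R
    obtain ⟨n₁, hn₁⟩ := exists_nat_gt (1 / √c)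
    filter_upwards [Filter.eventually_ge_atTop n₁] with n hn
    by_contra! hlt
    have h1 := hη n
    have h2 : √c ≤ √(profNormSq σ p (region a b p) (η n)) := Real.sqrt_le_sqrt (hcb _ hlt.le)
    have h3 := gaussKernel_le_one σ p.2 (ξ - p.1.2) (η n - p.1.2)
    have hc' := Real.sqrt_pos.mpr hc
    have h4 : 1 < n * √c := by
      rw [div_lt_iff₀ hc'] at hn₁
      have : (n₁ : ℝ) ≤ n := by exact_mod_cast hn
      nlinarith
    have h5 : (n : ℝ) * √c ≤ n * √(profNormSq σ p (region a b p) (η n)) := by gcongr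
    linarith
  have hlim1 : Filter.Tendsto (fun n => ‖η n - p.1.2‖) Filter.atTop Filter.atTop := by
    refine Filter.tendsto_atTop_mono (fun n => norm_sub_norm_le _ _) ?_
    exact Filter.tendsto_atTop_add_const_right _ _ hlim0
  have hball : ∀ n, ‖η n - p.1.2‖⁻¹ • (η n - p.1.2) ∈ Metric.closedBall (0 : E3) 1 := by
    intro n
    rw [mem_closedBall_zero_iff, norm_smul, norm_inv, norm_norm]
    exact inv_mul_le_one
  obtain ⟨ω, -, φ, hφ, hω⟩ := (isCompact_closedBall (0 : E3) 1).tendsto_subseq hball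
  obtain ⟨c, hc, hev⟩ := h.profNormSq_lower hσ hs (fun n => hηA (φ n))
    (hlim1.comp hφ.tendsto_atTop) hω
  -- Decay of order 5 matches the square root of the tenth-power lower bound on the squared norm;
  -- the factor `n` then gives the contradiction.
  obtain ⟨C, hC, hdec⟩ := gaussKernel_decay hσ hs (ξ - p.1.2) 5
  obtain ⟨n₁, hn₁⟩ := exists_nat_gt (C / √c)
  obtain ⟨n, hn, hnn⟩ := (hev.and (Filter.eventually_ge_atTop n₁)).exists
  have hc' := Real.sqrt_pos.mpr hc
  have hE0 : 0 < energy p.2 (η (φ n) - p.1.2) := energy_pos hs _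
  set E := energy p.2 (η (φ n) - p.1.2)
  have h1 : √c / E ^ 5 ≤ √(profNormSq σ p (region a b p) (η (φ n))) := by
    refine le_trans (le_of_eq ?_) (Real.sqrt_le_sqrt hn)
    rw [Real.sqrt_div hc.le, show E ^ 10 = (E ^ 5) ^ 2 by ring, Real.sqrt_sq (by positivity)]
  have h2 := hη (φ n)
  have h3 := hdec (η (φ n) - p.1.2)
  have h4 : (n₁ : ℝ) ≤ φ n := by exact_mod_cast hnn.trans (hφ.id_le n)
  have h5 : (n₁ : ℝ) * (√c / E ^ 5) ≤ C / E ^ 5 := by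
    calc (n₁ : ℝ) * (√c / E ^ 5) ≤ φ n * √(profNormSq σ p (region a b p) (η (φ n))) := by gcongr
      _ ≤ C / E ^ 5 := h2.le.trans h3
  rw [mul_div_assoc', div_le_div_iff_of_pos_right (by positivity)] at h5
  rw [div_lt_iff₀ hc'] at hn₁
  linarith

/-- The normalization of the profile functions. -/
theorem RegularRegion.lintegral_prof_sq {σ : ℝ} (hσ : 0 < σ) (hs : 0 < p.2)
    (h : RegularRegion a b p) {η : E3} (hη : η ∈ region a b p) :
    ∫⁻ ξ, ENNReal.ofReal (volDensity p.2 (ξ - p.1.2) * prof σ p (region a b p) ξ η ^ 2) = 1 := by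
  have hpos := h.profNormSq_pos hσ hs ⟨η, hη⟩ η
  have hm := measurableSet_region a b p
  -- The integration is over the center `ξ`, whereas the denominator is the norm of the Gaussian
  -- centered at `η` and does not depend on `ξ`. By symmetry of the kernel the numerator integrates
  -- to the square of this norm.
  have e : ∀ ξ, volDensity p.2 (ξ - p.1.2) * prof σ p (region a b p) ξ η ^ 2
      = (region a b p).indicator (fun ξ => (profNormSq σ p (region a b p) η)⁻¹ *
        (gaussKernel σ p.2 (η - p.1.2) (ξ - p.1.2) ^ 2 * volDensity p.2 (ξ - p.1.2))) ξ := by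
    intro ξ
    by_cases hξ : ξ ∈ region a b p
    · rw [indicator_of_mem hξ, prof, if_pos ⟨hη, hξ⟩, div_pow, Real.sq_sqrt hpos.le,
        gaussKernel_comm]
      ring
    · rw [indicator_of_notMem hξ, prof, if_neg (fun h => hξ h.2)]
      ring
  simp_rw [e]
  rw [← ofReal_integral_eq_lintegral_ofReal, integral_indicator hm, integral_const_mul]
  · rw [← profNormSq, inv_mul_cancel₀ hpos.ne', ENNReal.ofReal_one]
  · exact (((integrable_profNormSq hσ hs η).const_mul _).indicator hm)
  · refine ae_of_all _ fun ξ => indicator_nonneg (fun x _ => ?_) _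
    exact mul_nonneg (inv_nonneg.mpr hpos.le) (mul_nonneg (sq_nonneg _) (volDensity_pos hs _).le)

end Regular

theorem measurable_profNormSq {X : Type*} [MeasurableSpace X] (σ : ℝ) {p : X → Minkowski × ℝ}
    (hp : Measurable p) {A : X → Set E3} (hA : MeasurableSet {q : X × E3 | q.2 ∈ A q.1}) :
    Measurable fun q : X × E3 => profNormSq σ (p q.1) (A q.1) q.2 := by
  unfold profNormSq
  have e : ∀ q : X × E3, ∫ w in A q.1, gaussKernel σ (p q.1).2 (q.2 - (p q.1).1.2)
      (w - (p q.1).1.2) ^ 2 * volDensity (p q.1).2 (w - (p q.1).1.2)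
      = ∫ w, {r : (X × E3) × E3 | r.2 ∈ A r.1.1}.indicator (fun r =>
        gaussKernel σ (p r.1.1).2 (r.1.2 - (p r.1.1).1.2) (r.2 - (p r.1.1).1.2) ^ 2
          * volDensity (p r.1.1).2 (r.2 - (p r.1.1).1.2)) (q, w) := by
    intro q
    have hq : MeasurableSet (A q.1) := (measurable_prodMk_left (x := q.1)) hA
    rw [← integral_indicator hq]
    rfl
  simp_rw [e]
  refine (StronglyMeasurable.integral_prod_right ?_).measurable
  apply Measurable.stronglyMeasurable
  refine Measurable.indicator ?_ ?_
  · have h1 := (measurable_gaussKernel σ).comp (g := fun p : ℝ × E3 × E3 => gaussKernel σ p.1 p.2.1 p.2.2)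
      (f := fun r : (X × E3) × E3 =>
        ((p r.1.1).2, r.1.2 - (p r.1.1).1.2, r.2 - (p r.1.1).1.2)) (by fun_prop)
    have h2 := measurable_volDensity.comp
      (f := fun r : (X × E3) × E3 => ((p r.1.1).2, r.2 - (p r.1.1).1.2)) (by fun_prop)
    exact (h1.pow_const 2).mul h2
  · exact (show Measurable fun r : (X × E3) × E3 => (r.1.1, r.2) by fun_prop) hA

theorem measurable_prof {X : Type*} [MeasurableSpace X] (σ : ℝ) {p : X → Minkowski × ℝ}
    (hp : Measurable p) {A : X → Set E3} (hA : MeasurableSet {q : X × E3 | q.2 ∈ A q.1})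
    {ξ : X → E3} (hξ : Measurable ξ) :
    Measurable fun q : X × E3 => prof σ (p q.1) (A q.1) (ξ q.1) q.2 := by
  unfold prof
  refine Measurable.ite ?_ ?_ measurable_const
  · exact hA.inter ((show Measurable fun q : X × E3 => (q.1, ξ q.1) by fun_prop) hA)
  · refine Measurable.div ?_ (measurable_profNormSq σ hp hA).sqrt
    exact (measurable_gaussKernel σ).comp
      (f := fun q : X × E3 => ((p q.1).2, ξ q.1 - (p q.1).1.2, q.2 - (p q.1).1.2)) (by fun_prop)

/-! ### Cells cut out by chains of hyperboloids -/

theorem HypParam.lt_hypTime (p : HypParam) (ξ : E3) :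
    p.1.1.1 + ‖ξ - p.1.1.2‖ < hypTime p.1.1 p.1.2 ξ := by
  have := norm_lt_energy p.2 (ξ - p.1.1.2)
  unfold energy at this
  unfold hypTime
  linarith

section Cells

variable {N : ℕ}

/-- The `l`-th hyperboloid of particle `i`, as a function of the spatial coordinate. -/
def sheet (h : Fin N → ℕ → HypParam) (i : Fin N) (l : ℕ) (ξ : E3) : ℝ :=
  hypTime (h i l).1.1 (h i l).1.2 ξ

/-- The point of the `l`-th hyperboloid of particle `i` with spatial coordinate `ξ`. -/
def sheetPt (h : Fin N → ℕ → HypParam) (i : Fin N) (l : ℕ) (ξ : E3) : Minkowski :=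
  (sheet h i l ξ, ξ)

/-- Every hyperboloid is based at a point of the preceding one. -/
def IsChain (h : Fin N → ℕ → HypParam) : Prop :=
  ∀ i l, (h i (l + 1)).1.1.1 = sheet h i l (h i (l + 1)).1.1.2

/-- The abstract cell of a point `z`: for every particle the number of hyperboloids, among the first
`K j`, with `z` in their future. -/
def cellAt (h : Fin N → ℕ → HypParam) (K : Fin N → ℕ) (z : Minkowski) : Fin N → ℕ := fun j =>
  ((Finset.range (K j)).filter fun l => sheet h j l z.2 ≤ z.1).card

/-- The part of the `l`-th hyperboloid of particle `i` in the abstract cell `a`. -/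
def sheetCell (h : Fin N → ℕ → HypParam) (K : Fin N → ℕ) (i : Fin N) (l : ℕ) (a : Fin N → ℕ) :
    Set E3 := {ξ | cellAt h K (sheetPt h i l ξ) = a}

theorem mem_sheetCell {h : Fin N → ℕ → HypParam} {K : Fin N → ℕ} {i : Fin N} {l : ℕ}
    {a : Fin N → ℕ} {ξ : E3} : ξ ∈ sheetCell h K i l a ↔ cellAt h K (sheetPt h i l ξ) = a := Iff.rfl

theorem lipschitz_sheet (h : Fin N → ℕ → HypParam) (i : Fin N) (l : ℕ) :
    LipschitzWith 1 (sheet h i l) := hypTime_lipschitz _ _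

variable {h : Fin N → ℕ → HypParam} {K K' : Fin N → ℕ}

/-- The base point of the sheet lies on or above the graph of `f`, the graph stays on or below the
future light cone of that point, and the sheet lies strictly above the cone. -/
theorem lt_sheet_succ {f : E3 → ℝ} (hf : LipschitzWith 1 f) {i : Fin N}
    {l : ℕ} (hx : f (h i (l + 1)).1.1.2 ≤ (h i (l + 1)).1.1.1) (ξ : E3) :
    f ξ < sheet h i (l + 1) ξ := by
  have := (h i (l + 1)).lt_hypTime ξ
  have h2 := lipschitz_le_add hf ξ (h i (l + 1)).1.1.2
  unfold sheet
  linarith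

theorem IsChain.strictMono (hc : IsChain h) (i : Fin N) (ξ : E3) :
    StrictMono fun l => sheet h i l ξ :=
  strictMono_nat_of_lt_succ fun l =>
    lt_sheet_succ (lipschitz_sheet h i l) (hc i l).ge ξ

/-- The sheets of one particle are strictly ordered in time, so the sheets with `z` in their future
form an initial segment, which is determined by its cardinality. -/
theorem IsChain.lt_cellAt_iff (hc : IsChain h) {z : Minkowski} {j : Fin N} {l : ℕ} :
    l < cellAt h K z j ↔ l < K j ∧ sheet h j l z.2 ≤ z.1 := by
  classical
  set S := (Finset.range (K j)).filter fun l => sheet h j l z.2 ≤ z.1 with hS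
  have hdown : ∀ l ∈ S, ∀ l' < l, l' ∈ S := by
    intro l hl l' hl'
    rw [hS, Finset.mem_filter, Finset.mem_range] at hl ⊢
    exact ⟨by omega, ((hc.strictMono j z.2) hl').le.trans hl.2⟩
  have hmem : l ∈ S ↔ l < K j ∧ sheet h j l z.2 ≤ z.1 := by
    rw [hS, Finset.mem_filter, Finset.mem_range]
  rw [← hmem]
  change l < S.card ↔ l ∈ S
  constructor
  · intro hl
    by_contra hn
    have : S ⊆ Finset.range l := fun l' hl' => by
      rw [Finset.mem_range]
      by_contra hge
      rcases (not_lt.mp hge).eq_or_lt with h | h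
      · exact hn (h ▸ hl')
      · exact hn (hdown l' hl' l h)
    have := Finset.card_le_card this
    rw [Finset.card_range] at this
    omega
  · intro hl
    have : Finset.range (l + 1) ⊆ S := fun l' hl' => by
      rw [Finset.mem_range] at hl'
      rcases (Nat.lt_succ_iff.mp hl').eq_or_lt with h | h
      · exact h ▸ hl
      · exact hdown l hl l' h
    have := Finset.card_le_card this
    rw [Finset.card_range] at this
    omega

theorem cellAt_le (h : Fin N → ℕ → HypParam) (K : Fin N → ℕ) (z : Minkowski) :
    cellAt h K z ≤ K := fun j => by
  have := Finset.card_filter_le (Finset.range (K j)) fun l => sheet h j l z.2 ≤ z.1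
  rwa [Finset.card_range] at this

theorem cellAt_mono (hK : K ≤ K') (z : Minkowski) : cellAt h K z ≤ cellAt h K' z := fun j =>
  Finset.card_le_card (Finset.filter_subset_filter _ (Finset.range_mono (hK j)))

theorem cellAt_mono_future {z z' : Minkowski} (hz : z.1 + ‖z'.2 - z.2‖ ≤ z'.1) :
    cellAt h K z ≤ cellAt h K z' := fun j => by
  refine Finset.card_le_card fun l hl => ?_
  rw [Finset.mem_filter] at hl ⊢
  refine ⟨hl.1, ?_⟩
  linarith [lipschitz_le_add (lipschitz_sheet h j l) z'.2 z.2, hl.2]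

theorem IsChain.cellAt_sheetPt (hc : IsChain h) {i : Fin N} {l : ℕ} (hl : l < K i) (ξ : E3) :
    cellAt h K (sheetPt h i l ξ) i = l + 1 := by
  apply le_antisymm
  · by_contra! hlt
    have := (hc.lt_cellAt_iff.mp hlt).2
    exact absurd ((hc.strictMono i ξ) (Nat.lt_succ_self l)) (not_lt.mpr this)
  · exact Nat.succ_le_of_lt (hc.lt_cellAt_iff.mpr ⟨hl, le_rfl⟩)

theorem IsChain.flash_eq (hc : IsChain h) (i : Fin N) (l : ℕ) :
    (h i (l + 1)).1.1 = sheetPt h i l (h i (l + 1)).1.1.2 := Prod.ext (hc i l) rfl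

/-- The cells in the past of a predecessor complete set of cells are the region below a common
spacelike surface, which contains the 3-cells crossed next. -/
theorem IsChain.exists_surface (hc : IsChain h) {V : Set (Fin N → ℕ)}
    (hV : ∀ b ∈ V, ∀ c ≤ b, c ∈ V) {a : Fin N → ℕ} (ha : ∀ c ≤ a, c ≠ a → c ∈ V) (haV : a ∉ V)
    (h0 : V.Nonempty) (hK : K ∉ V) :
    ∃ f : E3 → ℝ, LipschitzWith 1 f ∧ (∀ z : Minkowski, cellAt h K z ∈ V ↔ z.1 < f z.2) ∧
      ∀ (j : Fin N) (l : ℕ), l < K j → ∀ ξ ∈ sheetCell h K j l a, sheet h j l ξ = f ξ := by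
  -- The surface is the lower boundary of the points whose cell is not in `V`. Their set is closed
  -- under passing to the causal future because `V` is downward closed, which makes its lower
  -- boundary 1-Lipschitz.
  let T : E3 → Set ℝ := fun ξ => {t | cellAt h K (t, ξ) ∉ V}
  have h0V : (0 : Fin N → ℕ) ∈ V := by
    obtain ⟨b, hb⟩ := h0
    exact hV b hb 0 (fun j => Nat.zero_le _)
  have hup : ∀ {z z' : Minkowski}, z.1 + ‖z'.2 - z.2‖ ≤ z'.1 → cellAt h K z ∉ V →
      cellAt h K z' ∉ V := fun hz h1 h2 => h1 (hV _ h2 _ (cellAt_mono_future hz))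
  have hne : ∀ ξ, (T ξ).Nonempty := by
    intro ξ
    obtain ⟨t, ht⟩ := (Finset.univ.biUnion fun j =>
      (Finset.range (K j)).image fun l => sheet h j l ξ).bddAbove
    refine ⟨t, ?_⟩
    have : cellAt h K (t, ξ) = K := by
      refine le_antisymm (cellAt_le _ _ _) fun j => ?_
      by_contra! hlt
      refine lt_irrefl _ (hc.lt_cellAt_iff.mpr ⟨hlt, ?_⟩)
      refine ht ?_
      simp only [Finset.coe_biUnion, Finset.coe_image, Finset.coe_range, mem_iUnion, mem_image]
      exact ⟨j, Finset.mem_coe.mpr (Finset.mem_univ j), _, hlt, rfl⟩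
    change cellAt h K (t, ξ) ∉ V
    rwa [this]
  have hbdd : ∀ ξ, BddBelow (T ξ) := by
    intro ξ
    obtain ⟨t, ht⟩ := (Finset.univ.biUnion fun j =>
      (Finset.range (K j)).image fun l => sheet h j l ξ).bddBelow
    refine ⟨t, fun t' ht' => ?_⟩
    by_contra! hlt
    refine ht' ?_
    have : cellAt h K (t', ξ) = 0 := by
      funext j
      rw [Pi.zero_apply, ← Nat.le_zero]
      by_contra! hpos
      obtain ⟨h1, h2⟩ := hc.lt_cellAt_iff.mp hpos
      have : t ≤ sheet h j 0 ξ := by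
        refine ht ?_
        simp only [Finset.coe_biUnion, Finset.coe_image, Finset.coe_range, mem_iUnion, mem_image]
        exact ⟨j, Finset.mem_coe.mpr (Finset.mem_univ j), _, h1, rfl⟩
      exact absurd (this.trans h2) (not_le.mpr hlt)
    rwa [this]
  have hclosed : ∀ ξ, IsClosed (T ξ) := by
    intro ξ
    -- Since `V` is downward closed, lying outside `V` means dominating one of the finitely many
    -- cells `c ≤ K` outside `V`, and each such condition on `t` is closed.
    have : T ξ = ⋃ c ∈ {c | c ≤ K ∧ c ∉ V}, {t : ℝ | ∀ j, c j ≤ cellAt h K (t, ξ) j} := by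
      ext t
      simp only [mem_iUnion, mem_ofPred_eq, exists_prop, T]
      constructor
      · exact fun ht => ⟨_, ⟨cellAt_le _ _ _, ht⟩, fun j => le_rfl⟩
      · rintro ⟨c, ⟨-, hcV⟩, hcle⟩ ht
        exact hcV (hV _ ht _ hcle)
    rw [this]
    refine Set.Finite.isClosed_biUnion ((Set.finite_Iic K).subset fun c hc => hc.1) fun c _ => ?_
    rw [ofPred_forall]
    refine isClosed_iInter fun j => ?_
    rcases Nat.eq_zero_or_pos (c j) with h0 | h0
    · simp [h0]
    · obtain ⟨l, hl⟩ := Nat.exists_eq_succ_of_ne_zero h0.ne'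
      have : {t : ℝ | c j ≤ cellAt h K (t, ξ) j} = {t | l < K j ∧ sheet h j l ξ ≤ t} := by
        ext t
        rw [mem_ofPred_eq, hl, Nat.succ_le_iff, hc.lt_cellAt_iff]
        rfl
      rw [this]
      by_cases hlK : l < K j
      · simp only [hlK, true_and]
        exact isClosed_Ici
      · simp [hlK]
  let f : E3 → ℝ := fun ξ => sInf (T ξ)
  have hf : ∀ z : Minkowski, cellAt h K z ∉ V ↔ f z.2 ≤ z.1 := by
    intro z
    refine ⟨fun hz => csInf_le (hbdd _) hz, fun hz => ?_⟩
    have h1 : cellAt h K (f z.2, z.2) ∉ V := (hclosed z.2).csInf_mem (hne _) (hbdd _)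
    exact hup (by simpa using hz) h1
  refine ⟨f, ?_, ?_, ?_⟩
  · apply lipschitz_of_le_add
    intro ξ η
    have h1 : cellAt h K (f η, η) ∉ V := (hf (f η, η)).mpr le_rfl
    exact (hf (f η + ‖ξ - η‖, ξ)).mp (hup (z := (f η, η)) le_rfl h1)
  · intro z
    rw [← not_le, ← hf, not_not]
  · intro j l hl ξ hξ
    have hle : f ξ ≤ sheet h j l ξ := by
      refine (hf (sheetPt h j l ξ)).mp ?_
      rwa [mem_sheetCell.mp hξ]
    refine le_antisymm ?_ hle
    -- If the surface were strictly below the sheet at a point of the cell `a`, the cell of the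
    -- surface point would be at most `a` and would not count the sheet `l`. So it would be a proper
    -- lower cell, hence in `V`, although surface points have cells outside `V`.
    by_contra! hlt
    have h1 : cellAt h K (f ξ, ξ) ∉ V := (hf (f ξ, ξ)).mpr le_rfl
    refine h1 (ha _ ?_ ?_)
    · rw [← mem_sheetCell.mp hξ]
      refine cellAt_mono_future ?_
      simp only [sheetPt, sub_self, norm_zero, add_zero]
      exact hle
    · intro heq
      have h2 : l < cellAt h K (f ξ, ξ) j := by
        rw [heq, ← mem_sheetCell.mp hξ, hc.cellAt_sheetPt hl]
        omega
      exact absurd (hc.lt_cellAt_iff.mp h2).2 (not_le.mpr hlt)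

/-! ### Configurations of realized flashes -/

/-- The numbers of hyperboloids that are determined if `κ i` flashes of particle `i` are given. -/
def known (n κ : Fin N → ℕ) : Fin N → ℕ := fun i => min (κ i + 1) (n i)

/-- The configuration with one more flash of particle `i`. -/
def bump (κ : Fin N → ℕ) (i : Fin N) : Fin N → ℕ := Function.update κ i (κ i + 1)

variable {n κ : Fin N → ℕ}

theorem lt_known {i : Fin N} (hi : κ i < n i) : κ i < known n κ i := by
  unfold known; omega

theorem known_le : known n κ ≤ n := fun _ => min_le_right _ _

theorem known_self : known n n = n := funext fun i => by unfold known; omega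

theorem known_mono {κ' : Fin N → ℕ} (h : κ ≤ κ') : known n κ ≤ known n κ' := fun i => by
  exact min_le_min (Nat.succ_le_succ (h i)) le_rfl

@[simp]
theorem bump_self (κ : Fin N → ℕ) (i : Fin N) : bump κ i i = κ i + 1 := by simp [bump]

theorem bump_of_ne (κ : Fin N → ℕ) {i j : Fin N} (h : j ≠ i) : bump κ i j = κ j := by
  simp [bump, h]

theorem le_bump (κ : Fin N → ℕ) (i : Fin N) : κ ≤ bump κ i := fun j => by
  by_cases h : j = i
  · subst h; simp
  · rw [bump_of_ne κ h]

theorem bump_le {i : Fin N} (h : κ ≤ n) (hi : κ i < n i) : bump κ i ≤ n := fun j => by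
  by_cases h' : j = i
  · subst h'; simpa using hi
  · rw [bump_of_ne κ h']; exact h j

theorem known_bump_of_ne {i j : Fin N} (h : j ≠ i) : known n (bump κ i) j = known n κ j := by
  unfold known; rw [bump_of_ne κ h]

theorem cellAt_known_bump {i : Fin N} {z : Minkowski}
    (h2 : κ i + 1 < n i → z.1 < sheet h i (κ i + 1) z.2) :
    cellAt h (known n (bump κ i)) z = cellAt h (known n κ) z := by
  funext j
  by_cases hj : j = i
  · subst hj
    unfold cellAt
    rcases lt_or_ge (κ j + 1) (n j) with hlt | hge
    · have e1 : known n (bump κ j) j = (κ j + 1) + 1 := by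
        unfold known; rw [bump_self]; omega
      have e2 : known n κ j = κ j + 1 := by unfold known; omega
      rw [e1, e2, Finset.range_add_one, Finset.filter_insert, if_neg (not_le.mpr (h2 hlt))]
    · have : known n (bump κ j) j = known n κ j := by
        unfold known; rw [bump_self]; omega
      rw [this]
  · unfold cellAt
    rw [known_bump_of_ne hj]

theorem cellAt_flash_le {i : Fin N} {z : Minkowski} (hz : sheet h i (κ i + 1) z.2 ≤ z.1) :
    cellAt h K (h i (κ i + 1)).1.1 ≤ cellAt h K z := by
  refine cellAt_mono_future ?_
  have := (h i (κ i + 1)).lt_hypTime z.2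
  unfold sheet at hz
  linarith

/-- Realizing the next flash of particle `i`, in the cell `a`, does not change the 3-cells that have
already been crossed. -/
theorem IsChain.sheetCell_bump (hc : IsChain h) {i : Fin N} {a : Fin N → ℕ}
    (hx : cellAt h (known n κ) (h i (κ i + 1)).1.1 = a) {j : Fin N} {l : ℕ} {b : Fin N → ℕ}
    (hb : a ≤ b → b = a) (hl : l + 1 = b j) :
    sheetCell h (known n (bump κ i)) j l b = sheetCell h (known n κ) j l b := by
  have key : ∀ ξ, cellAt h (known n κ) (sheetPt h j l ξ) ≤ b →
      cellAt h (known n (bump κ i)) (sheetPt h j l ξ)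
        = cellAt h (known n κ) (sheetPt h j l ξ) := by
    intro ξ hb1
    refine cellAt_known_bump fun _ => ?_
    -- A point above the new sheet is in the future of the flash, so `a ≤ b` and hence `b = a`. But
    -- then the flash lies on or above the sheet `l`, and the new sheet lies strictly above it.
    by_contra! hz
    have h1 := hx ▸ cellAt_flash_le (K := known n κ) hz
    have hba := hb (h1.trans hb1)
    have h2 : l < cellAt h (known n κ) (h i (κ i + 1)).1.1 j := by rw [hx, ← hba]; omega
    have h3 := lt_sheet_succ (lipschitz_sheet h j l) (hc.lt_cellAt_iff.mp h2).2 ξ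
    exact absurd hz (not_le.mpr h3)
  have hmono : ∀ z, cellAt h (known n κ) z ≤ cellAt h (known n (bump κ i)) z :=
    cellAt_mono (known_mono (le_bump κ i))
  ext ξ
  constructor
  · intro hξ
    have := key ξ ((hmono _).trans (mem_sheetCell.mp hξ).le)
    exact mem_sheetCell.mpr (this.symm.trans (mem_sheetCell.mp hξ))
  · intro hξ
    have := key ξ (mem_sheetCell.mp hξ).le
    exact mem_sheetCell.mpr (this.trans (mem_sheetCell.mp hξ))

/-- The cells of the new hyperboloid have not been crossed. -/
theorem IsChain.sheetCell_bump_self (hc : IsChain h) {i : Fin N} {a : Fin N → ℕ} (hi : κ i < n i)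
    (hx : cellAt h (known n κ) (h i (κ i + 1)).1.1 = a) (hlt : κ i + 1 < n i) {b : Fin N → ℕ}
    (hb : a ≤ b → b = a) :
    sheetCell h (known n (bump κ i)) i (κ i + 1) b = ∅ := by
  rw [Set.eq_empty_iff_forall_notMem]
  intro ξ hξ
  have h1 := hx ▸ cellAt_flash_le (K := known n κ) (z := sheetPt h i (κ i + 1) ξ) le_rfl
  have h2 : cellAt h (known n κ) (sheetPt h i (κ i + 1) ξ) ≤ b :=
    (cellAt_mono (known_mono (le_bump κ i)) _).trans (mem_sheetCell.mp hξ).le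
  have h3 := hb (h1.trans h2)
  have h4 : b i = κ i + 1 + 1 := by
    rw [← mem_sheetCell.mp hξ]
    apply hc.cellAt_sheetPt
    unfold known; rw [bump_self]; omega
  have h5 : a i = κ i + 1 := by
    rw [← hx, hc.flash_eq]
    exact hc.cellAt_sheetPt (lt_known hi) _
  rw [h3, h5] at h4
  omega

end Cells

section Crossing

variable {N : ℕ} {h h' : Fin N → ℕ → HypParam} {K n κ : Fin N → ℕ}

/-! ### Measurability of the cells -/

@[fun_prop]
theorem measurable_cellAt (K : Fin N → ℕ) {X : Type*} [MeasurableSpace X]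
    {h : X → Fin N → ℕ → HypParam} (hh : ∀ i l, Measurable fun x => h x i l) {z : X → Minkowski}
    (hz : Measurable z) : Measurable fun x => cellAt (h x) K (z x) := by
  rw [measurable_pi_iff]
  intro j
  simp only [cellAt, Finset.card_filter]
  refine Finset.measurable_fun_sum _ fun l _ => ?_
  refine Measurable.ite (measurableSet_le ?_ hz.fst) measurable_const measurable_const
  exact continuous_hypTime.measurable.comp
    (f := fun x => ((h x j l).1, (z x).2)) ((hh j l).subtype_val.prodMk hz.snd)

theorem measurable_sheetPt (i : Fin N) (l : ℕ) {X : Type*} [MeasurableSpace X]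
    {h : X → Fin N → ℕ → HypParam} (hh : ∀ i l, Measurable fun x => h x i l) {ξ : X → E3}
    (hξ : Measurable ξ) : Measurable fun x => sheetPt (h x) i l (ξ x) := by
  refine Measurable.prodMk ?_ hξ
  exact continuous_hypTime.measurable.comp
    (f := fun x => ((h x i l).1, ξ x)) ((hh i l).subtype_val.prodMk hξ)

/-- The part of the `l`-th hyperboloid of particle `i` in the cells `a` with `(a, i) ∈ D`. -/
def doneRegion (h : Fin N → ℕ → HypParam) (K : Fin N → ℕ) (D : Set ((Fin N → ℕ) × Fin N))
    (i : Fin N) (l : ℕ) : Set E3 := {ξ | (cellAt h K (sheetPt h i l ξ), i) ∈ D}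

theorem measurableSet_setOf_doneRegion (K : Fin N → ℕ) {X : Type*} [MeasurableSpace X]
    {h : X → Fin N → ℕ → HypParam} (hh : ∀ i l, Measurable fun x => h x i l)
    (D : Set ((Fin N → ℕ) × Fin N)) (i : Fin N) (l : ℕ) :
    MeasurableSet {q : X × E3 | q.2 ∈ doneRegion (h q.1) K D i l} := by
  have h1 : Measurable fun q : X × E3 => cellAt (h q.1) K (sheetPt (h q.1) i l q.2) :=
    measurable_cellAt K (h := fun q : X × E3 => h q.1) (fun i l => (hh i l).comp measurable_fst)
      (measurable_sheetPt i l (h := fun q : X × E3 => h q.1)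
        (fun i l => (hh i l).comp measurable_fst) measurable_snd)
  exact h1 (MeasurableSet.of_discrete (s := {b | (b, i) ∈ D}))

theorem measurableSet_setOf_sheetCell (K : Fin N → ℕ) {X : Type*} [MeasurableSpace X]
    {h : X → Fin N → ℕ → HypParam} (hh : ∀ i l, Measurable fun x => h x i l)
    (i : Fin N) (l : ℕ) (a : Fin N → ℕ) :
    MeasurableSet {q : X × E3 | q.2 ∈ sheetCell (h q.1) K i l a} := by
  convert measurableSet_setOf_doneRegion K hh {(a, i)} i l using 3
  simp [doneRegion, sheetCell]

theorem measurableSet_doneRegion (h : Fin N → ℕ → HypParam) (K : Fin N → ℕ)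
    (D : Set ((Fin N → ℕ) × Fin N)) (i : Fin N) (l : ℕ) : MeasurableSet (doneRegion h K D i l) :=
  (measurable_prodMk_left (x := ())) (measurableSet_setOf_doneRegion K
    (h := fun _ : Unit => h) (fun _ _ => measurable_const) D i l)

theorem measurableSet_sheetCell (h : Fin N → ℕ → HypParam) (K : Fin N → ℕ) (i : Fin N) (l : ℕ)
    (a : Fin N → ℕ) : MeasurableSet (sheetCell h K i l a) :=
  (measurable_prodMk_left (x := ())) (measurableSet_setOf_sheetCell K
    (h := fun _ : Unit => h) (fun _ _ => measurable_const) i l a)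

theorem doneRegion_insert (h : Fin N → ℕ → HypParam) (K : Fin N → ℕ)
    (D : Set ((Fin N → ℕ) × Fin N)) (a : Fin N → ℕ) (i : Fin N) (l : ℕ) :
    doneRegion h K (insert (a, i) D) i l = doneRegion h K D i l ∪ sheetCell h K i l a := by
  ext ξ
  simp [doneRegion, sheetCell, or_comm]

theorem doneRegion_insert_of_ne (h : Fin N → ℕ → HypParam) (K : Fin N → ℕ)
    (D : Set ((Fin N → ℕ) × Fin N)) (a : Fin N → ℕ) {i j : Fin N} (hj : j ≠ i) (l : ℕ) :
    doneRegion h K (insert (a, i) D) j l = doneRegion h K D j l := by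
  ext ξ
  simp [doneRegion, hj]

/-! ### Only the first hyperboloids matter -/

/-- Two families of hyperboloids agree up to `K`. -/
def AgreeBelow (K : Fin N → ℕ) (h h' : Fin N → ℕ → HypParam) : Prop :=
  ∀ j, ∀ l < K j, h j l = h' j l

theorem AgreeBelow.cellAt_eq (H : AgreeBelow K h h') (z : Minkowski) :
    cellAt h K z = cellAt h' K z := by
  funext j
  unfold cellAt
  congr 1
  refine Finset.filter_congr fun l hl => ?_
  rw [sheet, sheet, H j l (Finset.mem_range.mp hl)]

theorem AgreeBelow.sheetPt_eq (H : AgreeBelow K h h') {i : Fin N} {l : ℕ} (hl : l < K i) (ξ : E3) :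
    sheetPt h i l ξ = sheetPt h' i l ξ := by
  rw [sheetPt, sheetPt, sheet, sheet, H i l hl]

theorem AgreeBelow.doneRegion_eq (H : AgreeBelow K h h') (D : Set ((Fin N → ℕ) × Fin N))
    {i : Fin N} {l : ℕ} (hl : l < K i) : doneRegion h K D i l = doneRegion h' K D i l := by
  ext ξ
  simp only [doneRegion, mem_ofPred_eq, H.cellAt_eq, H.sheetPt_eq hl]

theorem AgreeBelow.sheetCell_eq (H : AgreeBelow K h h') (a : Fin N → ℕ)
    {i : Fin N} {l : ℕ} (hl : l < K i) : sheetCell h K i l a = sheetCell h' K i l a := by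
  ext ξ
  simp only [sheetCell, mem_ofPred_eq, H.cellAt_eq, H.sheetPt_eq hl]

/-! ### 3-cells as regions -/

/-- The 3-cell `a` on the `l`-th hyperboloid of particle `i` is a regular region. -/
def CellRegular (h : Fin N → ℕ → HypParam) (K : Fin N → ℕ) (i : Fin N) (l : ℕ)
    (a : Fin N → ℕ) : Prop :=
  RegularRegion (fun j : {j // j ≠ i ∧ 1 ≤ a j ∧ a j - 1 < K j} => (h j (a j - 1)).1)
    (fun j : {j // j ≠ i ∧ a j < K j} => (h j (a j)).1) (h i l).1

theorem AgreeBelow.cellRegular_iff (H : AgreeBelow K h h') (a : Fin N → ℕ)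
    {i : Fin N} {l : ℕ} (hl : l < K i) : CellRegular h K i l a ↔ CellRegular h' K i l a := by
  have e1 : (fun j : {j // j ≠ i ∧ 1 ≤ a j ∧ a j - 1 < K j} => (h j (a j - 1)).1)
      = fun j : {j // j ≠ i ∧ 1 ≤ a j ∧ a j - 1 < K j} => (h' j (a j - 1)).1 :=
    funext fun j => by rw [H j _ j.2.2.2]
  have e2 : (fun j : {j // j ≠ i ∧ a j < K j} => (h j (a j)).1)
      = fun j : {j // j ≠ i ∧ a j < K j} => (h' j (a j)).1 :=
    funext fun j => by rw [H j _ j.2.2]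
  unfold CellRegular
  rw [e1, e2, H i l hl]

theorem IsChain.sheetCell_eq_region (hc : IsChain h) {i : Fin N} {l : ℕ} (hl : l < K i)
    {a : Fin N → ℕ} (ha : a ≤ K) (hai : a i = l + 1) :
    sheetCell h K i l a =
      region (fun j : {j // j ≠ i ∧ 1 ≤ a j ∧ a j - 1 < K j} => (h j (a j - 1)).1)
        (fun j : {j // j ≠ i ∧ a j < K j} => (h j (a j)).1) (h i l).1 := by
  ext ξ
  rw [mem_sheetCell, mem_region]
  constructor
  · intro hξ
    refine ⟨fun ⟨j, _, h1, _⟩ => ?_, fun ⟨j, _, h1⟩ => ?_⟩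
    · have : a j - 1 < cellAt h K (sheetPt h i l ξ) j := by rw [hξ]; omega
      exact (hc.lt_cellAt_iff.mp this).2
    · by_contra hle
      have : a j < cellAt h K (sheetPt h i l ξ) j := hc.lt_cellAt_iff.mpr ⟨h1, not_lt.mp hle⟩
      rw [hξ] at this
      exact lt_irrefl _ this
  · rintro ⟨h1, h2⟩
    funext j
    by_cases hj : j = i
    · subst hj; rw [hc.cellAt_sheetPt hl, hai]
    apply le_antisymm
    · by_contra! hlt
      obtain ⟨h3, h4⟩ := hc.lt_cellAt_iff.mp hlt
      exact absurd (h2 ⟨j, hj, h3⟩) (not_lt.mpr h4)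
    · rcases Nat.eq_zero_or_pos (a j) with h0 | h0
      · omega
      · have hlt : a j - 1 < K j := by have : a j ≤ K j := ha j; omega
        have : a j - 1 < cellAt h K (sheetPt h i l ξ) j :=
          hc.lt_cellAt_iff.mpr ⟨hlt, h1 ⟨j, hj, h0, hlt⟩⟩
        omega

theorem IsChain.of_mem_sheetCell (hc : IsChain h) {i : Fin N} {l : ℕ} (hl : l < K i)
    {a : Fin N → ℕ} {ξ : E3} (hξ : ξ ∈ sheetCell h K i l a) : a ≤ K ∧ a i = l + 1 := by
  rw [mem_sheetCell] at hξ
  exact ⟨hξ ▸ cellAt_le _ _ _, by rw [← hξ, hc.cellAt_sheetPt hl]⟩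

theorem measurableSet_setOf_cellRegular (K : Fin N → ℕ) {X : Type*} [MeasurableSpace X]
    {h : X → Fin N → ℕ → HypParam} (hh : ∀ i l, Measurable fun x => h x i l)
    (i : Fin N) (l : ℕ) (a : Fin N → ℕ) : MeasurableSet {x | CellRegular (h x) K i l a} := by
  refine (Measurable.prodMk ?_ (Measurable.prodMk ?_ (hh i l).subtype_val))
    measurableSet_regularRegion
  · exact measurable_pi_lambda _ fun j => (hh _ _).subtype_val
  · exact measurable_pi_lambda _ fun j => (hh _ _).subtype_val

/-! ### The collapse operators -/

open Classical in
/-- The profile function of a flash at `ξ` on the 3-cell `a` of the `l`-th hyperboloid of particle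
`i`, replaced by `0` if the cell is not regular. -/
def cellProf (σ : ℝ) (h : Fin N → ℕ → HypParam) (K : Fin N → ℕ) (i : Fin N) (l : ℕ)
    (a : Fin N → ℕ) (ξ η : E3) : ℝ :=
  if CellRegular h K i l a then prof σ (h i l).1 (sheetCell h K i l a) ξ η else 0

theorem AgreeBelow.cellProf_eq (H : AgreeBelow K h h') (σ : ℝ) (a : Fin N → ℕ)
    {i : Fin N} {l : ℕ} (hl : l < K i) : cellProf σ h K i l a = cellProf σ h' K i l a := by
  funext ξ η
  unfold cellProf
  rw [H.sheetCell_eq a hl, H i l hl]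
  by_cases hr : CellRegular h K i l a
  · rw [if_pos hr, if_pos ((H.cellRegular_iff a hl).mp hr)]
  · rw [if_neg hr, if_neg fun hn => hr ((H.cellRegular_iff a hl).mpr hn)]

theorem cellProf_nonneg (σ : ℝ) (h : Fin N → ℕ → HypParam) (K : Fin N → ℕ) (i : Fin N) (l : ℕ)
    (a : Fin N → ℕ) (ξ η : E3) : 0 ≤ cellProf σ h K i l a ξ η := by
  unfold cellProf; split_ifs
  · exact prof_nonneg ..
  · exact le_rfl

theorem IsChain.exists_cellProf_le (hc : IsChain h) {σ : ℝ} (hσ : 0 < σ) {i : Fin N} {l : ℕ}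
    (hl : l < K i) (a : Fin N → ℕ) (ξ : E3) : ∃ c, ∀ η, cellProf σ h K i l a ξ η ≤ c := by
  by_cases hr : CellRegular h K i l a
  · simp only [cellProf, if_pos hr]
    rcases (sheetCell h K i l a).eq_empty_or_nonempty with he | ⟨η, hη⟩
    · exact ⟨0, fun η => by simp [he, prof]⟩
    · obtain ⟨h1, h2⟩ := hc.of_mem_sheetCell hl hη
      rw [hc.sheetCell_eq_region hl h1 h2]
      exact RegularRegion.exists_prof_le hσ (h i l).2 hr ξ
  · simp only [cellProf, if_neg hr]
    exact ⟨0, fun η => le_rfl⟩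

theorem cellProf_eq_zero (σ : ℝ) (h : Fin N → ℕ → HypParam) (K : Fin N → ℕ) (i : Fin N) (l : ℕ)
    (a : Fin N → ℕ) {ξ η : E3} (hξ : ¬ (η ∈ sheetCell h K i l a ∧ ξ ∈ sheetCell h K i l a)) :
    cellProf σ h K i l a ξ η = 0 := by
  unfold cellProf prof; split_ifs
  · rfl
  · rfl

theorem measurable_cellProf (σ : ℝ) (K : Fin N → ℕ) {X : Type*} [MeasurableSpace X]
    {h : X → Fin N → ℕ → HypParam} (hh : ∀ i l, Measurable fun x => h x i l)
    (i : Fin N) (l : ℕ) (a : Fin N → ℕ) {ξ : X → E3} (hξ : Measurable ξ) :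
    Measurable fun q : X × E3 => cellProf σ (h q.1) K i l a (ξ q.1) q.2 := by
  unfold cellProf
  refine Measurable.ite ?_ ?_ measurable_const
  · exact measurable_fst (measurableSet_setOf_cellRegular K hh i l a)
  · exact measurable_prof σ (A := fun x => sheetCell (h x) K i l a) (hh i l).subtype_val
      (measurableSet_setOf_sheetCell K hh i l a) hξ

/-- The normalization of the profile functions of a 3-cell. -/
theorem IsChain.lintegral_cellProf_sq (hc : IsChain h) {σ : ℝ} (hσ : 0 < σ) {i : Fin N} {l : ℕ}
    (hl : l < K i) {a : Fin N → ℕ} (hr : CellRegular h K i l a) {η : E3} :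
    ∫⁻ ξ, ENNReal.ofReal (volDensity (h i l).1.2 (ξ - (h i l).1.1.2) *
      cellProf σ h K i l a ξ η ^ 2) = (sheetCell h K i l a).indicator 1 η := by
  by_cases hη : η ∈ sheetCell h K i l a
  · rw [indicator_of_mem hη]
    simp only [cellProf, if_pos hr]
    obtain ⟨h1, h2⟩ := hc.of_mem_sheetCell hl hη
    rw [hc.sheetCell_eq_region hl h1 h2] at hη ⊢
    exact RegularRegion.lintegral_prof_sq hσ (h i l).2 hr hη
  · rw [indicator_of_notMem hη]
    have : ∀ ξ, cellProf σ h K i l a ξ η = 0 := fun ξ => cellProf_eq_zero _ _ _ _ _ _ (fun h => hη h.1)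
    simp [this]

variable {H : Type*} [NormedAddCommGroup H] [InnerProductSpace ℂ H] [CompleteSpace H]
  (F : LocalFamily N H)

/-- The collapse operator of a flash at `ξ` on the 3-cell `a` of the `l`-th hyperboloid of particle
`i`. -/
def collapse (σ : ℝ) (h : Fin N → ℕ → HypParam) (K : Fin N → ℕ) (i : Fin N) (l : ℕ)
    (a : Fin N → ℕ) (ξ : E3) : H →L[ℂ] H :=
  (F.hyp (h i l) i).multOp (cellProf σ h K i l a ξ)

theorem AgreeBelow.collapse_eq (A : AgreeBelow K h h') (σ : ℝ) (a : Fin N → ℕ)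
    {i : Fin N} {l : ℕ} (hl : l < K i) (ξ : E3) :
    collapse F σ h K i l a ξ = collapse F σ h' K i l a ξ := by
  unfold collapse
  rw [A.cellProf_eq σ a hl, A i l hl]

theorem measurable_cellProf_right (σ : ℝ) (h : Fin N → ℕ → HypParam) (K : Fin N → ℕ) (i : Fin N)
    (l : ℕ) (a : Fin N → ℕ) (ξ : E3) : Measurable (cellProf σ h K i l a ξ) := by
  have h1 : Measurable fun q : E3 × E3 => cellProf σ h K i l a q.1 q.2 :=
    measurable_cellProf σ K (X := E3) (h := fun _ => h) (fun _ _ => measurable_const) i l a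
      (ξ := fun x => x) measurable_id
  exact Measurable.of_uncurry_left (f := cellProf σ h K i l a) h1

theorem stronglyMeasurable_collapse {σ : ℝ} (hσ : 0 < σ) {X : Type*} [MeasurableSpace X]
    {h : X → Fin N → ℕ → HypParam} (hh : ∀ i l, Measurable fun x => h x i l)
    (hc : ∀ x, IsChain (h x)) {i : Fin N} {l : ℕ} (hl : l < K i) (a : Fin N → ℕ) {ξ : X → E3}
    (hξ : Measurable ξ) (φ : H) :
    StronglyMeasurable fun x => collapse F σ (h x) K i l a (ξ x) φ :=
  F.stronglyMeasurable_multOp i (hh i l)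
    (f := fun x => cellProf σ (h x) K i l a (ξ x)) (measurable_cellProf σ K hh i l a hξ)
    (fun _ _ => cellProf_nonneg ..) (fun x => (hc x).exists_cellProf_le hσ hl a (ξ x)) φ

/-- The total weight of the collapses on a regular 3-cell is the probability of the cell. -/
theorem IsChain.lintegral_collapse (hc : IsChain h) {σ : ℝ} (hσ : 0 < σ) {i : Fin N} {l : ℕ}
    (hl : l < K i) {a : Fin N → ℕ} (hr : CellRegular h K i l a) (φ : H) :
    ∫⁻ ξ, ENNReal.ofReal (volDensity (h i l).1.2 (ξ - (h i l).1.1.2)) *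
      ENNReal.ofReal (‖collapse F σ h K i l a ξ φ‖ ^ 2)
      = ENNReal.ofReal (‖(F.hyp (h i l) i).toFun (sheetCell h K i l a) φ‖ ^ 2) := by
  set μ := (F.hyp (h i l) i).measure φ
  have hpos : ∀ ξ, 0 ≤ volDensity (h i l).1.2 (ξ - (h i l).1.1.2) :=
    fun ξ => (volDensity_pos (h i l).2 _).le
  have h1 : ∀ ξ, ENNReal.ofReal (volDensity (h i l).1.2 (ξ - (h i l).1.1.2)) *
      ENNReal.ofReal (‖collapse F σ h K i l a ξ φ‖ ^ 2)
      = ∫⁻ η, ENNReal.ofReal (volDensity (h i l).1.2 (ξ - (h i l).1.1.2) *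
        cellProf σ h K i l a ξ η ^ 2) ∂μ := by
    intro ξ
    obtain ⟨c, hb⟩ := hc.exists_cellProf_le hσ hl a ξ
    have hm := measurable_cellProf_right σ h K i l a ξ
    rw [collapse, PVM.norm_multOp_sq _ hm (cellProf_nonneg σ h K i l a ξ) hb,
      ofReal_integral_eq_lintegral_ofReal, ← lintegral_const_mul _ (by fun_prop)]
    · exact lintegral_congr fun η => (ENNReal.ofReal_mul (hpos ξ)).symm
    · refine Integrable.of_bound (by fun_prop) (c ^ 2) (ae_of_all _ fun η => ?_)
      rw [Real.norm_eq_abs, abs_of_nonneg (sq_nonneg _)]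
      exact pow_le_pow_left₀ (cellProf_nonneg ..) (hb η) 2
    · exact ae_of_all _ fun η => sq_nonneg _
  simp_rw [h1]
  -- For each fixed configuration point `η`, the weighted squares of the profiles integrate over the
  -- centers to the indicator of the cell.
  rw [lintegral_lintegral_swap]
  · simp_rw [hc.lintegral_cellProf_sq hσ hl hr]
    rw [lintegral_indicator_one (measurableSet_sheetCell ..),
      PVM.measure_apply' _ (measurableSet_sheetCell ..)]
  · have h2 : Measurable fun q : E3 × E3 => cellProf σ h K i l a q.1 q.2 :=
      measurable_cellProf σ K (X := E3) (h := fun _ => h) (fun _ _ => measurable_const) i l a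
        (ξ := fun x => x) measurable_id
    have h3 : Measurable fun q : E3 × E3 => volDensity (h i l).1.2 (q.1 - (h i l).1.1.2) :=
      measurable_volDensity.comp (f := fun q : E3 × E3 => ((h i l).1.2, q.1 - (h i l).1.1.2))
        (by fun_prop)
    exact (h3.mul (h2.pow_const 2)).ennreal_ofReal.aemeasurable

/-! ### Commutation of the operators of one step -/

/-- The 3-cell `(a, i)` may be crossed next if the 3-cells in `D` have been crossed: up to some
3-cells of the 4-cell `a`, the set `D` consists of the 3-cells of a predecessor complete set of
4-cells, to which `a` may be added. -/
def IsNext (D : Set ((Fin N → ℕ) × Fin N)) (a : Fin N → ℕ) (i : Fin N) : Prop :=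
  ∃ V : Set (Fin N → ℕ), (∀ b ∈ V, ∀ c ≤ b, c ∈ V) ∧ (∀ c ≤ a, c ≠ a → c ∈ V) ∧ a ∉ V ∧
    (∀ b j, (b, j) ∈ D → b ∈ V ∨ b = a) ∧ (∀ b ∈ V, ∀ j, (b, j) ∈ D) ∧ (a, i) ∉ D

theorem IsNext.eq_of_le {D : Set ((Fin N → ℕ) × Fin N)} {a b : Fin N → ℕ} {i j : Fin N}
    (hN : IsNext D a i) (hb : (b, j) ∈ insert (a, i) D) (hab : a ≤ b) : b = a := by
  obtain ⟨V, hV, -, haV, hD, -⟩ := hN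
  rcases hb with hb | hb
  · exact (Prod.mk.inj hb).1
  · exact (hD b j hb).resolve_left fun h => haV (hV b h a hab)

theorem IsNext.mem_of_lt {D : Set ((Fin N → ℕ) × Fin N)} {a b : Fin N → ℕ} {i : Fin N}
    (hN : IsNext D a i) (hab : b ≤ a) (hne : b ≠ a) (j : Fin N) : (b, j) ∈ D := by
  obtain ⟨V, -, ha, -, -, hD, -⟩ := hN
  exact hD b (ha b hab hne) j

/-- On a common surface, all projections for the crossed 3-cells and for the 3-cells crossed next
act as position projections. -/
theorem IsChain.exists_common (hc : IsChain h) {D : Set ((Fin N → ℕ) × Fin N)} {a : Fin N → ℕ}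
    {i : Fin N} (hN : IsNext D a i) (l : Fin N → ℕ) :
    ∃ g hg, ∀ j, l j < K j →
      (F.hyp (h j (l j)) j).toFun (doneRegion h K D j (l j))
        = (F.R g hg j).toFun (doneRegion h K D j (l j)) ∧
      ∀ S ⊆ sheetCell h K j (l j) a, MeasurableSet S →
        (F.hyp (h j (l j)) j).toFun S = (F.R g hg j).toFun S := by
  obtain ⟨V, hV, ha, haV, hD, hVD, -⟩ := hN
  -- If `V` is empty, then `a = 0`; no 3-cell has this label, since on the sheet `l` the own index
  -- is `l + 1`. All sets are empty and any surface will do.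
  rcases V.eq_empty_or_nonempty with hVe | hVne
  · have ha0 : a = 0 := by
      by_contra hne
      have := ha 0 (fun j => Nat.zero_le _) (Ne.symm hne)
      simp [hVe] at this
    have he : ∀ j, l j < K j → sheetCell h K j (l j) a = ∅ := by
      intro j hj
      rw [Set.eq_empty_iff_forall_notMem]
      intro ξ hξ
      have := (hc.of_mem_sheetCell hj hξ).2
      rw [ha0, Pi.zero_apply] at this
      omega
    refine ⟨0, LipschitzWith.const 0 |>.weaken zero_le_one, fun j hj => ⟨?_, ?_⟩⟩
    · have : doneRegion h K D j (l j) = ∅ := by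
        rw [Set.eq_empty_iff_forall_notMem]
        intro ξ hξ
        rcases hD _ _ hξ with h1 | h1
        · simp [hVe] at h1
        · exact (he j hj).subset h1
      rw [this, PVM.toFun_empty, PVM.toFun_empty]
    · intro S hS _
      rw [Set.subset_eq_empty hS (he j hj), PVM.toFun_empty, PVM.toFun_empty]
  -- If the largest cell is in `V`, every cell has been crossed, so the sets are everything or empty
  -- and again any surface will do.
  by_cases hK : K ∈ V
  · refine ⟨0, LipschitzWith.const 0 |>.weaken zero_le_one, fun j hj => ⟨?_, ?_⟩⟩
    · have : doneRegion h K D j (l j) = univ :=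
        Set.eq_univ_of_forall fun ξ => hVD _ (hV K hK _ (cellAt_le _ _ _)) _
      rw [this, (PVM.isPOVM _).univ, (PVM.isPOVM _).univ]
    · intro S hS _
      have : sheetCell h K j (l j) a = ∅ := by
        rw [Set.eq_empty_iff_forall_notMem]
        intro ξ hξ
        exact haV (hV K hK a (hc.of_mem_sheetCell hj hξ).1)
      rw [Set.subset_eq_empty hS this, PVM.toFun_empty, PVM.toFun_empty]
  obtain ⟨f, hf, hf1, hf2⟩ := hc.exists_surface hV ha haV hVne hK
  refine ⟨f, hf, fun j hj => ?_⟩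
  have hcell : ∀ S ⊆ sheetCell h K j (l j) a, MeasurableSet S →
      (F.hyp (h j (l j)) j).toFun S = (F.R f hf j).toFun S := fun S hS hSm =>
    F.isLocal _ _ _ _ _ _ hSm fun ξ hξ => hf2 j (l j) hj ξ (hS hξ)
  refine ⟨?_, hcell⟩
  -- the crossed 4-cells
  set B := {ξ | cellAt h K (sheetPt h j (l j) ξ) ∈ V} with hB
  have hBm : MeasurableSet B := by
    convert measurableSet_doneRegion h K (V ×ˢ univ) j (l j) using 1
    ext ξ; simp [doneRegion, B]
  have hBlt : ∀ ξ, ξ ∈ B ↔ sheet h j (l j) ξ < f ξ := fun ξ => hf1 _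
  -- Over `B` the sheet lies strictly below `f`, so locality does not compare the two directly. The
  -- minimum agrees with the sheet over `B` and with `f` over the complement; passing to complements
  -- transfers the projection.
  have hmin : LipschitzWith 1 fun ξ => min (sheet h j (l j) ξ) (f ξ) := by
    have := (lipschitz_sheet h j (l j)).min hf
    rwa [max_self] at this
  have hV1 : (F.hyp (h j (l j)) j).toFun B = (F.R f hf j).toFun B := by
    have e1 : (F.hyp (h j (l j)) j).toFun B = (F.R _ hmin j).toFun B :=
      F.isLocal _ _ _ _ _ _ hBm fun ξ hξ => (min_eq_left ((hBlt ξ).mp hξ).le).symm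
    have e2 : (F.R f hf j).toFun Bᶜ = (F.R _ hmin j).toFun Bᶜ :=
      F.isLocal _ _ _ _ _ _ hBm.compl fun ξ hξ =>
        (min_eq_right (not_lt.mp fun h => hξ ((hBlt ξ).mpr h))).symm
    rw [PVM.toFun_compl _ hBm, PVM.toFun_compl _ hBm, sub_right_inj] at e2
    rw [e1, e2]
  set C := {ξ | ξ ∈ sheetCell h K j (l j) a ∧ (a, j) ∈ D} with hC
  have hCm : MeasurableSet C := (measurableSet_sheetCell h K j (l j) a).inter (MeasurableSet.const _)
  have hdec : doneRegion h K D j (l j) = B ∪ C := by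
    ext ξ
    constructor
    · intro hξ
      rcases hD _ _ hξ with h1 | h1
      · exact Or.inl h1
      · refine Or.inr ⟨h1, ?_⟩
        rw [← h1]; exact hξ
    · rintro (h1 | ⟨h1, h2⟩)
      · exact hVD _ h1 _
      · change (cellAt h K (sheetPt h j (l j) ξ), j) ∈ D
        rwa [mem_sheetCell.mp h1]
  have hdis : Disjoint B C := by
    rw [Set.disjoint_left]
    rintro ξ h1 ⟨h2, -⟩
    exact haV (mem_sheetCell.mp h2 ▸ h1)
  rw [hdec, PVM.toFun_union _ hBm hCm hdis, PVM.toFun_union _ hBm hCm hdis, hV1,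
    hcell C (fun ξ hξ => hξ.1) hCm]

end Crossing

/-! ### Commuting products -/

theorem prod_map_eq_mul_prod_update {M ι : Type*} [Monoid M] [DecidableEq ι] (T : ι → M)
    (hT : ∀ i j, Commute (T i) (T j)) (i : ι) :
    ∀ L : List ι, L.Nodup → i ∈ L →
      (L.map T).prod = T i * (L.map (Function.update T i 1)).prod
  | [], _, h => by simp at h
  | j :: L, hn, h => by
    rw [List.nodup_cons] at hn
    rw [List.map_cons, List.prod_cons, List.map_cons, List.prod_cons]
    by_cases hj : j = i
    · subst hj
      rw [Function.update_self, one_mul]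
      congr 2
      refine List.map_congr_left fun k hk => ?_
      rw [Function.update_of_ne]
      rintro rfl
      exact hn.1 hk
    · rw [prod_map_eq_mul_prod_update T hT i L hn.2 ((List.mem_cons.mp h).resolve_left (Ne.symm hj)),
        Function.update_of_ne hj, ← mul_assoc, ← mul_assoc, (hT j i).eq]

/-! ### The operators of the pending flashes and Pythagoras for one crossing. -/

section Factors

variable {N : ℕ} {h : Fin N → ℕ → HypParam} {n κ : Fin N → ℕ}
  {H : Type*} [NormedAddCommGroup H] [InnerProductSpace ℂ H] [CompleteSpace H]
  (F : LocalFamily N H)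

/-- The projection to particle `i` not being found in the 3-cells already crossed on the
hyperboloid of its next flash. -/
def remFactor (h : Fin N → ℕ → HypParam) (n κ : Fin N → ℕ) (D : Set ((Fin N → ℕ) × Fin N))
    (i : Fin N) : H →L[ℂ] H :=
  if κ i < n i then (F.hyp (h i (κ i)) i).toFun (doneRegion h (known n κ) D i (κ i))ᶜ else 1

/-- The product of the `remFactor` of all particles. -/
def remOp (h : Fin N → ℕ → HypParam) (n κ : Fin N → ℕ) (D : Set ((Fin N → ℕ) × Fin N)) :
    H →L[ℂ] H := ((List.finRange N).map (remFactor F h n κ D)).prod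

/-- The product of the `remFactor` of all particles but `i`. -/
def restOp (h : Fin N → ℕ → HypParam) (n κ : Fin N → ℕ) (D : Set ((Fin N → ℕ) × Fin N))
    (i : Fin N) : H →L[ℂ] H :=
  ((List.finRange N).map (Function.update (remFactor F h n κ D) i 1)).prod

theorem remFactor_insert_of_ne (D : Set ((Fin N → ℕ) × Fin N)) (a : Fin N → ℕ) {i j : Fin N}
    (hj : j ≠ i) : remFactor F h n κ (insert (a, i) D) j = remFactor F h n κ D j := by
  unfold remFactor
  rw [doneRegion_insert_of_ne _ _ _ _ hj]

theorem restOp_insert (D : Set ((Fin N → ℕ) × Fin N)) (a : Fin N → ℕ) (i : Fin N) :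
    restOp F h n κ (insert (a, i) D) i = restOp F h n κ D i := by
  unfold restOp
  congr 2
  funext j
  by_cases hj : j = i
  · subst hj; rw [Function.update_self, Function.update_self]
  · rw [Function.update_of_ne hj, Function.update_of_ne hj, remFactor_insert_of_ne F D a hj]

/-- One surface serves for the factors of all particles, before and after the crossing, and for the
cell being crossed; this is the source of all commutation relations. -/
theorem IsChain.exists_common_factor (hc : IsChain h) {D : Set ((Fin N → ℕ) × Fin N)}
    {a : Fin N → ℕ} {i : Fin N} (hN : IsNext D a i) :
    ∃ g hg, (∀ j, ∃ S, MeasurableSet S ∧ remFactor F h n κ D j = (F.R g hg j).toFun S) ∧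
      (∀ j, ∃ S, MeasurableSet S ∧
        remFactor F h n κ (insert (a, i) D) j = (F.R g hg j).toFun S) ∧
      (κ i < n i → ∀ S ⊆ sheetCell h (known n κ) i (κ i) a, MeasurableSet S →
        (F.hyp (h i (κ i)) i).toFun S = (F.R g hg i).toFun S) := by
  obtain ⟨g, hg, hR⟩ := hc.exists_common F (K := known n κ) hN κ
  have hfac : ∀ j, ∃ S, MeasurableSet S ∧ remFactor F h n κ D j = (F.R g hg j).toFun S := by
    intro j
    by_cases hj : κ j < n j
    · have hm := measurableSet_doneRegion h (known n κ) D j (κ j)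
      refine ⟨_, hm.compl, ?_⟩
      rw [remFactor, if_pos hj, PVM.toFun_compl _ hm, PVM.toFun_compl _ hm,
        (hR j (lt_known hj)).1]
    · exact ⟨univ, MeasurableSet.univ, by rw [remFactor, if_neg hj, (PVM.isPOVM _).univ]⟩
  refine ⟨g, hg, hfac, fun j => ?_, fun hi => (hR i (lt_known hi)).2⟩
  by_cases hj : j = i
  · subst hj
    by_cases hj : κ j < n j
    · have hm := measurableSet_doneRegion h (known n κ) D j (κ j)
      have hC := measurableSet_sheetCell h (known n κ) j (κ j) a
      refine ⟨_, (hm.union hC).compl, ?_⟩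
      have hdis : Disjoint (doneRegion h (known n κ) D j (κ j))
          (sheetCell h (known n κ) j (κ j) a) := by
        rw [Set.disjoint_left]
        intro ξ h1 h2
        obtain ⟨V, -, -, -, -, -, haD⟩ := hN
        rw [doneRegion, mem_ofPred_eq, mem_sheetCell.mp h2] at h1
        exact haD h1
      rw [remFactor, if_pos hj, doneRegion_insert, PVM.toFun_compl _ (hm.union hC),
        PVM.toFun_compl _ (hm.union hC), PVM.toFun_union _ hm hC hdis, PVM.toFun_union _ hm hC hdis,
        (hR j (lt_known hj)).1, (hR j (lt_known hj)).2 _ subset_rfl hC]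
    · exact ⟨univ, MeasurableSet.univ, by rw [remFactor, if_neg hj, (PVM.isPOVM _).univ]⟩
  · obtain ⟨S, hS, he⟩ := hfac j
    exact ⟨S, hS, by rw [remFactor_insert_of_ne F D a hj, he]⟩

theorem remOp_eq_mul_restOp {D : Set ((Fin N → ℕ) × Fin N)} {g : E3 → ℝ} {hg : LipschitzWith 1 g}
    (hS : ∀ j, ∃ S, MeasurableSet S ∧ remFactor F h n κ D j = (F.R g hg j).toFun S) (i : Fin N) :
    remOp F h n κ D = remFactor F h n κ D i * restOp F h n κ D i := by
  refine prod_map_eq_mul_prod_update _ (fun j k => ?_) i _ (List.nodup_finRange N)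
    (List.mem_finRange i)
  obtain ⟨S, hS1, e1⟩ := hS j
  obtain ⟨S', hS2, e2⟩ := hS k
  rw [e1, e2]
  exact F.comm _ _ _ _ _ _ hS1 hS2

/-- The profile vanishes outside the cell `a`, so the collapse operator commutes with whatever
commutes with the projections to subsets of this cell. On the common surface these commute with the
factors of the other particles. -/
theorem IsChain.commute_collapse_restOp (hc : IsChain h) {σ : ℝ} (hσ : 0 < σ)
    {D : Set ((Fin N → ℕ) × Fin N)} {a : Fin N → ℕ} {i : Fin N} (hN : IsNext D a i)
    (hi : κ i < n i) (ξ : E3) :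
    Commute (collapse F σ h (known n κ) i (κ i) a ξ) (restOp F h n κ D i) := by
  obtain ⟨g, hg, h1, -, h2⟩ := hc.exists_common_factor F (n := n) (κ := κ) hN
  obtain ⟨c, hcb⟩ := hc.exists_cellProf_le hσ (lt_known hi) a ξ
  refine PVM.multOp_commute _ (measurable_cellProf_right σ h _ i _ a ξ) (fun _ => cellProf_nonneg ..) hcb
    fun A hA hsub => ?_
  rw [h2 hi A (fun η hη => ?_) hA]
  · refine Commute.list_prod_right _ _ fun T hT => ?_
    obtain ⟨j, -, rfl⟩ := List.mem_map.mp hT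
    by_cases hj : j = i
    · subst hj; rw [Function.update_self]; exact Commute.one_right _
    · rw [Function.update_of_ne hj]
      obtain ⟨S, hS, e⟩ := h1 j
      rw [e]
      exact F.comm _ _ _ _ _ _ hA hS
  · by_contra hn
    exact hsub hη (cellProf_eq_zero _ _ _ _ _ _ fun h => hn h.1)

/-- The crossing removes the cell `a` from the region still allowed for particle `i`. As `(a, i)` is
not in `D`, the old region is the disjoint union of the new one and the cell, and squared norms of
projections add. -/
theorem IsChain.norm_remOp_sq (hc : IsChain h) {D : Set ((Fin N → ℕ) × Fin N)} {a : Fin N → ℕ}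
    {i : Fin N} (hN : IsNext D a i) (hi : κ i < n i) (φ : H) :
    ‖remOp F h n κ D φ‖ ^ 2 = ‖remOp F h n κ (insert (a, i) D) φ‖ ^ 2 +
      ‖(F.hyp (h i (κ i)) i).toFun (sheetCell h (known n κ) i (κ i) a)
        (restOp F h n κ D i φ)‖ ^ 2 := by
  obtain ⟨g, hg, h1, h2, -⟩ := hc.exists_common_factor F (n := n) (κ := κ) hN
  rw [remOp_eq_mul_restOp F h1 i, remOp_eq_mul_restOp F h2 i, restOp_insert]
  change ‖remFactor F h n κ D i (restOp F h n κ D i φ)‖ ^ 2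
    = ‖remFactor F h n κ (insert (a, i) D) i (restOp F h n κ D i φ)‖ ^ 2 + _
  set ψ := restOp F h n κ D i φ
  rw [remFactor, if_pos hi, remFactor, if_pos hi, doneRegion_insert]
  have hm := measurableSet_doneRegion h (known n κ) D i (κ i)
  have hC := measurableSet_sheetCell h (known n κ) i (κ i) a
  set P := F.hyp (h i (κ i)) i
  rw [← P.measure_real hm.compl, ← P.measure_real (hm.union hC).compl, ← P.measure_real hC,
    ← measureReal_union _ hC]
  · congr 1
    ext ξ
    by_cases h3 : ξ ∈ sheetCell h (known n κ) i (κ i) a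
    · have h4 : ξ ∉ doneRegion h (known n κ) D i (κ i) := by
        obtain ⟨V, -, -, -, -, -, haD⟩ := hN
        rw [doneRegion, mem_ofPred_eq, mem_sheetCell.mp h3]
        exact haD
      simp [h3, h4]
    · simp [h3]
  · rw [Set.disjoint_left]
    exact fun ξ h3 h4 => h3 (Or.inr h4)

theorem AgreeBelow.remFactor_eq {h' : Fin N → ℕ → HypParam} (A : AgreeBelow (known n κ) h h')
    (D : Set ((Fin N → ℕ) × Fin N)) (i : Fin N) :
    remFactor F h n κ D i = remFactor F h' n κ D i := by
  unfold remFactor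
  by_cases hi : κ i < n i
  · rw [if_pos hi, if_pos hi, A.doneRegion_eq D (lt_known hi), A i _ (lt_known hi)]
  · rw [if_neg hi, if_neg hi]

theorem AgreeBelow.restOp_eq {h' : Fin N → ℕ → HypParam} (A : AgreeBelow (known n κ) h h')
    (D : Set ((Fin N → ℕ) × Fin N)) (i : Fin N) :
    restOp F h n κ D i = restOp F h' n κ D i := by
  unfold restOp
  rw [show remFactor F h n κ D = remFactor F h' n κ D from funext fun j => A.remFactor_eq F D j]

/-- After the next flash of particle `i` has been realized in the 3-cell crossed next, only the
factors of the other particles remain. -/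
theorem IsChain.remOp_bump (hc : IsChain h) {D : Set ((Fin N → ℕ) × Fin N)} {a : Fin N → ℕ}
    {i : Fin N} (hN : IsNext D a i) (hi : κ i < n i)
    (hx : cellAt h (known n κ) (h i (κ i + 1)).1.1 = a) :
    remOp F h n (bump κ i) (insert (a, i) D) = restOp F h n κ D i := by
  unfold remOp restOp
  congr 2
  funext j
  by_cases hj : j = i
  · subst hj
    rw [Function.update_self, remFactor]
    split_ifs with hlt
    · rw [bump_self] at hlt ⊢
      -- Everything on the new hyperboloid is later than the flash in `a`, so none of it lies in a
      -- crossed cell and the factor of this particle is 1.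
      have : doneRegion h (known n (bump κ j)) (insert (a, j) D) j (κ j + 1) = ∅ := by
        rw [Set.eq_empty_iff_forall_notMem]
        intro ξ hξ
        have := hc.sheetCell_bump_self hi hx hlt (b := _) (hN.eq_of_le hξ)
        exact this.subset (mem_sheetCell.mpr rfl)
      rw [this, compl_empty, (PVM.isPOVM _).univ]
    · rfl
  · rw [Function.update_of_ne hj, remFactor, remFactor, bump_of_ne κ hj]
    split_ifs with hlt
    · congr 2
      rw [← doneRegion_insert_of_ne h (known n κ) D a hj]
      have hkey : ∀ b, (b, j) ∈ insert (a, i) D → ∀ ξ,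
          (ξ ∈ sheetCell h (known n (bump κ i)) j (κ j) b ↔
            ξ ∈ sheetCell h (known n κ) j (κ j) b) := by
        intro b hb ξ
        by_cases hl : κ j + 1 = b j
        · rw [hc.sheetCell_bump hx (hN.eq_of_le hb) hl]
        · constructor <;> intro h1 <;> exfalso
          · refine hl (hc.of_mem_sheetCell ?_ h1).2.symm
            rw [known_bump_of_ne hj]; exact lt_known hlt
          · exact hl (hc.of_mem_sheetCell (lt_known hlt) h1).2.symm
      ext ξ
      constructor
      · intro hξ
        have := (hkey _ hξ ξ).mp (mem_sheetCell.mpr rfl)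
        change (cellAt h (known n κ) (sheetPt h j (κ j) ξ), j) ∈ insert (a, i) D
        rw [mem_sheetCell.mp this]; exact hξ
      · intro hξ
        have := (hkey _ hξ ξ).mpr (mem_sheetCell.mpr rfl)
        change (cellAt h (known n (bump κ i)) (sheetPt h j (κ j) ξ), j) ∈ insert (a, i) D
        rw [mem_sheetCell.mp this]; exact hξ
    · rfl

end Factors

/-! ### Flashes in relative coordinates -/

section Path

variable {N : ℕ} {n κ : Fin N → ℕ}

/-- The flashes of particle `i`, starting with the seed flash, if each flash lies at proper time
`exp r` and relative spatial position `u` from the preceding one. -/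
def worldPt (y : Fin N → Minkowski) (r : Fin N × ℕ → ℝ) (u : Fin N × ℕ → E3) (i : Fin N) :
    ℕ → Minkowski
  | 0 => y i
  | l + 1 => worldPt y r u i l + (energy (Real.exp (r (i, l))) (u (i, l)), u (i, l))

/-- The hyperboloids of the flashes `worldPt y r u`. -/
def chainOf (y : Fin N → Minkowski) (r : Fin N × ℕ → ℝ) (u : Fin N × ℕ → E3) (i : Fin N) (l : ℕ) :
    HypParam := ⟨(worldPt y r u i l, Real.exp (r (i, l))), Real.exp_pos _⟩

theorem isChain_chainOf (y : Fin N → Minkowski) (r : Fin N × ℕ → ℝ) (u : Fin N × ℕ → E3) :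
    IsChain (chainOf y r u) := by
  intro i l
  simp [chainOf, sheet, worldPt, hypTime, energy]

theorem measurable_worldPt (y : Fin N → Minkowski) {X : Type*} [MeasurableSpace X]
    {r : X → Fin N × ℕ → ℝ} {u : X → Fin N × ℕ → E3} (hr : Measurable r) (hu : Measurable u)
    (i : Fin N) (l : ℕ) : Measurable fun x => worldPt y (r x) (u x) i l := by
  induction l with
  | zero => exact measurable_const
  | succ l ih =>
    refine ih.add (Measurable.prodMk ?_ (by fun_prop))
    unfold energy
    fun_prop

theorem measurable_chainOf (y : Fin N → Minkowski) {X : Type*} [MeasurableSpace X]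
    {r : X → Fin N × ℕ → ℝ} {u : X → Fin N × ℕ → E3} (hr : Measurable r) (hu : Measurable u)
    (i : Fin N) (l : ℕ) : Measurable fun x => chainOf y (r x) (u x) i l :=
  ((measurable_worldPt y hr hu i l).prodMk (by fun_prop)).subtype_mk

theorem worldPt_congr (y : Fin N → Minkowski) (r : Fin N × ℕ → ℝ) {u u' : Fin N × ℕ → E3}
    (i : Fin N) {l : ℕ} (h : ∀ l' < l, u (i, l') = u' (i, l')) :
    worldPt y r u i l = worldPt y r u' i l := by
  induction l with
  | zero => rfl
  | succ l ih =>
    rw [worldPt, worldPt, ih fun l' hl' => h l' (by omega), h l (by omega)]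

theorem chainOf_congr (y : Fin N → Minkowski) (r : Fin N × ℕ → ℝ) {u u' : Fin N × ℕ → E3}
    (i : Fin N) {l : ℕ} (h : ∀ l' < l, u (i, l') = u' (i, l')) :
    chainOf y r u i l = chainOf y r u' i l := by
  unfold chainOf
  simp only [worldPt_congr y r i h]

/-- The indices of the flashes that are not yet realized. -/
def unrealized (n κ : Fin N → ℕ) : Finset (Fin N × ℕ) :=
  (Finset.univ ×ˢ Finset.range (∑ i, n i)).filter fun p => κ p.1 ≤ p.2 ∧ p.2 < n p.1

theorem mem_unrealized {p : Fin N × ℕ} : p ∈ unrealized n κ ↔ κ p.1 ≤ p.2 ∧ p.2 < n p.1 := by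
  simp only [unrealized, Finset.mem_filter, Finset.mem_product, Finset.mem_univ, true_and,
    Finset.mem_range, and_iff_right_iff_imp]
  intro h
  exact h.2.trans_le (Finset.single_le_sum (f := n) (fun _ _ => Nat.zero_le _)
    (Finset.mem_univ p.1))

theorem unrealized_self : unrealized n n = ∅ := by
  ext p
  simp [mem_unrealized]

theorem unrealized_eq_insert {i : Fin N} (hi : κ i < n i) :
    unrealized n κ = insert (i, κ i) (unrealized n (bump κ i)) := by
  ext ⟨j, l⟩
  rw [Finset.mem_insert, mem_unrealized, mem_unrealized]
  by_cases hj : j = i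
  · subst hj
    simp only [bump_self, Prod.mk.injEq, true_and]
    omega
  · simp [bump_of_ne κ hj, hj]

theorem notMem_unrealized_bump (i : Fin N) : (i, κ i) ∉ unrealized n (bump κ i) := by
  simp [mem_unrealized]

/-- The pending hyperboloid of a particle uses the proper time of the unrealized flash, which is
fixed in `r`, but not its position. -/
theorem agreeBelow_chainOf (y : Fin N → Minkowski) (r : Fin N × ℕ → ℝ) {u u' : Fin N × ℕ → E3}
    (h : ∀ p ∉ unrealized n κ, u p = u' p) :
    AgreeBelow (known n κ) (chainOf y r u) (chainOf y r u') := by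
  intro j l hl
  refine chainOf_congr y r j fun l' hl' => h _ ?_
  rw [mem_unrealized]
  have : l < min (κ j + 1) (n j) := hl
  change ¬ (κ j ≤ l' ∧ l' < n j)
  omega

/-- All 3-cells of all configurations are regular. -/
def AllRegular (y : Fin N → Minkowski) (n : Fin N → ℕ) (r : Fin N × ℕ → ℝ)
    (u : Fin N × ℕ → E3) : Prop :=
  ∀ κ ≤ n, ∀ i, κ i < n i → ∀ a ≤ n, CellRegular (chainOf y r u) (known n κ) i (κ i) a

theorem measurableSet_setOf_allRegular (y : Fin N → Minkowski) (n : Fin N → ℕ) {X : Type*}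
    [MeasurableSpace X] {r : X → Fin N × ℕ → ℝ} {u : X → Fin N × ℕ → E3} (hr : Measurable r)
    (hu : Measurable u) : MeasurableSet {x | AllRegular y n (r x) (u x)} := by
  simp only [AllRegular, ofPred_forall]
  refine MeasurableSet.iInter fun κ => MeasurableSet.iInter fun _ => MeasurableSet.iInter fun i =>
    MeasurableSet.iInter fun _ => MeasurableSet.iInter fun a => MeasurableSet.iInter fun _ => ?_
  exact measurableSet_setOf_cellRegular _ (fun i l => measurable_chainOf y hr hu i l) i _ a

/-- The indicator function of configurations with an irregular 3-cell. -/
def irregular (y : Fin N → Minkowski) (n : Fin N → ℕ) (r : Fin N × ℕ → ℝ) :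
    (Fin N × ℕ → E3) → ℝ≥0∞ := {u | AllRegular y n r u}ᶜ.indicator 1

theorem measurable_irregular (y : Fin N → Minkowski) (n : Fin N → ℕ) (r : Fin N × ℕ → ℝ) :
    Measurable (irregular y n r) :=
  measurable_one.indicator (measurableSet_setOf_allRegular y n (r := fun _ => r) measurable_const
    measurable_id).compl

theorem allRegular_of_irregular_eq_zero {y : Fin N → Minkowski} {r : Fin N × ℕ → ℝ}
    {u : Fin N × ℕ → E3} (h : irregular y n r u = 0) : AllRegular y n r u := by
  by_contra hn
  rw [irregular, indicator_of_mem (show u ∈ {u | AllRegular y n r u}ᶜ from hn)] at h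
  exact one_ne_zero h

/-- The iterated integral over the relative positions of the flashes in `s`. -/
abbrev posMarginal (s : Finset (Fin N × ℕ)) (f : (Fin N × ℕ → E3) → ℝ≥0∞) :
    (Fin N × ℕ → E3) → ℝ≥0∞ := lmarginal (fun _ => (volume : Measure E3)) s f

theorem updateFinset_of_notMem {u : Fin N × ℕ → E3} {s : Finset (Fin N × ℕ)} {z : s → E3}
    {p : Fin N × ℕ} (hp : p ∉ s) : Function.updateFinset u s z p = u p := by
  simp [Function.updateFinset_def, hp]

/-- The current cells do not depend on the unrealized positions, so one regular completion of the
pattern suffices, and almost every completion is regular. -/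
theorem cellRegular_of_posMarginal {y : Fin N → Minkowski} {r : Fin N × ℕ → ℝ}
    {u : Fin N × ℕ → E3} (h : posMarginal (unrealized n κ) (irregular y n r) u = 0) (hκ : κ ≤ n)
    {i : Fin N} (hi : κ i < n i) {a : Fin N → ℕ} (ha : a ≤ n) :
    CellRegular (chainOf y r u) (known n κ) i (κ i) a := by
  have hm : Measurable fun z => irregular y n r (Function.updateFinset u (unrealized n κ) z) :=
    (measurable_irregular y n r).comp measurable_updateFinset
  rw [posMarginal, lmarginal, lintegral_eq_zero_iff hm] at h
  obtain ⟨z, hz⟩ := h.exists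
  have := allRegular_of_irregular_eq_zero hz κ hκ i hi a ha
  rwa [AgreeBelow.cellRegular_iff (h' := chainOf y r u) ?_ a (lt_known hi)] at this
  exact agreeBelow_chainOf y r fun p hp => updateFinset_of_notMem hp

theorem ae_posMarginal_update {y : Fin N → Minkowski} {r : Fin N × ℕ → ℝ}
    {u : Fin N × ℕ → E3} (h : posMarginal (unrealized n κ) (irregular y n r) u = 0)
    {i : Fin N} (hi : κ i < n i) : ∀ᵐ v : E3, posMarginal (unrealized n (bump κ i))
      (irregular y n r) (Function.update u (i, κ i) v) = 0 := by
  rw [unrealized_eq_insert hi, posMarginal,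
    lmarginal_insert _ (measurable_irregular y n r) (notMem_unrealized_bump i),
    lintegral_eq_zero_iff] at h
  · exact h
  · exact ((measurable_irregular y n r).lmarginal _).comp (measurable_update u)

/-! ### The total weight of the paths through the 3-cells -/

variable {H : Type*} [NormedAddCommGroup H] [InnerProductSpace ℂ H] [CompleteSpace H]
  (F : LocalFamily N H) (σ : ℝ) (y : Fin N → Minkowski) (r : Fin N × ℕ → ℝ)

open Classical in
/-- The contribution of collapsing the state when the 3-cell `p` is crossed, if the next flash of
the particle lies in it, where `W` is the contribution of the 3-cells crossed later. -/
def crossTerm (n : Fin N → ℕ) (W : (Fin N → ℕ) → (Fin N × ℕ → E3) → H → ℝ≥0∞)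
    (p : (Fin N → ℕ) × Fin N) (κ : Fin N → ℕ) (u : Fin N × ℕ → E3) (φ : H) : ℝ≥0∞ :=
  if κ p.2 < n p.2 ∧ cellAt (chainOf y r u) (known n κ) (worldPt y r u p.2 (κ p.2 + 1)) = p.1
  then ENNReal.ofReal (volDensity (Real.exp (r (p.2, κ p.2))) (u (p.2, κ p.2))) *
    W (bump κ p.2) u (collapse F σ (chainOf y r u) (known n κ) p.2 (κ p.2) p.1
      (worldPt y r u p.2 (κ p.2 + 1)).2 φ)
  else 0

open Classical in
/-- The weight of the flashes `u` if the 3-cells of a list are crossed successively, where `κ`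
records the numbers of flashes realized so far: whenever the next flash of particle `i` lies in the
3-cell being crossed, it may be realized by collapsing the state. -/
def pathWeight (n : Fin N → ℕ) : List ((Fin N → ℕ) × Fin N) → (Fin N → ℕ) →
    (Fin N × ℕ → E3) → H → ℝ≥0∞
  | [] => fun κ _ φ => if κ = n then ENNReal.ofReal (‖φ‖ ^ 2) else 0
  | p :: L => fun κ u φ =>
      pathWeight n L κ u φ + crossTerm F σ y r n (pathWeight n L) p κ u φ

theorem measurable_crossTerm {σ : ℝ} (hσ : 0 < σ) {X : Type*} [MeasurableSpace X]
    {r : X → Fin N × ℕ → ℝ} {u : X → Fin N × ℕ → E3} (hr : Measurable r) (hu : Measurable u)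
    {W : X → (Fin N → ℕ) → (Fin N × ℕ → E3) → H → ℝ≥0∞}
    (hW : ∀ κ (v : X → H), StronglyMeasurable v → Measurable fun x => W x κ (u x) (v x))
    (p : (Fin N → ℕ) × Fin N) (κ : Fin N → ℕ) {v : X → H} (hv : StronglyMeasurable v) :
    Measurable fun x => crossTerm F σ y (r x) n (W x) p κ (u x) (v x) := by
  unfold crossTerm
  by_cases hi : κ p.2 < n p.2
  · simp only [hi, true_and]
    have hw := measurable_worldPt y hr hu p.2 (κ p.2 + 1)
    refine Measurable.ite ?_ (Measurable.mul ?_ ?_) measurable_const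
    · exact measurable_cellAt (known n κ) (fun i l => measurable_chainOf y hr hu i l) hw
        (MeasurableSet.of_discrete (s := {p.1}))
    · exact (measurable_volDensity.comp (f := fun x =>
        (Real.exp (r x (p.2, κ p.2)), u x (p.2, κ p.2))) (by fun_prop)).ennreal_ofReal
    · refine hW _ _ ?_
      exact stronglyMeasurable_clm_apply (fun φ => stronglyMeasurable_collapse F hσ
        (fun i l => measurable_chainOf y hr hu i l) (fun x => isChain_chainOf y (r x) (u x))
        (lt_known hi) p.1 hw.snd φ) hv
  · simp only [hi, false_and, if_false]
    exact measurable_const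

theorem measurable_pathWeight {σ : ℝ} (hσ : 0 < σ) {X : Type*} [MeasurableSpace X]
    {r : X → Fin N × ℕ → ℝ} {u : X → Fin N × ℕ → E3} (hr : Measurable r) (hu : Measurable u) :
    ∀ (L : List ((Fin N → ℕ) × Fin N)) (κ : Fin N → ℕ) (v : X → H), StronglyMeasurable v →
      Measurable fun x => pathWeight F σ y (r x) n L κ (u x) (v x)
  | [], κ, v, hv => by
    simp only [pathWeight]
    split_ifs
    · exact (hv.norm.measurable.pow_const 2).ennreal_ofReal
    · exact measurable_const
  | p :: L, κ, v, hv =>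
    (measurable_pathWeight hσ hr hu L κ v hv).add
      (measurable_crossTerm F y hσ hr hu (measurable_pathWeight hσ hr hu L) p κ hv)

/-- The 3-cells in `D` have been crossed, and those in the list will be crossed successively. -/
def ValidFrom (n : Fin N → ℕ) : Set ((Fin N → ℕ) × Fin N) → List ((Fin N → ℕ) × Fin N) → Prop
  | D, [] => ∀ a ≤ n, ∀ i, (a, i) ∈ D
  | D, p :: L => IsNext D p.1 p.2 ∧ ValidFrom n (insert p D) L

/-- With all cells crossed, a particle with a pending flash contributes the projection to the empty
set. So only complete patterns survive, which starts the induction on the list. -/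
theorem remOp_of_forall_mem {h : Fin N → ℕ → HypParam} (hκ : κ ≤ n)
    {D : Set ((Fin N → ℕ) × Fin N)} (hD : ∀ a ≤ n, ∀ i, (a, i) ∈ D) (φ : H) :
    ENNReal.ofReal (‖remOp F h n κ D φ‖ ^ 2)
      = if κ = n then ENNReal.ofReal (‖φ‖ ^ 2) else 0 := by
  classical
  have h1 : ∀ i, remFactor F h n κ D i = if κ i < n i then 0 else 1 := by
    intro i
    unfold remFactor
    split_ifs with hi
    · have : doneRegion h (known n κ) D i (κ i) = univ :=
        Set.eq_univ_of_forall fun ξ => hD _ ((cellAt_le _ _ _).trans known_le) i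
      rw [this, compl_univ, PVM.toFun_empty]
    · rfl
  split_ifs with he
  · have : remOp F h n κ D = 1 := by
      unfold remOp
      refine List.prod_eq_one fun T hT => ?_
      obtain ⟨i, -, rfl⟩ := List.mem_map.mp hT
      rw [h1, he, if_neg (lt_irrefl _)]
    rw [this]; rfl
  · obtain ⟨i, hi⟩ : ∃ i, κ i < n i := by
      by_contra! hn
      exact he (le_antisymm hκ hn)
    have : remOp F h n κ D = 0 := by
      unfold remOp
      apply List.prod_eq_zero
      exact List.mem_map.mpr ⟨i, List.mem_finRange i, by rw [h1, if_pos hi]⟩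
    rw [this]
    simp

theorem remOp_insert_of_le {h : Fin N → ℕ → HypParam} {D : Set ((Fin N → ℕ) × Fin N)}
    {a : Fin N → ℕ} {i : Fin N} (hi : ¬ κ i < n i) :
    remOp F h n κ (insert (a, i) D) = remOp F h n κ D := by
  unfold remOp
  congr 2
  funext j
  by_cases hj : j = i
  · subst hj; rw [remFactor, remFactor, if_neg hi, if_neg hi]
  · exact remFactor_insert_of_ne F D a hj

theorem collapse_eq_zero {h : Fin N → ℕ → HypParam} {K : Fin N → ℕ} (σ : ℝ) {i : Fin N} {l : ℕ}
    {a : Fin N → ℕ} {ξ : E3} (hξ : ξ ∉ sheetCell h K i l a) :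
    collapse F σ h K i l a ξ = 0 := by
  have h0 : cellProf σ h K i l a ξ = fun _ => 0 :=
    funext fun η => cellProf_eq_zero _ _ _ _ _ _ fun h => hξ h.2
  ext ψ
  have := (F.hyp (h i l) i).norm_multOp_sq (f := fun _ => 0) measurable_const (c := 0)
    (fun _ => le_rfl) (fun _ => le_rfl) ψ
  rw [collapse, h0, _root_.zero_apply, ← norm_eq_zero]
  simpa using this

/-- The hypothesis `hW` evaluates the later flashes on the collapsed vector. The remaining operator
is then `restOp`, and commuting it past the collapse operator leaves the collapse outermost, ready
to be integrated over the position of this flash. -/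
theorem posMarginal_crossTerm {σ : ℝ} (hσ : 0 < σ) {D : Set ((Fin N → ℕ) × Fin N)}
    {a : Fin N → ℕ} {i : Fin N} (hN : IsNext D a i) (hi : κ i < n i) {u : Fin N × ℕ → E3} {φ : H}
    {W : (Fin N → ℕ) → (Fin N × ℕ → E3) → H → ℝ≥0∞}
    (hW : ∀ ψ, posMarginal (unrealized n (bump κ i)) (fun u => W (bump κ i) u ψ) u
      = ENNReal.ofReal (‖remOp F (chainOf y r u) n (bump κ i) (insert (a, i) D) ψ‖ ^ 2)) :
    posMarginal (unrealized n (bump κ i)) (fun u => crossTerm F σ y r n W (a, i) κ u φ) u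
      = ENNReal.ofReal (volDensity (Real.exp (r (i, κ i))) (u (i, κ i))) *
        ENNReal.ofReal (‖collapse F σ (chainOf y r u) (known n κ) i (κ i) a
          (worldPt y r u i (κ i + 1)).2 (restOp F (chainOf y r u) n κ D i φ)‖ ^ 2) := by
  have hc := isChain_chainOf y r u
  set ξ := (worldPt y r u i (κ i + 1)).2 with hξ
  set ψ := collapse F σ (chainOf y r u) (known n κ) i (κ i) a ξ φ with hψ
  have hcond : cellAt (chainOf y r u) (known n κ) (worldPt y r u i (κ i + 1)) = a ↔
      ξ ∈ sheetCell (chainOf y r u) (known n κ) i (κ i) a := by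
    rw [mem_sheetCell, hξ]
    have := hc.flash_eq i (κ i)
    change worldPt y r u i (κ i + 1) = sheetPt _ _ _ (worldPt y r u i (κ i + 1)).2 at this
    rw [← this]
  have hterm : ∀ z, crossTerm F σ y r n W (a, i) κ
      (Function.updateFinset u (unrealized n (bump κ i)) z) φ
      = if cellAt (chainOf y r u) (known n κ) (worldPt y r u i (κ i + 1)) = a then
        ENNReal.ofReal (volDensity (Real.exp (r (i, κ i))) (u (i, κ i))) *
          W (bump κ i) (Function.updateFinset u (unrealized n (bump κ i)) z) ψ else 0 := by
    intro z
    have hu : ∀ p ∉ unrealized n (bump κ i),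
        Function.updateFinset u (unrealized n (bump κ i)) z p = u p :=
      fun p hp => updateFinset_of_notMem hp
    have hA : AgreeBelow (known n κ)
        (chainOf y r (Function.updateFinset u (unrealized n (bump κ i)) z)) (chainOf y r u) :=
      fun j l hl => agreeBelow_chainOf y r hu j l
        (hl.trans_le (known_mono (le_bump κ i) j))
    have hw : worldPt y r (Function.updateFinset u (unrealized n (bump κ i)) z) i (κ i + 1)
        = worldPt y r u i (κ i + 1) := by
      refine worldPt_congr y r i fun l' hl' => hu _ ?_
      rw [mem_unrealized]
      simp only [bump_self]
      omega
    unfold crossTerm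
    simp only [hi, true_and]
    rw [hA.cellAt_eq, hw, hu _ (notMem_unrealized_bump i), hA.collapse_eq F σ a (lt_known hi)]
  rw [posMarginal, lmarginal]
  simp only [hterm]
  by_cases hx : cellAt (chainOf y r u) (known n κ) (worldPt y r u i (κ i + 1)) = a
  · simp only [if_pos hx]
    rw [lintegral_const_mul' _ _ ENNReal.ofReal_ne_top]
    congr 1
    refine (hW ψ).trans ?_
    rw [hc.remOp_bump F hN hi hx, hψ]
    congr 3
    exact (congrArg (fun T : H →L[ℂ] H => T φ) (hc.commute_collapse_restOp F hσ hN hi ξ).eq).symm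
  · simp only [if_neg hx]
    rw [collapse_eq_zero F σ fun h => hx (hcond.mpr h)]
    simp

/-- The weights of all flash patterns add up to the probability that no unrealized flash is in a
3-cell already crossed. -/
theorem posMarginal_pathWeight {σ : ℝ} (hσ : 0 < σ) :
    ∀ (L : List ((Fin N → ℕ) × Fin N)) (D : Set ((Fin N → ℕ) × Fin N)) (κ : Fin N → ℕ),
      ValidFrom n D L → κ ≤ n → ∀ (u : Fin N × ℕ → E3) (φ : H),
      posMarginal (unrealized n κ) (irregular y n r) u = 0 →
      posMarginal (unrealized n κ) (fun u => pathWeight F σ y r n L κ u φ) u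
        = ENNReal.ofReal (‖remOp F (chainOf y r u) n κ D φ‖ ^ 2)
  | [], D, κ, hD, hκ, u, φ, _ => by
    rw [remOp_of_forall_mem F hκ hD]
    simp only [pathWeight]
    split_ifs with he
    · rw [he, unrealized_self]; simp
    · simp [posMarginal, lmarginal]
  | (a, i) :: L, D, κ, ⟨hN, hV⟩, hκ, u, φ, hreg => by
    have hc := isChain_chainOf y r u
    have hmeas : ∀ (L : List ((Fin N → ℕ) × Fin N)) (κ : Fin N → ℕ),
        Measurable fun u => pathWeight F σ y r n L κ u φ := fun L κ =>
      measurable_pathWeight F y hσ (r := fun _ => r) measurable_const measurable_id L κ _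
        stronglyMeasurable_const
    have hIH := posMarginal_pathWeight hσ L _ κ hV hκ u φ hreg
    by_cases hi : κ i < n i
    swap
    · have : ∀ u, pathWeight F σ y r n ((a, i) :: L) κ u φ = pathWeight F σ y r n L κ u φ := by
        intro u; simp only [pathWeight, crossTerm, hi, false_and, if_false, add_zero]
      simp only [this]
      rw [hIH, remOp_insert_of_le F hi]
    have hcross : Measurable fun u => crossTerm F σ y r n (pathWeight F σ y r n L) (a, i) κ u φ :=
      measurable_crossTerm F y hσ (r := fun _ => r) (W := fun _ => pathWeight F σ y r n L)
        measurable_const measurable_id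
        (fun κ v hv => measurable_pathWeight F y hσ (r := fun _ => r) measurable_const
          measurable_id L κ v hv) (a, i) κ stronglyMeasurable_const
    -- Pythagoras matches the two summands of `pathWeight`: the flash is not realized here, or it is
    -- realized in the cell `a`.
    rw [hc.norm_remOp_sq F hN hi, ENNReal.ofReal_add (sq_nonneg _) (sq_nonneg _), ← hIH]
    simp only [pathWeight, posMarginal, lmarginal]
    have hm : Measurable fun z => pathWeight F σ y r n L κ
        (Function.updateFinset u (unrealized n κ) z) φ := (hmeas L κ).comp measurable_updateFinset
    rw [lintegral_add_left hm]
    congr 1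
    change posMarginal (unrealized n κ)
      (fun u => crossTerm F σ y r n (pathWeight F σ y r n L) (a, i) κ u φ) u = _
    rw [unrealized_eq_insert hi, posMarginal,
      lmarginal_insert _ hcross (notMem_unrealized_bump i)]
    have hae : ∀ᵐ v : E3, posMarginal (unrealized n (bump κ i))
        (fun u => crossTerm F σ y r n (pathWeight F σ y r n L) (a, i) κ u φ)
          (Function.update u (i, κ i) v)
        = ENNReal.ofReal (volDensity (Real.exp (r (i, κ i))) v) *
          ENNReal.ofReal (‖collapse F σ (chainOf y r u) (known n κ) i (κ i) a
            ((worldPt y r u i (κ i)).2 + v) (restOp F (chainOf y r u) n κ D i φ)‖ ^ 2) := by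
      filter_upwards [ae_posMarginal_update hreg hi] with v hv
      have hA : AgreeBelow (known n κ) (chainOf y r (Function.update u (i, κ i) v))
          (chainOf y r u) := by
        refine agreeBelow_chainOf y r fun p hp => Function.update_of_ne ?_ _ _
        rintro rfl
        exact hp (mem_unrealized.mpr ⟨le_rfl, hi⟩)
      rw [posMarginal_crossTerm F y r hσ hN hi fun ψ =>
        posMarginal_pathWeight hσ L _ (bump κ i) hV (bump_le hκ hi) _ ψ hv,
        Function.update_self, hA.collapse_eq F σ a (lt_known hi), hA.restOp_eq]
      congr 5
      rw [worldPt, Prod.snd_add, Function.update_self, worldPt_congr y r (u' := u) i]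
      intro l' hl'
      refine Function.update_of_ne ?_ _ _
      intro he
      exact hl'.ne (Prod.mk.inj he).2
    rw [lintegral_congr_ae hae]
    -- The path weight uses the position `v` relative to the preceding flash; translation invariance
    -- passes to the absolute position on the hyperboloid.
    have htr := lintegral_add_left_eq_self (μ := (volume : Measure E3))
      (fun ξ => ENNReal.ofReal (volDensity (Real.exp (r (i, κ i))) (ξ - (worldPt y r u i (κ i)).2)) *
          ENNReal.ofReal (‖collapse F σ (chainOf y r u) (known n κ) i (κ i) a ξ
            (restOp F (chainOf y r u) n κ D i φ)‖ ^ 2)) (worldPt y r u i (κ i)).2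
    simp only [add_sub_cancel_left] at htr
    rw [htr]
    by_cases ha : a ≤ n
    · exact hc.lintegral_collapse F hσ (lt_known hi) (cellRegular_of_posMarginal hreg hκ hi ha) _
    · have he : sheetCell (chainOf y r u) (known n κ) i (κ i) a = ∅ := by
        rw [Set.eq_empty_iff_forall_notMem]
        exact fun ξ hξ => ha ((hc.of_mem_sheetCell (lt_known hi) hξ).1.trans known_le)
      have h0 : ∀ ξ, collapse F σ (chainOf y r u) (known n κ) i (κ i) a ξ = 0 := fun ξ =>
        collapse_eq_zero F σ (by rw [he]; exact notMem_empty _)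
      simp [he, h0, PVM.toFun_empty]

end Path

/-! ### The cells containing the flashes -/

section Faithful

variable {N : ℕ} {n κ : Fin N → ℕ} {h : Fin N → ℕ → HypParam}
  {D : Set ((Fin N → ℕ) × Fin N)} {a : Fin N → ℕ} {i : Fin N}

/-- The cell containing the flash `(i, l)`, if all hyperboloids are taken into account. -/
def flashCell (h : Fin N → ℕ → HypParam) (n : Fin N → ℕ) (i : Fin N) (l : ℕ) : Fin N → ℕ :=
  cellAt h n (h i (l + 1)).1.1

theorem flashCell_le : flashCell h n i ≤ fun _ => n := fun _ => cellAt_le _ _ _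

theorem IsChain.flashCell_self (hc : IsChain h) {l : ℕ} (hl : l < n i) :
    flashCell h n i l i = l + 1 := by
  rw [flashCell, hc.flash_eq, hc.cellAt_sheetPt hl]

theorem IsChain.flash_mem_iff (hc : IsChain h) {K : Fin N → ℕ} {l : ℕ} :
    (h i (l + 1)).1.1.2 ∈ sheetCell h K i l a ↔ cellAt h K (h i (l + 1)).1.1 = a := by
  rw [mem_sheetCell, ← hc.flash_eq]

theorem IsChain.flashCell_le_of_lt (hc : IsChain h) {l l' : ℕ} (hl : l < l') :
    flashCell h n i l ≤ flashCell h n i l' := by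
  refine cellAt_flash_le (κ := fun _ => l) ?_
  have h1 := (hc.strictMono i (h i (l' + 1)).1.1.2).monotone (show l + 1 ≤ l' by omega)
  exact h1.trans (hc i l').ge

/-- Exactly those flashes are realized that lie in the crossed 3-cells. -/
def Faithful (h : Fin N → ℕ → HypParam) (n κ : Fin N → ℕ) (D : Set ((Fin N → ℕ) × Fin N)) : Prop :=
  ∀ i, ∀ l < n i, (flashCell h n i l, i) ∈ D ↔ l < κ i

/-- A flash in the cell about to be crossed is not yet realized. Were it later than the next one,
the next flash would lie in a strictly lower cell, which has been crossed, and would therefore be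
realized already. -/
theorem Faithful.eq_of_isNext (hf : Faithful h n κ D) (hc : IsChain h) (hN : IsNext D a i) {l : ℕ}
    (hl : l < n i) (ha : flashCell h n i l = a) : l = κ i := by
  have h1 : ¬ l < κ i := by
    rw [← hf i l hl, ha]
    obtain ⟨V, -, -, -, -, -, h⟩ := hN
    exact h
  by_contra hne
  have hlt : κ i < l := by omega
  refine lt_irrefl (κ i) ((hf i (κ i) (hlt.trans hl)).mp (hN.mem_of_lt ?_ ?_ i))
  · rw [← ha]; exact hc.flashCell_le_of_lt hlt
  · intro he
    have h2 := congrFun (he.trans ha.symm) i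
    rw [hc.flashCell_self hl, hc.flashCell_self (hlt.trans hl)] at h2
    omega

/-- The unknown hyperboloids do not affect the cell of the next flash. If one of particle `j` had it
in its future, the pending flash of `j` would lie in a strictly lower cell than `a`, thus in a
crossed one, and would be realized. -/
theorem Faithful.cellAt_known (hf : Faithful h n κ D) (hc : IsChain h) (hN : IsNext D a i)
    (ha : flashCell h n i (κ i) = a) :
    cellAt h (known n κ) (h i (κ i + 1)).1.1 = a := by
  set x := (h i (κ i + 1)).1.1 with hx
  rw [← ha, flashCell, ← hx]
  refine le_antisymm (cellAt_mono known_le x) fun j => ?_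
  by_contra! hlt
  obtain ⟨h1, h2⟩ := hc.lt_cellAt_iff.mp hlt
  have h3 : ¬ cellAt h (known n κ) x j < known n κ j := fun h4 =>
    lt_irrefl _ (hc.lt_cellAt_iff.mpr ⟨h4, h2⟩)
  have h4 : κ j + 1 ≤ cellAt h (known n κ) x j := by
    have : ¬ cellAt h (known n κ) x j < min (κ j + 1) (n j) := h3
    omega
  have h5 : sheet h j (κ j + 1) x.2 ≤ x.1 := ((hc.strictMono j x.2).monotone h4).trans h2
  have h6 : flashCell h n j (κ j) ≤ a := by
    rw [← ha]; exact cellAt_flash_le h5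
  have h7 : κ j + 1 < a j := by
    rw [← ha]
    exact hc.lt_cellAt_iff.mpr ⟨h4.trans_lt h1, h5⟩
  have hlt : κ j < n j := by omega
  refine lt_irrefl (κ j) ((hf j (κ j) hlt).mp (hN.mem_of_lt h6 ?_ j))
  intro he
  have := congrFun he j
  rw [hc.flashCell_self hlt] at this
  omega

theorem Faithful.insert_bump (hf : Faithful h n κ D) (hc : IsChain h) (hi : κ i < n i)
    (ha : flashCell h n i (κ i) = a) : Faithful h n (bump κ i) (insert (a, i) D) := by
  intro j l hl
  rw [mem_insert_iff, Prod.mk.injEq, hf j l hl]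
  by_cases hj : j = i
  · subst hj
    rw [bump_self]
    constructor
    · rintro (⟨h1, -⟩ | h1)
      · have := congrFun (h1.trans ha.symm) j
        rw [hc.flashCell_self hl, hc.flashCell_self hi] at this
        omega
      · omega
    · intro h1
      rcases (Nat.lt_succ_iff.mp h1).eq_or_lt with h2 | h2
      · left; rw [h2]; exact ⟨ha, rfl⟩
      · right; exact h2
  · rw [bump_of_ne κ hj]
    simp [hj]

theorem Faithful.insert (hf : Faithful h n κ D) (hc : IsChain h) (hN : IsNext D a i)
    (hn : ¬ (κ i < n i ∧ flashCell h n i (κ i) = a)) : Faithful h n κ (insert (a, i) D) := by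
  intro j l hl
  rw [mem_insert_iff, Prod.mk.injEq, hf j l hl]
  refine ⟨?_, Or.inr⟩
  rintro (⟨h1, rfl⟩ | h1)
  · have := hf.eq_of_isNext hc hN hl h1
    exact absurd ⟨this ▸ hl, this ▸ h1⟩ hn
  · exact h1

end Faithful

/-! ### Only one branch of the path weight survives for a given flash pattern. -/

section Pointwise

variable {N : ℕ} {n : Fin N → ℕ}
  {H : Type*} [NormedAddCommGroup H] [InnerProductSpace ℂ H] [CompleteSpace H]
  (F : LocalFamily N H) (σ : ℝ) (y : Fin N → Minkowski) (r : Fin N × ℕ → ℝ)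

open Classical in
/-- The factor contributed when the 3-cell `(a, i)` is crossed. -/
def crossFactor (h : Fin N → ℕ → HypParam) (n : Fin N → ℕ) (p : (Fin N → ℕ) × Fin N) :
    H →L[ℂ] H :=
  if 1 ≤ p.1 p.2 ∧ flashCell h n p.2 (p.1 p.2 - 1) = p.1 then
    (F.hyp (h p.2 (p.1 p.2 - 1)) p.2).multOp (prof σ (h p.2 (p.1 p.2 - 1)).1
      (sheetCell h n p.2 (p.1 p.2 - 1) p.1) (h p.2 (p.1 p.2 - 1 + 1)).1.1.2)
  else 1

/-- The product of the factors of the 3-cells in a list, the first one applied first. -/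
def pathOp (h : Fin N → ℕ → HypParam) (n : Fin N → ℕ) (L : List ((Fin N → ℕ) × Fin N)) :
    H →L[ℂ] H := (L.reverse.map (crossFactor F σ h n)).prod

theorem pathOp_cons_apply (h : Fin N → ℕ → HypParam) (p : (Fin N → ℕ) × Fin N)
    (L : List ((Fin N → ℕ) × Fin N)) (φ : H) :
    pathOp F σ h n (p :: L) φ = pathOp F σ h n L (crossFactor F σ h n p φ) := by
  simp [pathOp]

variable {u : Fin N × ℕ → E3}

/-- A flash whose final cell has been crossed can no longer be realized: that would require crossing
a cell `a` at most equal to its final cell, and a crossed cell cannot lie above one still to be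
crossed. So the path ends with an unrealized flash. -/
theorem pathWeight_eq_zero :
    ∀ (L : List ((Fin N → ℕ) × Fin N)) (D : Set ((Fin N → ℕ) × Fin N)) (κ : Fin N → ℕ) (φ : H),
      ValidFrom n D L → ∀ {i : Fin N} {l : ℕ}, κ i ≤ l → l < n i →
      (flashCell (chainOf y r u) n i l, i) ∈ D → pathWeight F σ y r n L κ u φ = 0
  | [], D, κ, φ, _, i, l, hκ, hl, _ => by
    simp only [pathWeight]
    rw [if_neg]
    rintro rfl
    omega
  | (a, i') :: L, D, κ, φ, ⟨hN, hV⟩, i, l, hκ, hl, hD => by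
    simp only [pathWeight]
    rw [pathWeight_eq_zero L _ κ φ hV hκ hl (Or.inr hD), zero_add, crossTerm]
    split_ifs with hcond
    · rw [pathWeight_eq_zero L _ (bump κ i') _ hV (i := i) (l := l) ?_ hl (Or.inr hD), mul_zero]
      by_cases hi : i = i'
      · subst hi
        rw [bump_self]
        by_contra hle
        have hlκ : l = κ i := by omega
        subst hlκ
        have h1 : a ≤ flashCell (chainOf y r u) n i (κ i) := by
          have h0 : cellAt (chainOf y r u) (known n κ) (worldPt y r u i (κ i + 1)) = a := hcond.2
          rw [← h0]
          exact cellAt_mono known_le _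
        have h2 := hN.eq_of_le (Or.inr hD) h1
        obtain ⟨V, -, -, -, -, -, h⟩ := hN
        rw [h2] at hD
        exact h hD
      · rwa [bump_of_ne κ hi]
    · rfl

/-- A nonzero weight means that some path realizes all flashes, and each realization leaves the
already crossed cells unchanged. So they are the final ones. -/
theorem sheetCell_eq_of_pathWeight_ne_zero :
    ∀ (L : List ((Fin N → ℕ) × Fin N)) (D : Set ((Fin N → ℕ) × Fin N)) (κ : Fin N → ℕ) (φ : H),
      ValidFrom n D L → pathWeight F σ y r n L κ u φ ≠ 0 → ∀ b j l, (b, j) ∈ D → l + 1 = b j →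
      sheetCell (chainOf y r u) (known n κ) j l b = sheetCell (chainOf y r u) n j l b
  | [], D, κ, φ, _, hw, b, j, l, _, _ => by
    simp only [pathWeight] at hw
    have : κ = n := by
      by_contra hne
      exact hw (if_neg hne)
    rw [this, known_self]
  | (a, i) :: L, D, κ, φ, ⟨hN, hV⟩, hw, b, j, l, hb, hl => by
    simp only [pathWeight] at hw
    by_cases h1 : pathWeight F σ y r n L κ u φ = 0
    · rw [h1, zero_add, crossTerm] at hw
      split_ifs at hw with hcond
      · have h2 := right_ne_zero_of_mul hw
        rw [← sheetCell_eq_of_pathWeight_ne_zero L _ _ _ hV h2 b j l (Or.inr hb) hl]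
        exact ((isChain_chainOf y r u).sheetCell_bump hcond.2 (hN.eq_of_le (Or.inr hb)) hl).symm
      · exact absurd rfl hw
    · exact sheetCell_eq_of_pathWeight_ne_zero L _ κ φ hV h1 b j l (Or.inr hb) hl

/-- The crossed 3-cells are not changed by the flashes realized later. -/
theorem sheetCell_eq_of_faithful :
    ∀ (L : List ((Fin N → ℕ) × Fin N)) (D : Set ((Fin N → ℕ) × Fin N)) (κ : Fin N → ℕ),
      ValidFrom n D L → κ ≤ n → Faithful (chainOf y r u) n κ D → ∀ b j l, (b, j) ∈ D → l + 1 = b j →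
      sheetCell (chainOf y r u) (known n κ) j l b = sheetCell (chainOf y r u) n j l b
  | [], D, κ, hD, hκ, hf, b, j, l, _, _ => by
    have : κ = n := by
      refine le_antisymm hκ fun i => ?_
      by_contra! hlt
      exact lt_irrefl _ ((hf i (κ i) hlt).mp (hD _ (flashCell_le _) i))
    rw [this, known_self]
  | (a, i) :: L, D, κ, ⟨hN, hV⟩, hκ, hf, b, j, l, hb, hl => by
    have hc := isChain_chainOf y r u
    by_cases hi : κ i < n i ∧ flashCell (chainOf y r u) n i (κ i) = a
    · rw [← sheetCell_eq_of_faithful L _ _ hV (bump_le hκ hi.1) (hf.insert_bump hc hi.1 hi.2) b j l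
        (Or.inr hb) hl]
      exact (hc.sheetCell_bump (hf.cellAt_known hc hN hi.2) (hN.eq_of_le (Or.inr hb)) hl).symm
    · exact sheetCell_eq_of_faithful L _ κ hV hκ (hf.insert hc hN hi) b j l (Or.inr hb) hl

/-- The weight of a flash pattern is given by the collapse operators of the 3-cells that contain
the flashes. -/
theorem pathWeight_eq (hreg : AllRegular y n r u) :
    ∀ (L : List ((Fin N → ℕ) × Fin N)) (D : Set ((Fin N → ℕ) × Fin N)) (κ : Fin N → ℕ) (φ : H),
      ValidFrom n D L → κ ≤ n → Faithful (chainOf y r u) n κ D →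
      pathWeight F σ y r n L κ u φ =
        (∏ p ∈ unrealized n κ, ENNReal.ofReal (volDensity (Real.exp (r p)) (u p))) *
          ENNReal.ofReal (‖pathOp F σ (chainOf y r u) n L φ‖ ^ 2)
  | [], D, κ, φ, hD, hκ, hf => by
    have : κ = n := by
      refine le_antisymm hκ fun i => ?_
      by_contra! hlt
      exact lt_irrefl _ ((hf i (κ i) hlt).mp (hD _ (flashCell_le _) i))
    rw [this, unrealized_self]
    simp [pathWeight, pathOp]
  | (a, i) :: L, D, κ, φ, ⟨hN, hV⟩, hκ, hf => by
    have hc := isChain_chainOf y r u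
    simp only [pathWeight, pathOp_cons_apply]
    by_cases hi : κ i < n i ∧ flashCell (chainOf y r u) n i (κ i) = a
    · have hx := hf.cellAt_known hc hN hi.2
      have hf' := hf.insert_bump hc hi.1 hi.2
      have hai : a i = κ i + 1 := by rw [← hi.2, hc.flashCell_self hi.1]
      -- The branch that skips this flash vanishes, because the flash would remain unrealized in a
      -- crossed cell.
      rw [pathWeight_eq_zero F σ y r L _ κ φ hV le_rfl hi.1 (by rw [hi.2]; exact Or.inl rfl),
        zero_add, crossTerm, if_pos ⟨hi.1, hx⟩]
      simp only
      rw [pathWeight_eq hreg L _ _ _ hV (bump_le hκ hi.1) hf', unrealized_eq_insert hi.1,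
        Finset.prod_insert (notMem_unrealized_bump i), mul_assoc]
      congr 6
      have hcell : sheetCell (chainOf y r u) (known n κ) i (κ i) a
          = sheetCell (chainOf y r u) n i (κ i) a := by
        rw [← sheetCell_eq_of_faithful y r L _ _ hV (bump_le hκ hi.1) hf' a i (κ i) (Or.inl rfl)
          hai.symm]
        exact (hc.sheetCell_bump hx (fun _ => rfl) hai.symm).symm
      have hprof : cellProf σ (chainOf y r u) (known n κ) i (κ i) a (worldPt y r u i (κ i + 1)).2
          = prof σ (chainOf y r u i (κ i)).1 (sheetCell (chainOf y r u) n i (κ i) a)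
            (worldPt y r u i (κ i + 1)).2 := by
        funext η
        rw [cellProf, if_pos (hreg κ hκ i hi.1 a (hi.2 ▸ flashCell_le _)), hcell]
      rw [collapse, hprof, crossFactor]
      simp only [hai, Nat.add_sub_cancel]
      rw [if_pos ⟨by omega, hi.2⟩]
      rfl
    · have hf' := hf.insert hc hN hi
      have h1 : crossFactor F σ (chainOf y r u) n (a, i) = 1 := by
        rw [crossFactor, if_neg]
        rintro ⟨h1, h2⟩
        simp only at h1 h2
        have hle : a i ≤ n i := by rw [← h2]; exact flashCell_le _ _
        have hlt : a i - 1 < n i := by omega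
        have h3 := hf.eq_of_isNext hc hN hlt h2
        exact hi ⟨h3 ▸ hlt, h3 ▸ h2⟩
      rw [h1]
      change _ = _ * ENNReal.ofReal (‖pathOp F σ (chainOf y r u) n L φ‖ ^ 2)
      rw [← pathWeight_eq hreg L _ κ φ hV hκ hf']
      refine (congrArg _ ?_).trans (add_zero _)
      -- The branch that realizes a flash here vanishes too. Otherwise the cell `a` would not change
      -- any more, and the flash would finally lie in `a`, contrary to the case assumption.
      rw [crossTerm]
      split_ifs with hcond
      · by_contra hne
        refine hi ⟨hcond.1, ?_⟩
        have hai : a i = κ i + 1 := by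
          have h0 : cellAt (chainOf y r u) (known n κ) (chainOf y r u i (κ i + 1)).1.1 = a := hcond.2
          rw [← h0, hc.flash_eq, hc.cellAt_sheetPt (lt_known hcond.1)]
        have h2 := sheetCell_eq_of_pathWeight_ne_zero F σ y r L _ _ _ hV
          (right_ne_zero_of_mul hne) a i (κ i) (Or.inl rfl) hai.symm
        rw [hc.sheetCell_bump hcond.2 (fun _ => rfl) hai.symm] at h2
        have h3 := hc.flash_mem_iff.mpr hcond.2
        rw [h2] at h3
        exact hc.flash_mem_iff.mp h3
      · rfl

end Pointwise

/-! ### Almost every flash pattern is regular. -/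

section Total

variable {N : ℕ} {n : Fin N → ℕ} (y : Fin N → Minkowski)

theorem worldPt_update_of_ne (r : Fin N × ℕ → ℝ) (u : Fin N × ℕ → E3) {i j : Fin N} (hj : j ≠ i)
    (l m : ℕ) (s : ℝ) : worldPt y (Function.update r (i, l) s) u j m = worldPt y r u j m := by
  induction m with
  | zero => rfl
  | succ m ih =>
    rw [worldPt, worldPt, ih, Function.update_of_ne]
    simp [hj]

theorem worldPt_update_of_le (r : Fin N × ℕ → ℝ) (u : Fin N × ℕ → E3) (i : Fin N)
    {l m : ℕ} (hm : m ≤ l) (s : ℝ) :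
    worldPt y (Function.update r (i, l) s) u i m = worldPt y r u i m := by
  induction m with
  | zero => rfl
  | succ m ih =>
    rw [worldPt, worldPt, ih (by omega), Function.update_of_ne]
    simp only [ne_eq, Prod.mk.injEq, true_and]
    omega

/-- The proper time of the flash `(i, l)` enters only as the radius of the sheet under
consideration: its base point and the sheets of the other particles stay fixed, and later sheets of
`i` bound no cell on it. -/
theorem countable_not_cellRegular (r : Fin N × ℕ → ℝ) (u : Fin N × ℕ → E3) (K : Fin N → ℕ)
    (i : Fin N) (l : ℕ) (a : Fin N → ℕ) :
    {s : ℝ | ¬ CellRegular (chainOf y (Function.update r (i, l) s) u) K i l a}.Countable := by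
  have h1 : ∀ (s : ℝ) (j : Fin N) (m : ℕ), j ≠ i →
      chainOf y (Function.update r (i, l) s) u j m = chainOf y r u j m := by
    intro s j m hj
    refine Subtype.ext (Prod.ext (worldPt_update_of_ne y r u hj l m s) ?_)
    change Real.exp _ = Real.exp _
    rw [Function.update_of_ne]
    simp [hj]
  have h2 : ∀ s : ℝ, (chainOf y (Function.update r (i, l) s) u i l).1
      = (worldPt y r u i l, Real.exp s) := by
    intro s
    unfold chainOf
    simp only [worldPt_update_of_le y r u i le_rfl, Function.update_self]
  refine (countable_not_regularRegion
    (fun j : {j // j ≠ i ∧ 1 ≤ a j ∧ a j - 1 < K j} => (chainOf y r u j (a j - 1)).1)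
    (fun j : {j // j ≠ i ∧ a j < K j} => (chainOf y r u j (a j)).1) (worldPt y r u i l)).mono ?_
  intro s hs
  rw [mem_ofPred_eq] at hs ⊢
  unfold CellRegular at hs
  rw [h2] at hs
  convert hs using 3
  · rw [h1 s _ _ (by rename_i j; exact j.2.1)]
  · rw [h1 s _ _ (by rename_i j; exact j.2.1)]

/-- Each irregularity has measure zero in the one proper time that sets the radius, hence in all of
them by Fubini, and there are only countably many cells and configurations. -/
theorem ae_allRegular_left (r₀ : Fin N × ℕ → ℝ) (u : Fin N × ℕ → E3) :
    ∀ᵐ ρ : unrealized n 0 → ℝ, AllRegular y n (Function.updateFinset r₀ (unrealized n 0) ρ) u := by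
  unfold AllRegular
  simp only [ae_all_iff]
  intro κ hκ i hi a ha
  let B : Set (Fin N × ℕ → ℝ) := {r | ¬ CellRegular (chainOf y r u) (known n κ) i (κ i) a}
  have hB : MeasurableSet B :=
    (measurableSet_setOf_cellRegular (known n κ) (h := fun r => chainOf y r u)
      (fun j m => measurable_chainOf y (r := fun r => r) (u := fun _ => u) measurable_id
        measurable_const j m) i (κ i) a).compl
  have h1 : lmarginal (fun _ => (volume : Measure ℝ)) (unrealized n 0) (B.indicator 1) r₀ = 0 := by
    rw [lmarginal_erase' _ (measurable_one.indicator hB)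
      (mem_unrealized.mpr ⟨Nat.zero_le _, hi⟩ : (i, κ i) ∈ unrealized n 0)]
    have : ∀ r, ∫⁻ s, B.indicator (1 : (Fin N × ℕ → ℝ) → ℝ≥0∞) (Function.update r (i, κ i) s)
        = 0 := by
      intro r
      have hc := (countable_not_cellRegular y r u (known n κ) i (κ i) a).ae_notMem volume
      rw [lintegral_congr_ae (g := fun _ => 0), lintegral_zero]
      filter_upwards [hc] with s hs
      exact indicator_of_notMem hs _
    simp [this, lmarginal]
  have hm : Measurable fun ρ : unrealized n 0 → ℝ =>
      B.indicator (1 : (Fin N × ℕ → ℝ) → ℝ≥0∞) (Function.updateFinset r₀ (unrealized n 0) ρ) :=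
    (measurable_one.indicator hB).comp measurable_updateFinset
  rw [lmarginal, lintegral_eq_zero_iff hm] at h1
  filter_upwards [h1] with ρ hρ
  by_contra hn
  rw [indicator_of_mem (show _ ∈ B from hn)] at hρ
  exact one_ne_zero hρ

variable (n) in
/-- The proper times between the flashes, extended by `0`. -/
def extTime (ρ : unrealized n 0 → ℝ) : Fin N × ℕ → ℝ :=
  Function.updateFinset 0 (unrealized n 0) ρ

variable (n) in
/-- The relative positions of the flashes, extended by `0`. -/
def extPos (z : unrealized n 0 → E3) : Fin N × ℕ → E3 :=
  Function.updateFinset 0 (unrealized n 0) z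

theorem measurable_extTime : Measurable (extTime n) := measurable_updateFinset

theorem measurable_extPos : Measurable (extPos n) := measurable_updateFinset

/-- Irregular proper times are negligible for every choice of positions; measurability of the joint
set lets Fubini exchange the roles, so that for almost all times almost all positions are regular.
-/
theorem ae_allRegular : ∀ᵐ q : (unrealized n 0 → ℝ) × (unrealized n 0 → E3),
    AllRegular y n (extTime n q.1) (extPos n q.2) := by
  have hm : MeasurableSet {q : (unrealized n 0 → E3) × (unrealized n 0 → ℝ) |
      AllRegular y n (extTime n q.2) (extPos n q.1)} :=
    measurableSet_setOf_allRegular y n (measurable_extTime.comp measurable_snd)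
      (measurable_extPos.comp measurable_fst)
  have h1 : ∀ᵐ q : (unrealized n 0 → E3) × (unrealized n 0 → ℝ),
      AllRegular y n (extTime n q.2) (extPos n q.1) := by
    rw [Measure.volume_eq_prod, Measure.ae_prod_iff_ae_ae hm]
    exact ae_of_all _ fun z => ae_allRegular_left y 0 (extPos n z)
  exact (Measure.measurePreserving_swap (μ := (volume : Measure (unrealized n 0 → ℝ)))
    (ν := (volume : Measure (unrealized n 0 → E3)))).quasiMeasurePreserving.ae h1

variable {H : Type*} [NormedAddCommGroup H] [InnerProductSpace ℂ H] [CompleteSpace H]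
  (F : LocalFamily N H)

theorem remOp_empty (h : Fin N → ℕ → HypParam) (κ : Fin N → ℕ) : remOp F h n κ ∅ = 1 := by
  unfold remOp
  refine List.prod_eq_one fun T hT => ?_
  obtain ⟨i, -, rfl⟩ := List.mem_map.mp hT
  unfold remFactor
  split_ifs
  · simp [doneRegion, (PVM.isPOVM _).univ]
  · rfl

/-- For almost all proper times, the probabilities of the relative positions add up to one. -/
theorem lintegral_pathOp {σ : ℝ} (hσ : 0 < σ) {L : List ((Fin N → ℕ) × Fin N)}
    (hL : ValidFrom n ∅ L) (φ : H) : ∀ᵐ ρ : unrealized n 0 → ℝ,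
    ∫⁻ z, (∏ p ∈ unrealized n 0,
        ENNReal.ofReal (volDensity (Real.exp (extTime n ρ p)) (extPos n z p))) *
      ENNReal.ofReal (‖pathOp F σ (chainOf y (extTime n ρ) (extPos n z)) n L φ‖ ^ 2)
      = ENNReal.ofReal (‖φ‖ ^ 2) := by
  have h1 := ae_allRegular (n := n) y
  rw [Measure.volume_eq_prod] at h1
  filter_upwards [Measure.ae_ae_of_ae_prod h1] with ρ hρ
  have h2 : posMarginal (unrealized n 0) (irregular y n (extTime n ρ)) 0 = 0 := by
    rw [posMarginal, lmarginal, lintegral_congr_ae (g := fun _ => 0), lintegral_zero]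
    filter_upwards [hρ] with z hz
    exact indicator_of_notMem (notMem_compl_iff.mpr hz) _
  have h3 := posMarginal_pathWeight F y (extTime n ρ) hσ L ∅ 0 hL (fun _ => Nat.zero_le _) 0 φ h2
  rw [remOp_empty] at h3
  refine Eq.trans ?_ h3
  rw [posMarginal, lmarginal]
  refine lintegral_congr_ae ?_
  filter_upwards [hρ] with z hz
  symm
  refine pathWeight_eq F σ y (extTime n ρ) hz L ∅ 0 φ hL (fun _ => Nat.zero_le _) ?_
  intro i l _
  simp

end Total

/-! ### Admissible sequences -/

section Admissible

variable {N : ℕ} {n : Fin N → ℕ}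

/-- A cell as a function to the natural numbers. -/
def cellVal (a : Cell n) : Fin N → ℕ := fun i => a i

theorem cellVal_injective : Function.Injective (cellVal (n := n)) := fun _ _ h =>
  funext fun i => Fin.ext (congrFun h i)

theorem cellVal_le (a : Cell n) : cellVal a ≤ n := fun i => Nat.lt_succ_iff.mp (a i).2

theorem exists_cellVal {b : Fin N → ℕ} (hb : b ≤ n) : ∃ c : Cell n, cellVal c = b :=
  ⟨fun i => ⟨b i, Nat.lt_succ_of_le (hb i)⟩, rfl⟩

/-- Descend from `b` to `c` by predecessors, lowering one index by one each time; `d` is the number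
of steps left. -/
theorem PredecessorComplete.of_le {V : Set (Cell n)} (hV : PredecessorComplete V) :
    ∀ (d : ℕ) (b c : Cell n), ∑ i, (cellVal b i - cellVal c i) = d → cellVal c ≤ cellVal b →
      b ∈ V → c ∈ V
  | 0, b, c, hd, hle, hb => by
    have : c = b := by
      apply cellVal_injective
      refine le_antisymm hle fun i => ?_
      have := (Finset.sum_eq_zero_iff.mp hd) i (Finset.mem_univ i)
      exact Nat.sub_eq_zero_iff_le.mp this
    rwa [this]
  | d + 1, b, c, hd, hle, hb => by
    obtain ⟨i, -, hi⟩ : ∃ i ∈ Finset.univ, cellVal b i - cellVal c i ≠ 0 := by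
      apply Finset.exists_ne_zero_of_sum_ne_zero
      omega
    have hpos : 0 < cellVal b i - cellVal c i := Nat.pos_of_ne_zero hi
    obtain ⟨b', hb'⟩ : ∃ b' : Cell n, cellVal b' = Function.update (cellVal b) i (cellVal b i - 1) := by
      refine exists_cellVal fun j => ?_
      have : cellVal b j ≤ n j := cellVal_le b j
      by_cases hj : j = i
      · subst hj; rw [Function.update_self]; exact (Nat.sub_le _ _).trans this
      · rwa [Function.update_of_ne hj]
    have hb'i : cellVal b' i = cellVal b i - 1 := by rw [hb', Function.update_self]
    have hb'j : ∀ j, j ≠ i → cellVal b' j = cellVal b j := fun j hj => by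
      rw [hb', Function.update_of_ne hj]
    refine PredecessorComplete.of_le hV d b' c ?_ ?_ (hV b' b ⟨i, ?_, fun j hj => Fin.ext (hb'j j hj)⟩ hb)
    · rw [← Finset.add_sum_erase _ _ (Finset.mem_univ i)] at hd ⊢
      have : ∀ j ∈ Finset.univ.erase i, cellVal b' j - cellVal c j = cellVal b j - cellVal c j :=
        fun j hj => by rw [hb'j j (Finset.ne_of_mem_erase hj)]
      rw [Finset.sum_congr rfl this, hb'i]
      omega
    · intro j
      by_cases hj : j = i
      · subst hj
        have : cellVal c j ≤ cellVal b j - 1 := by omega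
        rwa [← hb'i] at this
      · rw [hb'j j hj]; exact hle j
    · change cellVal b' i + 1 = cellVal b i
      omega

namespace AdmissibleSequence

variable (s : AdmissibleSequence n)

theorem mem_V_iff (m : ℕ) (hm : m < s.r + 1) (c : Cell n) :
    c ∈ s.V ⟨m, hm⟩ ↔ ∃ m' : Fin s.r, (m' : ℕ) < m ∧ s.crossed m' = c := by
  induction m with
  | zero =>
    have : s.V ⟨0, hm⟩ = ∅ := s.first
    rw [this]
    simp
  | succ m ih =>
    have h1 : m < s.r := by omega
    have h2 : s.V ⟨m + 1, hm⟩ = insert (s.crossed ⟨m, h1⟩) (s.V ⟨m, by omega⟩) := s.step ⟨m, h1⟩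
    rw [h2, mem_insert_iff, ih]
    constructor
    · rintro (h | ⟨m', h, h'⟩)
      · exact ⟨⟨m, h1⟩, Nat.lt_succ_self m, h.symm⟩
      · exact ⟨m', by omega, h'⟩
    · rintro ⟨m', h, h'⟩
      rcases (Nat.lt_succ_iff.mp h).eq_or_lt with h3 | h3
      · left
        rw [← h']
        congr 1
        exact Fin.ext h3
      · exact Or.inr ⟨m', h3, h'⟩

/-- The 3-cells in the order in which they are crossed, where in the step `m` the order is the
reverse of `ord m`. -/
def steps (ord : Fin s.r → Equiv.Perm (Fin N)) : List ((Fin N → ℕ) × Fin N) :=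
  (List.finRange s.r).flatMap fun m =>
    (List.finRange N).reverse.map fun i => (cellVal (s.crossed m), ord m i)

/-- The 3-cells of the 4-cells crossed before step `m`. -/
def before (m : ℕ) : Set ((Fin N → ℕ) × Fin N) :=
  {p | ∃ m' : Fin s.r, (m' : ℕ) < m ∧ cellVal (s.crossed m') = p.1}

/-- Inside step `m`, the completed 4-cells form the predecessor complete set, and `S` holds the
particles whose 3-cells of the current 4-cell have been crossed. Nothing is assumed about the order
within the step. -/
theorem isNext_union {m : Fin s.r} {S : Set (Fin N)} {i : Fin N} (hi : i ∉ S) :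
    IsNext (s.before m ∪ {p | p.1 = cellVal (s.crossed m) ∧ p.2 ∈ S}) (cellVal (s.crossed m)) i := by
  have hV : ∀ c : Cell n, cellVal c ∈ cellVal '' s.V m.castSucc ↔ c ∈ s.V m.castSucc := fun c =>
    cellVal_injective.mem_set_image
  have hbefore : ∀ c : Cell n, c ∈ s.V m.castSucc ↔
      ∃ m' : Fin s.r, (m' : ℕ) < m ∧ s.crossed m' = c := s.mem_V_iff m (by omega)
  refine ⟨cellVal '' s.V m.castSucc, ?_, ?_, ?_, ?_, ?_, ?_⟩
  · rintro _ ⟨b, hb, rfl⟩ c hc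
    obtain ⟨c, rfl⟩ := exists_cellVal (hc.trans (cellVal_le b))
    exact ⟨c, (s.predecessorComplete _).of_le _ b c rfl hc hb, rfl⟩
  · intro c hc hne
    obtain ⟨c, rfl⟩ := exists_cellVal (hc.trans (cellVal_le _))
    rw [hV]
    have h1 : c ∈ s.V m.succ := by
      refine (s.predecessorComplete _).of_le _ (s.crossed m) c rfl hc ?_
      rw [s.step]; exact mem_insert _ _
    rw [s.step] at h1
    exact h1.resolve_left fun h => hne (by rw [h])
  · rw [hV]; exact s.crossed_notMem m
  · rintro b j (⟨m', h1, h2⟩ | ⟨h1, -⟩)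
    · left
      change cellVal (s.crossed m') = b at h2
      rw [← h2, hV, hbefore]
      exact ⟨m', h1, rfl⟩
    · exact Or.inr h1
  · rintro _ ⟨b, hb, rfl⟩ j
    obtain ⟨m', h1, h2⟩ := (hbefore b).mp hb
    exact Or.inl ⟨m', h1, by rw [h2]⟩
  · rintro (⟨m', h1, h2⟩ | ⟨-, h1⟩)
    · refine s.crossed_notMem m ((hbefore _).mpr ⟨m', h1, ?_⟩)
      exact cellVal_injective h2
    · exact hi h1

theorem validFrom_step {m : Fin s.r} {ℓ : List ((Fin N → ℕ) × Fin N)}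
    (hℓ : ValidFrom n (s.before (m + 1)) ℓ) :
    ∀ (l : List (Fin N)) (S : Set (Fin N)), l.Nodup → (∀ i, i ∈ l ↔ i ∉ S) →
      ValidFrom n (s.before m ∪ {p | p.1 = cellVal (s.crossed m) ∧ p.2 ∈ S})
        (l.map (fun i => (cellVal (s.crossed m), i)) ++ ℓ)
  | [], S, _, hS => by
    suffices hset : s.before m ∪ {p | p.1 = cellVal (s.crossed m) ∧ p.2 ∈ S} = s.before (m + 1) by
      rw [hset]; exact hℓ
    ext p
    simp only [before, mem_union, mem_ofPred_eq]
    constructor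
    · rintro (⟨m', h1, h2⟩ | ⟨h1, -⟩)
      · exact ⟨m', by omega, h2⟩
      · exact ⟨m, Nat.lt_succ_self _, h1.symm⟩
    · rintro ⟨m', h1, h2⟩
      rcases (Nat.lt_succ_iff.mp h1).eq_or_lt with h3 | h3
      · refine Or.inr ⟨?_, ?_⟩
        · rw [← h2, Fin.ext h3]
        · by_contra hn
          simpa using (hS p.2).mpr hn
      · exact Or.inl ⟨m', h3, h2⟩
  | i :: l, S, hn, hS => by
    rw [List.nodup_cons] at hn
    refine ⟨s.isNext_union ((hS i).mp List.mem_cons_self), ?_⟩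
    have hset : insert (cellVal (s.crossed m), i)
          (s.before m ∪ {p | p.1 = cellVal (s.crossed m) ∧ p.2 ∈ S}) =
        s.before m ∪ {p | p.1 = cellVal (s.crossed m) ∧ p.2 ∈ insert i S} := by
      ext p
      simp only [mem_insert_iff, mem_union, mem_ofPred_eq, Prod.ext_iff]
      tauto
    rw [hset]
    refine validFrom_step hℓ l (insert i S) hn.2 ?_
    · intro j
      have := hS j
      rw [List.mem_cons] at this
      rw [mem_insert_iff, not_or, ← this]
      constructor
      · intro hj
        refine ⟨?_, Or.inr hj⟩
        rintro rfl
        exact hn.1 hj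
      · rintro ⟨h1, h2⟩
        exact h2.resolve_left h1

theorem validFrom_steps (ord : Fin s.r → Equiv.Perm (Fin N)) :
    ValidFrom n ∅ (s.steps ord) := by
  -- Induction from the end of the sequence: `k` is the number of steps still to be made.
  have key : ∀ k ≤ s.r, ValidFrom n (s.before (s.r - k))
      (((List.finRange s.r).drop (s.r - k)).flatMap fun m =>
        (List.finRange N).reverse.map fun i => (cellVal (s.crossed m), ord m i)) := by
    intro k hk
    induction k with
    | zero =>
      rw [Nat.sub_zero, List.drop_of_length_le (by simp)]
      intro a ha i
      obtain ⟨c, rfl⟩ := exists_cellVal ha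
      have h1 : c ∈ s.V (Fin.last s.r) := by rw [s.last]; exact mem_univ _
      obtain ⟨m', h2, h3⟩ := (s.mem_V_iff s.r (Nat.lt_succ_self _) c).mp h1
      exact ⟨m', h2, by rw [h3]⟩
    | succ k ih =>
      have h1 : s.r - k = s.r - (k + 1) + 1 := by omega
      have h2 : s.r - (k + 1) < s.r := by omega
      have ih := ih (by omega)
      rw [h1] at ih
      rw [List.drop_eq_getElem_cons (by simpa using h2), List.flatMap_cons, List.getElem_finRange]
      have h3 := s.validFrom_step (m := ⟨s.r - (k + 1), h2⟩) ih
        ((List.finRange N).reverse.map (ord ⟨s.r - (k + 1), h2⟩)) ∅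
        (((List.nodup_reverse.mpr (List.nodup_finRange N)).map (Equiv.injective _))) (fun i => by
          simp only [List.mem_map, List.mem_reverse, List.mem_finRange, true_and, mem_empty_iff_false,
            not_false_eq_true, iff_true]
          exact ⟨(ord _).symm i, Equiv.apply_symm_apply _ _⟩)
      convert h3 using 1
      · simp [before]
      · rw [List.map_map]
        rfl
  have h := key s.r le_rfl
  rw [Nat.sub_self, List.drop_zero] at h
  have hset : s.before 0 = ∅ := by
    ext p
    simp [before]
  rw [hset] at h
  exact h

end AdmissibleSequence

end Admissible

/-! ### Hyperbolic coordinates of a product of light cones -/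

section Coordinates

/-- The point of the future of the origin at proper time `exp q.1` with spatial part `q.2`. -/
def coneMap (q : ℝ × E3) : Minkowski := (energy (Real.exp q.1) q.2, q.2)

/-- The Jacobian of `coneMap`. -/
def coneDensity (q : ℝ × E3) : ℝ≥0∞ :=
  ENNReal.ofReal (Real.exp q.1 * volDensity (Real.exp q.1) q.2)

theorem measurable_coneMap : Measurable coneMap := by
  unfold coneMap energy
  fun_prop

theorem measurable_coneDensity : Measurable coneDensity := by
  unfold coneDensity volDensity energy
  fun_prop

theorem injective_coneMap : Function.Injective coneMap := by
  rintro ⟨r, v⟩ ⟨r', v'⟩ h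
  simp only [coneMap, Prod.mk.injEq] at h
  obtain ⟨h1, rfl⟩ := h
  have h2 : Real.exp r ^ 2 = Real.exp r' ^ 2 := by
    have := congrArg (· ^ 2) h1
    simpa [energy_sq] using this
  have h3 := (sq_eq_sq₀ (Real.exp_pos r).le (Real.exp_pos r').le).mp h2
  rw [Real.exp_injective h3]

theorem measurableSet_future (y : Minkowski) : MeasurableSet (future y) := by
  unfold future
  exact measurableSet_le (by fun_prop) (by fun_prop)

theorem hasDerivAt_energy_exp (v : E3) (r : ℝ) :
    HasDerivAt (fun r => energy (Real.exp r) v)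
      (Real.exp r * volDensity (Real.exp r) v) r := by
  have h1 : HasDerivAt (fun r => Real.exp r ^ 2 + ‖v‖ ^ 2) (2 * Real.exp r * Real.exp r) r := by
    have := ((Real.hasDerivAt_exp r).pow 2).add_const (‖v‖ ^ 2)
    simpa using this
  have h2 := h1.sqrt (by positivity)
  refine h2.congr_deriv ?_
  have h3 : energy (Real.exp r) v ≠ 0 := (energy_pos (Real.exp_pos r) v).ne'
  have h4 : √(Real.exp r ^ 2 + ‖v‖ ^ 2) = energy (Real.exp r) v := rfl
  rw [h4, volDensity]
  field_simp

theorem range_energy_exp (v : E3) : (fun r => energy (Real.exp r) v) '' univ = Ioi ‖v‖ := by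
  ext t
  simp only [image_univ, mem_range, mem_Ioi]
  constructor
  · rintro ⟨r, rfl⟩
    exact norm_lt_energy (Real.exp_pos r) v
  · intro ht
    have h0 : 0 < t ^ 2 - ‖v‖ ^ 2 := by nlinarith [norm_nonneg v]
    refine ⟨Real.log (√(t ^ 2 - ‖v‖ ^ 2)), ?_⟩
    rw [Real.exp_log (Real.sqrt_pos.mpr h0), energy, Real.sq_sqrt h0.le, sub_add_cancel,
      Real.sqrt_sq (by linarith [norm_nonneg v])]

/-- For fixed spatial part `v`, the map from `r` to the time coordinate is a bijection onto `(‖v‖,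
∞)` whose derivative is the stated density. The light cone itself is a null set. -/
theorem map_coneMap :
    Measure.map coneMap ((volume : Measure (ℝ × E3)).withDensity coneDensity)
      = (volume : Measure Minkowski).restrict (future 0) := by
  refine Measure.ext_of_lintegral _ fun f hf => ?_
  rw [lintegral_map hf measurable_coneMap,
    lintegral_withDensity_eq_lintegral_mul (g := fun q => f (coneMap q)) _ measurable_coneDensity
      (hf.comp measurable_coneMap),
    ← lintegral_indicator (measurableSet_future 0), Measure.volume_eq_prod,
    lintegral_prod_symm' (coneDensity * fun q => f (coneMap q))
      (measurable_coneDensity.mul (hf.comp measurable_coneMap)),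
    lintegral_prod_symm' _ (hf.indicator (measurableSet_future 0))]
  refine lintegral_congr fun v => ?_
  have h1 : ∀ t : ℝ, (future 0).indicator f (t, v) = (Ici ‖v‖).indicator (fun t => f (t, v)) t := by
    intro t
    refine indicator_eq_indicator ?_ rfl
    simp [future]
  simp only [h1]
  rw [lintegral_indicator measurableSet_Ici, ← restrict_Ioi_eq_restrict_Ici, ← range_energy_exp,
    lintegral_image_eq_lintegral_abs_deriv_mul MeasurableSet.univ
      (fun r _ => (hasDerivAt_energy_exp v r).hasDerivWithinAt), Measure.restrict_univ]
  · refine lintegral_congr fun r => ?_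
    rw [abs_of_nonneg]
    · rfl
    · have := (energy_pos (Real.exp_pos r) v).le
      unfold volDensity
      positivity
  · intro r _ r' _ h
    have : coneMap (r, v) = coneMap (r', v) := Prod.ext h rfl
    exact congrArg Prod.fst (injective_coneMap this)

/-- The points `y + v 0 + … + v k`. -/
def walk {m : ℕ} (y : Minkowski) (v : Fin m → Minkowski) (k : Fin m) : Minkowski :=
  y + ∑ j, if j ≤ k then v j else 0

theorem walk_cons {m : ℕ} (y v₀ : Minkowski) (v : Fin m → Minkowski) :
    walk y (Fin.cons v₀ v : Fin (m + 1) → Minkowski) = Fin.cons (y + v₀) (walk (y + v₀) v) := by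
  ext1 k
  refine Fin.cases ?_ (fun k => ?_) k
  · simp [walk]
  · simp [walk, Fin.sum_univ_succ, add_assoc]

theorem measurable_walk {m : ℕ} : Measurable fun p : Minkowski × (Fin m → Minkowski) =>
    walk p.1 p.2 := by
  refine measurable_pi_lambda _ fun k => ?_
  unfold walk
  refine measurable_fst.add (Finset.measurable_sum _ fun j _ => ?_)
  split_ifs
  · fun_prop
  · exact measurable_const

/-- The map is a shear: the first point is a translate of the first step, and given it, the
remaining points are a walk from that point, which preserves volume by induction. -/
theorem measurePreserving_walk (m : ℕ) (y : Minkowski) :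
    MeasurePreserving (walk y : (Fin m → Minkowski) → Fin m → Minkowski) := by
  induction m generalizing y with
  | zero =>
    have : (walk y : (Fin 0 → Minkowski) → Fin 0 → Minkowski) = id := funext fun v =>
      Subsingleton.elim _ _
    rw [this]; exact MeasurePreserving.id _
  | succ m ih =>
    have e := volume_preserving_piFinSuccAbove (fun _ : Fin (m + 1) => Minkowski) 0
    have h1 : MeasurePreserving (fun p : Minkowski × (Fin m → Minkowski) =>
        (y + p.1, walk (y + p.1) p.2)) := by
      have : (volume : Measure Minkowski).IsAddLeftInvariant :=
        inferInstanceAs ((volume : Measure ℝ).prod (volume : Measure E3)).IsAddLeftInvariant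
      refine (measurePreserving_add_left volume y).skew_product
        (g := fun v₀ v => walk (y + v₀) v) ?_ (ae_of_all _ fun v₀ => (ih (y + v₀)).map_eq)
      exact measurable_walk.comp ((measurable_const.add measurable_fst).prodMk measurable_snd)
    have h2 := (e.symm _).comp (h1.comp e)
    convert h2 using 1
    ext1 v
    rw [← Fin.cons_self_tail v, walk_cons]
    simp [Function.comp_def, MeasurableEquiv.piFinSuccAbove, Fin.insertNthEquiv]

theorem walk_zero_iff {m : ℕ} (y : Minkowski) (v : Fin m → Minkowski) (k : Fin m) :
    (Fin.cons y (walk y v) : Fin (m + 1) → Minkowski) k.succ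
      = (Fin.cons y (walk y v) : Fin (m + 1) → Minkowski) k.castSucc + v k := by
  induction m generalizing y with
  | zero => exact k.elim0
  | succ m ih =>
    rw [← Fin.cons_self_tail v, walk_cons]
    refine Fin.cases ?_ (fun k => ?_) k
    · simp
    · rw [Fin.cons_succ, ih]
      rfl

theorem injective_walk {m : ℕ} (y : Minkowski) :
    Function.Injective (walk y : (Fin m → Minkowski) → Fin m → Minkowski) := by
  intro v v' h
  ext1 k
  have h1 := walk_zero_iff y v k
  have h2 := walk_zero_iff y v' k
  rw [h, h2] at h1
  exact (add_left_cancel h1).symm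

end Coordinates

/-! ### Hyperbolic coordinates of flash patterns -/

section FlashCoordinates

variable {N : ℕ} {n : Fin N → ℕ}

theorem lintegral_pi_prod {ι : Type*} [Fintype ι] {α : ι → Type*} [∀ i, MeasurableSpace (α i)]
    (μ : ∀ i, Measure (α i)) [∀ i, SigmaFinite (μ i)] {f : ∀ i, α i → ℝ≥0∞}
    (hf : ∀ i, Measurable (f i)) :
    ∫⁻ x, ∏ i, f i (x i) ∂Measure.pi μ = ∏ i, ∫⁻ t, f i t ∂μ i := by
  classical
  have hm : ∀ s : Finset ι, Measurable fun x : ∀ i, α i => ∏ i ∈ s, f i (x i) := fun s =>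
    Finset.measurable_prod _ fun i _ => (hf i).comp (measurable_pi_apply i)
  have key : ∀ (s : Finset ι) (x : ∀ i, α i),
      lmarginal μ s (fun x => ∏ i ∈ s, f i (x i)) x = ∏ i ∈ s, ∫⁻ t, f i t ∂μ i := by
    intro s
    induction s using Finset.induction_on with
    | empty => intro x; simp
    | insert i s hi ih =>
      intro x
      rw [lmarginal_insert' _ (hm _) hi, Finset.prod_insert hi, ← ih x, lmarginal, lmarginal,
        ← lintegral_const_mul]
      · refine lintegral_congr fun z => ?_
        rw [← lintegral_mul_const _ (hf i)]
        refine lintegral_congr fun t => ?_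
        rw [Finset.prod_insert hi, Function.update_self]
        congr 1
        refine Finset.prod_congr rfl fun j hj => ?_
        rw [Function.update_of_ne (ne_of_mem_of_not_mem hj hi)]
      · exact (hm s).comp measurable_updateFinset
  -- A marginal integral needs a base point; if some factor is empty, both sides vanish.
  rcases isEmpty_or_nonempty (∀ i, α i) with h | ⟨⟨x⟩⟩
  · obtain ⟨i, hi⟩ := isEmpty_pi.mp h
    rw [Finset.prod_eq_zero (Finset.mem_univ i), lintegral_of_isEmpty]
    rw [lintegral_of_isEmpty]
  · rw [← key Finset.univ x, lintegral_eq_lmarginal_univ x]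

theorem pi_withDensity {ι : Type*} [Fintype ι] {α : ι → Type*} [∀ i, MeasurableSpace (α i)]
    (μ : ∀ i, Measure (α i)) [∀ i, SigmaFinite (μ i)] {f : ∀ i, α i → ℝ≥0∞}
    (hf : ∀ i, Measurable (f i)) [∀ i, SigmaFinite ((μ i).withDensity (f i))] :
    Measure.pi (fun i => (μ i).withDensity (f i))
      = (Measure.pi μ).withDensity (fun x => ∏ i, f i (x i)) := by
  refine Measure.pi_eq fun s hs => ?_
  rw [withDensity_apply _ (MeasurableSet.univ_pi hs), Measure.restrict_pi_pi,
    lintegral_pi_prod _ hf]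
  exact Finset.prod_congr rfl fun i _ => (withDensity_apply _ (hs i)).symm

variable (n) in
/-- The indices of the flashes. -/
def flashIndex : unrealized n 0 ≃ (i : Fin N) × Fin (n i) where
  toFun p := ⟨p.1.1, p.1.2, (mem_unrealized.mp p.2).2⟩
  invFun p := ⟨(p.1, p.2), mem_unrealized.mpr ⟨Nat.zero_le _, p.2.2⟩⟩
  left_inv _ := rfl
  right_inv _ := rfl

variable (n) in
/-- Families of points with the indices of the flashes as flash patterns. -/
def flashCurry : (unrealized n 0 → Minkowski) ≃ᵐ Flashes n where
  toFun v i k := v ((flashIndex n).symm ⟨i, k⟩)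
  invFun x p := x (flashIndex n p).1 (flashIndex n p).2
  left_inv _ := rfl
  right_inv _ := rfl
  measurable_toFun := by
    refine measurable_pi_lambda _ fun i => measurable_pi_lambda _ fun k => ?_
    exact measurable_pi_apply _
  measurable_invFun := by
    refine measurable_pi_lambda _ fun p => ?_
    exact (measurable_pi_apply (flashIndex n p).2).comp (measurable_pi_apply (flashIndex n p).1)

theorem measurePreserving_flashCurry : MeasurePreserving (flashCurry n) := by
  refine MeasurePreserving.symm (flashCurry n).symm ⟨(flashCurry n).symm.measurable, ?_⟩
  symm
  refine Measure.pi_eq fun s hs => ?_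
  rw [Measure.map_apply (flashCurry n).symm.measurable (MeasurableSet.univ_pi hs)]
  have h1 : (flashCurry n).symm ⁻¹' univ.pi s
      = univ.pi fun i => univ.pi fun k => s ((flashIndex n).symm ⟨i, k⟩) := by
    ext x
    simp only [mem_preimage, mem_univ_pi]
    exact ⟨fun h i k => h ((flashIndex n).symm ⟨i, k⟩), fun h p =>
      h (flashIndex n p).1 (flashIndex n p).2⟩
  rw [h1, volume_pi_pi]
  simp only [volume_pi_pi]
  rw [← Fintype.prod_sigma' (fun i k => volume (s ((flashIndex n).symm ⟨i, k⟩)))]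
  exact Fintype.prod_equiv (flashIndex n).symm _ _ fun p => rfl

/-- The flash patterns in which every flash lies in the future of the preceding one. -/
def causal (y : Fin N → Minkowski) (n : Fin N → ℕ) : Set (Flashes n) :=
  {x | ∀ i k, pt y x i (Fin.succ k) ∈ future (pt y x i (Fin.castSucc k))}

/-- The flashes at proper times `exp (q.1 p)` and relative positions `q.2 p` from the preceding
flashes. -/
def flashMap (y : Fin N → Minkowski) (n : Fin N → ℕ)
    (q : (unrealized n 0 → ℝ) × (unrealized n 0 → E3)) : Flashes n :=
  fun i k => worldPt y (extTime n q.1) (extPos n q.2) i (k + 1)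

theorem extTime_apply (ρ : unrealized n 0 → ℝ) (p : unrealized n 0) : extTime n ρ p = ρ p := by
  simp [extTime, Function.updateFinset]

theorem extPos_apply (z : unrealized n 0 → E3) (p : unrealized n 0) : extPos n z p = z p := by
  simp [extPos, Function.updateFinset]

theorem pt_flashMap (y : Fin N → Minkowski) (q : (unrealized n 0 → ℝ) × (unrealized n 0 → E3))
    (i : Fin N) (l : Fin (n i + 1)) :
    pt y (flashMap y n q) i l = worldPt y (extTime n q.1) (extPos n q.2) i l := by
  refine Fin.cases rfl (fun k => ?_) l
  simp [pt, flashMap]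

theorem flashMap_eq (y : Fin N → Minkowski) (q : (unrealized n 0 → ℝ) × (unrealized n 0 → E3)) :
    flashMap y n q = fun i => walk (y i)
      (flashCurry n (fun p => coneMap (q.1 p, q.2 p)) i) := by
  ext1 i
  have key : ∀ (m : ℕ) (hm : m ≤ n i) (k : ℕ) (hk : k < m + 1),
      (Fin.cons (y i) (walk (y i) (flashCurry n (fun p => coneMap (q.1 p, q.2 p)) i)) :
        Fin (n i + 1) → Minkowski) ⟨k, by omega⟩
      = worldPt y (extTime n q.1) (extPos n q.2) i k := by
    intro m hm k hk
    induction k with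
    | zero => rfl
    | succ k ih =>
      have h1 := walk_zero_iff (y i) (flashCurry n (fun p => coneMap (q.1 p, q.2 p)) i)
        ⟨k, by omega⟩
      have h2 := ih (by omega)
      refine h1.trans ?_
      rw [worldPt]
      congr 1
      have h3 := extTime_apply q.1 ((flashIndex n).symm ⟨i, ⟨k, by omega⟩⟩)
      have h4 := extPos_apply q.2 ((flashIndex n).symm ⟨i, ⟨k, by omega⟩⟩)
      change extTime n q.1 (i, k) = _ at h3
      change extPos n q.2 (i, k) = _ at h4
      rw [h3, h4]
      rfl
  ext1 k
  exact (key (n i) le_rfl (k + 1) (by omega)).symm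

/-- The Jacobian of `flashMap`. -/
def flashDensity (n : Fin N → ℕ) (q : (unrealized n 0 → ℝ) × (unrealized n 0 → E3)) : ℝ≥0∞ :=
  ∏ p, coneDensity (q.1 p, q.2 p)

theorem measurable_flashDensity : Measurable (flashDensity n) := by
  refine Finset.measurable_prod _ fun p _ => measurable_coneDensity.comp ?_
  fun_prop

theorem causal_eq (y : Fin N → Minkowski) :
    (fun v : Flashes n => fun i => walk (y i) (v i)) ⁻¹' causal y n
      = (flashCurry n).symm ⁻¹' (univ.pi fun _ => future 0) := by
  ext v
  simp only [mem_preimage, causal, mem_ofPred_eq, mem_univ_pi, pt]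
  have h1 : ∀ (i : Fin N) (k : Fin (n i)),
      ((Fin.cons (y i) (walk (y i) (v i)) : Fin (n i + 1) → Minkowski) k.succ ∈
        future ((Fin.cons (y i) (walk (y i) (v i)) : Fin (n i + 1) → Minkowski) k.castSucc)) ↔
      v i k ∈ future 0 := by
    intro i k
    rw [walk_zero_iff]
    simp [future]
  simp only [h1]
  exact ⟨fun h p => h (flashIndex n p).1 (flashIndex n p).2, fun h i k =>
    h ((flashIndex n).symm ⟨i, k⟩)⟩

theorem measurableSet_causal (y : Fin N → Minkowski) : MeasurableSet (causal y n) := by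
  simp only [causal, ofPred_forall]
  refine MeasurableSet.iInter fun i => MeasurableSet.iInter fun k => ?_
  have h : ∀ l, Measurable fun x : Flashes n => pt y x i l := by
    intro l
    refine Fin.cases measurable_const (fun k => ?_) l
    simp only [pt, Fin.cons_succ]
    fun_prop
  have h1 := h k.succ
  have h2 := h k.castSucc
  simp only [future, mem_ofPred_eq]
  exact measurableSet_le (by fun_prop) (by fun_prop)

theorem measurable_flashMap (y : Fin N → Minkowski) : Measurable (flashMap y n) := by
  refine measurable_pi_lambda _ fun i => measurable_pi_lambda _ fun k => ?_
  exact measurable_worldPt y (measurable_extTime.comp measurable_fst)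
    (measurable_extPos.comp measurable_snd) i _

theorem measurableEmbedding_flashMap (y : Fin N → Minkowski) :
    MeasurableEmbedding (flashMap y n) := by
  refine (measurable_flashMap y).measurableEmbedding fun q q' h => ?_
  rw [flashMap_eq, flashMap_eq] at h
  have h1 : (fun p => coneMap (q.1 p, q.2 p)) = fun p => coneMap (q'.1 p, q'.2 p) :=
    (flashCurry n).injective (funext fun i => injective_walk (y i) (congrFun h i))
  have h2 : ∀ p, (q.1 p, q.2 p) = (q'.1 p, q'.2 p) := fun p => injective_coneMap (congrFun h1 p)
  exact Prod.ext (funext fun p => congrArg Prod.fst (h2 p)) (funext fun p => congrArg Prod.snd (h2 p))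

/-- The map factors into the cone map for each step, a reindexing and a walk for each particle. The
first carries the density to the volume on the future cone and the others preserve volume. Patterns
with a lightlike step form a null set and are not missed. -/
theorem map_flashMap (y : Fin N → Minkowski) :
    Measure.map (flashMap y n)
      ((volume : Measure ((unrealized n 0 → ℝ) × (unrealized n 0 → E3))).withDensity
        (flashDensity n))
      = (volume : Measure (Flashes n)).restrict (causal y n) := by
  let e := MeasurableEquiv.arrowProdEquivProdArrow ℝ E3 (unrealized n 0)
  have he : MeasurePreserving e := volume_measurePreserving_arrowProdEquivProdArrow _ _ _
  have hwd : SigmaFinite ((volume : Measure (ℝ × E3)).withDensity coneDensity) :=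
    SigmaFinite.withDensity_of_ne_top (ae_of_all _ fun _ => ENNReal.ofReal_ne_top)
  have h1 : Measure.map (fun w : unrealized n 0 → ℝ × E3 => fun p => coneMap (w p))
      ((volume : Measure (unrealized n 0 → ℝ × E3)).withDensity fun w => ∏ p, coneDensity (w p))
      = (volume : Measure (unrealized n 0 → Minkowski)).restrict (univ.pi fun _ => future 0) := by
    have hsf : SigmaFinite
        (Measure.map coneMap ((volume : Measure (ℝ × E3)).withDensity coneDensity)) := by
      rw [map_coneMap]; infer_instance
    rw [volume_pi, ← pi_withDensity (fun _ => volume) (fun _ => measurable_coneDensity),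
      Measure.restrict_pi_pi, Measure.pi_map_pi (fun _ => measurable_coneMap.aemeasurable)]
    simp only [map_coneMap]
  have h2 : MeasurePreserving (fun v : Flashes n => fun i => walk (y i) (v i)) :=
    volume_preserving_pi fun i => measurePreserving_walk (n i) (y i)
  have h3 := (h2.restrict_preimage (measurableSet_causal y)).comp
    ((measurePreserving_flashCurry (n := n)).restrict_preimage
      (h2.measurable (measurableSet_causal y)))
  rw [causal_eq] at h3
  have h4 : (flashCurry n) ⁻¹' ((flashCurry n).symm ⁻¹' (univ.pi fun _ => future 0))
      = univ.pi fun _ => future 0 := by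
    ext v; simp
  rw [h4] at h3
  have h5 : Measurable fun w : unrealized n 0 → ℝ × E3 => fun p => coneMap (w p) :=
    measurable_pi_lambda _ fun p => measurable_coneMap.comp (measurable_pi_apply p)
  rw [← h3.map_eq, ← h1, Measure.map_map h3.measurable h5]
  have h6 : Measure.map e
      ((volume : Measure (unrealized n 0 → ℝ × E3)).withDensity fun w => ∏ p, coneDensity (w p))
      = (volume : Measure ((unrealized n 0 → ℝ) × (unrealized n 0 → E3))).withDensity
        (flashDensity n) := by
    ext s hs
    rw [e.map_apply, withDensity_apply _ (e.measurable hs), withDensity_apply _ hs,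
      ← he.setLIntegral_comp_preimage hs measurable_flashDensity]
    rfl
  rw [← h6, Measure.map_map (measurable_flashMap y) e.measurable]
  congr 1
  ext1 w
  exact flashMap_eq y (e w)

end FlashCoordinates

/-! ### Hyperboloids in spatial coordinates -/

section Hyperboloids

theorem time_graphSurface (f : E3 → ℝ) (hf : LipschitzWith 1 f) : (graphSurface f hf).time = f :=
  funext fun ξ => (graphSurface f hf).time_mem ξ

theorem mem_futureSet_graphSurface {f : E3 → ℝ} (hf : LipschitzWith 1 f) {z : Minkowski} :
    z ∈ futureSet (graphSurface f hf).carrier ↔ f z.2 ≤ z.1 := by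
  simp only [futureSet, mem_iUnion, exists_prop]
  constructor
  · rintro ⟨p, hp, hz⟩
    have h1 : p.1 = f p.2 := hp
    have h2 : ‖z.2 - p.2‖ ≤ z.1 - p.1 := hz
    have h3 := lipschitz_le_add hf z.2 p.2
    linarith
  · intro h
    refine ⟨(f z.2, z.2), rfl, ?_⟩
    simpa [future] using h

namespace HypParam

variable (p : HypParam)

/-- The hyperboloid with given parameters. -/
def surface : SpacelikeSurface := graphSurface (hypTime p.1.1 p.1.2) (hypTime_lipschitz _ _)

variable {p} {z x : Minkowski}

theorem mem_surface : z ∈ p.surface.carrier ↔ z.1 = hypTime p.1.1 p.1.2 z.2 := Iff.rfl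

theorem properLength_sub (hz : z ∈ p.surface.carrier) : properLength (z - p.1.1) = p.1.2 := by
  have : z ∈ hyperboloidSet p.1.1 p.1.2 := by
    rw [mem_hyperboloidSet_iff _ _ p.2.le, sub_eq_iff_eq_add']
    exact hz
  exact this.2

theorem hyperboloidThrough_eq (hz : z ∈ p.surface.carrier) :
    hyperboloidThrough p.1.1 z = p.surface := by
  have h : ∀ (s : ℝ) (hs : 0 ≤ s), s = p.1.2 → hyperboloid p.1.1 s hs = p.surface := by
    rintro s hs rfl
    exact hyperboloid_eq_graphSurface _ _ _
  exact h _ _ (properLength_sub hz)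

theorem gaussian_eq (σ : ℝ) (hx : x ∈ p.surface.carrier) (hz : z ∈ p.surface.carrier) :
    gaussian σ p.1.1 x z = gaussKernel σ p.1.2 (x.2 - p.1.1.2) (z.2 - p.1.1.2) := by
  have h : ∀ w ∈ p.surface.carrier, w.1 - p.1.1.1 = energy p.1.2 (w.2 - p.1.1.2) := by
    intro w hw
    rw [mem_surface.mp hw, hypTime, energy]
    ring
  simp only [gaussian, sDist, gaussKernel, properLength_sub hx, mink, hypProd, Prod.fst_sub,
    Prod.snd_sub, h x hx, h z hz]

theorem hasFDerivAt_hypTime (ξ : E3) : HasFDerivAt (hypTime p.1.1 p.1.2)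
    ((1 / energy p.1.2 (ξ - p.1.1.2)) • innerSL ℝ (ξ - p.1.1.2)) ξ := by
  have h1 : HasFDerivAt (fun ξ : E3 => p.1.2 ^ 2 + ‖ξ - p.1.1.2‖ ^ 2)
      (2 • innerSL ℝ (ξ - p.1.1.2)) ξ := by
    have := ((hasStrictFDerivAt_norm_sq (ξ - p.1.1.2)).hasFDerivAt.comp ξ
      ((hasFDerivAt_id ξ).sub_const p.1.1.2)).const_add (p.1.2 ^ 2)
    simpa using this
  have hp := p.2
  have h2 := (h1.sqrt (by positivity)).const_add p.1.1.1
  refine h2.congr_fderiv ?_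
  rw [← energy, smul_comm, ← Nat.cast_smul_eq_nsmul ℝ, smul_smul]
  congr 1
  have := (energy_pos hp (ξ - p.1.1.2)).ne'
  field_simp
  norm_num

/-- The gradient of the time function is `v / energy s v` with `v = ξ - p.1.1.2`, and `1 - ‖v‖² /
energy²` is `s² / energy²`. -/
theorem sqrt_one_sub_fderiv (ξ : E3) : √(1 - ‖fderiv ℝ p.surface.time ξ‖ ^ 2)
    = volDensity p.1.2 (ξ - p.1.1.2) := by
  have he := energy_pos p.2 (ξ - p.1.1.2)
  rw [surface, time_graphSurface, (hasFDerivAt_hypTime ξ).fderiv, norm_smul, innerSL_apply_norm,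
    Real.norm_of_nonneg (by positivity), volDensity, Real.sqrt_eq_iff_mul_self_eq]
  · have h2 := energy_sq p.1.2 (ξ - p.1.1.2)
    field_simp
    linarith
  · have h2 := energy_sq p.1.2 (ξ - p.1.1.2)
    have : (1 / energy p.1.2 (ξ - p.1.1.2) * ‖ξ - p.1.1.2‖) ^ 2
        = 1 - p.1.2 ^ 2 / energy p.1.2 (ξ - p.1.1.2) ^ 2 := by
      field_simp; linarith
    rw [this]
    have : 0 ≤ p.1.2 ^ 2 / energy p.1.2 (ξ - p.1.1.2) ^ 2 := by positivity
    linarith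
  · exact (div_pos p.2 he).le

theorem setIntegral_volume3 {A : Set Minkowski} (hA : MeasurableSet A) (f : Minkowski → ℝ) :
    ∫ z in A, f z ∂p.surface.volume3
      = ∫ ξ in {ξ | (hypTime p.1.1 p.1.2 ξ, ξ) ∈ A},
          f (hypTime p.1.1 p.1.2 ξ, ξ) * volDensity p.1.2 (ξ - p.1.1.2) := by
  have hm : Measurable fun ξ : E3 => ((hypTime p.1.1 p.1.2 ξ, ξ) : Minkowski) :=
    (hypTime_lipschitz _ _).continuous.measurable.prodMk measurable_id
  have he : MeasurableEmbedding fun ξ : E3 => ((hypTime p.1.1 p.1.2 ξ, ξ) : Minkowski) :=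
    hm.measurableEmbedding fun ξ η h => congrArg Prod.snd h
  have ht : p.surface.time = hypTime p.1.1 p.1.2 := time_graphSurface _ _
  rw [SpacelikeSurface.volume3]
  simp only [sqrt_one_sub_fderiv]
  simp only [ht]
  rw [he.setIntegral_map]
  have hd : Measurable fun ξ : E3 => ENNReal.ofReal (volDensity p.1.2 (ξ - p.1.1.2)) := by
    have := measurable_volDensity.comp
      (measurable_const.prodMk (measurable_id.sub_const p.1.1.2) : Measurable fun ξ : E3 =>
        (p.1.2, ξ - p.1.1.2))
    exact this.ennreal_ofReal
  rw [restrict_withDensity (hm hA), integral_withDensity_eq_integral_toReal_smul hd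
    (ae_of_all _ fun _ => ENNReal.ofReal_lt_top)]
  refine integral_congr_ae (ae_of_all _ fun ξ => ?_)
  simp only [smul_eq_mul]
  rw [ENNReal.toReal_ofReal (volDensity_pos p.2 _).le, mul_comm]

theorem cutoffProfile_eq (σ : ℝ) {A : Set Minkowski} (hA : MeasurableSet A)
    (hAp : A ⊆ p.surface.carrier) (hx : x ∈ p.surface.carrier) (hz : z ∈ p.surface.carrier) :
    cutoffProfile σ p.1.1 A x z
      = prof σ p.1 {ξ | (hypTime p.1.1 p.1.2 ξ, ξ) ∈ A} x.2 z.2 := by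
  have hmem : ∀ w ∈ p.surface.carrier,
      (w ∈ A ↔ w.2 ∈ {ξ | (hypTime p.1.1 p.1.2 ξ, ξ) ∈ A}) := by
    intro w hw
    rw [mem_ofPred_eq, ← mem_surface.mp hw]
  rw [cutoffProfile, prof]
  classical
  refine if_congr (and_congr (hmem z hz) (hmem x hx)) ?_ rfl
  rw [gaussian_eq σ hx hz, l2norm, hyperboloidThrough_eq hz, setIntegral_volume3 hA, profNormSq]
  congr 2
  refine setIntegral_congr_fun ?_ fun ξ hξ => ?_
  · exact ((hypTime_lipschitz _ _).continuous.measurable.prodMk measurable_id) hA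
  · rw [gaussian_eq σ hz (hAp hξ), sq_abs]

end HypParam

end Hyperboloids

/-! ### Multiplication operators in the Heisenberg picture -/

section Heisenberg

variable {α β : Type*} [MeasurableSpace α] [MeasurableSpace β]
  {H H' : Type*} [NormedAddCommGroup H] [InnerProductSpace ℂ H] [CompleteSpace H]
  [NormedAddCommGroup H'] [InnerProductSpace ℂ H'] [CompleteSpace H']

theorem PVM.isMultOp_transport (P : PVM α H) (f : α → β) (hf : Measurable f) (U : H ≃ₗᵢ[ℂ] H')
    {g : β → ℝ} (hg : Measurable g) {T : H →L[ℂ] H} (hT : P.IsMultOp (g ∘ f) T) :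
    (P.transport f hf U).IsMultOp g ((U : H →L[ℂ] H') ∘L T ∘L (U.symm : H' →L[ℂ] H)) := by
  intro ψ
  rw [PVM.transport_measure, integrable_map_measure hg.aestronglyMeasurable hf.aemeasurable,
    integral_map hf.aemeasurable hg.aestronglyMeasurable]
  have h := hT (U.symm ψ)
  refine ⟨h.1, ?_⟩
  have h2 := h.2
  have e : ⟪ψ, U (T (U.symm ψ))⟫_ℂ = ⟪U.symm ψ, T (U.symm ψ)⟫_ℂ := by
    conv_lhs => rw [← U.apply_symm_apply ψ, U.inner_map_map, U.apply_symm_apply]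
  simpa [e] using h2

/-- Bounded operators `∫ g` exist on both sides or on neither, so the default value 0 is matched as
well and no boundedness of `g` is required. -/
theorem PVM.multOp_transport (P : PVM α H) (f : α → β) (hf : Measurable f) (U : H ≃ₗᵢ[ℂ] H')
    {g : β → ℝ} (hg : Measurable g) : (P.transport f hf U).multOp g
      = (U : H →L[ℂ] H') ∘L P.multOp (g ∘ f) ∘L (U.symm : H' →L[ℂ] H) := by
  by_cases h : ∃ T, P.IsMultOp (g ∘ f) T
  · obtain ⟨T, hT⟩ := h
    rw [P.multOp_eq hT, (P.transport f hf U).multOp_eq (P.isMultOp_transport f hf U hg hT)]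
  · have h' : ¬ ∃ T, (P.transport f hf U).IsMultOp g T := fun ⟨T, hT⟩ =>
      h ⟨_, P.transport_isMultOp f hf U hg hT⟩
    rw [PVM.multOp, dif_neg h', PVM.multOp, dif_neg h]
    simp

theorem HypersurfaceEvolution.evol_multOp {N : ℕ} (E : HypersurfaceEvolution.{u} N)
    (hE : E.InteractionLocal) (S₀ : SpacelikeSurface) {f : E3 → ℝ} (hf : LipschitzWith 1 f)
    (i : Fin N) {g : E3 → ℝ} (hg : Measurable g) :
    E.evol (graphSurface f hf) S₀ ∘L
        (E.P (graphSurface f hf)).multOp (fun q => g (q i : Minkowski).2) ∘L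
        E.evol S₀ (graphSurface f hf) = ((E.toLocalFamily hE S₀).R f hf i).multOp g := by
  have h := (E.P (graphSurface f hf)).multOp_transport (fun q => ((q i : Minkowski)).2)
    (measurable_coord _ i) (E.U (graphSurface f hf) S₀) hg
  refine Eq.trans ?_ h.symm
  ext ψ
  simp [HypersurfaceEvolution.evol, HypersurfaceEvolution.U_symm, Function.comp_def]

end Heisenberg

/-! ### The collapse operators in hyperbolic coordinates -/

section Link

variable {N : ℕ} {n : Fin N → ℕ} (y : Fin N → Minkowski)

/-- The hyperboloids of the flash pattern with given hyperbolic coordinates. -/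
def flashChain (n : Fin N → ℕ) (q : (unrealized n 0 → ℝ) × (unrealized n 0 → E3)) :
    Fin N → ℕ → HypParam := chainOf y (extTime n q.1) (extPos n q.2)

theorem isChain_flashChain (q : (unrealized n 0 → ℝ) × (unrealized n 0 → E3)) :
    IsChain (flashChain y n q) :=
  isChain_chainOf y (extTime n q.1) (extPos n q.2)

theorem measurable_flashChain (i : Fin N) (l : ℕ) : Measurable fun
    q : (unrealized n 0 → ℝ) × (unrealized n 0 → E3) => flashChain y n q i l :=
  measurable_chainOf y (measurable_extTime.comp measurable_fst)
    (measurable_extPos.comp measurable_snd) i l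

variable {y} {q : (unrealized n 0 → ℝ) × (unrealized n 0 → E3)}

theorem flash_mem_surface (i : Fin N) (l : ℕ) :
    (flashChain y n q i (l + 1)).1.1 ∈ (flashChain y n q i l).surface.carrier :=
  isChain_flashChain y q i l

theorem hyp_flashMap (i : Fin N) (k : Fin (n i)) :
    hyp y (flashMap y n q) i k = (flashChain y n q i k).surface := by
  rw [hyp, pt_flashMap, pt_flashMap]
  exact HypParam.hyperboloidThrough_eq (p := flashChain y n q i k) (flash_mem_surface (q := q) i k)

theorem properLength_flashMap (i : Fin N) (k : Fin (n i)) :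
    properLength (pt y (flashMap y n q) i k.succ - pt y (flashMap y n q) i k.castSucc)
      = Real.exp (extTime n q.1 (i, k)) := by
  rw [pt_flashMap, pt_flashMap]
  exact HypParam.properLength_sub (p := flashChain y n q i k) (flash_mem_surface (q := q) i k)

/-- Lying in the future of the `l`-th sheet of `j` amounts to `l < cellAt … j`, so the two
conditions on `a j` pin this count from both sides. For the particle `i` itself the count is
automatic on its own sheet. -/
theorem mem_threeCell_flashMap {i : Fin N} {k : Fin (n i)} {a : Cell n} (ha : (a i : ℕ) = k + 1)
    {z : Minkowski} : z ∈ threeCell y (flashMap y n q) i k a ↔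
      z ∈ (flashChain y n q i k).surface.carrier ∧ cellAt (flashChain y n q) n z = cellVal a := by
  have hc := isChain_flashChain y q
  have hF : ∀ j (l : Fin (n j)), z ∈ futureSet (hyp y (flashMap y n q) j l).carrier ↔
      (l : ℕ) < cellAt (flashChain y n q) n z j := by
    intro j l
    rw [hyp_flashMap, HypParam.surface, mem_futureSet_graphSurface, hc.lt_cellAt_iff]
    exact ⟨fun h => ⟨l.2, h⟩, fun h => h.2⟩
  rw [threeCell, hyp_flashMap]
  simp only [mem_inter_iff, mem_iInter, afterHyp, beforeNextHyp, mem_ofPred_eq, hF]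
  refine and_congr_right fun hz => ?_
  constructor
  · intro h
    ext1 j
    by_cases hj : j = i
    · subst hj
      have h1 : z = sheetPt (flashChain y n q) j k z.2 := Prod.ext hz rfl
      rw [h1, hc.cellAt_sheetPt k.2]
      exact ha.symm
    · obtain ⟨h1, h2⟩ := h j hj
      have hle : cellAt (flashChain y n q) n z j ≤ n j := cellAt_le _ _ _ j
      have hal : (a j : ℕ) ≤ n j := cellVal_le a j
      change _ = (a j : ℕ)
      refine le_antisymm ?_ ?_
      · by_contra! hlt
        exact h2 ⟨a j, by omega⟩ rfl hlt
      · by_contra! hlt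
        have := h1 ⟨a j - 1, by omega⟩ (by simp only; omega)
        simp only at this
        omega
  · intro h j _
    have hj : cellAt (flashChain y n q) n z j = a j := congrFun h j
    rw [hj]
    exact ⟨fun l hl => by omega, fun l hl => by omega⟩

theorem threeCell_flashMap_subset {i : Fin N} {k : Fin (n i)} {a : Cell n} :
    threeCell y (flashMap y n q) i k a ⊆ (flashChain y n q i k).surface.carrier := by
  rw [threeCell, hyp_flashMap]
  exact inter_subset_left

theorem measurableSet_threeCell_flashMap {i : Fin N} {k : Fin (n i)} {a : Cell n}
    (ha : (a i : ℕ) = k + 1) : MeasurableSet (threeCell y (flashMap y n q) i k a) := by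
  have h : threeCell y (flashMap y n q) i k a
      = {z | z.1 = hypTime (flashChain y n q i k).1.1 (flashChain y n q i k).1.2 z.2} ∩
        {z | cellAt (flashChain y n q) n z = cellVal a} :=
    Set.ext fun z => mem_threeCell_flashMap ha
  rw [h]
  refine MeasurableSet.inter ?_ ?_
  · exact measurableSet_eq_fun measurable_fst
      ((hypTime_lipschitz _ _).continuous.measurable.comp measurable_snd)
  · exact measurable_cellAt n (X := Minkowski) (h := fun _ => flashChain y n q)
      (fun _ _ => measurable_const) measurable_id (measurableSet_singleton (cellVal a))

theorem setOf_mem_threeCell {i : Fin N} {k : Fin (n i)} {a : Cell n} (ha : (a i : ℕ) = k + 1) :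
    {ξ | (hypTime (flashChain y n q i k).1.1 (flashChain y n q i k).1.2 ξ, ξ)
      ∈ threeCell y (flashMap y n q) i k a} = sheetCell (flashChain y n q) n i k (cellVal a) := by
  ext ξ
  rw [mem_ofPred_eq, mem_threeCell_flashMap ha]
  exact ⟨fun h => h.2, fun h => ⟨rfl, h⟩⟩

variable (E : HypersurfaceEvolution.{u} N) (hE : E.InteractionLocal) (S₀ : SpacelikeSurface) (σ : ℝ)

theorem collapseOp_flashMap {i : Fin N} {k : Fin (n i)} {a : Cell n} (ha : (a i : ℕ) = k + 1) :
    collapseOp E S₀ σ y (flashMap y n q) i k (threeCell y (flashMap y n q) i k a)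
      = ((E.toLocalFamily hE S₀).hyp (flashChain y n q i k) i).multOp
        (prof σ (flashChain y n q i k).1 (sheetCell (flashChain y n q) n i k (cellVal a))
          (flashChain y n q i (k + 1)).1.1.2) := by
  set h := flashChain y n q with hh
  set A := threeCell y (flashMap y n q) i k a with hA
  set g : E3 → ℝ := prof σ (h i k).1 (sheetCell h n i k (cellVal a)) (h i (k + 1)).1.1.2 with hg
  have hgm : Measurable g := by
    have h1 : Measurable fun p : E3 × E3 =>
        prof σ (h i k).1 (sheetCell h n i k (cellVal a)) p.1 p.2 :=
      measurable_prof (X := E3) σ (p := fun _ => (h i k).1)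
        (A := fun _ => sheetCell h n i k (cellVal a)) measurable_const
        (measurableSet_setOf_sheetCell (X := E3) n (h := fun _ => h) (fun _ _ => measurable_const)
          i k (cellVal a)) (ξ := fun x => x) measurable_id
    exact Measurable.of_uncurry_left
      (f := prof σ (h i k).1 (sheetCell h n i k (cellVal a))) h1
  -- The Hilbert space and the PVM depend on the surface, so the surface is made a variable and the
  -- equality is then substituted.
  have key : ∀ S : SpacelikeSurface, S = (h i k).surface →
      E.evol S S₀ ∘L (E.P S).multOp (fun q' => cutoffProfile σ (h i k).1.1 A
        (h i (k + 1)).1.1 (q' i)) ∘L E.evol S₀ S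
      = ((E.toLocalFamily hE S₀).hyp (h i k) i).multOp g := by
    rintro S rfl
    rw [LocalFamily.hyp, ← E.evol_multOp hE S₀ (hypTime_lipschitz _ _) i hgm]
    have hfun : (fun q' : Fin N → (h i k).surface => cutoffProfile σ (h i k).1.1 A
        (h i (k + 1)).1.1 (q' i)) = fun q' => g (q' i : Minkowski).2 := by
      funext q'
      rw [HypParam.cutoffProfile_eq σ (measurableSet_threeCell_flashMap ha)
        threeCell_flashMap_subset (flash_mem_surface i k) (q' i).2, setOf_mem_threeCell ha]
    rw [hfun]
    rfl
  rw [collapseOp, pt_flashMap]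
  exact key _ (hyp_flashMap i k)

theorem crossingFactor_flashMap (a : Cell n) (i : Fin N) :
    crossingFactor E S₀ σ y (flashMap y n q) a i
      = crossFactor (E.toLocalFamily hE S₀) σ (flashChain y n q) n (cellVal a, i) := by
  have hal : (a i : ℕ) ≤ n i := cellVal_le a i
  have hmem : ∀ k : Fin (n i), (k : ℕ) + 1 = a i →
      (flashMap y n q i k ∈ threeCell y (flashMap y n q) i k a ↔
        flashCell (flashChain y n q) n i k = cellVal a) := by
    intro k hk
    rw [mem_threeCell_flashMap hk.symm]
    exact ⟨fun h => h.2, fun h => ⟨flash_mem_surface (q := q) i k, h⟩⟩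
  by_cases h : ∃ k : Fin (n i), (k : ℕ) + 1 = a i ∧
      flashMap y n q i k ∈ threeCell y (flashMap y n q) i k a
  · rw [crossingFactor, dif_pos h]
    obtain ⟨h1, h2⟩ := h.choose_spec
    generalize h.choose = k at h1 h2
    have hk : (cellVal a i : ℕ) - 1 = k := by change (a i : ℕ) - 1 = k; omega
    rw [collapseOp_flashMap E hE S₀ σ h1.symm, crossFactor]
    simp only [hk]
    rw [if_pos ⟨by change 1 ≤ (a i : ℕ); omega, (hmem k h1).mp h2⟩]
  · rw [crossingFactor, dif_neg h, crossFactor, if_neg]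
    rintro ⟨h1, h2⟩
    change 1 ≤ (a i : ℕ) at h1
    change flashCell (flashChain y n q) n i ((a i : ℕ) - 1) = cellVal a at h2
    have h3 : ((a i : ℕ) - 1) + 1 = a i := by omega
    exact h ⟨⟨a i - 1, by omega⟩, h3, (hmem ⟨a i - 1, by omega⟩ h3).mpr h2⟩

theorem opL_flashMap (s : AdmissibleSequence n) (ord : Fin s.r → Equiv.Perm (Fin N)) :
    opL E S₀ σ y s ord (flashMap y n q)
      = pathOp (E.toLocalFamily hE S₀) σ (flashChain y n q) n (s.steps ord) := by
  simp only [opL, pathOp, AdmissibleSequence.steps, crossingFactor_flashMap E hE S₀ σ]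
  rw [List.reverse_flatMap, List.map_flatMap, List.flatMap_def,
    List.prod_flatten, List.map_map]
  congr 1
  refine List.map_congr_left fun m _ => ?_
  simp [List.map_reverse, Function.comp_def]

end Link

/-! ### Operator densities of the form `V(x)† V(x)` -/

section Densities

variable {X : Type*} [MeasurableSpace X] {H : Type*} [NormedAddCommGroup H]
  [InnerProductSpace ℂ H] [CompleteSpace H] {V : X → H →L[ℂ] H} {μ : Measure X}

theorem inner_adjoint_comp_self (T : H →L[ℂ] H) (φ ψ : H) :
    ⟪φ, (ContinuousLinearMap.adjoint T ∘L T) ψ⟫_ℂ = ⟪T φ, T ψ⟫_ℂ := by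
  rw [ContinuousLinearMap.comp_apply, ContinuousLinearMap.adjoint_inner_right]

omit [InnerProductSpace ℂ H] [CompleteSpace H] in
theorem eLpNorm_two_sq {f : X → H} : eLpNorm f 2 μ ^ 2 = ∫⁻ x, ‖f x‖ₑ ^ 2 ∂μ := by
  have h := eLpNorm_nnreal_pow_eq_lintegral (p := 2) (f := f) (μ := μ) two_ne_zero
  simpa using h

-- The density is encoded by the single contraction `φ ↦ V(·) φ` into the square-integrable vector
-- functions.
omit [CompleteSpace H] in
theorem exists_toLp (hV : ∀ φ, AEStronglyMeasurable (fun x => V x φ) μ)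
    (hle : ∀ φ, ∫⁻ x, ‖V x φ‖ₑ ^ 2 ∂μ ≤ ‖φ‖ₑ ^ 2) :
    ∃ T : H →L[ℂ] Lp H 2 μ, ‖T‖ ≤ 1 ∧ ∀ φ, T φ =ᵐ[μ] fun x => V x φ := by
  have h1 : ∀ φ, eLpNorm (fun x => V x φ) 2 μ ≤ ‖φ‖ₑ := fun φ => by
    have := hle φ
    rw [← eLpNorm_two_sq] at this
    exact (ENNReal.pow_le_pow_left_iff two_ne_zero).mp this
  have h2 : ∀ φ, MemLp (fun x => V x φ) 2 μ := fun φ =>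
    ⟨hV φ, (h1 φ).trans_lt enorm_lt_top⟩
  let T₀ : H →ₗ[ℂ] Lp H 2 μ :=
    { toFun φ := (h2 φ).toLp _
      map_add' φ ψ := by
        rw [← MemLp.toLp_add]
        exact MemLp.toLp_congr _ _ (ae_of_all _ fun x => map_add _ _ _)
      map_smul' c φ := by
        rw [RingHom.id_apply, ← MemLp.toLp_const_smul]
        exact MemLp.toLp_congr _ _ (ae_of_all _ fun x => map_smul _ _ _) }
  have h3 : ∀ φ, ‖T₀ φ‖ ≤ 1 * ‖φ‖ := fun φ => by
    change ‖(h2 φ).toLp _‖ ≤ _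
    rw [Lp.norm_toLp, one_mul]
    exact ENNReal.toReal_le_of_le_ofReal (norm_nonneg _) (by rw [ofReal_norm]; exact h1 φ)
  exact ⟨T₀.mkContinuous 1 h3, T₀.mkContinuous_norm_le zero_le_one h3, fun φ => (h2 φ).coeFn_toLp⟩

/-- The weak integral is `T† T` for the contraction `T` into `L²`. The last estimate, `‖T† T ψ‖ ≤ ‖T
ψ‖`, is what upgrades weak to strong countable additivity. -/
theorem exists_hasWeakIntegral (hV : ∀ φ, AEStronglyMeasurable (fun x => V x φ) μ)
    (hle : ∀ φ, ∫⁻ x, ‖V x φ‖ₑ ^ 2 ∂μ ≤ ‖φ‖ₑ ^ 2) :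
    ∃ S : H →L[ℂ] H, S.IsPositive ∧
      HasWeakIntegral (fun x => ContinuousLinearMap.adjoint (V x) ∘L V x) μ S ∧
      ∀ ψ, ‖S ψ‖ ^ 2 ≤ ∫ x, ‖V x ψ‖ ^ 2 ∂μ := by
  obtain ⟨T, hT1, hT⟩ := exists_toLp hV hle
  have hin : ∀ φ ψ, (fun x => ⟪T φ x, T ψ x⟫_ℂ) =ᵐ[μ]
      fun x => ⟪φ, (ContinuousLinearMap.adjoint (V x) ∘L V x) ψ⟫_ℂ := fun φ ψ => by
    filter_upwards [hT φ, hT ψ] with x h1 h2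
    rw [h1, h2, inner_adjoint_comp_self]
  have hS : ∀ φ ψ, ⟪φ, (ContinuousLinearMap.adjoint T ∘L T) ψ⟫_ℂ = ⟪T φ, T ψ⟫_ℂ := fun φ ψ => by
    rw [ContinuousLinearMap.comp_apply, ContinuousLinearMap.adjoint_inner_right]
  refine ⟨ContinuousLinearMap.adjoint T ∘L T, ContinuousLinearMap.isPositive_adjoint_comp_self T,
    fun φ ψ => ⟨(L2.integrable_inner (T φ) (T ψ)).congr (hin φ ψ), ?_⟩, fun ψ => ?_⟩
  · rw [hS, L2.inner_def, integral_congr_ae (hin φ ψ)]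
  · have h1 : ‖(ContinuousLinearMap.adjoint T ∘L T) ψ‖ ≤ ‖T ψ‖ := by
      rw [ContinuousLinearMap.comp_apply]
      refine (ContinuousLinearMap.le_opNorm _ _).trans ?_
      rw [LinearIsometryEquiv.norm_map]
      exact mul_le_of_le_one_left (norm_nonneg _) hT1
    refine (pow_le_pow_left₀ (norm_nonneg _) h1 2).trans (le_of_eq ?_)
    have h2 : ((‖T ψ‖ ^ 2 : ℝ) : ℂ) = ((∫ x, ‖V x ψ‖ ^ 2 ∂μ : ℝ) : ℂ) := by
      rw [← integral_complex_ofReal]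
      have h3 := inner_self_eq_norm_sq_to_K (𝕜 := ℂ) (T ψ)
      rw [L2.inner_def] at h3
      push_cast
      refine h3.symm.trans (integral_congr_ae ?_)
      filter_upwards [hT ψ] with x hx
      rw [hx, inner_self_eq_norm_sq_to_K]
      simp
    exact_mod_cast h2

/-- The operator-valued measure with a density of the form `V(x)† V(x)`, if it is normalized. -/
theorem exists_isPOVM (hV : ∀ φ, AEStronglyMeasurable (fun x => V x φ) μ)
    (hI : ∀ φ, ∫⁻ x, ‖V x φ‖ₑ ^ 2 ∂μ = ‖φ‖ₑ ^ 2) :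
    ∃ G : Set X → H →L[ℂ] H, IsPOVM G ∧ ∀ B,
      HasWeakIntegral (fun x => ContinuousLinearMap.adjoint (V x) ∘L V x) (μ.restrict B) (G B) := by
  have h := fun B : Set X => exists_hasWeakIntegral (μ := μ.restrict B) (fun φ => (hV φ).restrict)
    (fun φ => (lintegral_mono' Measure.restrict_le_self le_rfl).trans (hI φ).le)
  choose G hpos hw hn using h
  have hint : ∀ φ, Integrable (fun x => ‖V x φ‖ ^ 2) μ := fun φ => by
    refine ⟨(hV φ).norm.pow 2, ?_⟩
    rw [hasFiniteIntegral_iff_enorm]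
    simp only [enorm_pow, enorm_norm]
    rw [hI φ]
    exact ENNReal.pow_lt_top enorm_lt_top
  have hinner : ∀ x φ, ⟪φ, (ContinuousLinearMap.adjoint (V x) ∘L V x) φ⟫_ℂ
      = ((‖V x φ‖ ^ 2 : ℝ) : ℂ) := fun x φ => by
    rw [inner_adjoint_comp_self, inner_self_eq_norm_sq_to_K]; simp
  have hdiag : ∀ B φ, ⟪φ, G B φ⟫_ℂ = ((∫ x in B, ‖V x φ‖ ^ 2 ∂μ : ℝ) : ℂ) := fun B φ => by
    rw [← (hw B φ φ).2, ← integral_complex_ofReal]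
    simp only [hinner]
  refine ⟨G, ⟨fun B _ => hpos B, ?_, ?_⟩, hw⟩
  · rw [← ContinuousLinearMap.coe_inj]
    refine (ext_inner_map _ _).mp fun φ => ?_
    have h1 : ∫ x, ‖V x φ‖ ^ 2 ∂μ = ‖φ‖ ^ 2 := by
      rw [integral_eq_lintegral_of_nonneg_ae (ae_of_all _ fun _ => sq_nonneg _)
        (hint φ).aestronglyMeasurable]
      have h2 : ∀ x, ENNReal.ofReal (‖V x φ‖ ^ 2) = ‖V x φ‖ₑ ^ 2 := fun x => by
        rw [ENNReal.ofReal_pow (norm_nonneg _), ofReal_norm]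
      simp only [h2]
      rw [hI, ENNReal.toReal_pow, toReal_enorm]
    have h3 := hdiag univ φ
    rw [Measure.restrict_univ, h1] at h3
    rw [← inner_conj_symm]
    simp only [ContinuousLinearMap.coe_coe]
    rw [h3]
    simp
  · intro B hB hd ψ
    have hsum : HasSum (fun m => ∫ x in B m, ‖V x ψ‖ ^ 2 ∂μ) (∫ x in ⋃ m, B m, ‖V x ψ‖ ^ 2 ∂μ) :=
      hasSum_integral_iUnion hB hd (hint ψ).integrableOn
    have hsub : ∀ s : Finset ℕ, MeasurableSet (⋃ m ∈ s, B m) := fun s =>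
      s.measurableSet_biUnion fun m _ => hB m
    have hss : ∀ s : Finset ℕ, (⋃ m ∈ s, B m) ⊆ ⋃ m, B m := fun s =>
      iUnion₂_subset fun m _ => subset_iUnion B m
    have hsplit : ∀ (s : Finset ℕ) {Y : Type _} [NormedAddCommGroup Y] [NormedSpace ℝ Y]
        (f : X → Y), IntegrableOn f (⋃ m, B m) μ →
        ∫ x in (⋃ m, B m) \ ⋃ m ∈ s, B m, f x ∂μ
          = ∫ x in ⋃ m, B m, f x ∂μ - ∑ m ∈ s, ∫ x in B m, f x ∂μ := by
      intro s Y _ _ f hf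
      rw [setIntegral_sdiff (hsub s) hf (hss s), integral_biUnion_finset s (fun m _ => hB m)
        (hd.set_pairwise _) fun m _ => hf.mono_set (subset_iUnion B m)]
    have hG : ∀ s : Finset ℕ, G (⋃ m, B m) ψ - ∑ m ∈ s, G (B m) ψ
        = G ((⋃ m, B m) \ ⋃ m ∈ s, B m) ψ := by
      intro s
      refine ext_inner_left ℂ fun φ => ?_
      rw [inner_sub_right, inner_sum, ← (hw _ φ ψ).2, ← (hw _ φ ψ).2, hsplit s _ (hw _ φ ψ).1]
      congr 1
      exact Finset.sum_congr rfl fun m _ => (hw _ φ ψ).2.symm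
    rw [HasSum, SummationFilter.unconditional_filter, tendsto_iff_norm_sub_tendsto_zero]
    have hlim : Filter.Tendsto (fun s : Finset ℕ =>
        √(∫ x in ⋃ m, B m, ‖V x ψ‖ ^ 2 ∂μ - ∑ m ∈ s, ∫ x in B m, ‖V x ψ‖ ^ 2 ∂μ))
        Filter.atTop (𝓝 0) := by
      have h1 := (tendsto_const_nhds (x := ∫ x in ⋃ m, B m, ‖V x ψ‖ ^ 2 ∂μ)).sub hsum
      rw [sub_self] at h1
      have := (Real.continuous_sqrt.tendsto 0).comp h1
      rwa [Real.sqrt_zero] at this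
    -- The remainder of the operator series is the operator of the leftover set, whose norm on `ψ`
    -- is bounded by the root of the scalar remainder.
    refine squeeze_zero (fun _ => norm_nonneg _) (fun s => ?_) hlim
    rw [norm_sub_rev, hG]
    refine Real.le_sqrt_of_sq_le ((hn _ ψ).trans (le_of_eq ?_))
    exact hsplit s _ (hint ψ).integrableOn

end Densities

/-! ### The distribution of proper times -/

section ProperTime

/-- Substituting `t = exp r` turns this into the total mass of the exponential distribution with
mean `τ`. -/
theorem lintegral_exp_density {τ : ℝ} (hτ : 0 < τ) :
    ∫⁻ r, ENNReal.ofReal (Real.exp r * (1 / τ * Real.exp (-Real.exp r / τ))) = 1 := by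
  have himg : Real.exp '' univ = Ioi 0 := by rw [image_univ, Real.range_exp]
  have h1 := lintegral_image_eq_lintegral_abs_deriv_mul MeasurableSet.univ
    (fun r _ => (Real.hasDerivAt_exp r).hasDerivWithinAt) Real.exp_injective.injOn
    (fun t => ENNReal.ofReal (1 / τ * Real.exp (-t / τ)))
  rw [himg, Measure.restrict_univ] at h1
  have h2 : ∀ r, ENNReal.ofReal |Real.exp r| * ENNReal.ofReal (1 / τ * Real.exp (-Real.exp r / τ))
      = ENNReal.ofReal (Real.exp r * (1 / τ * Real.exp (-Real.exp r / τ))) := fun r => by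
    rw [abs_of_pos (Real.exp_pos r), ENNReal.ofReal_mul (Real.exp_pos r).le]
  simp only [h2] at h1
  rw [← h1]
  have h3 : ∀ t : ℝ, Real.exp (-t / τ) = Real.exp (-(1 / τ) * t) := fun t => by
    congr 1; ring
  have ha : -(1 / τ) < 0 := by have : 0 < 1 / τ := by positivity
                               linarith
  simp only [h3]
  rw [← ofReal_integral_eq_lintegral_ofReal ((integrableOn_exp_mul_Ioi ha 0).const_mul _)
    (ae_of_all _ fun _ => by positivity), integral_const_mul, integral_exp_mul_Ioi ha]
  have : 1 / τ * (-Real.exp (-(1 / τ) * 0) / -(1 / τ)) = 1 := by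
    rw [mul_zero, Real.exp_zero]
    field_simp
  rw [this, ENNReal.ofReal_one]

end ProperTime

/-! ### Normalization -/

section Normalization

variable {N : ℕ} {n : Fin N → ℕ}

theorem cellRegular_congr {h : Fin N → ℕ → HypParam} {K K' : Fin N → ℕ} {i : Fin N}
    (hK : ∀ j, j ≠ i → K j = K' j) (l : ℕ) (a : Fin N → ℕ) :
    CellRegular h K i l a ↔ CellRegular h K' i l a := by
  have key : ∀ P P' Q Q' : Fin N → Prop, P = P' → Q = Q' →
      (RegularRegion (fun j : {j // P j} => (h j (a j - 1)).1) (fun j : {j // Q j} => (h j (a j)).1)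
          (h i l).1 ↔
        RegularRegion (fun j : {j // P' j} => (h j (a j - 1)).1)
          (fun j : {j // Q' j} => (h j (a j)).1) (h i l).1) := by
    rintro P P' Q Q' rfl rfl
    exact Iff.rfl
  refine key _ _ _ _ (funext fun j => propext ?_) (funext fun j => propext ?_)
  · exact and_congr_right fun hj => by rw [hK j hj]
  · exact and_congr_right fun hj => by rw [hK j hj]

theorem AllRegular.cellRegular {y : Fin N → Minkowski} {r : Fin N × ℕ → ℝ} {u : Fin N × ℕ → E3}
    (hreg : AllRegular y n r u) {i : Fin N} {l : ℕ} (hl : l < n i) {a : Fin N → ℕ} (ha : a ≤ n) :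
    CellRegular (chainOf y r u) n i l a := by
  -- In the configuration with only `l` flashes of particle `i` realized and all flashes of the
  -- others, the pending sheet of `i` is the sheet `l`, and all sheets of the other particles are
  -- known.
  have h1 := hreg (Function.update n i l) (fun j => ?_) i (by simpa using hl) a ha
  · rw [Function.update_self] at h1
    refine (cellRegular_congr (fun j hj => ?_) l a).mp h1
    rw [known, Function.update_of_ne hj]
    omega
  · by_cases hj : j = i
    · subst hj; rw [Function.update_self]; exact hl.le
    · rw [Function.update_of_ne hj]

variable {H : Type*} [NormedAddCommGroup H] [InnerProductSpace ℂ H] [CompleteSpace H]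
  (F : LocalFamily N H) {σ : ℝ} (y : Fin N → Minkowski)

/-- On regular patterns the factors agree with collapse operators whose profile is set to zero on
irregular cells. These depend measurably on the parameters everywhere, and irregular patterns are
null. -/
theorem aestronglyMeasurable_pathOp (hσ : 0 < σ) (L : List ((Fin N → ℕ) × Fin N)) (φ : H) :
    AEStronglyMeasurable fun q : (unrealized n 0 → ℝ) × (unrealized n 0 → E3) =>
      pathOp F σ (flashChain y n q) n L φ := by
  classical
  let c : (unrealized n 0 → ℝ) × (unrealized n 0 → E3) → (Fin N → ℕ) × Fin N → H →L[ℂ] H :=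
    fun q p => if 1 ≤ p.1 p.2 ∧ p.1 p.2 - 1 < n p.2 ∧
        flashCell (flashChain y n q) n p.2 (p.1 p.2 - 1) = p.1 then
      collapse F σ (flashChain y n q) n p.2 (p.1 p.2 - 1) p.1
        (flashChain y n q p.2 (p.1 p.2 - 1 + 1)).1.1.2 else 1
  have hmeas : ∀ p φ, StronglyMeasurable fun q => c q p φ := by
    intro p φ
    have hx : Measurable fun q : (unrealized n 0 → ℝ) × (unrealized n 0 → E3) =>
        (flashChain y n q p.2 (p.1 p.2 - 1 + 1)).1.1 :=
      measurable_fst.comp (measurable_flashChain y p.2 (p.1 p.2 - 1 + 1)).subtype_val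
    have hset : MeasurableSet {q : (unrealized n 0 → ℝ) × (unrealized n 0 → E3) |
        flashCell (flashChain y n q) n p.2 (p.1 p.2 - 1) = p.1} :=
      measurable_cellAt n (measurable_flashChain y) hx (measurableSet_singleton p.1)
    by_cases hp : 1 ≤ p.1 p.2 ∧ p.1 p.2 - 1 < n p.2
    · have h1 : (fun q => c q p φ) = fun q =>
          if flashCell (flashChain y n q) n p.2 (p.1 p.2 - 1) = p.1 then
            collapse F σ (flashChain y n q) n p.2 (p.1 p.2 - 1) p.1
              (flashChain y n q p.2 (p.1 p.2 - 1 + 1)).1.1.2 φ else φ := by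
        funext q
        simp only [c, hp.1, hp.2, true_and]
        split_ifs <;> rfl
      rw [h1]
      exact StronglyMeasurable.ite hset
        (stronglyMeasurable_collapse F hσ (measurable_flashChain y)
          (isChain_flashChain y) hp.2 p.1 (measurable_snd.comp hx) φ) stronglyMeasurable_const
    · have h1 : (fun q => c q p φ) = fun _ => φ := by
        funext q
        simp only [c]
        rw [if_neg fun h => hp ⟨h.1, h.2.1⟩]
        rfl
      rw [h1]
      exact stronglyMeasurable_const
  have hlist : ∀ (l : List ((Fin N → ℕ) × Fin N)) (φ : H),
      StronglyMeasurable fun q => (l.map (c q)).prod φ := by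
    intro l
    induction l with
    | nil => intro φ; simpa using stronglyMeasurable_const
    | cons p l ih =>
      intro φ
      simp only [List.map_cons, List.prod_cons, mul_apply_eq_comp]
      exact stronglyMeasurable_clm_apply (hmeas p) (ih φ)
  refine ⟨_, hlist L.reverse φ, ?_⟩
  filter_upwards [ae_allRegular (n := n) y] with q hq
  rw [pathOp]
  congr 2
  refine List.map_congr_left fun p _ => ?_
  simp only [crossFactor, c]
  by_cases hp : 1 ≤ p.1 p.2 ∧ flashCell (flashChain y n q) n p.2 (p.1 p.2 - 1) = p.1
  · have hle : p.1 ≤ n := by rw [← hp.2]; exact flashCell_le _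
    have hlt : p.1 p.2 - 1 < n p.2 := by
      have : p.1 p.2 ≤ n p.2 := hle p.2
      omega
    rw [if_pos hp, if_pos ⟨hp.1, hlt, hp.2⟩, collapse]
    congr 1
    funext η
    have hr : CellRegular (flashChain y n q) n p.2 (p.1 p.2 - 1) p.1 := hq.cellRegular hlt hle
    rw [cellProf, if_pos hr]
  · rw [if_neg hp, if_neg fun h => hp ⟨h.1, h.2.2⟩]

theorem weight_flashMap (τ : ℝ) (q : (unrealized n 0 → ℝ) × (unrealized n 0 → E3)) :
    weight τ y (flashMap y n q) = ∏ p, (1 / τ * Real.exp (-Real.exp (q.1 p) / τ)) := by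
  have hfut : ∀ (i : Fin N) (k : Fin (n i)), pt y (flashMap y n q) i k.succ ∈
      future (pt y (flashMap y n q) i k.castSucc) := by
    intro i k
    rw [pt_flashMap, pt_flashMap]
    have h := HypParam.lt_hypTime (flashChain y n q i k) (flashChain y n q i (k + 1)).1.1.2
    have h2 := flash_mem_surface (y := y) (q := q) i k
    rw [HypParam.mem_surface] at h2
    rw [← h2] at h
    change ‖_‖ ≤ _
    exact (lt_sub_iff_add_lt'.mpr h).le
  simp only [weight, hfut, if_true, properLength_flashMap]
  rw [Finset.prod_mul_distrib, Finset.prod_const, ← one_div_pow]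
  congr 1
  · congr 1
    have h1 := Fintype.card_congr (flashIndex n)
    rw [Fintype.card_sigma] at h1
    rw [Finset.card_univ, h1]
    simp
  · rw [← Fintype.prod_sigma' (fun i (k : Fin (n i)) => Real.exp (-Real.exp (extTime n q.1 (i, k)) / τ))]
    refine Fintype.prod_equiv (flashIndex n).symm _ _ fun p => ?_
    have := extTime_apply q.1 ((flashIndex n).symm p)
    rw [← this]
    rfl

theorem weight_nonneg {τ : ℝ} (hτ : 0 < τ) (x : Flashes n) : 0 ≤ weight τ y x := by
  refine mul_nonneg (by positivity) (Finset.prod_nonneg fun i _ => Finset.prod_nonneg fun k _ => ?_)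
  split_ifs
  · exact (Real.exp_pos _).le
  · exact le_rfl

theorem weight_eq_zero {τ : ℝ} {x : Flashes n} (hx : x ∉ causal y n) : weight τ y x = 0 := by
  simp only [causal, mem_ofPred_eq, not_forall] at hx
  obtain ⟨i, k, hk⟩ := hx
  rw [weight, Finset.prod_eq_zero (Finset.mem_univ i), mul_zero]
  exact Finset.prod_eq_zero (Finset.mem_univ k) (if_neg hk)

variable {y}

/-- The probabilities of the flash patterns add up to one. -/
theorem lintegral_weight_pathOp {τ : ℝ} (hτ : 0 < τ) (hσ : 0 < σ) {L : List ((Fin N → ℕ) × Fin N)}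
    (hL : ValidFrom n ∅ L) (φ : H) :
    ∫⁻ q : (unrealized n 0 → ℝ) × (unrealized n 0 → E3), flashDensity n q *
      ENNReal.ofReal (weight τ y (flashMap y n q) * ‖pathOp F σ (flashChain y n q) n L φ‖ ^ 2)
      = ENNReal.ofReal (‖φ‖ ^ 2) := by
  have hw : ∀ q : (unrealized n 0 → ℝ) × (unrealized n 0 → E3), flashDensity n q *
      ENNReal.ofReal (weight τ y (flashMap y n q) * ‖pathOp F σ (flashChain y n q) n L φ‖ ^ 2)
      = (∏ p, ENNReal.ofReal (Real.exp (q.1 p) * (1 / τ * Real.exp (-Real.exp (q.1 p) / τ)))) *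
        ((∏ p ∈ unrealized n 0,
          ENNReal.ofReal (volDensity (Real.exp (extTime n q.1 p)) (extPos n q.2 p))) *
        ENNReal.ofReal (‖pathOp F σ (chainOf y (extTime n q.1) (extPos n q.2)) n L φ‖ ^ 2)) := by
    intro q
    have hnn : ∀ p, 0 ≤ 1 / τ * Real.exp (-Real.exp (q.1 p) / τ) := fun p => by positivity
    rw [weight_flashMap, ENNReal.ofReal_mul (Finset.prod_nonneg fun p _ => hnn p),
      ENNReal.ofReal_prod_of_nonneg fun p _ => hnn p, ← mul_assoc, ← mul_assoc, flashDensity,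
      ← Finset.prod_attach (unrealized n 0), ← Finset.univ_eq_attach, ← Finset.prod_mul_distrib,
      ← Finset.prod_mul_distrib]
    refine congrArg₂ _ (Finset.prod_congr rfl fun p _ => ?_) rfl
    have he := (Real.exp_pos (q.1 p)).le
    rw [coneDensity, extTime_apply, extPos_apply, ENNReal.ofReal_mul he, ENNReal.ofReal_mul he]
    ring
  have hmeas : AEMeasurable fun q : (unrealized n 0 → ℝ) × (unrealized n 0 → E3) =>
      flashDensity n q * ENNReal.ofReal (weight τ y (flashMap y n q) *
        ‖pathOp F σ (flashChain y n q) n L φ‖ ^ 2) := by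
    refine measurable_flashDensity.aemeasurable.mul (AEMeasurable.ennreal_ofReal ?_)
    refine AEMeasurable.mul ?_ ((aestronglyMeasurable_pathOp F y hσ L φ).norm.aemeasurable.pow_const 2)
    simp only [weight_flashMap]
    fun_prop
  rw [Measure.volume_eq_prod, lintegral_prod _ hmeas]
  simp only [hw]
  -- For fixed proper times the positions integrate to `‖φ‖ ^ 2`, and what is left factorizes over
  -- the proper times.
  have h1 : ∀ᵐ ρ : unrealized n 0 → ℝ, ∫⁻ z, (∏ p, ENNReal.ofReal
        (Real.exp (ρ p) * (1 / τ * Real.exp (-Real.exp (ρ p) / τ)))) *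
      ((∏ p ∈ unrealized n 0,
          ENNReal.ofReal (volDensity (Real.exp (extTime n ρ p)) (extPos n z p))) *
        ENNReal.ofReal (‖pathOp F σ (chainOf y (extTime n ρ) (extPos n z)) n L φ‖ ^ 2))
      = (∏ p, ENNReal.ofReal (Real.exp (ρ p) * (1 / τ * Real.exp (-Real.exp (ρ p) / τ)))) *
        ENNReal.ofReal (‖φ‖ ^ 2) := by
    filter_upwards [lintegral_pathOp y F hσ hL φ] with ρ hρ
    rw [lintegral_const_mul' _ _ (ENNReal.prod_lt_top fun _ _ => ENNReal.ofReal_lt_top).ne, hρ]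
  rw [lintegral_congr_ae h1, lintegral_mul_const' _ _ ENNReal.ofReal_ne_top, volume_pi,
    lintegral_pi_prod _ (f := fun _ r => ENNReal.ofReal
      (Real.exp r * (1 / τ * Real.exp (-Real.exp r / τ)))) (fun _ => by fun_prop)]
  simp only [lintegral_exp_density hτ, Finset.prod_const_one, one_mul]

end Normalization

/-! ### Transfer to space-time and assembly of the result. -/

section Main

variable {N : ℕ} {n : Fin N → ℕ} (E : HypersurfaceEvolution.{u} N) (S₀ : SpacelikeSurface)
  (σ τ : ℝ) (y : Fin N → Minkowski) (s : AdmissibleSequence n)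
  (ord : Fin s.r → Equiv.Perm (Fin N))

/-- The square root of the operator density. -/
def sqrtDensity (x : Flashes n) : E.Hil S₀ →L[ℂ] E.Hil S₀ :=
  ((√(weight τ y x) : ℝ) : ℂ) • opL E S₀ σ y s ord x

theorem adjoint_sqrtDensity_comp (hτ : 0 < τ) (x : Flashes n) :
    ContinuousLinearMap.adjoint (sqrtDensity E S₀ σ τ y s ord x) ∘L sqrtDensity E S₀ σ τ y s ord x
      = opD E S₀ σ τ y s ord x := by
  refine ContinuousLinearMap.ext fun ψ => ext_inner_left ℂ fun φ => ?_
  rw [inner_adjoint_comp_self]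
  simp only [sqrtDensity, opD, _root_.smul_apply, inner_smul_left, inner_smul_right]
  rw [inner_adjoint_comp_self, Complex.conj_ofReal, ← mul_assoc, ← Complex.ofReal_mul,
    Real.mul_self_sqrt (weight_nonneg y hτ x)]

theorem sqrtDensity_eq_indicator (φ : E.Hil S₀) :
    (fun x => sqrtDensity E S₀ σ τ y s ord x φ)
      = (causal y n).indicator fun x => sqrtDensity E S₀ σ τ y s ord x φ := by
  funext x
  by_cases hx : x ∈ causal y n
  · rw [indicator_of_mem hx]
  · rw [indicator_of_notMem hx, sqrtDensity, weight_eq_zero y hx]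
    simp

variable {E S₀ σ τ y}

theorem aestronglyMeasurable_sqrtDensity (hE : E.InteractionLocal) (hσ : 0 < σ) (φ : E.Hil S₀) :
    AEStronglyMeasurable fun x => sqrtDensity E S₀ σ τ y s ord x φ := by
  rw [sqrtDensity_eq_indicator, aestronglyMeasurable_indicator_iff (measurableSet_causal y),
    ← map_flashMap, (measurableEmbedding_flashMap y).aestronglyMeasurable_map_iff]
  refine AEStronglyMeasurable.mono_ac (withDensity_absolutelyContinuous _ _) ?_
  have h1 := aestronglyMeasurable_pathOp (n := n) (E.toLocalFamily hE S₀) y hσ (s.steps ord) φ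
  have h2 : Measurable fun q : (unrealized n 0 → ℝ) × (unrealized n 0 → E3) =>
      ((√(weight τ y (flashMap y n q)) : ℝ) : ℂ) := by
    simp only [weight_flashMap]
    fun_prop
  refine (h2.aestronglyMeasurable.smul h1).congr (ae_of_all _ fun q => ?_)
  simp [sqrtDensity, opL_flashMap E hE S₀ σ]

theorem lintegral_sqrtDensity (hE : E.InteractionLocal) (hσ : 0 < σ) (hτ : 0 < τ)
    (φ : E.Hil S₀) : ∫⁻ x, ‖sqrtDensity E S₀ σ τ y s ord x φ‖ₑ ^ 2 = ‖φ‖ₑ ^ 2 := by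
  have h1 : (fun x => ‖sqrtDensity E S₀ σ τ y s ord x φ‖ₑ ^ 2)
      = (causal y n).indicator fun x => ‖sqrtDensity E S₀ σ τ y s ord x φ‖ₑ ^ 2 := by
    funext x
    by_cases hx : x ∈ causal y n
    · rw [indicator_of_mem hx]
    · rw [indicator_of_notMem hx, sqrtDensity, weight_eq_zero y hx]
      simp
  rw [h1, lintegral_indicator (measurableSet_causal y), ← map_flashMap,
    (measurableEmbedding_flashMap y).lintegral_map,
    lintegral_withDensity_eq_lintegral_mul_non_measurable _ measurable_flashDensity
      (ae_of_all _ fun q => ENNReal.prod_lt_top fun _ _ => ENNReal.ofReal_lt_top)]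
  have h2 : ∀ ψ : E.Hil S₀, ‖ψ‖ₑ ^ 2 = ENNReal.ofReal (‖ψ‖ ^ 2) := fun ψ => by
    rw [ENNReal.ofReal_pow (norm_nonneg _), ofReal_norm]
  rw [h2 φ, ← lintegral_weight_pathOp (E.toLocalFamily hE S₀) (y := y) hτ hσ
    (s.validFrom_steps ord) φ]
  refine lintegral_congr fun q => ?_
  rw [Pi.mul_apply, h2, sqrtDensity, opL_flashMap E hE S₀ σ]
  simp only [_root_.smul_apply]
  rw [norm_smul, mul_pow, Complex.norm_real, Real.norm_of_nonneg (Real.sqrt_nonneg _),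
    Real.sq_sqrt (weight_nonneg y hτ _)]

end Main

end RelGRW

end

open RelGRW in
theorem proposition4p8 (N : ℕ) (n : Fin N → ℕ) (E : HypersurfaceEvolution.{u} N)
    (hE : E.InteractionLocal) (S₀ : SpacelikeSurface) (y : Fin N → Minkowski)
    (σ τ : ℝ) (hσ : 0 < σ) (hτ : 0 < τ)
    (s : AdmissibleSequence n) (ord : Fin s.r → Equiv.Perm (Fin N)) :
    HasWeakIntegral (opD E S₀ σ τ y s ord) volume 1 ∧
    (∃ G : Set (Flashes n) → E.Hil S₀ →L[ℂ] E.Hil S₀, IsPOVM G ∧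
      ∀ B, MeasurableSet B →
        HasWeakIntegral (opD E S₀ σ τ y s ord) (volume.restrict B) (G B)) ∧
    (∀ ψ₀ : E.Hil S₀, ‖ψ₀‖ = 1 →
      IsProbabilityMeasure ((volume : Measure (Flashes n)).withDensity
        (fun x => ENNReal.ofReal (⟪ψ₀, opD E S₀ σ τ y s ord x ψ₀⟫_ℂ).re))) := by
  have hI := lintegral_sqrtDensity (y := y) s ord hE (S₀ := S₀) hσ hτ
  -- The POVM gives all the rest: the weak integral over the whole space is `G univ = 1`, and the
  -- density of the probability measure is `‖sqrtDensity ψ₀‖ ^ 2`.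
  obtain ⟨G, hG, hw⟩ := exists_isPOVM (aestronglyMeasurable_sqrtDensity s ord hE hσ) hI
  simp only [adjoint_sqrtDensity_comp E S₀ σ τ y s ord hτ] at hw
  refine ⟨?_, ⟨G, hG, fun B _ => hw B⟩, fun ψ₀ hψ₀ => ⟨?_⟩⟩
  · have h := hw univ
    rwa [Measure.restrict_univ, hG.univ] at h
  · rw [withDensity_apply _ MeasurableSet.univ, Measure.restrict_univ]
    have h1 : ∀ x, ENNReal.ofReal (⟪ψ₀, opD E S₀ σ τ y s ord x ψ₀⟫_ℂ).re
        = ‖sqrtDensity E S₀ σ τ y s ord x ψ₀‖ₑ ^ 2 := fun x => by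
      rw [← adjoint_sqrtDensity_comp E S₀ σ τ y s ord hτ, inner_adjoint_comp_self,
        inner_self_eq_norm_sq_to_K, ← ofReal_norm, ← ENNReal.ofReal_pow (norm_nonneg _)]
      congr 1
      exact_mod_cast Complex.ofReal_re _
    simp only [h1]
    rw [hI, ← ofReal_norm, hψ₀]
    simp
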